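/- **Setting.** Let $G$ be a simple graph on the vertex set $\{0,\dots,n-1\}$, $n\ge 1$ (the number of a vertex is its id), with degrees $d(v)$, $m=\sum_v d(v)$ ordered edges, and $n_K$ cliques on $k\ge 2$ vertices. An algorithm may perform degree queries ($d(v)$), neighbor queries (the $i$-th neighbor of $v$ in an arbitrary fixed order, or a failure symbol if there is none) and pair queries (whether $\{u,v\}$ is an edge). Algorithms are fixed randomized RAM programs, not depending on $n$, $k$, $G$ or the other parameters, with words of $w$ bits, where every input number is less than $2^w$. An operation on numbers that fit in one word takes unit time (in general, the product of the lengths of the operands in words); a query or a random draw takes unit time plus the time to evaluate its arguments. Random draws are uniform integers from $\{0,\dots,a-1\}$ and coins of bias $\min(1,\sqrt{a/b})$ for computed integers $a,b$. Real parameters $\epsilon,\delta\in(0,1)$ are given to the programs as $\lceil 1/\epsilon\rceil$, $\lceil 1/\delta\rceil$. Write $u\prec v$ if $d(u)<d(v)$, or $d(u)=d(v)$ and $u$ has the smaller id. **Typical data structures.** Let $\bar\epsilon\in(0,\frac12)$ and let $\bar\gamma,\bar m$ be positive integers. A nonempty multiset $S$ of vertices is $(\bar\epsilon,\bar\gamma,\bar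 m)$-degrees-typical if, counting with multiplicity, (i) every $v$ with $d(v)>\bar\gamma$ has between $(1-\bar\epsilon)|S|\frac{d(v)}n$ and $(1+\bar\epsilon)|S|\frac{d(v)}n$ neighbors in $S$, and (ii) $\sum_{u\in S}d(u)\le 2|S|\frac{\bar m}n$. A data structure $\mathcal D$ is a device which on each access returns, in unit time and independently, a vertex or fails; it is $(\bar\epsilon,\bar\gamma,\bar m)$-degrees-typical if for some such $S$ each element $u\in S$ is returned with probability $\frac{d(u)}{2(\bar m/n)|S|}$. *Sample-Medium-High-Vertex* accesses $\mathcal D$ to obtain $u$, takes a uniform neighbor $v$ of $u$, and returns $v$ if $d(v)>\bar\gamma$, and otherwise fails. **Samplers.** A $k$-clique is *low* if its minimum degree (in $G$) is at most $\bar\gamma$, *medium* if it is in $[\bar\gamma+1,\sqrt{\bar m}]$, and *high* if it exceeds $\sqrt{\bar m}$. Consider the following three procedures, each of which ends by verifying that $v_1,\dots,v_k$ form a clique and $v_1\prec\dots\prec v_k$ (returning this clique if so, and otherwise failing). - *Low:* $v_1$ is a uniform vertex; fail if $d(v_1)>\bar\gamma$; $v_2,\dots,v_k$ are chosen independently, each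 being any given neighbor of $v_1$ with probability $1/\bar\gamma$ (fail with the remaining probability). - *Medium:* $v_1$ is obtained from Sample-Medium-High-Vertex; fail if $d(v_1)>\sqrt{\bar m}$; $v_2$ is a uniform neighbor of $v_1$; $v_3,\dots,v_k$ are chosen independently, each being any given neighbor of $v_1$ with probability $1/\sqrt{\bar m}$. - *High:* $v_1,\dots,v_k$ are obtained from $k$ calls of Sample-Medium-High-Vertex; fail if some $d(v_i)\le\sqrt{\bar m}$; each $v_i$ is kept with probability $\sqrt{\bar m}/d(v_i)$ (otherwise fail). **Theorem.** 1. Each of the three procedures, for any $\mathcal D$, either fails or returns a clique of its own type, and always uses at most $O(k^2)$ queries and time, with an absolute constant. Each low clique is returned by the first procedure with probability exactly $\frac1{n\bar\gamma^{k-1}}$. If $\mathcal D$ is $(\bar\epsilon,\bar\gamma,\bar m)$-degrees-typical, then each medium clique is returned by the second procedure with probability in $(1\pm\bar\epsilon)\frac1{2\bar m^{k/2}}$ and, if moreover $\bar\gamma\le\sqrt{\bar m}$, each high clique is returned by the third procedure with probability in $(1\pm\bar\epsilon)^k\frac1{2^k\bar m^{k/2}}$. 2. (Counting.) There are a program with query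 access to $G$ and an absolute constant $C$ such that for all $n,k,\epsilon,G$ as above, on input $n,k,\epsilon$, with probability at least $2/3$ it returns $\hat n_K$ with $(1-\epsilon)n_K\le\hat n_K\le(1+\epsilon)n_K$, and, if $n_K\ge1$, its expected query complexity and expected running time are at most $$T=C\,k!\left(\frac{1+\log n}{\epsilon}\right)^{C}\left(\frac n{n_K^{1/k}}+\frac{m^{k/2}}{n_K}\right),$$ that is, $O^*\big(n/n_K^{1/k}+m^{k/2}/n_K\big)$, where $O^*$ suppresses factors $O(k!)$ and $\mathrm{poly}(1/\epsilon,\log n)$. 3. (Sampling.) There are a preprocessing program and a sampling program with query access to $G$, and an absolute constant $C$, such that for all $n,k,\epsilon,\delta,G$ as above with $n_K\ge1$ the following holds with $T$ as in 2. On input $n,k,\epsilon,\delta$ the preprocessing has expected query complexity and expected running time at most $T\log(2/\delta)$, and with probability at least $1-\delta$ it ends in a state from which repeated runs of the sampling program return independent $k$-cliques, all drawn from one distribution $p$ with $|p(c)-\frac1{n_K}|<\frac\epsilon{n_K}$ for every $k$-clique $c$, each run having expected query complexity and expected running time at most $T\log(2/\delta)$. -/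

import Mathlib

open scoped ENNReal Nat

noncomputable section

namespace CliqueSampling

/-! ### Graphs with query access -/

/-- A simple graph on the vertex set `{0, …, n-1}` together with an arbitrary enumeration of the
neighbours of each vertex (the order in which neighbour queries reveal them).
The identifier of a vertex is its number. -/
structure QueryGraph (n : ℕ) where
  graph : SimpleGraph (Fin n)
  nbrs : Fin n → List (Fin n)
  nodup_nbrs : ∀ v, (nbrs v).Nodup
  mem_nbrs : ∀ u v, v ∈ nbrs u ↔ graph.Adj u v

namespace QueryGraph

variable {n : ℕ}

/-- The degree `d(v)`. -/
def deg (G : QueryGraph n) (v : Fin n) : ℕ := (G.nbrs v).length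

open Classical in
theorem deg_eq_degree (G : QueryGraph n) (v : Fin n) : G.deg v = G.graph.degree v := by
  have h : (G.nbrs v).toFinset = G.graph.neighborFinset v := by
    ext u
    simp [G.mem_nbrs]
  rw [← SimpleGraph.card_neighborFinset_eq_degree, ← h,
    List.toFinset_card_of_nodup (G.nodup_nbrs v), deg]

/-- The number `m` of ordered edges. -/
def m (G : QueryGraph n) : ℕ := ∑ v, G.deg v

/-- The number of `k`-cliques. -/
def numCliques (G : QueryGraph n) (k : ℕ) : ℕ :=
  Set.ncard {c : Finset (Fin n) | G.graph.IsNClique k c}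

/-- The degree of the minimum-degree vertex of a (nonempty) set of vertices. -/
def minDeg (G : QueryGraph n) (c : Finset (Fin n)) : ℕ := sInf {d | ∃ v ∈ c, d = G.deg v}

/-- `k`-cliques whose minimum degree is at most `γ`. -/
def IsLowClique (G : QueryGraph n) (k γ : ℕ) (c : Finset (Fin n)) : Prop :=
  G.graph.IsNClique k c ∧ G.minDeg c ≤ γ

/-- `k`-cliques whose minimum degree lies in `[γ + 1, √mbar]`. -/
def IsMediumClique (G : QueryGraph n) (k γ mbar : ℕ) (c : Finset (Fin n)) : Prop :=
  G.graph.IsNClique k c ∧ γ + 1 ≤ G.minDeg c ∧ (G.minDeg c : ℝ) ≤ √(mbar : ℝ)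

/-- `k`-cliques whose minimum degree exceeds `√mbar`. -/
def IsHighClique (G : QueryGraph n) (k mbar : ℕ) (c : Finset (Fin n)) : Prop :=
  G.graph.IsNClique k c ∧ √(mbar : ℝ) < (G.minDeg c : ℝ)

/-- The number of elements of the multiset `S`, with multiplicity, that are neighbours of `v`. -/
def degIn (G : QueryGraph n) (S : Multiset (Fin n)) (v : Fin n) : ℕ :=
  open Classical in (S.filter (fun u => G.graph.Adj v u)).card

/-- An `(eps, γ, mbar)`-degrees-typical (nonempty) multiset of vertices. -/
def IsTypicalMultiset (G : QueryGraph n) (eps : ℝ) (γ mbar : ℕ) (S : Multiset (Fin n)) : Prop :=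
  S ≠ 0 ∧
  (∀ v, γ < G.deg v →
    (1 - eps) * (S.card * (G.deg v / n : ℝ)) ≤ G.degIn S v ∧
    (G.degIn S v : ℝ) ≤ (1 + eps) * (S.card * (G.deg v / n : ℝ))) ∧
  (((S.map G.deg).sum : ℕ) : ℝ) ≤ 2 * S.card * (mbar / n : ℝ)

/-- A data structure, seen through the distribution of what one access to it returns (`none` is
failure), is degrees-typical if for some degrees-typical multiset `S` it yields each element `u`
of `S` with probability `d(u) / (2 * (mbar / n) * |S|)`; elements count with multiplicity. -/
def IsTypicalDS (G : QueryGraph n) (eps : ℝ) (γ mbar : ℕ) (D : PMF (Option (Fin n))) : Prop :=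
  ∃ S : Multiset (Fin n), G.IsTypicalMultiset eps γ mbar S ∧
    ∀ u, D (some u) =
      ENNReal.ofReal (S.count u * (G.deg u / (2 * (mbar / n : ℝ) * S.card)))

end QueryGraph

/-! ### Randomized RAM programs with graph queries -/

/-- Memory: scalar registers and arrays of natural numbers (registers and arrays are named by
natural numbers), together with counters of the time and the queries spent so far. Programs
cannot read the two counters. -/
structure State where
  reg : ℕ → ℕ
  arr : ℕ → ℕ → ℕ
  time : ℕ
  queries : ℕ

namespace State

def setReg (σ : State) (x v : ℕ) : State := { σ with reg := Function.update σ.reg x v }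

def setArr (σ : State) (a i v : ℕ) : State :=
  { σ with arr := Function.update σ.arr a (Function.update (σ.arr a) i v) }

def tick (σ : State) (t : ℕ) : State := { σ with time := σ.time + t }

def countQuery (σ : State) : State := { σ with queries := σ.queries + 1 }

/-- The start of a computation: the inputs are in the registers `1, 2, …`, the rest is `0`. -/
def start (inputs : List ℕ) : State where
  reg := fun x => (0 :: inputs).getD x 0
  arr := fun _ _ => 0
  time := 0
  queries := 0

end State

/-- Arithmetic expressions. `lt` and `eq` evaluate to `1` (true) or `0` (false), `sub` is truncated
subtraction, `div` is rounded down, and `get a i` is entry `i` of array `a`. -/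
inductive Exp where
  | lit (v : ℕ)
  | reg (x : ℕ)
  | get (a : ℕ) (i : Exp)
  | add (e f : Exp)
  | sub (e f : Exp)
  | mul (e f : Exp)
  | div (e f : Exp)
  | lt (e f : Exp)
  | eq (e f : Exp)

/-- The number of machine words of `w` bits occupied by `v`. -/
def words (w v : ℕ) : ℕ := 1 + Nat.log 2 v / w

namespace Exp

def eval (σ : State) : Exp → ℕ
  | lit v => v
  | reg x => σ.reg x
  | get a i => σ.arr a (i.eval σ)
  | add e f => e.eval σ + f.eval σ
  | sub e f => e.eval σ - f.eval σ
  | mul e f => e.eval σ * f.eval σ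
  | div e f => e.eval σ / f.eval σ
  | lt e f => if e.eval σ < f.eval σ then 1 else 0
  | eq e f => if e.eval σ = f.eval σ then 1 else 0

/-- The time to evaluate an expression with word length `w`. Reading a number costs its length in
words; an operation on two numbers costs the product of their lengths in words. So everything has
unit cost as long as the numbers involved fit into one word. -/
def cost (w : ℕ) (σ : State) : Exp → ℕ
  | lit v => words w v
  | reg x => words w (σ.reg x)
  | get a i => i.cost w σ + words w (i.eval σ) + words w (σ.arr a (i.eval σ))
  | add e f => e.cost w σ + f.cost w σ + words w (e.eval σ) * words w (f.eval σ)
  | sub e f => e.cost w σ + f.cost w σ + words w (e.eval σ) * words w (f.eval σ)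
  | mul e f => e.cost w σ + f.cost w σ + words w (e.eval σ) * words w (f.eval σ)
  | div e f => e.cost w σ + f.cost w σ + words w (e.eval σ) * words w (f.eval σ)
  | lt e f => e.cost w σ + f.cost w σ + words w (e.eval σ) * words w (f.eval σ)
  | eq e f => e.cost w σ + f.cost w σ + words w (e.eval σ) * words w (f.eval σ)

end Exp

/-- Programs. Conditions are true when their value is not `0`.
* `rand x e` stores in `x` a uniformly random element of `{0, …, e - 1}`;
* `coin x e f` stores in `x` the value `1` with probability `√(e / f)` (at most `1`), and else `0`;
* `deg`, `nbr`, `adj` are the degree, neighbour and pair queries;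
* `sample x` accesses a data structure for sampling vertices, if one is provided. -/
inductive Cmd where
  | skip
  | assign (x : ℕ) (e : Exp)
  | store (a : ℕ) (i e : Exp)
  | seq (P Q : Cmd)
  | ite (b : Exp) (P Q : Cmd)
  | while (b : Exp) (P : Cmd)
  | rand (x : ℕ) (e : Exp)
  | coin (x : ℕ) (e f : Exp)
  | deg (x : ℕ) (v : Exp)
  | nbr (x : ℕ) (v i : Exp)
  | adj (x : ℕ) (u v : Exp)
  | sample (x : ℕ)

/-- What a program has access to: a graph, and a data structure for sampling vertices. -/
structure Access (n : ℕ) where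
  G : QueryGraph n
  D : PMF (Option (Fin n))

/-- Access to the graph only: the data structure is void. -/
def QueryGraph.access {n : ℕ} (G : QueryGraph n) : Access n := ⟨G, PMF.pure none⟩

/-- A vertex `v` is reported as `v + 1`, and `0` is the special symbol for failure. -/
def report {n : ℕ} : Option (Fin n) → ℕ
  | none => 0
  | some v => v + 1

namespace Access

variable {n : ℕ} (A : Access n)

def degAnswer (v : ℕ) : ℕ := if h : v < n then A.G.deg ⟨v, h⟩ else 0

/-- The neighbours of `v` have the indices `0, …, d(v) - 1`. -/
def nbrAnswer (v i : ℕ) : ℕ := if h : v < n then report ((A.G.nbrs ⟨v, h⟩)[i]?) else 0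

def adjAnswer (u v : ℕ) : ℕ :=
  open Classical in
  if ∃ (hu : u < n) (hv : v < n), A.G.graph.Adj ⟨u, hu⟩ ⟨v, hv⟩ then 1 else 0

/-- The semantics of programs, for word length `w`: `A.expect w P f σ` is the expectation of `f` at
the final state of the run of `P` from the state `σ`, where runs that do not terminate contribute
`0`. A loop is the limit of its finite unfoldings. -/
def expect (w : ℕ) : Cmd → (State → ℝ≥0∞) → State → ℝ≥0∞
  | .skip, f => f
  | .assign x e, f => fun σ => f ((σ.setReg x (e.eval σ)).tick (1 + e.cost w σ))
  | .store a i e, f => fun σ =>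
      f ((σ.setArr a (i.eval σ) (e.eval σ)).tick
        (1 + i.cost w σ + words w (i.eval σ) + e.cost w σ))
  | .seq P Q, f => expect w P (expect w Q f)
  | .ite b P Q, f => fun σ =>
      if b.eval σ ≠ 0 then expect w P f (σ.tick (1 + b.cost w σ))
      else expect w Q f (σ.tick (1 + b.cost w σ))
  | .while b P, f => fun σ =>
      ⨆ t : ℕ, (fun (X : State → ℝ≥0∞) (τ : State) =>
        if b.eval τ ≠ 0 then expect w P X (τ.tick (1 + b.cost w τ))
        else f (τ.tick (1 + b.cost w τ)))^[t] (fun _ => 0) σ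
  | .rand x e, f => fun σ =>
      (∑ v ∈ Finset.range (max 1 (e.eval σ)),
        f ((σ.setReg x v).tick (e.cost w σ + words w (e.eval σ)))) /
          ((max 1 (e.eval σ) : ℕ) : ℝ≥0∞)
  | .coin x e g, f => fun σ =>
      let p : ℝ≥0∞ := min 1 (ENNReal.ofReal √((e.eval σ : ℝ) / (g.eval σ : ℝ)))
      let t : ℕ := e.cost w σ + g.cost w σ + words w (e.eval σ) * words w (g.eval σ)
      p * f ((σ.setReg x 1).tick t) + (1 - p) * f ((σ.setReg x 0).tick t)
  | .deg x v, f => fun σ =>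
      f ((σ.setReg x (A.degAnswer (v.eval σ))).countQuery.tick (1 + v.cost w σ))
  | .nbr x v i, f => fun σ =>
      f ((σ.setReg x (A.nbrAnswer (v.eval σ) (i.eval σ))).countQuery.tick
        (1 + v.cost w σ + i.cost w σ))
  | .adj x u v, f => fun σ =>
      f ((σ.setReg x (A.adjAnswer (u.eval σ) (v.eval σ))).countQuery.tick
        (1 + u.cost w σ + v.cost w σ))
  | .sample x, f => fun σ => ∑ o, A.D o * f ((σ.setReg x (report o)).tick 1)

/-- The probability that `P`, started in `σ`, terminates in a state that satisfies `E`. -/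
def prob (w : ℕ) (P : Cmd) (σ : State) (E : State → Prop) : ℝ≥0∞ :=
  open Classical in A.expect w P (fun τ => if E τ then 1 else 0) σ

/-- The expected running time of `P` from `σ`; infinite unless `P` terminates almost surely. -/
def expTime (w : ℕ) (P : Cmd) (σ : State) : ℝ≥0∞ :=
  open Classical in
  if A.prob w P σ (fun _ => True) = 1 then
    A.expect w P (fun τ => ((τ.time - σ.time : ℕ) : ℝ≥0∞)) σ
  else ⊤

/-- The expected number of queries of `P` from `σ`; infinite unless `P` terminates almost
surely. -/
def expQueries (w : ℕ) (P : Cmd) (σ : State) : ℝ≥0∞ :=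
  open Classical in
  if A.prob w P σ (fun _ => True) = 1 then
    A.expect w P (fun τ => ((τ.queries - σ.queries : ℕ) : ℝ≥0∞)) σ
  else ⊤

end Access

/-! ### Samplers -/

/-- A sampler returns the clique `c` with `k` vertices by leaving `1` in register `0` and the
vertices of `c` in the entries `0, …, k - 1` of array `0`. -/
def Returns {n : ℕ} (k : ℕ) (c : Finset (Fin n)) (τ : State) : Prop :=
  τ.reg 0 = 1 ∧ (Finset.range k).image (τ.arr 0) = c.image Fin.val

/-- A sampler returns `fail` by leaving `0` in register `0`. -/
def Fails (τ : State) : Prop := τ.reg 0 = 0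

section Programs

local infixr:60 " ;; " => Cmd.seq

/-! Registers of the attempted samplers: `0` is the status (`1` as long as the procedure has not
failed), the inputs are `n`, `k`, `γ`, `mbar` in this order, the other registers are scratch. -/

def rOk : ℕ := 0
def rN : ℕ := 1
def rK : ℕ := 2
def rGamma : ℕ := 3
def rMbar : ℕ := 4
def rV : ℕ := 5
def rDeg : ℕ := 6
def rI : ℕ := 7
def rJ : ℕ := 8
def rX : ℕ := 9
def rPrev : ℕ := 10

/-- Return `fail`: everything below is skipped once the status is `0`. -/
def fail : Cmd := .assign rOk (.lit 0)

def require (b : Exp) : Cmd := .ite b .skip fail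

def ifOk (P : Cmd) : Cmd := .ite (.reg rOk) P .skip

/-- While the procedure has not failed, and as long as the counter is below the bound: run `P` and
increment the counter. -/
def forBelow (counter : ℕ) (bound : Exp) (P : Cmd) : Cmd :=
  .while (.mul (.reg rOk) (.lt (.reg counter) bound))
    (P ;; .assign counter (.add (.reg counter) (.lit 1)))

/-- The entry `i` of the output array. -/
def out (i : Exp) : Exp := .get 0 i

/-- Fail unless the vertices `v₀, …, v_{k-1}` in the output array form a clique and
`v₀ ≺ ⋯ ≺ v_{k-1}`, where `u ≺ v` if `d(u) < d(v)`, or if `d(u) = d(v)` and `u < v`. -/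
def verify : Cmd :=
  .assign rI (.lit 0) ;;
  forBelow rI (.reg rK)
    (.deg rDeg (out (.reg rI)) ;;
     .assign rJ (.lit 0) ;;
     forBelow rJ (.reg rI)
       (.adj rX (out (.reg rJ)) (out (.reg rI)) ;;
        require (.reg rX)) ;;
     .ite (.lt (.lit 0) (.reg rI))
       (require (.add (.lt (.reg rPrev) (.reg rDeg))
         (.mul (.eq (.reg rPrev) (.reg rDeg))
           (.lt (out (.sub (.reg rI) (.lit 1))) (out (.reg rI))))))
       .skip ;;
     .assign rPrev (.reg rDeg))

/-- Sample a vertex `u` with the data structure, then a uniform neighbour `v` of `u`; fail if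
`d(v) ≤ γ`, otherwise leave `v` and `d(v)` in the registers `rV` and `rDeg`. -/
def sampleMediumHighVertex : Cmd :=
  .sample rX ;;
  .ite (.reg rX)
    (.assign rV (.sub (.reg rX) (.lit 1)) ;;
     .deg rDeg (.reg rV) ;;
     .rand rJ (.reg rDeg) ;;
     .nbr rX (.reg rV) (.reg rJ) ;;
     .ite (.reg rX)
       (.assign rV (.sub (.reg rX) (.lit 1)) ;;
        .deg rDeg (.reg rV) ;;
        require (.lt (.reg rGamma) (.reg rDeg)))
       fail)
    fail

/-- Sample a uniform vertex `v₀`; fail if `d(v₀) > γ`. Sample `k - 1` neighbours of `v₀`, each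
neighbour with probability `1 / γ`. Verify. -/
def lowSampler : Cmd :=
  .assign rOk (.lit 1) ;;
  .rand rV (.reg rN) ;;
  .store 0 (.lit 0) (.reg rV) ;;
  .deg rDeg (.reg rV) ;;
  require (.lt (.reg rDeg) (.add (.reg rGamma) (.lit 1))) ;;
  .assign rI (.lit 1) ;;
  forBelow rI (.reg rK)
    (.rand rJ (.reg rGamma) ;;
     .nbr rX (.reg rV) (.reg rJ) ;;
     .ite (.reg rX) (.store 0 (.reg rI) (.sub (.reg rX) (.lit 1))) fail) ;;
  verify

/-- Sample a vertex `v₀` with `γ < d(v₀) ≤ √mbar` (or fail) and a uniform neighbour of it. Sample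
`k - 2` further neighbours of `v₀`, each neighbour with probability `1 / √mbar` (a uniform one,
which is kept with probability `d(v₀) / √mbar`). Verify. -/
def mediumSampler : Cmd :=
  .assign rOk (.lit 1) ;;
  sampleMediumHighVertex ;;
  ifOk (require (.lt (.mul (.reg rDeg) (.reg rDeg)) (.add (.reg rMbar) (.lit 1)))) ;;
  ifOk
    (.store 0 (.lit 0) (.reg rV) ;;
     .rand rJ (.reg rDeg) ;;
     .nbr rX (.reg rV) (.reg rJ) ;;
     .store 0 (.lit 1) (.sub (.reg rX) (.lit 1))) ;;
  .assign rI (.lit 2) ;;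
  forBelow rI (.reg rK)
    (.rand rJ (.reg rDeg) ;;
     .nbr rX (.reg rV) (.reg rJ) ;;
     .store 0 (.reg rI) (.sub (.reg rX) (.lit 1)) ;;
     .coin rX (.mul (.reg rDeg) (.reg rDeg)) (.reg rMbar) ;;
     require (.reg rX)) ;;
  verify

/-- Sample `k` vertices `v` with `d(v) > max γ √mbar` (or fail), each of which is kept with
probability `√mbar / d(v)`. Verify. -/
def highSampler : Cmd :=
  .assign rOk (.lit 1) ;;
  .assign rI (.lit 0) ;;
  forBelow rI (.reg rK)
    (sampleMediumHighVertex ;;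
     ifOk (require (.lt (.reg rMbar) (.mul (.reg rDeg) (.reg rDeg)))) ;;
     ifOk
       (.coin rX (.reg rMbar) (.mul (.reg rDeg) (.reg rDeg)) ;;
        require (.reg rX) ;;
        .store 0 (.reg rI) (.reg rV))) ;;
  verify

end Programs

/-- The procedure `P`, started in `σ`, is an attempted sampler for the sets of vertices in the class
`cls` with worst-case query complexity and running time `T`: it always stops after at most `T` queries
and `T` steps, and it either fails or returns a member of the class. -/
def IsAttemptedSampler {n : ℕ} (A : Access n) (w k : ℕ) (P : Cmd) (σ : State)
    (cls : Finset (Fin n) → Prop) (T : ℕ) : Prop :=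
  A.prob w P σ (fun τ => (Fails τ ∨ ∃ c, cls c ∧ Returns k c τ) ∧
    τ.queries ≤ T ∧ τ.time ≤ T) = 1

/-- The probability that successive runs of `P`, the first one from `σ` and each later one from the
state in which the previous one ended, return the cliques in the list in turn. -/
def jointProb {n : ℕ} (A : Access n) (w k : ℕ) (P : Cmd) :
    List (Finset (Fin n)) → State → ℝ≥0∞
  | [] => fun _ => 1
  | c :: cs =>
      open Classical in
      A.expect w P (fun τ => if Returns k c τ then jointProb A w k P cs τ else 0)

/-- From the state `σ` on, the program `P` can be run again and again to obtain independent
`k`-cliques from one distribution that is `eps`-pointwise close to uniform, and each of these runs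
has expected query complexity and running time at most `T`. -/
def SamplesFrom {n : ℕ} (G : QueryGraph n) (w k : ℕ) (eps : ℝ) (T : ℝ≥0∞) (P : Cmd) (σ : State) :
    Prop :=
  (∃ p : PMF {c : Finset (Fin n) // G.graph.IsNClique k c},
    (∀ c, |(p c).toReal - 1 / (G.numCliques k : ℝ)| < eps / (G.numCliques k : ℝ)) ∧
    ∀ cs : List {c : Finset (Fin n) // G.graph.IsNClique k c},
      jointProb G.access w k P (cs.map (fun c => c.1)) σ = (cs.map p).prod) ∧
  ∀ r : ℕ,
    (G.access.expect w P)^[r] (G.access.expTime w P) σ ≤ T ∧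
    (G.access.expect w P)^[r] (G.access.expQueries w P) σ ≤ T

/-- The bound `n / N^(1/k) + m^(k/2) / N` for the number `N` of `k`-cliques, with the suppressed
factors `C * k!` and `((1 + log n) / eps)^C` written out. -/
def starBound {n : ℕ} (G : QueryGraph n) (k : ℕ) (eps : ℝ) (C : ℕ) : ℝ :=
  C * (k ! : ℝ) * ((1 + Real.log n) / eps) ^ C *
    ((n : ℝ) / (G.numCliques k : ℝ) ^ (1 / (k : ℝ)) +
      (G.m : ℝ) ^ ((k : ℝ) / 2) / (G.numCliques k : ℝ))

end CliqueSampling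

end

open scoped ENNReal Nat

noncomputable section

namespace CliqueSampling

local infixr:60 " ;; " => Cmd.seq

/-! Samplers. The relation ≺ is a strict total order refining the degree order, so a clique has
exactly one increasing list of vertices, that list starts with a vertex of minimum degree, and the
probability of the clique is the probability of this one list, a product. A typical structure
returns `u` with a weight proportional to `d(u)`; this cancels the factor `1 / d(u)` of the uniform
neighbour, so Sample-Medium-High-Vertex hits `v` in proportion to its number of neighbours in `S`,
that is, with probability about `d(v) / (2 * mbar)`. The remaining factors of `d(v)` are cancelled
by the uniform neighbour in the medium case and by the coin of bias `√mbar / d(v)` in the high case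
(`low_prob`, `medium_prob`, `high_prob`).

One attempt. Take `mbar = θ * θ` and choose between the low, medium and high sampler with the
integer weights `n * γ ^ (k - 1)`, `2 * θ ^ k`, `(2 * θ) ^ k`. These are the reciprocals of the
three probabilities, so every clique comes out with probability close to `1 / Z`, where `Z` is the
sum of the weights (`attemptPMF_bounds`).

One round, with effort `B`. The structure is a list `S` of `B * K` uniform vertices, `γ = n / B +
1`, and `θ` is the first of `γ, 2γ, 4γ, …` for which the degree-sum condition holds. By Chernoff and
a union bound `S` is typical except with tiny probability (`not_good_le`). By Markov the degree sum
is usually `O(|S| * m / n)`, so `θ = γ` or `θ ^ 2 = O(m)`; hence `Z ≤ N * B` for the number `N` of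
cliques, as soon as `B` exceeds `3 * 6 ^ k` times the main term of the complexity
(`totalWeight_le_mul`). Then `R * B` attempts have about `R` successes or more.

Search. Neither `m` nor `N` is known, so `B` runs through the powers of two until a round has enough
successes. A small `B` costs time but not accuracy: for a typical list the cliques are nearly
equally likely whatever `B` is (`round_ratio`), and by Chebyshev a round rarely reaches the required
number of successes without also giving a good estimate (`round_accuracy`). Once `B` is large enough
a round fails with probability at most `3 / 10`, so the expected value of the last `B` is within a
constant factor of the first sufficient one (`Config.avg_search_two_pow`). Counting returns `Z * X /
r`, rounded, for `X` successes among `r` attempts. Sampling stops at the first success and repeats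
the whole search if it fails; its preprocessing only computes the parameters.

Programs. `Ref` couples the final state of a program with an outcome from an explicit distribution;
`Run` adds a time bound and forgets the counters. `Ref` demands only lower bounds on expectations,
but since a distribution has mass one, upper bounds and almost sure termination follow
(`Ref.expect_le`). All numbers fit into `18 * k` words, so an operation costs `O(k ^ 2)`, and all
factors depending on `k` alone are absorbed by `k!` (`pow_six_le`). Query bounds come for free,
since a query takes at least one unit of time. -/

/-- Structural induction on commands. -/
protected theorem Cmd.induct {motive : Cmd → Prop} (skip : motive .skip)
    (assign : ∀ x e, motive (.assign x e)) (store : ∀ a i e, motive (.store a i e))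
    (seq : ∀ P Q, motive P → motive Q → motive (.seq P Q))
    (ite : ∀ b P Q, motive P → motive Q → motive (.ite b P Q))
    (loop : ∀ b P, motive P → motive (.while b P)) (rand : ∀ x e, motive (.rand x e))
    (coin : ∀ x e f, motive (.coin x e f)) (deg : ∀ x v, motive (.deg x v))
    (nbr : ∀ x v i, motive (.nbr x v i)) (adj : ∀ x u v, motive (.adj x u v))
    (sample : ∀ x, motive (.sample x)) (P : Cmd) : motive P :=
  Cmd.rec skip assign store seq ite loop rand coin deg nbr adj sample P

/-! ### The expectation functional -/

namespace Access

variable {n : ℕ} (A : Access n) (w : ℕ)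

/-- One unfolding of a loop. -/
def unfold (b : Exp) (P : Cmd) (f X : State → ℝ≥0∞) : State → ℝ≥0∞ := fun τ =>
  if b.eval τ ≠ 0 then A.expect w P X (τ.tick (1 + b.cost w τ)) else f (τ.tick (1 + b.cost w τ))

theorem expect_while (b : Exp) (P : Cmd) (f : State → ℝ≥0∞) (σ : State) :
    A.expect w (.while b P) f σ = ⨆ t : ℕ, (A.unfold w b P f)^[t] (fun _ => 0) σ := rfl

theorem expect_mono (P : Cmd) : ∀ {f g : State → ℝ≥0∞}, f ≤ g →
    A.expect w P f ≤ A.expect w P g := by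
  induction P using Cmd.induct with
  | skip => intro f g h; exact h
  | assign x e => intro f g h σ; exact h _
  | store a i e => intro f g h σ; exact h _
  | seq P Q hP hQ => intro f g h; exact hP (hQ h)
  | ite b P Q hP hQ =>
    intro f g h σ
    simp only [expect]
    split_ifs
    · exact hP h _
    · exact hQ h _
  | loop b P hP =>
    intro f g h σ
    rw [expect_while, expect_while]
    refine iSup_mono fun t => ?_
    have : (A.unfold w b P f)^[t] (fun _ => 0) ≤ (A.unfold w b P g)^[t] (fun _ => 0) := by
      induction t with
      | zero => exact le_rfl
      | succ t ih =>
        rw [Function.iterate_succ_apply', Function.iterate_succ_apply']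
        intro τ
        simp only [unfold]
        split_ifs
        · exact hP ih _
        · exact h _
    exact this σ
  | rand x e =>
    intro f g h σ
    simp only [expect]
    gcongr
    exact h _
  | coin x e e' =>
    intro f g h σ
    simp only [expect]
    gcongr <;> exact h _
  | deg x v => intro f g h σ; exact h _
  | nbr x v i => intro f g h σ; exact h _
  | adj x u v => intro f g h σ; exact h _
  | sample x =>
    intro f g h σ
    simp only [expect]
    gcongr
    exact h _

theorem unfold_mono (b : Exp) (P : Cmd) (f : State → ℝ≥0∞) : Monotone (A.unfold w b P f) := by
  intro X Y h τ
  simp only [unfold]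
  split_ifs
  · exact A.expect_mono w P h _
  · exact le_rfl

theorem monotone_unfold_iterate (b : Exp) (P : Cmd) (f : State → ℝ≥0∞) :
    Monotone fun t : ℕ => (A.unfold w b P f)^[t] (fun _ => 0) := by
  refine monotone_nat_of_le_succ fun t => ?_
  rw [Function.iterate_succ_apply]
  exact (A.unfold_mono w b P f).iterate t (fun _ => bot_le)

/-- Monotone convergence. For a loop, two suprema are exchanged and each finite unfolding is
continuous by induction. This turns Kleene iterates into fixed points and later removes truncations.
-/
theorem expect_iSup (P : Cmd) : ∀ X : ℕ → State → ℝ≥0∞, Monotone X →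
    A.expect w P (fun τ => ⨆ s, X s τ) = fun σ => ⨆ s, A.expect w P (X s) σ := by
  induction P using Cmd.induct with
  | skip => intro X hX; rfl
  | assign x e => intro X hX; rfl
  | store a i e => intro X hX; rfl
  | seq P Q hP hQ =>
    intro X hX
    simp only [expect]
    rw [hQ X hX, hP _ (fun s t hst => A.expect_mono w Q (hX hst))]
  | ite b P Q hP hQ =>
    intro X hX
    funext σ
    simp only [expect]
    split_ifs
    · rw [hP X hX]
    · rw [hQ X hX]
  | loop b P hP =>
    intro X hX
    funext σ
    simp only [expect_while]
    rw [iSup_comm]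
    refine iSup_congr fun t => ?_
    have hm : ∀ t : ℕ, Monotone fun s => (A.unfold w b P (X s))^[t] (fun _ => 0) := by
      intro t
      induction t with
      | zero => exact fun _ _ _ => le_rfl
      | succ t ih =>
        intro s s' h
        simp only [Function.iterate_succ_apply']
        intro τ
        simp only [unfold]
        split_ifs
        · exact A.expect_mono w P (ih h) _
        · exact hX h _
    have : (A.unfold w b P (fun τ => ⨆ s, X s τ))^[t] (fun _ => 0) =
        fun τ => ⨆ s, (A.unfold w b P (X s))^[t] (fun _ => 0) τ := by
      induction t with
      | zero => funext τ; simp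
      | succ t ih =>
        simp only [Function.iterate_succ_apply', ih]
        funext τ
        simp only [unfold]
        split_ifs
        · rw [hP _ (hm t)]
        · rfl
    rw [this]
  | rand x e =>
    intro X hX
    funext σ
    simp only [expect]
    rw [ENNReal.finsetSum_iSup_of_monotone
      (f := fun v s => X s ((σ.setReg x v).tick (e.cost w σ + words w (e.eval σ))))
      (fun v s t h => hX h _), ENNReal.iSup_div]
  | coin x e e' =>
    intro X hX
    funext σ
    simp only [expect]
    rw [ENNReal.mul_iSup, ENNReal.mul_iSup, ENNReal.iSup_add_iSup_of_monotone]
    · intro s t h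
      dsimp only
      gcongr
      exact hX h _
    · intro s t h
      dsimp only
      gcongr
      exact hX h _
  | deg x v => intro X hX; rfl
  | nbr x v i => intro X hX; rfl
  | adj x u v => intro X hX; rfl
  | sample x =>
    intro X hX
    funext σ
    simp only [expect, ENNReal.mul_iSup]
    rw [ENNReal.finsetSum_iSup_of_monotone]
    intro v s t h
    dsimp only
    gcongr
    exact hX h _

/-- Kleene's fixed point theorem: dropping the first iterate does not change the supremum, and one
unfolding commutes with it by continuity. -/
theorem expect_while_eq (b : Exp) (P : Cmd) (f : State → ℝ≥0∞) :
    A.expect w (.while b P) f = A.unfold w b P f (A.expect w (.while b P) f) := by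
  have h1 : A.expect w (.while b P) f =
      fun σ => ⨆ t : ℕ, (A.unfold w b P f)^[t] (fun _ => 0) σ := rfl
  have hm := A.monotone_unfold_iterate w b P f
  have h2 : ∀ σ, ⨆ t : ℕ, (A.unfold w b P f)^[t] (fun _ => 0) σ =
      ⨆ t : ℕ, (A.unfold w b P f)^[t + 1] (fun _ => 0) σ := fun σ =>
    ((Monotone.iSup_nat_add (f := fun t : ℕ => (A.unfold w b P f)^[t] (fun _ => 0) σ)
      (fun _ _ h => hm h σ)) 1).symm
  funext σ
  conv_lhs => rw [h1]
  dsimp only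
  rw [h2]
  simp only [Function.iterate_succ_apply']
  rw [h1]
  simp only [unfold]
  split_ifs
  · rw [A.expect_iSup w P _ hm]
  · simp

/-- Park induction: a pre-fixed point bounds the expectation of a loop. -/
theorem expect_while_le {b : Exp} {P : Cmd} {f I : State → ℝ≥0∞} (h : A.unfold w b P f I ≤ I) :
    A.expect w (.while b P) f ≤ I := by
  intro σ
  rw [expect_while]
  refine iSup_le fun t => ?_
  have : (A.unfold w b P f)^[t] (fun _ => 0) ≤ I := by
    induction t with
    | zero => exact fun _ => bot_le
    | succ t ih =>
      rw [Function.iterate_succ_apply']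
      exact (A.unfold_mono w b P f ih).trans h
  exact this σ

/-- Additivity passes from the finite unfoldings of a loop to the limit because both sequences of
iterates are monotone. -/
theorem expect_add (P : Cmd) : ∀ f g : State → ℝ≥0∞,
    A.expect w P (fun τ => f τ + g τ) = fun σ => A.expect w P f σ + A.expect w P g σ := by
  induction P using Cmd.induct with
  | skip => intro f g; rfl
  | assign x e => intro f g; rfl
  | store a i e => intro f g; rfl
  | seq P Q hP hQ => intro f g; simp only [expect]; rw [hQ, hP]
  | ite b P Q hP hQ =>
    intro f g
    funext σ
    simp only [expect]
    split_ifs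
    · rw [hP]
    · rw [hQ]
  | loop b P hP =>
    intro f g
    funext σ
    simp only [expect_while]
    rw [ENNReal.iSup_add_iSup_of_monotone
      (fun _ _ h => A.monotone_unfold_iterate w b P f h σ)
      (fun _ _ h => A.monotone_unfold_iterate w b P g h σ)]
    refine iSup_congr fun t => ?_
    have : (A.unfold w b P (fun τ => f τ + g τ))^[t] (fun _ => 0) =
        fun τ => (A.unfold w b P f)^[t] (fun _ => 0) τ +
          (A.unfold w b P g)^[t] (fun _ => 0) τ := by
      induction t with
      | zero => funext τ; simp
      | succ t ih =>
        simp only [Function.iterate_succ_apply', ih]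
        funext τ
        simp only [unfold]
        split_ifs
        · rw [hP]
        · rfl
    rw [this]
  | rand x e =>
    intro f g
    funext σ
    simp only [expect, Finset.sum_add_distrib, ENNReal.add_div]
  | coin x e e' =>
    intro f g
    funext σ
    simp only [expect]
    ring
  | deg x v => intro f g; rfl
  | nbr x v i => intro f g; rfl
  | adj x u v => intro f g; rfl
  | sample x =>
    intro f g
    funext σ
    simp only [expect, mul_add, Finset.sum_add_distrib]

/-- Total mass is at most one. The inequality can be strict, since diverging runs contribute
nothing; for loops the constant itself is a pre-fixed point. -/
theorem expect_const_le (c : ℝ≥0∞) (P : Cmd) : A.expect w P (fun _ => c) ≤ fun _ => c := by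
  induction P using Cmd.induct with
  | skip => exact le_rfl
  | assign x e => exact fun _ => le_rfl
  | store a i e => exact fun _ => le_rfl
  | seq P Q hP hQ => exact (A.expect_mono w P hQ).trans hP
  | ite b P Q hP hQ =>
    intro σ
    simp only [expect]
    split_ifs
    · exact hP _
    · exact hQ _
  | loop b P hP =>
    refine A.expect_while_le w fun τ => ?_
    simp only [unfold]
    split_ifs
    · exact hP _
    · exact le_rfl
  | rand x e =>
    intro σ
    simp only [expect, Finset.sum_const, Finset.card_range, nsmul_eq_mul]
    refine ENNReal.div_le_of_le_mul ?_
    rw [mul_comm]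
  | coin x e e' =>
    intro σ
    simp only [expect]
    rw [← add_mul, add_tsub_cancel_of_le (min_le_left _ _), one_mul]
  | deg x v => exact fun _ => le_rfl
  | nbr x v i => exact fun _ => le_rfl
  | adj x u v => exact fun _ => le_rfl
  | sample x =>
    intro σ
    simp only [expect]
    rw [← Finset.sum_mul, ← tsum_fintype (L := .unconditional _), PMF.tsum_coe, one_mul]

/-- Every query takes at least one unit of time. -/
theorem expect_congr_of_queries_le (a b : ℕ) (P : Cmd) : ∀ {f g : State → ℝ≥0∞},
    (∀ τ, τ.queries + a ≤ τ.time + b → f τ = g τ) →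
    ∀ σ, σ.queries + a ≤ σ.time + b → A.expect w P f σ = A.expect w P g σ := by
  have ht : ∀ (σ : State) (t : ℕ), σ.queries + a ≤ σ.time + b →
      (σ.tick t).queries + a ≤ (σ.tick t).time + b := by
    intro σ t h; simp only [State.tick]; omega
  have hs : ∀ (σ : State) (x v t : ℕ), σ.queries + a ≤ σ.time + b →
      ((σ.setReg x v).tick t).queries + a ≤ ((σ.setReg x v).tick t).time + b := by
    intro σ x v t h; simp only [State.tick, State.setReg]; omega
  have hq : ∀ (σ : State) (x v t : ℕ), 1 ≤ t → σ.queries + a ≤ σ.time + b →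
      ((σ.setReg x v).countQuery.tick t).queries + a ≤
        ((σ.setReg x v).countQuery.tick t).time + b := by
    intro σ x v t h1 h; simp only [State.tick, State.setReg, State.countQuery]; omega
  induction P using Cmd.induct with
  | skip => intro f g h σ hσ; exact h _ hσ
  | assign x e => intro f g h σ hσ; exact h _ (hs _ _ _ _ hσ)
  | store x i e =>
    intro f g h σ hσ
    refine h _ ?_
    simp only [State.tick, State.setArr]; omega
  | seq P Q hP hQ => intro f g h σ hσ; exact hP (hQ h) σ hσ
  | ite e P Q hP hQ =>
    intro f g h σ hσ
    simp only [expect]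
    split_ifs
    · exact hP h _ (ht _ _ hσ)
    · exact hQ h _ (ht _ _ hσ)
  | loop e P hP =>
    intro f g h σ hσ
    rw [expect_while, expect_while]
    refine iSup_congr fun t => ?_
    have : ∀ τ : State, τ.queries + a ≤ τ.time + b →
        (A.unfold w e P f)^[t] (fun _ => 0) τ = (A.unfold w e P g)^[t] (fun _ => 0) τ := by
      induction t with
      | zero => exact fun _ _ => rfl
      | succ t ih =>
        intro τ hτ
        simp only [Function.iterate_succ_apply']
        unfold unfold
        split_ifs
        · exact hP ih _ (ht _ _ hτ)
        · exact h _ (ht _ _ hτ)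
    exact this σ hσ
  | rand x e =>
    intro f g h σ hσ
    simp only [expect]
    congr 1
    exact Finset.sum_congr rfl fun v _ => h _ (hs _ _ _ _ hσ)
  | coin x e e' =>
    intro f g h σ hσ
    simp only [expect]
    rw [h _ (hs _ _ _ _ hσ), h _ (hs _ _ _ _ hσ)]
  | deg x v => intro f g h σ hσ; exact h _ (hq _ _ _ _ (by omega) hσ)
  | nbr x v i => intro f g h σ hσ; exact h _ (hq _ _ _ _ (by omega) hσ)
  | adj x u v => intro f g h σ hσ; exact h _ (hq _ _ _ _ (by omega) hσ)
  | sample x =>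
    intro f g h σ hσ
    simp only [expect]
    exact Finset.sum_congr rfl fun o _ => by rw [h _ (hs _ _ _ _ hσ)]

end Access

/-! ### Averages with respect to discrete distributions -/

/-- The expectation of `v` under `μ`. -/
def avg {O : Type} (μ : PMF O) (v : O → ℝ≥0∞) : ℝ≥0∞ := ∑' o, μ o * v o

section Avg

variable {O O' : Type}

@[simp] theorem avg_pure (a : O) (v : O → ℝ≥0∞) : avg (PMF.pure a) v = v a := by
  classical
  rw [avg, tsum_eq_single a]
  · simp
  · intro b hb; simp [PMF.pure_apply, hb]

theorem avg_bind (μ : PMF O) (ν : O → PMF O') (v : O' → ℝ≥0∞) :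
    avg (μ.bind ν) v = avg μ (fun o => avg (ν o) v) := by
  simp only [avg, PMF.bind_apply, ← ENNReal.tsum_mul_left, ← ENNReal.tsum_mul_right]
  rw [ENNReal.tsum_comm]
  simp only [mul_assoc]

theorem avg_map (μ : PMF O) (g : O → O') (v : O' → ℝ≥0∞) :
    avg (μ.map g) v = avg μ (fun o => v (g o)) := by
  rw [PMF.map, avg_bind]
  simp

theorem avg_mono (μ : PMF O) {v v' : O → ℝ≥0∞} (h : ∀ o, v o ≤ v' o) : avg μ v ≤ avg μ v' :=
  ENNReal.tsum_le_tsum fun o => by gcongr; exact h o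

theorem avg_congr (μ : PMF O) {v v' : O → ℝ≥0∞} (h : ∀ o, v o = v' o) : avg μ v = avg μ v' := by
  rw [funext h]

theorem avg_add (μ : PMF O) (v v' : O → ℝ≥0∞) :
    avg μ (fun o => v o + v' o) = avg μ v + avg μ v' := by
  simp only [avg, mul_add, ENNReal.tsum_add]

@[simp] theorem avg_const (μ : PMF O) (c : ℝ≥0∞) : avg μ (fun _ => c) = c := by
  rw [avg, ENNReal.tsum_mul_right, PMF.tsum_coe, one_mul]

theorem avg_le_const (μ : PMF O) {v : O → ℝ≥0∞} {c : ℝ≥0∞} (h : ∀ o, v o ≤ c) : avg μ v ≤ c :=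
  (avg_mono μ h).trans_eq (avg_const μ c)

theorem avg_mul_left (μ : PMF O) (c : ℝ≥0∞) (v : O → ℝ≥0∞) :
    avg μ (fun o => c * v o) = c * avg μ v := by
  simp only [avg, ← ENNReal.tsum_mul_left]
  exact tsum_congr fun o => by ring

theorem avg_finset_sum {ι : Type} (μ : PMF O) (s : Finset ι) (v : ι → O → ℝ≥0∞) :
    avg μ (fun o => ∑ i ∈ s, v i o) = ∑ i ∈ s, avg μ (v i) := by
  classical
  induction s using Finset.induction_on with
  | empty => simp
  | insert a s ha ih => simp only [Finset.sum_insert ha, avg_add, ih]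

theorem avg_single [DecidableEq O] (μ : PMF O) (a : O) :
    avg μ (fun o => if o = a then 1 else 0) = μ a := by
  rw [avg, tsum_eq_single a]
  · simp
  · intro b hb; simp [hb]

/-- The uniform distribution on `{0, …, max 1 a - 1}`. -/
def unif (a : ℕ) : PMF ℕ :=
  PMF.uniformOfFinset (Finset.range (max 1 a)) (Finset.nonempty_range_iff.2 (by omega))

theorem avg_unif (a : ℕ) (v : ℕ → ℝ≥0∞) :
    avg (unif a) v = (∑ i ∈ Finset.range (max 1 a), v i) / ((max 1 a : ℕ) : ℝ≥0∞) := by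
  rw [avg, tsum_eq_sum (s := Finset.range (max 1 a))]
  · rw [ENNReal.div_eq_inv_mul, Finset.mul_sum]
    refine Finset.sum_congr rfl fun i hi => ?_
    rw [unif, PMF.uniformOfFinset_apply_of_mem _ hi, Finset.card_range]
  · intro i hi
    rw [unif, PMF.uniformOfFinset_apply_of_notMem _ hi, zero_mul]

/-- The uniform distribution on the vertices. -/
def unifFin (n : ℕ) [NeZero n] : PMF (Fin n) := PMF.uniformOfFintype (Fin n)

theorem avg_unifFin (n : ℕ) [NeZero n] (v : Fin n → ℝ≥0∞) :
    avg (unifFin n) v = (∑ i, v i) / (n : ℝ≥0∞) := by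
  rw [avg, tsum_fintype, ENNReal.div_eq_inv_mul, Finset.mul_sum]
  simp [unifFin]

/-- The coin of bias `min 1 √(a / b)`. -/
def coinPMF (a b : ℕ) : PMF Bool :=
  PMF.ofFintype (fun t => if t then min 1 (ENNReal.ofReal √((a : ℝ) / (b : ℝ)))
    else 1 - min 1 (ENNReal.ofReal √((a : ℝ) / (b : ℝ)))) (by simp)

theorem avg_coinPMF (a b : ℕ) (v : Bool → ℝ≥0∞) :
    avg (coinPMF a b) v = min 1 (ENNReal.ofReal √((a : ℝ) / (b : ℝ))) * v true +
      (1 - min 1 (ENNReal.ofReal √((a : ℝ) / (b : ℝ)))) * v false := by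
  rw [avg, tsum_fintype]
  simp [coinPMF]

end Avg

/-! ### Refinement of programs to distributions -/

/-- From the state `σ`, the program `P` produces an outcome with distribution `μ`: the final state
can be coupled with the outcome in such a way that they are related by `Q`. -/
def Ref {n : ℕ} (A : Access n) (w : ℕ) {O : Type} (P : Cmd) (σ : State) (μ : PMF O)
    (Q : O → State → Prop) : Prop :=
  ∀ (v : O → ℝ≥0∞) (f : State → ℝ≥0∞), (∀ o τ, Q o τ → v o ≤ f τ) →
    avg μ v ≤ A.expect w P f σ

namespace Ref

variable {n : ℕ} {A : Access n} {w : ℕ} {O O' : Type} {P P' : Cmd} {σ : State} {μ : PMF O}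
  {Q : O → State → Prop}

theorem mono {Q' : O → State → Prop} (h : Ref A w P σ μ Q) (hQ : ∀ o τ, Q o τ → Q' o τ) :
    Ref A w P σ μ Q' := fun v f hvf => h v f fun o τ ho => hvf o τ (hQ o τ ho)

theorem seq {ν : O → PMF O'} {Q' : O' → State → Prop} (h : Ref A w P σ μ Q)
    (h' : ∀ o τ, Q o τ → Ref A w P' τ (ν o) Q') : Ref A w (.seq P P') σ (μ.bind ν) Q' := by
  intro v f hvf
  rw [avg_bind]
  exact h _ _ fun o τ ho => h' o τ ho v f hvf

theorem map (g : O → O') (h : Ref A w P σ μ Q) :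
    Ref A w P σ (μ.map g) (fun o' τ => ∃ o, g o = o' ∧ Q o τ) := by
  intro v f hvf
  rw [avg_map]
  exact h _ _ fun o τ ho => hvf _ τ ⟨o, rfl, ho⟩

theorem while_true {b : Exp} {ν : O → PMF O'} {Q' : O' → State → Prop} (hb : b.eval σ ≠ 0)
    (h : Ref A w P (σ.tick (1 + b.cost w σ)) μ Q)
    (h' : ∀ o τ, Q o τ → Ref A w (.while b P) τ (ν o) Q') :
    Ref A w (.while b P) σ (μ.bind ν) Q' := by
  intro v f hvf
  rw [A.expect_while_eq, Access.unfold, if_pos hb, avg_bind]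
  exact h _ _ fun o τ ho => h' o τ ho v f hvf

theorem while_false {b : Exp} (hb : b.eval σ = 0) (o : O) (hQ : Q o (σ.tick (1 + b.cost w σ))) :
    Ref A w (.while b P) σ (PMF.pure o) Q := by
  intro v f hvf
  rw [A.expect_while_eq, Access.unfold, if_neg (by simpa using hb), avg_pure]
  exact hvf _ _ hQ

/-- The one-sided definition of `Ref` already yields upper bounds: the lower bound is applied to `C
- min C v`, and since `μ` has mass exactly one while the program has mass at most one, subtracting
from `C` reverses the inequality. Then `C` tends to infinity. -/
theorem expect_le (h : Ref A w P σ μ Q) {v : O → ℝ≥0∞} {f : State → ℝ≥0∞}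
    (hvf : ∀ o τ, Q o τ → f τ ≤ v o) : A.expect w P f σ ≤ avg μ v := by
  have key : ∀ C : ℕ, A.expect w P (fun τ => min (C : ℝ≥0∞) (f τ)) σ ≤ avg μ v := by
    intro C
    have h1 : avg μ (fun o => (C : ℝ≥0∞) - min (C : ℝ≥0∞) (v o)) ≤
        A.expect w P (fun τ => (C : ℝ≥0∞) - min (C : ℝ≥0∞) (f τ)) σ :=
      h _ _ fun o τ ho => by gcongr; exact hvf o τ ho
    have h2 : A.expect w P (fun τ => min (C : ℝ≥0∞) (f τ)) σ +
        A.expect w P (fun τ => (C : ℝ≥0∞) - min (C : ℝ≥0∞) (f τ)) σ ≤ C := by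
      have := A.expect_add w P (fun τ => min (C : ℝ≥0∞) (f τ))
        (fun τ => (C : ℝ≥0∞) - min (C : ℝ≥0∞) (f τ))
      rw [← congrFun this σ]
      refine le_trans (le_of_eq ?_) (A.expect_const_le w (C : ℝ≥0∞) P σ)
      congr 1
      funext τ
      exact add_tsub_cancel_of_le (min_le_left _ _)
    have h3 : avg μ (fun o => min (C : ℝ≥0∞) (v o)) +
        avg μ (fun o => (C : ℝ≥0∞) - min (C : ℝ≥0∞) (v o)) = C := by
      rw [← avg_add]
      simp only [add_tsub_cancel_of_le (min_le_left _ _), avg_const]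
    have h4 : avg μ (fun o => (C : ℝ≥0∞) - min (C : ℝ≥0∞) (v o)) ≠ ⊤ :=
      ne_top_of_le_ne_top (ENNReal.natCast_ne_top C) (avg_le_const μ fun o => tsub_le_self)
    have h5 : A.expect w P (fun τ => min (C : ℝ≥0∞) (f τ)) σ ≤
        avg μ (fun o => min (C : ℝ≥0∞) (v o)) := by
      rw [← ENNReal.add_le_add_iff_right h4, h3]
      exact le_trans (by gcongr) h2
    exact h5.trans (avg_mono μ fun o => min_le_right _ _)
  have hsup : f = fun τ => ⨆ C : ℕ, min (C : ℝ≥0∞) (f τ) := by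
    funext τ
    rw [← iSup_inf_eq, ENNReal.iSup_natCast, top_inf_eq]
  rw [hsup, A.expect_iSup w P (fun C τ => min (C : ℝ≥0∞) (f τ))]
  · exact iSup_le key
  · intro C C' hC τ
    exact min_le_min_right _ (by exact_mod_cast hC)

theorem expect_eq (h : Ref A w P σ μ Q) {v : O → ℝ≥0∞} {f : State → ℝ≥0∞}
    (hvf : ∀ o τ, Q o τ → f τ = v o) : A.expect w P f σ = avg μ v :=
  le_antisymm (h.expect_le fun o τ ho => (hvf o τ ho).le) (h _ _ fun o τ ho => (hvf o τ ho).ge)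

theorem prob_eq_one (h : Ref A w P σ μ Q) {E : State → Prop} (hE : ∀ o τ, Q o τ → E τ) :
    A.prob w P σ E = 1 := by
  classical
  rw [Access.prob, h.expect_eq (v := fun _ => 1), avg_const]
  intro o τ ho
  simp [hE o τ ho]

open Classical in
theorem prob_eq (h : Ref A w P σ μ Q) {E : State → Prop} {E' : O → Prop}
    (hE : ∀ o τ, Q o τ → (E τ ↔ E' o)) :
    A.prob w P σ E = avg μ (fun o => if E' o then 1 else 0) := by
  rw [Access.prob, h.expect_eq (v := fun o => if E' o then 1 else 0)]
  intro o τ ho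
  simp [hE o τ ho]

open Classical in
theorem prob_eq_apply (h : Ref A w P σ μ Q) {E : State → Prop} {a : O}
    (hE : ∀ o τ, Q o τ → (E τ ↔ o = a)) : A.prob w P σ E = μ a := by
  rw [h.prob_eq hE, ← avg_single μ a]

end Ref

/-! ### Costs -/

namespace Exp

/-- A measure of the length of an expression. -/
def size : Exp → ℕ
  | lit v => v + 1
  | reg _ => 1
  | get _ i => i.size + 1
  | add e f => e.size + f.size + 1
  | sub e f => e.size + f.size + 1
  | mul e f => e.size + f.size + 1
  | div e f => e.size + f.size + 1
  | lt e f => e.size + f.size + 1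
  | eq e f => e.size + f.size + 1

/-- All numbers read in the evaluation of the expression fit into `c` words. -/
def Bdd (w c : ℕ) (σ : State) : Exp → Prop
  | lit _ => True
  | reg x => σ.reg x < 2 ^ (c * w)
  | get a i => i.Bdd w c σ ∧ σ.arr a (i.eval σ) < 2 ^ (c * w)
  | add e f => e.Bdd w c σ ∧ f.Bdd w c σ
  | sub e f => e.Bdd w c σ ∧ f.Bdd w c σ
  | mul e f => e.Bdd w c σ ∧ f.Bdd w c σ
  | div e f => e.Bdd w c σ ∧ f.Bdd w c σ
  | lt e f => e.Bdd w c σ ∧ f.Bdd w c σ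
  | eq e f => e.Bdd w c σ ∧ f.Bdd w c σ

theorem one_le_size (e : Exp) : 1 ≤ e.size := by cases e <;> simp [size]

end Exp

theorem words_le {w v c : ℕ} (hw : 1 ≤ w) (hc : 1 ≤ c) (hv : v < 2 ^ (c * w)) : words w v ≤ c := by
  have h1 : Nat.log 2 v / w < c := by
    rw [Nat.div_lt_iff_lt_mul hw]
    exact Nat.log_lt_of_lt_pow' (by positivity) hv
  rw [words]; omega

namespace Exp

variable {w c : ℕ} {σ : State}

/-- Lengths of numbers add up along an expression, even under multiplication. A literal `v` has size
`v + 1`, so that `v < 2 ^ v` suffices for it. -/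
theorem eval_lt (hw : 1 ≤ w) (hc : 1 ≤ c) (e : Exp) (h : e.Bdd w c σ) :
    e.eval σ < 2 ^ (c * e.size * w) := by
  have hcw : 1 ≤ c * w := Nat.mul_pos hc hw
  have two : ∀ e : Exp, 2 ≤ 2 ^ (c * e.size * w) := fun e => by
    have : 1 ≤ c * e.size * w := Nat.mul_pos (Nat.mul_pos hc e.one_le_size) hw
    calc 2 = 2 ^ 1 := rfl
      _ ≤ _ := Nat.pow_le_pow_right (by norm_num) this
  have step : ∀ a b : Exp, 2 ^ (c * a.size * w) * 2 ^ (c * b.size * w) ≤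
      2 ^ (c * (a.size + b.size + 1) * w) := fun a b => by
    rw [← pow_add]
    apply Nat.pow_le_pow_right (by norm_num)
    nlinarith
  have one : ∀ s : ℕ, 1 ≤ s → 1 < 2 ^ (c * s * w) := fun s hs =>
    Nat.one_lt_two_pow (Nat.mul_pos (Nat.mul_pos hc hs) hw).ne'
  induction e with
  | lit v =>
    simp only [eval, size]
    calc v < 2 ^ v := Nat.lt_two_pow_self
      _ ≤ _ := Nat.pow_le_pow_right (by norm_num) (by nlinarith)
  | reg x => simpa [eval, size, Bdd] using h
  | get a i ih =>
    refine lt_of_lt_of_le h.2 (Nat.pow_le_pow_right (by norm_num) ?_)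
    simp only [size]; nlinarith
  | add e f he hf =>
    simp only [eval, size]
    have := he h.1; have := hf h.2; have := step e f; have := two e; have := two f
    nlinarith
  | sub e f he hf =>
    simp only [eval, size]
    have := he h.1; have := step e f; have := two e; have := two f
    have : e.eval σ - f.eval σ ≤ e.eval σ := Nat.sub_le _ _
    nlinarith
  | mul e f he hf =>
    simp only [eval, size]
    have h1 := he h.1; have h2 := hf h.2
    exact lt_of_lt_of_le (Nat.mul_lt_mul'' h1 h2) (step e f)
  | div e f he hf =>
    simp only [eval, size]
    have := he h.1; have := step e f; have := two e; have := two f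
    have : e.eval σ / f.eval σ ≤ e.eval σ := Nat.div_le_self _ _
    nlinarith
  | lt e f he hf =>
    simp only [eval, size]
    split_ifs
    · exact one _ (by omega)
    · positivity
  | eq e f he hf =>
    simp only [eval, size]
    split_ifs
    · exact one _ (by omega)
    · positivity

theorem words_eval_le (hw : 1 ≤ w) (hc : 1 ≤ c) (e : Exp) (h : e.Bdd w c σ) :
    words w (e.eval σ) ≤ c * e.size :=
  words_le hw (Nat.mul_pos hc e.one_le_size) (eval_lt hw hc e h)

/-- Each of the operations, fewer than the size, costs a product of two lengths that are linear in
the size; the cube is superadditive with room for the mixed product. -/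
theorem cost_le (hw : 1 ≤ w) (hc : 1 ≤ c) (e : Exp) (h : e.Bdd w c σ) :
    e.cost w σ ≤ c ^ 2 * e.size ^ 3 := by
  have step : ∀ (a b p q : ℕ) (e f : Exp), a ≤ c ^ 2 * e.size ^ 3 → b ≤ c ^ 2 * f.size ^ 3 →
      p ≤ c * e.size → q ≤ c * f.size →
      a + b + p * q ≤ c ^ 2 * (e.size + f.size + 1) ^ 3 := by
    intro a b p q e f h1 h2 h3 h4
    have h5 : p * q ≤ c ^ 2 * (e.size * f.size) := by
      calc p * q ≤ (c * e.size) * (c * f.size) := Nat.mul_le_mul h3 h4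
        _ = _ := by ring
    have h6 : e.size ^ 3 + f.size ^ 3 + e.size * f.size ≤ (e.size + f.size + 1) ^ 3 := by
      ring_nf
      nlinarith [Nat.zero_le (e.size * f.size), Nat.zero_le (e.size * f.size ^ 2),
        Nat.zero_le (e.size ^ 2 * f.size)]
    calc a + b + p * q ≤ c ^ 2 * (e.size ^ 3 + f.size ^ 3 + e.size * f.size) := by
          rw [mul_add, mul_add]; omega
      _ ≤ _ := Nat.mul_le_mul_left _ h6
  have hc2 : c ≤ c ^ 2 := by nlinarith
  induction e with
  | lit v =>
    have := words_eval_le (σ := σ) hw hc (.lit v) trivial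
    simp only [eval, size, cost] at *
    calc _ ≤ _ := this
      _ ≤ c ^ 2 * (v + 1) ^ 3 := Nat.mul_le_mul hc2 (by nlinarith [Nat.zero_le (v ^ 2), Nat.zero_le (v ^ 3)])
  | reg x =>
    have := words_eval_le (σ := σ) hw hc (.reg x) h
    simp only [eval, size, cost] at *
    nlinarith
  | get a i ih =>
    have h1 := words_eval_le hw hc i h.1
    have h2 := words_le hw hc h.2
    have h3 := ih h.1
    have h4 := i.one_le_size
    simp only [size, cost]
    have h5 : c * i.size ≤ c ^ 2 * i.size := Nat.mul_le_mul_right _ hc2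
    have h6 : c ^ 2 * (i.size + 1) ^ 3 = c ^ 2 * i.size ^ 3 + 3 * (c ^ 2 * i.size ^ 2) +
      3 * (c ^ 2 * i.size) + c ^ 2 := by ring
    have h7 : 0 ≤ c ^ 2 * i.size ^ 2 := Nat.zero_le _
    omega
  | add e f he hf =>
    exact step _ _ _ _ e f (he h.1) (hf h.2) (words_eval_le hw hc e h.1) (words_eval_le hw hc f h.2)
  | sub e f he hf =>
    exact step _ _ _ _ e f (he h.1) (hf h.2) (words_eval_le hw hc e h.1) (words_eval_le hw hc f h.2)
  | mul e f he hf =>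
    exact step _ _ _ _ e f (he h.1) (hf h.2) (words_eval_le hw hc e h.1) (words_eval_le hw hc f h.2)
  | div e f he hf =>
    exact step _ _ _ _ e f (he h.1) (hf h.2) (words_eval_le hw hc e h.1) (words_eval_le hw hc f h.2)
  | lt e f he hf =>
    exact step _ _ _ _ e f (he h.1) (hf h.2) (words_eval_le hw hc e h.1) (words_eval_le hw hc f h.2)
  | eq e f he hf =>
    exact step _ _ _ _ e f (he h.1) (hf h.2) (words_eval_le hw hc e h.1) (words_eval_le hw hc f h.2)

end Exp

/-- `U` bounds the cost of one command when all numbers fit into `c` words. -/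
structure Mach (w c U : ℕ) : Prop where
  hw : 1 ≤ w
  hc : 1 ≤ c
  hU : 10 ^ 8 * c ^ 2 ≤ U

/-- With sizes up to `200` this is `10 * 200 ^ 3 = 8 * 10 ^ 7`, below the constant `10 ^ 8` in
`Mach`. The factor `10` lets one unit `U` pay for all expressions of a command together with its
fixed charges. -/
theorem Mach.cost_le {w c U : ℕ} (hM : Mach w c U) {σ : State} {e : Exp} (h : e.Bdd w c σ)
    (hs : e.size ≤ 200) : 10 * e.cost w σ ≤ U := by
  have h1 := Exp.cost_le hM.hw hM.hc e h
  have h2 : e.size ^ 3 ≤ 200 ^ 3 := Nat.pow_le_pow_left hs 3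
  have h3 := hM.hU
  have h4 : c ^ 2 * e.size ^ 3 ≤ c ^ 2 * 200 ^ 3 := Nat.mul_le_mul_left _ h2
  omega

theorem Mach.words_le {w c U : ℕ} (hM : Mach w c U) {σ : State} {e : Exp} (h : e.Bdd w c σ)
    (hs : e.size ≤ 200) : words w (e.eval σ) ≤ 200 * c := by
  have h1 := Exp.words_eval_le hM.hw hM.hc e h
  nlinarith

theorem Mach.ten_le {w c U : ℕ} (hM : Mach w c U) : 10 ≤ U := by
  have := hM.hU; have := hM.hc
  nlinarith

/-! ### Runs modulo the counters -/

/-- Two states with the same memory. -/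
def SameMem (σ τ : State) : Prop := σ.reg = τ.reg ∧ σ.arr = τ.arr

theorem SameMem.refl (σ : State) : SameMem σ σ := ⟨rfl, rfl⟩

theorem SameMem.eval {σ τ : State} (h : SameMem σ τ) (e : Exp) : e.eval σ = e.eval τ := by
  induction e with
  | lit v => rfl
  | reg x => simp only [Exp.eval, h.1]
  | get a i ih => simp only [Exp.eval, ih, h.2]
  | add e f he hf => simp only [Exp.eval, he, hf]
  | sub e f he hf => simp only [Exp.eval, he, hf]
  | mul e f he hf => simp only [Exp.eval, he, hf]
  | div e f he hf => simp only [Exp.eval, he, hf]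
  | lt e f he hf => simp only [Exp.eval, he, hf]
  | eq e f he hf => simp only [Exp.eval, he, hf]

theorem SameMem.cost {σ τ : State} (h : SameMem σ τ) (w : ℕ) (e : Exp) :
    e.cost w σ = e.cost w τ := by
  induction e with
  | lit v => rfl
  | reg x => simp only [Exp.cost, h.1]
  | get a i ih => simp only [Exp.cost, ih, h.2, h.eval]
  | add e f he hf => simp only [Exp.cost, he, hf, h.eval]
  | sub e f he hf => simp only [Exp.cost, he, hf, h.eval]
  | mul e f he hf => simp only [Exp.cost, he, hf, h.eval]
  | div e f he hf => simp only [Exp.cost, he, hf, h.eval]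
  | lt e f he hf => simp only [Exp.cost, he, hf, h.eval]
  | eq e f he hf => simp only [Exp.cost, he, hf, h.eval]

/-- Starting with the memory of `σ`, the program produces an outcome distributed according to `μ`
and a memory that is related to it by `Q`, in at most `t` units of time of size `U`. -/
def Run {n : ℕ} (A : Access n) (w U : ℕ) {O : Type} (P : Cmd) (t : ℕ) (σ : State) (μ : PMF O)
    (Q : O → State → Prop) : Prop :=
  ∀ σ', SameMem σ' σ → Ref A w P σ' μ
    (fun o τ' => ∃ τ, Q o τ ∧ SameMem τ' τ ∧ τ'.time ≤ σ'.time + t * U)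

/-- `Run` for a program with a single outcome. -/
abbrev Det {n : ℕ} (A : Access n) (w U : ℕ) (P : Cmd) (t : ℕ) (σ : State) (Q : State → Prop) :
    Prop := Run A w U P t σ (PMF.pure ()) (fun _ => Q)

section Lookup

variable (σ : State) (x v y a i : ℕ)

@[simp] theorem setReg_reg : (σ.setReg x v).reg y = if y = x then v else σ.reg y := by
  simp [State.setReg, Function.update_apply]

@[simp] theorem setReg_arr : (σ.setReg x v).arr = σ.arr := rfl

@[simp] theorem setArr_reg : (σ.setArr a i v).reg = σ.reg := rfl

@[simp] theorem setArr_arr (b j : ℕ) :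
    (σ.setArr a i v).arr b j = if b = a ∧ j = i then v else σ.arr b j := by
  simp only [State.setArr, Function.update_apply]
  split_ifs <;> simp_all

theorem setArr_arr_ne {b : ℕ} (h : b ≠ a) : (σ.setArr a i v).arr b = σ.arr b := by
  simp [State.setArr, h]

end Lookup

namespace Run

variable {n : ℕ} {A : Access n} {w c U : ℕ} {O O' : Type} {P P' : Cmd} {t t' : ℕ} {σ : State}
  {μ : PMF O} {Q : O → State → Prop}

theorem mono {Q' : O → State → Prop} (h : Run A w U P t σ μ Q) (ht : t ≤ t')
    (hQ : ∀ o τ, Q o τ → Q' o τ) : Run A w U P t' σ μ Q' := fun σ' hσ =>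
  (h σ' hσ).mono fun _ _ ⟨τ, h1, h2, h3⟩ =>
    ⟨τ, hQ _ _ h1, h2, h3.trans (Nat.add_le_add_left (Nat.mul_le_mul_right _ ht) _)⟩

theorem time (h : Run A w U P t σ μ Q) (ht : t ≤ t') : Run A w U P t' σ μ Q :=
  h.mono ht fun _ _ => id

theorem post {Q' : O → State → Prop} (h : Run A w U P t σ μ Q)
    (hQ : ∀ o τ, Q o τ → Q' o τ) : Run A w U P t σ μ Q' := h.mono le_rfl hQ

theorem seq {ν : O → PMF O'} {Q' : O' → State → Prop} (h : Run A w U P t σ μ Q)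
    (h' : ∀ o τ, Q o τ → Run A w U P' t' τ (ν o) Q') :
    Run A w U (.seq P P') (t + t') σ (μ.bind ν) Q' := by
  intro σ' hσ
  refine (h σ' hσ).seq fun o τ' ⟨τ, h1, h2, h3⟩ => ?_
  refine (h' o τ h1 τ' h2).mono fun o' ρ' ⟨ρ, h4, h5, h6⟩ => ⟨ρ, h4, h5, h6.trans ?_⟩
  rw [add_mul]; omega

/-- Composition with a program with a single outcome on the left. -/
theorem det_seq {Q₁ : State → Prop} (h : Det A w U P t σ Q₁)
    (h' : ∀ τ, Q₁ τ → Run A w U P' t' τ μ Q) : Run A w U (.seq P P') (t + t') σ μ Q := by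
  have := h.seq (ν := fun _ => μ) (fun _ τ hτ => h' τ hτ)
  rwa [PMF.pure_bind] at this

/-- Composition with a program with a single outcome on the right. -/
theorem seq_pure {g : O → O'} {Q' : O' → State → Prop} (h : Run A w U P t σ μ Q)
    (h' : ∀ o τ, Q o τ → Run A w U P' t' τ (PMF.pure (g o)) Q') :
    Run A w U (.seq P P') (t + t') σ (μ.map g) Q' :=
  h.seq h'

/-- Testing against a function supported at the single point `o` shows that only the relation at `o`
matters, so this point may be renamed, even into another type. -/
theorem pure_congr {o : O} {o' : O'} {Q' : O' → State → Prop}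
    (h : Run A w U P t σ (PMF.pure o) Q) (hQ : ∀ τ, Q o τ → Q' o' τ) :
    Run A w U P t σ (PMF.pure o') Q' := by
  intro σ' hσ v f hvf
  rw [avg_pure]
  have := h σ' hσ (fun o₁ => open Classical in if o₁ = o then v o' else 0) f ?_
  · simpa using this
  · rintro o₁ τ' ⟨τ, h1, h2⟩
    split_ifs with ho
    · subst ho; exact hvf _ _ ⟨τ, hQ _ h1, h2⟩
    · exact bot_le

theorem seq_det {Q' : O → State → Prop} (h : Run A w U P t σ μ Q)
    (h' : ∀ o τ, Q o τ → Det A w U P' t' τ (Q' o)) :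
    Run A w U (.seq P P') (t + t') σ μ Q' := by
  have := h.seq_pure (g := id) (Q' := Q') fun o τ hτ => (h' o τ hτ).pure_congr fun τ => id
  rwa [PMF.map_id] at this

/-- Only outcomes of positive probability matter. -/
theorem support (h : Run A w U P t σ μ Q) :
    Run A w U P t σ μ (fun o τ => μ o ≠ 0 ∧ Q o τ) := by
  classical
  intro σ' hσ v f hvf
  have : avg μ v = avg μ (fun o => if μ o ≠ 0 then v o else 0) := by
    refine tsum_congr fun o => ?_
    by_cases ho : μ o = 0 <;> simp [ho]
  rw [this]
  refine h σ' hσ _ f fun o τ' ⟨τ, h1, h2⟩ => ?_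
  split_ifs with ho
  · exact hvf o τ' ⟨τ, ⟨ho, h1⟩, h2⟩
  · exact bot_le

theorem map_outcome (g : O → O') (h : Run A w U P t σ μ Q) :
    Run A w U P t σ (μ.map g) (fun o' τ => ∃ o, g o = o' ∧ Q o τ) := fun σ' hσ =>
  ((h σ' hσ).map g).mono fun _ _ ⟨o, h1, τ, h2, h3⟩ => ⟨τ, ⟨o, h1, h2⟩, h3⟩

theorem skip (o : O) (hQ : Q o σ) : Run A w U .skip 0 σ (PMF.pure o) Q := by
  intro σ' hσ v f hvf
  rw [avg_pure]
  exact hvf _ _ ⟨σ, hQ, hσ, by simp⟩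

theorem ite {b : Exp} (hM : Mach w c U) (hb : b.Bdd w c σ)
    (h : b.eval σ ≠ 0 → Run A w U P t σ μ Q) (h' : b.eval σ = 0 → Run A w U P' t σ μ Q)
    (hs : b.size ≤ 200 := by decide) :
    Run A w U (.ite b P P') (t + 1) σ μ Q := by
  intro σ' hσ v f hvf
  simp only [Access.expect]
  have hcost := hM.cost_le hb hs
  have hten := hM.ten_le
  rw [hσ.eval, hσ.cost]
  split_ifs with hb'
  · refine h hb' (σ'.tick (1 + b.cost w σ)) ⟨hσ.1, hσ.2⟩ v f fun o τ' ⟨τ, h1, h2, h3⟩ => hvf o τ' ⟨τ, h1, h2, h3.trans ?_⟩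
    simp only [State.tick]
    rw [add_mul]; omega
  · refine h' (by simpa using hb') (σ'.tick (1 + b.cost w σ)) ⟨hσ.1, hσ.2⟩ v f
      fun o τ' ⟨τ, h1, h2, h3⟩ => hvf o τ' ⟨τ, h1, h2, h3.trans ?_⟩
    simp only [State.tick]
    rw [add_mul]; omega

theorem while_true {b : Exp} {ν : O → PMF O'} {Q' : O' → State → Prop} (hM : Mach w c U)
    (hb : b.Bdd w c σ) (hb' : b.eval σ ≠ 0) (h : Run A w U P t σ μ Q)
    (h' : ∀ o τ, Q o τ → Run A w U (.while b P) t' τ (ν o) Q')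
    (hs : b.size ≤ 200 := by decide) :
    Run A w U (.while b P) (t + 1 + t') σ (μ.bind ν) Q' := by
  intro σ' hσ
  have hcost := hM.cost_le hb hs
  have hten := hM.ten_le
  refine Ref.while_true (by rwa [hσ.eval]) (h _ ⟨hσ.1, hσ.2⟩) fun o τ' ⟨τ, h1, h2, h3⟩ => ?_
  refine (h' o τ h1 τ' h2).mono fun o' ρ' ⟨ρ, h4, h5, h6⟩ => ⟨ρ, h4, h5, h6.trans ?_⟩
  simp only [State.tick, hσ.cost] at h3
  rw [add_mul, add_mul]; omega

theorem while_false {b : Exp} (hM : Mach w c U) (hb : b.Bdd w c σ) (hb' : b.eval σ = 0) (o : O)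
    (hQ : Q o σ) (hs : b.size ≤ 200 := by decide) :
    Run A w U (.while b P) 1 σ (PMF.pure o) Q := by
  intro σ' hσ
  have hcost := hM.cost_le hb hs
  have hten := hM.ten_le
  refine Ref.while_false (by rwa [hσ.eval]) o ⟨σ, hQ, ⟨hσ.1, hσ.2⟩, ?_⟩
  simp only [State.tick, hσ.cost]
  omega

/-- A loop with a decreasing measure. -/
theorem while_det {b : Exp} (hM : Mach w c U) (I : State → Prop) (meas : State → ℕ)
    (hI : ∀ τ, I τ → b.Bdd w c τ)
    (hP : ∀ τ, I τ → b.eval τ ≠ 0 → Det A w U P t τ (fun τ' => I τ' ∧ meas τ' < meas τ))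
    (hσ : I σ) (hs : b.size ≤ 200 := by decide) :
    Det A w U (.while b P) ((t + 1) * meas σ + 1) σ (fun τ => I τ ∧ b.eval τ = 0) := by
  induction hm : meas σ using Nat.strong_induction_on generalizing σ with
  | _ m ih =>
    by_cases hb : b.eval σ = 0
    · exact (while_false hM (hI σ hσ) hb () ⟨hσ, hb⟩ hs).time (by omega)
    · have hpos : ∀ τ, I τ → meas τ < m →
          Det A w U (.while b P) ((t + 1) * (m - 1) + 1) τ (fun τ => I τ ∧ b.eval τ = 0) :=
        fun τ hτ hlt => (ih _ hlt hτ rfl).time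
          (Nat.add_le_add_right (Nat.mul_le_mul_left _ (by omega)) _)
      rcases Nat.eq_zero_or_pos m with h0 | h0
      · have := while_true (ν := fun _ => PMF.pure ()) (t' := (t + 1) * (m - 1) + 1)
          (Q' := fun _ τ => I τ ∧ b.eval τ = 0) hM (hI σ hσ) hb ((hP σ hσ hb).post
          (Q' := fun _ _ => False) fun _ τ hτ => by omega) (fun _ _ h => h.elim) hs
        intro σ' hσ' v f hvf
        -- With measure zero a decrease is impossible, so the postcondition of the body is empty. A
        -- coupling with an empty relation bounds even the constant `⊤`, which settles this vacuous
        -- case.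
        have h1 := hP σ hσ hb (σ'.tick (1 + b.cost w σ')) ⟨hσ'.1, hσ'.2⟩ (fun _ => ⊤)
          (A.expect w (.while b P) f) (by rintro o τ ⟨ρ, h1, h2⟩; omega)
        rw [A.expect_while_eq, Access.unfold, if_pos (by rwa [hσ'.eval])]
        simp only [avg_pure] at h1
        exact le_top.trans h1
      · have := while_true (ν := fun _ => PMF.pure ()) hM (hI σ hσ) hb (hP σ hσ hb)
          (fun _ τ hτ => hpos τ hτ.1 (by omega)) hs
        rw [PMF.pure_bind] at this
        refine this.time ?_
        obtain ⟨m, rfl⟩ : ∃ m', m = m' + 1 := ⟨m - 1, by omega⟩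
        simp only [Nat.add_sub_cancel, mul_add]
        omega

theorem assign {e : Exp} {x : ℕ} (hM : Mach w c U) (he : e.Bdd w c σ) (o : O)
    (hQ : Q o (σ.setReg x (e.eval σ))) (hs : e.size ≤ 200 := by decide) :
    Run A w U (.assign x e) 1 σ (PMF.pure o) Q := by
  intro σ' hσ v f hvf
  rw [avg_pure]
  have hcost := hM.cost_le he hs
  have hten := hM.ten_le
  refine hvf _ _ ⟨_, hQ, ⟨?_, hσ.2⟩, ?_⟩
  · simp only [State.tick, State.setReg, hσ.eval, hσ.1]
  · simp only [State.tick, State.setReg, hσ.cost]; omega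

theorem store {e i : Exp} {a : ℕ} (hM : Mach w c U) (hi : i.Bdd w c σ) (he : e.Bdd w c σ) (o : O)
    (hQ : Q o (σ.setArr a (i.eval σ) (e.eval σ))) (hsi : i.size ≤ 200 := by decide)
    (hs : e.size ≤ 200 := by decide) :
    Run A w U (.store a i e) 1 σ (PMF.pure o) Q := by
  intro σ' hσ v f hvf
  rw [avg_pure]
  have hcost := hM.cost_le he hs
  have hcosti := hM.cost_le hi hsi
  have hwords := hM.words_le hi hsi
  have h1 := hM.hU
  have h2 := hM.hc
  refine hvf _ _ ⟨_, hQ, ⟨hσ.1, ?_⟩, ?_⟩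
  · simp only [State.tick, State.setArr, hσ.eval, hσ.2]
  · simp only [State.tick, State.setArr, hσ.cost, hσ.eval]; nlinarith

theorem deg {e : Exp} {x : ℕ} (hM : Mach w c U) (he : e.Bdd w c σ) (o : O)
    (hQ : Q o (σ.setReg x (A.degAnswer (e.eval σ)))) (hs : e.size ≤ 200 := by decide) :
    Run A w U (.deg x e) 1 σ (PMF.pure o) Q := by
  intro σ' hσ v f hvf
  rw [avg_pure]
  have hcost := hM.cost_le he hs
  have hten := hM.ten_le
  refine hvf _ _ ⟨_, hQ, ⟨?_, hσ.2⟩, ?_⟩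
  · simp only [State.tick, State.setReg, State.countQuery, hσ.eval, hσ.1]
  · simp only [State.tick, State.setReg, State.countQuery, hσ.cost]; omega

theorem nbr {e i : Exp} {x : ℕ} (hM : Mach w c U) (he : e.Bdd w c σ) (hi : i.Bdd w c σ) (o : O)
    (hQ : Q o (σ.setReg x (A.nbrAnswer (e.eval σ) (i.eval σ)))) (hs : e.size ≤ 200 := by decide)
    (hsi : i.size ≤ 200 := by decide) :
    Run A w U (.nbr x e i) 1 σ (PMF.pure o) Q := by
  intro σ' hσ v f hvf
  rw [avg_pure]
  have hcost := hM.cost_le he hs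
  have hcosti := hM.cost_le hi hsi
  have hten := hM.ten_le
  refine hvf _ _ ⟨_, hQ, ⟨?_, hσ.2⟩, ?_⟩
  · simp only [State.tick, State.setReg, State.countQuery, hσ.eval, hσ.1]
  · simp only [State.tick, State.setReg, State.countQuery, hσ.cost]; omega

theorem adj {e i : Exp} {x : ℕ} (hM : Mach w c U) (he : e.Bdd w c σ) (hi : i.Bdd w c σ) (o : O)
    (hQ : Q o (σ.setReg x (A.adjAnswer (e.eval σ) (i.eval σ)))) (hs : e.size ≤ 200 := by decide)
    (hsi : i.size ≤ 200 := by decide) :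
    Run A w U (.adj x e i) 1 σ (PMF.pure o) Q := by
  intro σ' hσ v f hvf
  rw [avg_pure]
  have hcost := hM.cost_le he hs
  have hcosti := hM.cost_le hi hsi
  have hten := hM.ten_le
  refine hvf _ _ ⟨_, hQ, ⟨?_, hσ.2⟩, ?_⟩
  · simp only [State.tick, State.setReg, State.countQuery, hσ.eval, hσ.1]
  · simp only [State.tick, State.setReg, State.countQuery, hσ.cost]; omega

theorem rand {e : Exp} {x : ℕ} (hM : Mach w c U) (he : e.Bdd w c σ)
    (hs : e.size ≤ 200 := by decide) :
    Run A w U (.rand x e) 1 σ (unif (e.eval σ))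
      (fun v τ => v < max 1 (e.eval σ) ∧ τ = σ.setReg x v) := by
  intro σ' hσ v f hvf
  have hcost := hM.cost_le he hs
  have hwords := hM.words_le he hs
  have h1 := hM.hU
  have h2 := hM.hc
  rw [avg_unif]
  simp only [Access.expect, hσ.eval, hσ.cost]
  gcongr with i hi
  refine hvf _ _ ⟨_, ⟨Finset.mem_range.1 hi, rfl⟩, ⟨?_, hσ.2⟩, ?_⟩
  · simp only [State.tick, State.setReg, hσ.1]
  · simp only [State.tick, State.setReg]; nlinarith

theorem rand_fin [NeZero n] {e : Exp} {x : ℕ} (hM : Mach w c U) (he : e.Bdd w c σ)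
    (hn : e.eval σ = n) (hs : e.size ≤ 200 := by decide) :
    Run A w U (.rand x e) 1 σ (unifFin n) (fun v τ => τ = σ.setReg x v) := by
  have h := rand (A := A) (x := x) hM he hs
  intro σ' hσ v f hvf
  have h1 := h σ' hσ (fun i => if hi : i < n then v ⟨i, hi⟩ else 0) f ?_
  · refine le_trans (le_of_eq ?_) h1
    have hmax : max 1 (e.eval σ) = n := by
      rw [hn]; exact max_eq_right (Nat.one_le_iff_ne_zero.2 (NeZero.ne n))
    rw [avg_unifFin, avg_unif, hmax, Finset.sum_range]
    simp
  · rintro i τ' ⟨τ, ⟨h2, h3⟩, h4⟩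
    split_ifs with hi
    · exact hvf _ _ ⟨τ, h3, h4⟩
    · exact bot_le

theorem coin {e e' : Exp} {x : ℕ} (hM : Mach w c U) (he : e.Bdd w c σ) (he' : e'.Bdd w c σ)
    (hs : e.size ≤ 200 := by decide) (hs' : e'.size ≤ 200 := by decide) :
    Run A w U (.coin x e e') 1 σ (coinPMF (e.eval σ) (e'.eval σ))
      (fun b τ => τ = σ.setReg x (if b then 1 else 0)) := by
  intro σ' hσ v f hvf
  have hcost := hM.cost_le he hs
  have hcost' := hM.cost_le he' hs'
  have hwords := hM.words_le he hs
  have hwords' := hM.words_le he' hs'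
  have h1 := hM.hU
  have h2 := hM.hc
  have hww := Nat.mul_le_mul hwords hwords'
  rw [avg_coinPMF]
  simp only [Access.expect, hσ.eval, hσ.cost]
  gcongr
  · refine hvf _ _ ⟨_, rfl, ⟨?_, hσ.2⟩, ?_⟩
    · simp only [State.tick, State.setReg, hσ.1, if_true]
    · simp only [State.tick, State.setReg]; nlinarith
  · refine hvf _ _ ⟨_, rfl, ⟨?_, hσ.2⟩, ?_⟩
    · simp [State.tick, State.setReg, hσ.1]
    · simp only [State.tick, State.setReg]; nlinarith

theorem sample {x : ℕ} (hM : Mach w c U) :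
    Run A w U (.sample x) 1 σ A.D (fun o τ => τ = σ.setReg x (report o)) := by
  intro σ' hσ v f hvf
  have hten := hM.ten_le
  rw [avg, tsum_fintype]
  simp only [Access.expect]
  gcongr with o
  refine hvf _ _ ⟨_, rfl, ⟨?_, hσ.2⟩, ?_⟩
  · simp only [State.tick, State.setReg, hσ.1]
  · simp only [State.tick, State.setReg]; omega

end Run

namespace Run

variable {n : ℕ} {A : Access n} {w c U : ℕ} {O O' : Type} {P P' : Cmd} {t t' : ℕ} {σ : State}
  {μ : PMF O} {Q : O → State → Prop}

theorem assign_seq {e : Exp} {x : ℕ} (hM : Mach w c U) (he : e.Bdd w c σ)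
    (h : Run A w U P t (σ.setReg x (e.eval σ)) μ Q) (hs : e.size ≤ 200 := by decide) :
    Run A w U (.assign x e ;; P) (t + 1) σ μ Q :=
  ((assign hM he () (Q := fun _ τ => τ = _) rfl hs).det_seq fun _ hτ => hτ ▸ h).time (by omega)

theorem store_seq {e i : Exp} {a : ℕ} (hM : Mach w c U) (hi : i.Bdd w c σ) (he : e.Bdd w c σ)
    (h : Run A w U P t (σ.setArr a (i.eval σ) (e.eval σ)) μ Q)
    (hsi : i.size ≤ 200 := by decide) (hs : e.size ≤ 200 := by decide) :
    Run A w U (.store a i e ;; P) (t + 1) σ μ Q :=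
  ((store hM hi he () (Q := fun _ τ => τ = _) rfl hsi hs).det_seq fun _ hτ => hτ ▸ h).time
    (by omega)

theorem deg_seq {e : Exp} {x : ℕ} (hM : Mach w c U) (he : e.Bdd w c σ)
    (h : Run A w U P t (σ.setReg x (A.degAnswer (e.eval σ))) μ Q)
    (hs : e.size ≤ 200 := by decide) :
    Run A w U (.deg x e ;; P) (t + 1) σ μ Q :=
  ((deg hM he () (Q := fun _ τ => τ = _) rfl hs).det_seq fun _ hτ => hτ ▸ h).time (by omega)

theorem adj_seq {e i : Exp} {x : ℕ} (hM : Mach w c U) (he : e.Bdd w c σ) (hi : i.Bdd w c σ)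
    (h : Run A w U P t (σ.setReg x (A.adjAnswer (e.eval σ) (i.eval σ))) μ Q)
    (hs : e.size ≤ 200 := by decide) (hsi : i.size ≤ 200 := by decide) :
    Run A w U (.adj x e i ;; P) (t + 1) σ μ Q :=
  ((adj hM he hi () (Q := fun _ τ => τ = _) rfl hs hsi).det_seq fun _ hτ => hτ ▸ h).time (by omega)

/-- `require` keeps the status if the condition holds and otherwise sets it to `0`. -/
theorem require {b : Exp} (hM : Mach w c U) (hb : b.Bdd w c σ)
    (hs : b.size ≤ 200 := by decide) :
    Det A w U (require b) 2 σ
      (fun τ => τ = if b.eval σ ≠ 0 then σ else σ.setReg rOk 0) := by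
  refine (Run.ite (t := 1) hM hb (fun h => (Run.skip () ?_).time (by omega)) (fun h =>
    Run.assign (e := .lit 0) hM trivial () ?_) hs)
  · simp [h]
  · simp [h, Exp.eval]

end Run

theorem Access.degAnswer_val {n : ℕ} (A : Access n) (v : Fin n) : A.degAnswer v = A.G.deg v := by
  simp [Access.degAnswer]

theorem Access.nbrAnswer_val {n : ℕ} (A : Access n) (v : Fin n) (i : ℕ) :
    A.nbrAnswer v i = report ((A.G.nbrs v)[i]?) := by
  simp [Access.nbrAnswer]

open Classical in
theorem Access.adjAnswer_val {n : ℕ} (A : Access n) (u v : Fin n) :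
    A.adjAnswer u v = if A.G.graph.Adj u v then 1 else 0 := by
  simp [Access.adjAnswer]

namespace QueryGraph

variable {n : ℕ} (G : QueryGraph n)

theorem deg_lt (v : Fin n) : G.deg v < n := by
  classical
  rw [G.deg_eq_degree]
  simpa using G.graph.degree_lt_card_verts v

/-- The order on the vertices: by degree, then by number. -/
def Prec (u v : Fin n) : Prop := G.deg u < G.deg v ∨ G.deg u = G.deg v ∧ u < v

/-- The first `k` entries of a sequence of vertices pass the verification. -/
def Verified (v : ℕ → Fin n) (k : ℕ) : Prop :=
  ∀ j < k, (∀ i < j, G.graph.Adj (v i) (v j)) ∧ (0 < j → G.Prec (v (j - 1)) (v j))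

theorem verified_succ (v : ℕ → Fin n) (k : ℕ) : G.Verified v (k + 1) ↔
    G.Verified v k ∧ (∀ i < k, G.graph.Adj (v i) (v k)) ∧ (0 < k → G.Prec (v (k - 1)) (v k)) :=
  Nat.forall_lt_succ_right

end QueryGraph

/-! ### Correctness and running time of the verification. -/

section Verify

variable {n : ℕ} {A : Access n} {w c U : ℕ}

/-- The registers that the verification leaves unchanged. -/
def VerifyFrame (σ τ : State) : Prop :=
  τ.arr = σ.arr ∧ ∀ x, (1 ≤ x ∧ x ≤ 5) ∨ 11 ≤ x → τ.reg x = σ.reg x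

-- The invariant ties the status to all indices below the counter. The counter also advances in the
-- iteration that fails, so the invariant survives a failure, and the loop then stops because its
-- condition contains the status.
open Classical in
theorem det_verify_inner (hM : Mach w c U) {k i : ℕ} {v : ℕ → Fin n} (hik : i < k)
    (hk : k < 2 ^ (c * w)) (hn : n < 2 ^ (c * w)) {σ : State}
    (hout : ∀ j < k, σ.arr 0 j = v j) (hi : σ.reg 7 = i) (hok : σ.reg 0 = 1) (hj : σ.reg 8 = 0) :
    Det A w U (forBelow rJ (.reg rI)
       (.adj rX (out (.reg rJ)) (out (.reg rI)) ;; CliqueSampling.require (.reg rX)))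
      (5 * k + 1) σ
      (fun τ => τ.arr = σ.arr ∧ (∀ x, (1 ≤ x ∧ x ≤ 7) ∨ 10 ≤ x → τ.reg x = σ.reg x) ∧
        τ.reg 0 = if ∀ j < i, A.G.graph.Adj (v j) (v i) then 1 else 0) := by
  have h0 : 0 < 2 ^ (c * w) := by positivity
  have h1 : 1 < 2 ^ (c * w) := Nat.one_lt_two_pow (Nat.mul_pos hM.hc hM.hw).ne'
  have hv : ∀ u : Fin n, (u : ℕ) < 2 ^ (c * w) := fun u => u.2.trans hn
  refine (Run.while_det (t := 4) hM (fun τ => τ.arr = σ.arr ∧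
    (∀ x, (1 ≤ x ∧ x ≤ 7) ∨ 10 ≤ x → τ.reg x = σ.reg x) ∧ τ.reg 8 ≤ i ∧
    τ.reg 0 = if ∀ j < τ.reg 8, A.G.graph.Adj (v j) (v i) then 1 else 0)
    (fun τ => k - τ.reg 8) ?_ ?_ ?_).mono ?_ ?_
  · rintro τ ⟨ha, hf, hle, hr⟩
    have h7 := hf 7 (by omega)
    simp only [Exp.Bdd, rOk, rJ, rI]
    refine ⟨?_, by omega, by omega⟩
    rw [hr]; split_ifs <;> omega
  · rintro τ ⟨ha, hf, hle, hr⟩ hb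
    have h7 := hf 7 (by omega)
    simp only [Exp.eval, rOk, rJ, rI, ne_eq, mul_eq_zero, not_or] at hb
    have hlt : τ.reg 8 < i := by rw [← hi, ← h7]; by_contra h; simp [h] at hb
    have hr1 : ∀ j < τ.reg 8, A.G.graph.Adj (v j) (v i) := by
      by_contra h; rw [if_neg h] at hr; exact hb.1 hr
    have ho : ∀ j < k, τ.arr 0 j = v j := fun j hj => by rw [ha, hout j hj]
    have e1 : τ.arr 0 (τ.reg 8) = v (τ.reg 8) := ho _ (by omega)
    have e2 : τ.arr 0 (τ.reg 7) = v i := by rw [h7, hi]; exact ho _ hik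
    refine Run.det_seq (t := 3) (t' := 1) (Q₁ := fun τ' => τ'.arr = τ.arr ∧
      (∀ x, (1 ≤ x ∧ x ≤ 8) ∨ 10 ≤ x → τ'.reg x = τ.reg x) ∧
      τ'.reg 0 = if A.G.graph.Adj (v (τ.reg 8)) (v i) then 1 else 0) ?_ ?_
    · refine Run.adj_seq hM ?_ ?_ ?_
      · simp only [out, Exp.Bdd, Exp.eval, rJ, e1]; exact ⟨by omega, hv _⟩
      · simp only [out, Exp.Bdd, Exp.eval, rI, e2]; exact ⟨by omega, hv _⟩
      · have e3 : A.adjAnswer (Exp.eval τ (out (.reg rJ))) (Exp.eval τ (out (.reg rI))) =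
            if A.G.graph.Adj (v (τ.reg 8)) (v i) then 1 else 0 := by
          simp only [out, Exp.eval, rJ, rI, e1, e2, A.adjAnswer_val]
        rw [e3]
        refine (Run.require hM ?_).post ?_
        · simp only [Exp.Bdd, setReg_reg, if_true]; split_ifs <;> omega
        · rintro - ρ rfl
          have hr2 : τ.reg 0 = 1 := by rw [hr, if_pos hr1]
          simp only [Exp.eval, setReg_reg, rX, rOk, if_true]
          split_ifs with hadj
          · refine ⟨rfl, fun x hx => ?_, ?_⟩
            · simp only [setReg_reg]; rw [if_neg (by omega)]
            · simp [hr2]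
          · simp at *
          · simp at *
          · refine ⟨rfl, fun x hx => ?_, ?_⟩
            · simp only [setReg_reg]; rw [if_neg (by omega), if_neg (by omega)]
            · simp
    · rintro ρ ⟨g1, g2, g3⟩
      have g8 := g2 8 (by omega)
      refine Run.assign hM ?_ () ?_
      · simp only [Exp.Bdd, rJ]; exact ⟨by omega, trivial⟩
      · simp only [Exp.eval, rJ, setReg_reg, setReg_arr, g8]
        refine ⟨⟨by rw [g1, ha], fun x hx => ?_, by simp; omega, ?_⟩, ?_⟩
        · rw [if_neg (by omega), g2 x (by omega), hf x hx]
        · simp only [reduceIte, g3]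
          have : (∀ j < τ.reg 8 + 1, A.G.graph.Adj (v j) (v i)) ↔
              A.G.graph.Adj (v (τ.reg 8)) (v i) := by
            rw [Nat.forall_lt_succ_right]; tauto
          simp only [this, show (0 : ℕ) ≠ 8 by decide, if_false]
        · simp; omega
  · refine ⟨rfl, fun _ _ => rfl, by omega, by simp [hj, hok]⟩
  · rw [hj]; omega
  · rintro - τ ⟨⟨ha, hf, hle, hr⟩, hb⟩
    refine ⟨ha, hf, ?_⟩
    have h7 := hf 7 (by omega)
    simp only [Exp.eval, rOk, rJ, rI, mul_eq_zero] at hb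
    by_cases h : ∀ j < τ.reg 8, A.G.graph.Adj (v j) (v i)
    · rw [if_pos h] at hr
      have : τ.reg 8 = i := by
        by_contra hne
        have hlt : τ.reg 8 < τ.reg 7 := by omega
        simp [hr, hlt] at hb
      rw [hr, if_pos]
      rwa [this] at h
    · rw [hr, if_neg h, if_neg]
      exact fun h' => h fun j hj => h' j (by omega)

-- The invariant: the status tells whether the vertices before the counter pass, and register `10`
-- holds the degree of the preceding one. Only consecutive vertices are compared in the order;
-- transitivity does the rest (`QueryGraph.IsOrdered.pairwise`). The inner loop makes the bound
-- quadratic in `k`.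
open Classical in
theorem det_verify (hM : Mach w c U) {k : ℕ} {v : ℕ → Fin n} (hk2 : 2 ≤ k)
    (hk : k < 2 ^ (c * w)) (hn : n < 2 ^ (c * w)) {σ : State}
    (hout : ∀ j < k, σ.arr 0 j = v j) (hkr : σ.reg 2 = k) (hok : σ.reg 0 = 1) :
    Det A w U verify (20 * k ^ 2) σ
      (fun τ => VerifyFrame σ τ ∧ τ.reg 0 = if A.G.Verified v k then 1 else 0) := by
  have h0 : 0 < 2 ^ (c * w) := by positivity
  have h1 : 1 < 2 ^ (c * w) := Nat.one_lt_two_pow (Nat.mul_pos hM.hc hM.hw).ne'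
  have hv : ∀ u : Fin n, (u : ℕ) < 2 ^ (c * w) := fun u => u.2.trans hn
  have hd : ∀ u : Fin n, A.G.deg u < 2 ^ (c * w) := fun u => (A.G.deg_lt u).trans hn
  rw [verify]
  refine Run.time (Run.assign_seq (t := (5 * k + 10) * k + 1) hM trivial ?_) (by nlinarith)
  simp only [Exp.eval, rI]
  refine (Run.while_det (t := 5 * k + 9) hM (fun τ => VerifyFrame σ τ ∧ τ.reg 7 ≤ k ∧
    (τ.reg 0 = if A.G.Verified v (τ.reg 7) then 1 else 0) ∧
    (0 < τ.reg 7 → τ.reg 0 = 1 → τ.reg 10 = A.G.deg (v (τ.reg 7 - 1))))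
    (fun τ => k - τ.reg 7) ?_ ?_ ?_).mono ?_ ?_
  · rintro τ ⟨⟨ha, hf⟩, hle, hr, -⟩
    have h2 := hf 2 (by omega)
    simp only [Exp.Bdd, rOk, rK]
    refine ⟨?_, by omega, by omega⟩
    rw [hr]; split_ifs <;> omega
  · rintro τ ⟨⟨ha, hf⟩, hle, hr, hprev⟩ hb
    have h2 := hf 2 (by omega)
    simp only [Exp.eval, rOk, rK, ne_eq, mul_eq_zero, not_or] at hb
    have hlt : τ.reg 7 < k := by rw [← hkr, ← h2]; by_contra h; simp [h] at hb
    have hr1 : A.G.Verified v (τ.reg 7) := by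
      by_contra h; rw [if_neg h] at hr; exact hb.1 hr
    have ho : ∀ j < k, τ.arr 0 j = v j := fun j hj => by rw [ha, hout j hj]
    have hok' : τ.reg 0 = 1 := by rw [hr, if_pos hr1]
    obtain ⟨i, hi⟩ : ∃ i, τ.reg 7 = i := ⟨_, rfl⟩
    simp only [hi] at hle hr hprev hlt hr1 ⊢
    have e1 : A.degAnswer (Exp.eval τ (out (.reg 7))) = A.G.deg (v i) := by
      simp only [out, Exp.eval, hi, ho i hlt, A.degAnswer_val]
    refine Run.det_seq (t := 5 * k + 8) (t' := 1) (Q₁ := fun τ' => τ'.arr = τ.arr ∧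
      (∀ x, (1 ≤ x ∧ x ≤ 5) ∨ x = 7 ∨ 11 ≤ x → τ'.reg x = τ.reg x) ∧
      τ'.reg 10 = A.G.deg (v i) ∧
      τ'.reg 0 = if A.G.Verified v (i + 1) then 1 else 0) ?_ ?_
    · refine Run.deg_seq hM ?_ ?_
      · simp only [out, Exp.Bdd, Exp.eval, hi, ho i hlt]; exact ⟨by omega, hv _⟩
      rw [e1]
      refine Run.assign_seq hM trivial ?_
      refine Run.time (Run.det_seq (det_verify_inner hM hlt hk hn (v := v) ?_ ?_ ?_ ?_)
        (t' := 4) ?_) (by omega)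
      · intro j hj; exact ho j hj
      · simp [hi, rDeg, rJ]
      · simp [hok', rDeg, rJ]
      · simp [rJ, Exp.eval]
      rintro ρ ⟨g1, g2, g3⟩
      simp only [Exp.eval, rJ, rDeg, setReg_reg, setReg_arr] at g1 g2
      have g7 : ρ.reg 7 = i := by rw [g2 7 (by omega)]; simp [hi]
      have g6 : ρ.reg 6 = A.G.deg (v i) := by rw [g2 6 (by omega)]; simp
      have g10 : ρ.reg 10 = τ.reg 10 := by rw [g2 10 (by omega)]; simp
      refine Run.det_seq (t := 3) (t' := 1) (Q₁ := fun τ' => τ'.arr = τ.arr ∧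
        (∀ x, 1 ≤ x → τ'.reg x = ρ.reg x) ∧
        τ'.reg 0 = if A.G.Verified v (i + 1) then 1 else 0) ?_ ?_
      · refine Run.ite hM ⟨trivial, ?_⟩ ?_ ?_
        · simp only [Exp.Bdd]; omega
        · intro hpos
          replace hpos : 0 < i := by
            simp only [Exp.eval, g7] at hpos; by_contra h; simp [h] at hpos
          have e10 : ρ.reg 10 = A.G.deg (v (i - 1)) := by
            rw [g10, hprev hpos hok']
          have ea : ∀ j < k, ρ.arr 0 j = v j := fun j hj => by rw [g1, ho j hj]
          have e2 := ea i hlt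
          have e3 := ea (i - 1) (by omega)
          refine (Run.require hM ?_).post ?_
          · simp only [Exp.Bdd, out, rPrev, rDeg, Exp.eval, e10, g6, g7, e2, e3]
            have := hd (v i); have := hd (v (i - 1)); have := hv (v i)
            have := hv (v (i - 1))
            simp only [and_true]
            omega
          · rintro - τ' rfl
            simp only [Exp.eval, out, rPrev, rDeg, g7, e2, e3, e10, g6]
            -- Sum and product of truth values play the roles of disjunction and conjunction in the
            -- definition of ≺.
            have hiff : ((if A.G.deg (v (i - 1)) < A.G.deg (v i) then 1 else 0) +
                (if A.G.deg (v (i - 1)) = A.G.deg (v i) then 1 else 0) *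
                (if ((v (i - 1) : Fin n) : ℕ) < (v i : Fin n) then 1 else 0) ≠ 0) ↔
                A.G.Prec (v (i - 1)) (v i) := by
              simp only [QueryGraph.Prec, Fin.lt_def]
              split_ifs <;> simp <;> omega
            simp only [hiff]
            rw [A.G.verified_succ]
            split_ifs with hp hq hq
            · refine ⟨g1, fun _ _ => rfl, ?_⟩
              rw [g3, if_pos hq.2.1]
            · refine ⟨g1, fun _ _ => rfl, ?_⟩
              rw [g3, if_neg]; tauto
            · tauto
            · refine ⟨g1, fun x hx => ?_, by simp [rOk]⟩
              simp only [setReg_reg, rOk]; rw [if_neg (by omega)]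
        · intro hpos
          have hi0 : i = 0 := by
            simp only [Exp.eval, g7] at hpos; by_contra h
            simp [Nat.pos_of_ne_zero h] at hpos
          refine (Run.skip () ⟨g1, fun _ _ => rfl, ?_⟩).time (by omega)
          rw [g3]
          subst hi0
          simp [A.G.verified_succ, hr1]
      · rintro τ' ⟨q1, q2, q3⟩
        have q6 := q2 6 (by omega)
        refine Run.assign hM ?_ () ⟨q1, fun x hx => ?_, ?_, ?_⟩
        · simp only [Exp.Bdd, rDeg]; have := hd (v i); omega
        · simp only [setReg_reg, rPrev]
          rw [if_neg (by omega), q2 x (by omega), g2 x (by omega)]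
          rw [if_neg (by omega), if_neg (by omega)]
        · simp [rPrev, rDeg, Exp.eval, q6, g6]
        · simp [rPrev, q3]
    · rintro ρ ⟨g1, g2, g3, g4⟩
      have g7 := g2 7 (by omega)
      refine Run.assign hM ?_ () ?_
      · simp only [Exp.Bdd]; exact ⟨by omega, trivial⟩
      · simp only [Exp.eval, setReg_reg, g7, hi]
        refine ⟨⟨⟨by rw [setReg_arr, g1, ha], fun x hx => ?_⟩, by simp; omega, ?_, ?_⟩, ?_⟩
        · simp only [setReg_reg]
          rw [if_neg (by omega), g2 x (by omega), hf x hx]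
        · simpa using g4
        · simpa using fun _ => g3
        · simp; omega
  · refine ⟨⟨rfl, fun x hx => ?_⟩, by simp, ?_, by simp⟩
    · simp only [setReg_reg]; rw [if_neg (by omega)]
    · simp [hok, QueryGraph.Verified]
  · simp
  · rintro - τ ⟨⟨⟨ha, hf⟩, hle, hr, -⟩, hb⟩
    refine ⟨⟨ha, hf⟩, ?_⟩
    have h2 := hf 2 (by omega)
    simp only [Exp.eval, rOk, rK, mul_eq_zero] at hb
    by_cases h : A.G.Verified v (τ.reg 7)
    · rw [if_pos h] at hr
      have : τ.reg 7 = k := by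
        by_contra hne
        have hlt : τ.reg 7 < τ.reg 2 := by omega
        simp [hr, hlt] at hb
      rw [hr, if_pos]
      rwa [this] at h
    · rw [hr, if_neg h, if_neg]
      exact fun h' => h fun j hj => h' j (by omega)

theorem det_verify_fail (hM : Mach w c U) {k : ℕ} (hk : k < 2 ^ (c * w)) {σ : State}
    (hkr : σ.reg 2 = k) (hok : σ.reg 0 = 0) :
    Det A w U verify 2 σ (fun τ => VerifyFrame σ τ ∧ τ.reg 0 = 0) := by
  have h0 : 0 < 2 ^ (c * w) := by positivity
  rw [verify]
  refine Run.assign_seq hM trivial (Run.while_false hM ?_ ?_ () ⟨⟨rfl, fun x hx => ?_⟩, ?_⟩)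
  · simp only [Exp.Bdd, Exp.eval, rOk, rI, rK, setReg_reg]
    simp [hok, hkr, hk]
  · simp [Exp.eval, rOk, rI, hok]
  · simp only [setReg_reg, rI]; rw [if_neg (by omega)]
  · simp [rI, hok]

end Verify

/-! ### Ordered cliques -/

namespace QueryGraph

variable {n : ℕ} (G : QueryGraph n)

theorem Prec.trans {u v x : Fin n} (h : G.Prec u v) (h' : G.Prec v x) : G.Prec u x := by
  simp only [Prec, Fin.lt_def] at *; omega

theorem Prec.asymm {u v : Fin n} (h : G.Prec u v) (h' : G.Prec v u) : False := by
  simp only [Prec, Fin.lt_def] at *; omega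

theorem prec_trichotomy {u v : Fin n} (h : u ≠ v) : G.Prec u v ∨ G.Prec v u := by
  have : (u : ℕ) ≠ v := fun h' => h (Fin.ext h')
  simp only [Prec, Fin.lt_def]; omega

variable [NeZero n]

/-- The list consists of `k` vertices that form a clique, in increasing order. -/
def IsOrdered (k : ℕ) (l : List (Fin n)) : Prop :=
  l.length = k ∧ G.Verified (fun j => l.getD j 0) k

variable {G} {k : ℕ} {l : List (Fin n)}

/-- The verification compares neighbours in the list only; transitivity of ≺ extends this to all
pairs. -/
theorem IsOrdered.pairwise (h : G.IsOrdered k l) :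
    l.Pairwise (fun u v => G.graph.Adj u v ∧ G.Prec u v) := by
  obtain ⟨rfl, h⟩ := h
  have key : ∀ j < l.length, ∀ i < j, G.Prec (l.getD i 0) (l.getD j 0) := by
    intro j
    induction j with
    | zero => intro _ i hi; omega
    | succ j ih =>
      intro hj i hi
      have h1 := (h (j + 1) hj).2 (by omega)
      rcases Nat.lt_succ_iff_lt_or_eq.1 hi with h2 | rfl
      · exact Prec.trans G (ih (by omega) i h2) h1
      · exact h1
  rw [List.pairwise_iff_getElem]
  intro i j hi hj hij
  have h1 := (h j hj).1 i hij
  have h2 := key j hj i hij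
  simp only [List.getD_eq_getElem _ _ hi, List.getD_eq_getElem _ _ hj] at h1 h2
  exact ⟨h1, h2⟩

theorem isOrdered_of_pairwise (hl : l.length = k)
    (h : l.Pairwise (fun u v => G.graph.Adj u v ∧ G.Prec u v)) : G.IsOrdered k l := by
  refine ⟨hl, fun j hj => ?_⟩
  subst hl
  rw [List.pairwise_iff_getElem] at h
  refine ⟨fun i hi => ?_, fun hj0 => ?_⟩
  · have := (h i j (by omega) hj hi).1
    simpa only [List.getD_eq_getElem _ _ hj, List.getD_eq_getElem _ _ (hi.trans hj)] using this
  · have := (h (j - 1) j (by omega) hj (by omega)).2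
    simpa only [List.getD_eq_getElem _ _ hj,
      List.getD_eq_getElem _ _ (show j - 1 < l.length by omega)] using this

theorem IsOrdered.nodup (h : G.IsOrdered k l) : l.Nodup :=
  h.pairwise.imp fun h => h.1.ne

theorem IsOrdered.isNClique (h : G.IsOrdered k l) : G.graph.IsNClique k l.toFinset := by
  refine ⟨?_, by rw [List.toFinset_card_of_nodup h.nodup, h.1]⟩
  intro u hu v hv huv
  simp only [Finset.mem_coe, List.mem_toFinset] at hu hv
  have : Std.Symm G.graph.Adj := ⟨fun _ _ h => h.symm⟩
  exact (h.pairwise.imp fun h => h.1).forall hu hv huv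

/-- A set has only one increasing enumeration under an asymmetric relation. This is why a clique is
counted once and no factor `k!` enters its probability. -/
theorem IsOrdered.eq_of_toFinset_eq {l' : List (Fin n)} (h : G.IsOrdered k l)
    (h' : G.IsOrdered k l') (he : l.toFinset = l'.toFinset) : l = l' :=
  List.Perm.eq_of_pairwise (le := G.Prec) (fun _ _ _ _ h1 h2 => (Prec.asymm G h1 h2).elim)
    (h.pairwise.imp fun h => h.2) (h'.pairwise.imp fun h => h.2)
    (List.perm_of_nodup_nodup_toFinset_eq h.nodup h'.nodup he)

variable (G) in
theorem exists_isOrdered {s : Finset (Fin n)} (hs : G.graph.IsNClique k s) :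
    ∃ l, G.IsOrdered k l ∧ l.toFinset = s := by
  classical
  -- Sorting needs a reflexive total order, so ≺ is replaced by its reflexive closure; equality is
  -- excluded afterwards because the sorted list has no duplicates.
  let r : Fin n → Fin n → Prop := fun u v => u = v ∨ G.Prec u v
  have : IsTrans (Fin n) r := ⟨by
    rintro u v x (rfl | h) (rfl | h')
    exacts [Or.inl rfl, Or.inr h', Or.inr h, Or.inr (Prec.trans G h h')]⟩
  have : Std.Antisymm r := ⟨by
    rintro u v (rfl | h) (h' | h')
    exacts [rfl, rfl, h'.symm, (Prec.asymm G h h').elim]⟩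
  have : Std.Total r := ⟨fun u v => by
    by_cases h : u = v
    · exact Or.inl (Or.inl h)
    · exact (G.prec_trichotomy h).imp Or.inr Or.inr⟩
  refine ⟨s.sort r, isOrdered_of_pairwise ((s.length_sort r).trans hs.2) ?_, s.sort_toFinset r⟩
  refine ((s.pairwise_sort r).and (s.sort_nodup r)).imp_of_mem ?_
  rintro u v hu hv ⟨h1 | h1, h2⟩
  · exact (h2 h1).elim
  · rw [Finset.mem_sort] at hu hv
    exact ⟨hs.1 hu hv h2, h1⟩

/-- The increasing list of the vertices of a clique. -/
def ordered (G : QueryGraph n) {k : ℕ} {s : Finset (Fin n)} (hs : G.graph.IsNClique k s) :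
    List (Fin n) := (G.exists_isOrdered hs).choose

theorem isOrdered_ordered {s : Finset (Fin n)} (hs : G.graph.IsNClique k s) :
    G.IsOrdered k (G.ordered hs) := (G.exists_isOrdered hs).choose_spec.1

theorem ordered_toFinset {s : Finset (Fin n)} (hs : G.graph.IsNClique k s) :
    (G.ordered hs).toFinset = s := (G.exists_isOrdered hs).choose_spec.2

/-- The order ≺ refines the order by degree. Hence the test of the degree of the first vertex
decides the type of the clique. -/
theorem IsOrdered.minDeg_eq {v : Fin n} (h : G.IsOrdered k (v :: l)) :
    G.minDeg (v :: l).toFinset = G.deg v := by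
  have hp := (List.pairwise_cons.1 h.pairwise).1
  refine le_antisymm (Nat.sInf_le ⟨v, by simp, rfl⟩) ?_
  refine le_csInf ⟨_, v, by simp, rfl⟩ ?_
  rintro _ ⟨u, hu, rfl⟩
  rw [List.mem_toFinset, List.mem_cons] at hu
  rcases hu with rfl | hu
  · exact le_rfl
  · have := (hp u hu).2
    simp only [Prec] at this; omega

/-- The verification of a list of vertices. -/
def verified (G : QueryGraph n) (k : ℕ) : Option (List (Fin n)) → Option (Finset (Fin n))
  | none => none
  | some l => open Classical in if G.IsOrdered k l then some l.toFinset else none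

theorem verified_eq_some {o : Option (List (Fin n))} {s : Finset (Fin n)}
    (hs : G.graph.IsNClique k s) : G.verified k o = some s ↔ o = some (G.ordered hs) := by
  rcases o with _ | l
  · simp [verified]
  · simp only [verified, Option.ite_none_right_eq_some, Option.some.injEq]
    constructor
    · rintro ⟨h1, h2⟩
      exact h1.eq_of_toFinset_eq (isOrdered_ordered hs) (h2.trans (ordered_toFinset hs).symm)
    · rintro rfl
      exact ⟨isOrdered_ordered hs, ordered_toFinset hs⟩

/-- Verification is injective on accepted lists, so the probability of a clique is that of its
increasing list. -/
theorem map_verified_apply (μ : PMF (Option (List (Fin n)))) {s : Finset (Fin n)}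
    (hs : G.graph.IsNClique k s) : μ.map (G.verified k) (some s) = μ (some (G.ordered hs)) := by
  classical
  rw [← avg_single, avg_map, ← avg_single]
  simp only [verified_eq_some hs]

end QueryGraph

/-- The entries of the output array are the vertices in the list. -/
def OutList {n : ℕ} [NeZero n] (l : List (Fin n)) (τ : State) : Prop :=
  ∀ j < l.length, τ.arr 0 j = (l.getD j 0 : Fin n)

theorem OutList.append {n : ℕ} [NeZero n] {l : List (Fin n)} {τ τ' : State} (u : Fin n)
    (h : OutList l τ) (hu : τ'.arr 0 l.length = u)
    (h' : ∀ j < l.length, τ'.arr 0 j = τ.arr 0 j) : OutList (l ++ [u]) τ' := by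
  intro j hj
  rw [List.length_append, List.length_singleton] at hj
  rcases Nat.lt_succ_iff_lt_or_eq.1 hj with h1 | rfl
  · rw [h' j h1, h j h1, List.getD_append _ _ _ _ h1]
  · rw [hu, List.getD_append_right _ _ _ _ le_rfl]; simp

theorem OutList.returns {n : ℕ} [NeZero n] {k : ℕ} {l : List (Fin n)} {τ : State}
    (h : OutList l τ) (hl : l.length = k) (h0 : τ.reg 0 = 1) : Returns k l.toFinset τ := by
  refine ⟨h0, ?_⟩
  subst hl
  ext x
  simp only [Finset.mem_image, Finset.mem_range, List.mem_toFinset]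
  constructor
  · rintro ⟨j, hj, rfl⟩
    rw [h j hj, List.getD_eq_getElem _ _ hj]
    exact ⟨_, List.getElem_mem hj, rfl⟩
  · rintro ⟨u, hu, rfl⟩
    obtain ⟨j, hj, rfl⟩ := List.getElem_of_mem hu
    exact ⟨j, hj, by rw [h j hj, List.getD_eq_getElem _ _ hj]⟩

theorem Returns.unique {n k : ℕ} {s s' : Finset (Fin n)} {τ : State} (h : Returns k s τ)
    (h' : Returns k s' τ) : s = s' :=
  Finset.image_injective Fin.val_injective (h.2.symm.trans h'.2)

/-! ### Distributions of the samplers -/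

/-- `m` independent choices; failure as soon as one of them fails. -/
def iterPMF {α : Type} (ν : PMF (Option α)) : ℕ → PMF (Option (List α))
  | 0 => PMF.pure (some [])
  | m + 1 => ν.bind fun o => match o with
    | none => PMF.pure none
    | some u => (iterPMF ν m).map (Option.map (u :: ·))

/-- Transfers a property tested in a single choice to every entry of the resulting list; the high
sampler needs it to see that all degrees passed the test. -/
theorem iterPMF_ne_zero {α : Type} {ν : PMF (Option α)} {m : ℕ} {r : List α}
    (h : iterPMF ν m (some r) ≠ 0) {u : α} (hu : u ∈ r) : ν (some u) ≠ 0 := by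
  induction m generalizing r with
  | zero =>
    have : r = [] := by simpa [iterPMF, PMF.pure_apply] using h
    simp [this] at hu
  | succ m ih =>
    rw [iterPMF, ← PMF.mem_support_iff, PMF.mem_support_bind_iff] at h
    obtain ⟨o, ho, h⟩ := h
    rcases o with _ | u'
    · simp at h
    · simp only [PMF.mem_support_map_iff] at h
      obtain ⟨o', ho', h⟩ := h
      obtain ⟨r', rfl, rfl⟩ := Option.map_eq_some_iff.1 h
      rcases List.mem_cons.1 hu with rfl | hu
      · exact (PMF.mem_support_iff _ _).1 ho
      · exact ih ((PMF.mem_support_iff _ _).1 ho') hu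

section Dist

variable {n : ℕ} [NeZero n] (G : QueryGraph n) (D : PMF (Option (Fin n)))

/-- A random neighbour of `v`, each with probability `1 / a`. -/
def nbrPMF (v : Fin n) (a : ℕ) : PMF (Option (Fin n)) := (unif a).map fun j => (G.nbrs v)[j]?

/-- The distribution of `sampleMediumHighVertex`. -/
def vertexPMF (γ : ℕ) : PMF (Option (Fin n)) :=
  D.bind fun o => match o with
    | none => PMF.pure none
    | some u => (nbrPMF G u (G.deg u)).map (Option.filter fun v => γ < G.deg v)

/-- The list of vertices chosen by the low sampler. -/
def lowPMF (k γ : ℕ) : PMF (Option (List (Fin n))) :=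
  (unifFin n).bind fun v =>
    if G.deg v ≤ γ then (iterPMF (nbrPMF G v γ) (k - 1)).map (Option.map (v :: ·))
    else PMF.pure none

/-- One neighbour chosen by the medium sampler. -/
def mediumStepPMF (v : Fin n) (mbar : ℕ) : PMF (Option (Fin n)) :=
  (nbrPMF G v (G.deg v)).bind fun o =>
    (coinPMF (G.deg v * G.deg v) mbar).map fun b => if b then o else none

/-- The list of vertices chosen by the medium sampler. -/
def mediumPMF (k γ mbar : ℕ) : PMF (Option (List (Fin n))) :=
  (vertexPMF G D γ).bind fun o => match o with
    | none => PMF.pure none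
    | some v =>
      if G.deg v * G.deg v ≤ mbar then
        (nbrPMF G v (G.deg v)).bind fun o' => match o' with
          | none => PMF.pure none
          | some u => (iterPMF (mediumStepPMF G v mbar) (k - 2)).map (Option.map (v :: u :: ·))
      else PMF.pure none

/-- One vertex chosen by the high sampler. -/
def highStepPMF (γ mbar : ℕ) : PMF (Option (Fin n)) :=
  (vertexPMF G D γ).bind fun o => match o with
    | none => PMF.pure none
    | some v =>
      if mbar < G.deg v * G.deg v then
        (coinPMF mbar (G.deg v * G.deg v)).map fun b => if b then some v else none
      else PMF.pure none

/-- The list of vertices chosen by the high sampler. -/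
def highPMF (k γ mbar : ℕ) : PMF (Option (List (Fin n))) := iterPMF (highStepPMF G D γ mbar) k

end Dist

/-! ### Samplers with an implemented data structure -/

/-- The part of the memory that the samplers do not change. -/
def Kept (σ τ : State) : Prop :=
  (∀ x, (1 ≤ x ∧ x ≤ 4) ∨ (11 ≤ x ∧ x < 40) → τ.reg x = σ.reg x) ∧
    ∀ a, 1 ≤ a → τ.arr a = σ.arr a

theorem Kept.refl (σ : State) : Kept σ σ := ⟨fun _ _ => rfl, fun _ _ => rfl⟩

theorem Kept.trans {σ τ ρ : State} (h : Kept σ τ) (h' : Kept τ ρ) : Kept σ ρ :=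
  ⟨fun x hx => (h'.1 x hx).trans (h.1 x hx), fun a ha => (h'.2 a ha).trans (h.2 a ha)⟩

theorem Kept.setReg {σ τ : State} (h : Kept σ τ) {x : ℕ} (v : ℕ)
    (hx : x = 0 ∨ (5 ≤ x ∧ x ≤ 10)) : Kept σ (τ.setReg x v) :=
  ⟨fun y hy => by rw [setReg_reg, if_neg (by omega), h.1 y hy], h.2⟩

theorem Kept.setArr {σ τ : State} (h : Kept σ τ) (i v : ℕ) : Kept σ (τ.setArr 0 i v) :=
  ⟨h.1, fun a ha => by rw [setArr_arr_ne _ _ _ _ (by omega), h.2 a ha]⟩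

theorem VerifyFrame.kept {σ τ : State} (h : VerifyFrame σ τ) : Kept σ τ :=
  ⟨fun x hx => h.2 x (by omega), fun a _ => by rw [h.1]⟩

/-- `Q` implements accesses to a data structure with distribution `D`, provided that the memory
satisfies `Data`. -/
structure Accesses {n : ℕ} (A : Access n) (w U : ℕ) (Q : Cmd) (D : PMF (Option (Fin n)))
    (Data : State → Prop) : Prop where
  kept : ∀ σ τ, Kept σ τ → Data σ → Data τ
  run : ∀ σ, Data σ → Run A w U Q 1 σ D (fun o τ => τ.reg 9 = report o ∧
    (∀ x < 40, x ≠ 9 → τ.reg x = σ.reg x) ∧ τ.arr = σ.arr)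

theorem accesses_sample {n : ℕ} (A : Access n) {w c U : ℕ} (hM : Mach w c U) :
    Accesses A w U (.sample rX) A.D (fun _ => True) where
  kept := fun _ _ _ _ => trivial
  run := fun σ _ => (Run.sample hM).post fun o τ hτ => by
    subst hτ
    refine ⟨by simp [rX], fun x _ hx => ?_, rfl⟩
    rw [setReg_reg, rX, if_neg hx]

/-- Abstracting from the access `Q` lets one analysis serve both the abstract device of the first
claim and the list in memory that the counting and sampling programs build. The body repeats
`sampleMediumHighVertex`, so the two agree definitionally for `.sample rX`. -/
def sampleVertexWith (Q : Cmd) : Cmd :=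
  Q ;;
  .ite (.reg rX)
    (.assign rV (.sub (.reg rX) (.lit 1)) ;;
     .deg rDeg (.reg rV) ;;
     .rand rJ (.reg rDeg) ;;
     .nbr rX (.reg rV) (.reg rJ) ;;
     .ite (.reg rX)
       (.assign rV (.sub (.reg rX) (.lit 1)) ;;
        .deg rDeg (.reg rV) ;;
        require (.lt (.reg rGamma) (.reg rDeg)))
       fail)
    fail

/-- The medium sampler with `Q` in place of the accesses to the data structure. -/
def mediumSamplerWith (Q : Cmd) : Cmd :=
  .assign rOk (.lit 1) ;;
  sampleVertexWith Q ;;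
  ifOk (require (.lt (.mul (.reg rDeg) (.reg rDeg)) (.add (.reg rMbar) (.lit 1)))) ;;
  ifOk
    (.store 0 (.lit 0) (.reg rV) ;;
     .rand rJ (.reg rDeg) ;;
     .nbr rX (.reg rV) (.reg rJ) ;;
     .store 0 (.lit 1) (.sub (.reg rX) (.lit 1))) ;;
  .assign rI (.lit 2) ;;
  forBelow rI (.reg rK)
    (.rand rJ (.reg rDeg) ;;
     .nbr rX (.reg rV) (.reg rJ) ;;
     .store 0 (.reg rI) (.sub (.reg rX) (.lit 1)) ;;
     .coin rX (.mul (.reg rDeg) (.reg rDeg)) (.reg rMbar) ;;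
     require (.reg rX)) ;;
  verify

/-- The high sampler with `Q` in place of the accesses to the data structure. -/
def highSamplerWith (Q : Cmd) : Cmd :=
  .assign rOk (.lit 1) ;;
  .assign rI (.lit 0) ;;
  forBelow rI (.reg rK)
    (sampleVertexWith Q ;;
     ifOk (require (.lt (.reg rMbar) (.mul (.reg rDeg) (.reg rDeg)))) ;;
     ifOk
       (.coin rX (.reg rMbar) (.mul (.reg rDeg) (.reg rDeg)) ;;
        require (.reg rX) ;;
        .store 0 (.reg rI) (.reg rV))) ;;
  verify

theorem mediumSampler_eq : mediumSampler = mediumSamplerWith (.sample rX) := rfl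

theorem highSampler_eq : highSampler = highSamplerWith (.sample rX) := rfl

theorem report_eq_zero {n : ℕ} {o : Option (Fin n)} : report o = 0 ↔ o = none := by
  cases o <;> simp [report]

/-! ### Building blocks of the three samplers. -/

section Phases

variable {n : ℕ} [NeZero n] {A : Access n} {w c U : ℕ}

theorem Mach.one_lt (hM : Mach w c U) : 1 < 2 ^ (c * w) :=
  Nat.one_lt_two_pow (Nat.mul_pos hM.hc hM.hw).ne'

omit [NeZero n] in
/-- A random neighbour of `v`: the index in register `8`, the answer in register `9`. -/
theorem run_nbr (hM : Mach w c U) {σ : State} {v : Fin n} {e : Exp} (he : e.Bdd w c σ)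
    (hs : e.size ≤ 200) (hlt : max 1 (e.eval σ) ≤ 2 ^ (c * w)) (hn : n < 2 ^ (c * w))
    (hv : σ.reg 5 = v) :
    Run A w U (.rand rJ e ;; .nbr rX (.reg rV) (.reg rJ)) 2 σ (nbrPMF A.G v (e.eval σ))
      (fun o τ => (0 < e.eval σ → e.eval σ ≤ A.G.deg v → o ≠ none) ∧ ∃ j,
        τ = (σ.setReg 8 j).setReg 9 (report o)) := by
  refine Run.seq_pure (t := 1) (t' := 1) (Run.rand hM he hs) ?_
  rintro j τ ⟨hj, rfl⟩
  have e1 : A.nbrAnswer (Exp.eval (σ.setReg rJ j) (.reg rV)) (Exp.eval (σ.setReg rJ j) (.reg rJ)) =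
      report ((A.G.nbrs v)[j]?) := by
    simp [Exp.eval, rV, rJ, hv, A.nbrAnswer_val]
  refine Run.nbr hM ?_ ?_ _ ⟨fun hpos hle => ?_, j, ?_⟩
  · simp only [Exp.Bdd, setReg_reg, rV, rJ]
    simp [hv]; exact v.2.trans hn
  · simp only [Exp.Bdd, setReg_reg, rJ]; simp; omega
  · have : j < (A.G.nbrs v).length := by
      change j < A.G.deg v; omega
    simp [this]
  · rw [e1]; rfl

omit [NeZero n] in
/-- `sampleVertexWith` yields a vertex with its degree, or fails. -/
theorem run_sampleVertex (hM : Mach w c U) {Q : Cmd} {D : PMF (Option (Fin n))}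
    {Data : State → Prop} (hQ : Accesses A w U Q D Data) {γ : ℕ} (hγ : γ < 2 ^ (c * w))
    (hn : n < 2 ^ (c * w)) {σ : State} (hD : Data σ) (hγr : σ.reg 3 = γ) :
    Run A w U (sampleVertexWith Q) 12 σ (vertexPMF A.G D γ)
      (fun o τ => Kept σ τ ∧ τ.reg 7 = σ.reg 7 ∧ τ.arr = σ.arr ∧ match o with
        | none => τ.reg 0 = 0
        | some v => τ.reg 0 = σ.reg 0 ∧ τ.reg 5 = v ∧ τ.reg 6 = A.G.deg v ∧ γ < A.G.deg v) := by
  have h0 := hM.one_lt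
  have hvn : ∀ u : Fin n, (u : ℕ) < 2 ^ (c * w) := fun u => u.2.trans hn
  have hd : ∀ u : Fin n, A.G.deg u < 2 ^ (c * w) := fun u => (A.G.deg_lt u).trans hn
  have hfail : ∀ (σ τ : State) (γ : ℕ), Kept σ τ → τ.reg 7 = σ.reg 7 → τ.arr = σ.arr →
      Run A w U fail 1 τ (PMF.pure none) (fun (o : Option (Fin n)) τ => Kept σ τ ∧
        τ.reg 7 = σ.reg 7 ∧ τ.arr = σ.arr ∧ match o with
        | none => τ.reg 0 = 0
        | some v => τ.reg 0 = σ.reg 0 ∧ τ.reg 5 = v ∧ τ.reg 6 = A.G.deg v ∧ γ < A.G.deg v) := by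
    intro σ τ γ h1 h2 h3
    refine Run.assign (e := .lit 0) hM trivial _ ⟨h1.setReg _ (by simp [rOk]), ?_, h3, ?_⟩
    · simpa [rOk] using h2
    · simp [rOk, Exp.eval]
  refine Run.seq (t := 1) (t' := 11) (hQ.run σ hD) ?_
  rintro o τ ⟨g9, gr, ga⟩
  have hk : Kept σ τ := ⟨fun x hx => gr x (by omega) (by omega), fun a _ => by rw [ga]⟩
  have g7 := gr 7 (by omega) (by omega)
  refine Run.ite (t := 10) hM ?_ ?_ ?_
  · simp only [Exp.Bdd, rX, g9]
    rcases o with _ | u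
    · simp [report]
    · have := u.2; simp only [report]; omega
  · intro hne
    simp only [Exp.eval, rX, g9, ne_eq, report_eq_zero] at hne
    obtain ⟨u, rfl⟩ := Option.ne_none_iff_exists'.1 hne
    simp only
    have hu9 : τ.reg 9 = u + 1 := g9
    refine Run.assign_seq hM ?_ (Run.deg_seq hM ?_ ?_)
    · simp only [Exp.Bdd, rX, and_true]; have := u.2; omega
    · simp only [Exp.Bdd, Exp.eval, rV, rX, setReg_reg, hu9]; simpa using hvn u
    · have e1 : A.degAnswer (Exp.eval (τ.setReg rV (Exp.eval τ ((Exp.reg rX).sub (Exp.lit 1))))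
          (.reg rV)) = A.G.deg u := by
        simp [Exp.eval, rV, rX, hu9, A.degAnswer_val]
      have e2 : Exp.eval τ ((Exp.reg rX).sub (Exp.lit 1)) = u := by simp [Exp.eval, rX, hu9]
      rw [e1, e2]
      set ρ := (τ.setReg rV u).setReg rDeg (A.G.deg u) with hρ
      have hρk : Kept σ ρ := (hk.setReg _ (by simp [rV])).setReg _ (by simp [rDeg])
      have e3 : Exp.eval ρ (.reg rDeg) = A.G.deg u := by simp [hρ, Exp.eval]
      -- the random neighbour and the final test
      have key : Run A w U ((.rand rJ (.reg rDeg) ;; .nbr rX (.reg rV) (.reg rJ)) ;;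
          .ite (.reg rX)
            (.assign rV (.sub (.reg rX) (.lit 1)) ;;
             .deg rDeg (.reg rV) ;;
             require (.lt (.reg rGamma) (.reg rDeg)))
            fail) (2 + 5) ρ ((nbrPMF A.G u (A.G.deg u)).map (Option.filter fun v => γ < A.G.deg v))
          (fun o τ => Kept σ τ ∧ τ.reg 7 = σ.reg 7 ∧ τ.arr = σ.arr ∧ match o with
            | none => τ.reg 0 = 0
            | some v => τ.reg 0 = σ.reg 0 ∧ τ.reg 5 = v ∧ τ.reg 6 = A.G.deg v ∧
                γ < A.G.deg v) := by
        have hr := run_nbr (A := A) hM (σ := ρ) (v := u) (e := .reg rDeg)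
          (by simp only [Exp.Bdd]; have := hd u; simp [hρ, this]) (by decide)
          (by rw [e3]; have := hd u; omega) hn (by simp [hρ, rV, rDeg])
        rw [e3] at hr
        refine hr.seq_pure ?_
        rintro o τ' ⟨-, j, rfl⟩
        have hτ'k : Kept σ ((ρ.setReg 8 j).setReg 9 (report o)) :=
          (hρk.setReg _ (by simp)).setReg _ (by simp)
        refine Run.ite (t := 4) hM ?_ ?_ ?_
        · simp only [Exp.Bdd, rX, setReg_reg]
          rcases o with _ | v
          · simp [report]
          · have := v.2; simp only [report, reduceIte]; omega
        · intro hne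
          simp only [Exp.eval, rX, setReg_reg, reduceIte, ne_eq, report_eq_zero] at hne
          obtain ⟨v, rfl⟩ := Option.ne_none_iff_exists'.1 hne
          have e4 : Exp.eval ((ρ.setReg 8 j).setReg 9 (report (some v)))
              ((Exp.reg rX).sub (Exp.lit 1)) = v := by simp [Exp.eval, rX, report]
          refine Run.assign_seq hM ?_ ?_
          · simp only [Exp.Bdd, rX, setReg_reg, and_true, reduceIte, report]
            have := v.2; omega
          rw [e4]
          refine Run.deg_seq hM ?_ ?_
          · simp only [Exp.Bdd, setReg_reg, rV, reduceIte]; exact hvn v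
          have e5 : A.degAnswer (Exp.eval (((ρ.setReg 8 j).setReg 9 (report (some v))).setReg rV v)
              (.reg rV)) = A.G.deg v := by simp [Exp.eval, A.degAnswer_val]
          rw [e5]
          set χ := (((ρ.setReg 8 j).setReg 9 (report (some v))).setReg rV v).setReg rDeg
            (A.G.deg v) with hχ
          have hχk : Kept σ χ := (hτ'k.setReg _ (by simp [rV])).setReg _ (by simp [rDeg])
          have h3 : χ.reg 3 = γ := (hχk.1 3 (by omega)).trans hγr
          have h6 : χ.reg 6 = A.G.deg v := by simp [hχ, rDeg]
          have h5 : χ.reg 5 = v := by simp [hχ, rDeg, rV]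
          have h7 : χ.reg 7 = σ.reg 7 := by simp [hχ, hρ, rDeg, rV, g7]
          have hc0 : χ.reg 0 = σ.reg 0 := by
            simp [hχ, hρ, rDeg, rV, gr 0 (by omega) (by omega)]
          have hca : χ.arr = σ.arr := ga
          refine ((Run.require hM ?_).pure_congr (o' := (some v).filter fun v => γ < A.G.deg v)
            (Q' := fun o τ => Kept σ τ ∧ τ.reg 7 = σ.reg 7 ∧ τ.arr = σ.arr ∧ match o with
            | none => τ.reg 0 = 0
            | some v => τ.reg 0 = σ.reg 0 ∧ τ.reg 5 = v ∧ τ.reg 6 = A.G.deg v ∧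
                γ < A.G.deg v) ?_).time (by omega)
          · simp only [Exp.Bdd, rGamma, rDeg, h3, h6]; exact ⟨hγ, hd v⟩
          · rintro τ' rfl
            simp only [Exp.eval, rGamma, rDeg, h3, h6]
            by_cases hlt : γ < A.G.deg v
            · simp [Option.filter, hlt, hχk, h7, hca, hc0, h5, h6]
            · simp only [hlt, if_false, ne_eq, not_true, Option.filter, decide_false]
              exact ⟨hχk.setReg _ (by simp [rOk]), by simpa [rOk] using h7, hca, by simp [rOk]⟩
        · intro he0
          simp only [Exp.eval, rX, setReg_reg, reduceIte, report_eq_zero] at he0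
          subst he0
          exact (hfail σ _ γ hτ'k (by simp [hρ, rDeg, rV, g7]) ga).time (by omega)
      -- The semantics of `seq` is composition, so both ways of bracketing the commands have
      -- definitionally equal expectations; `key` groups the random neighbour into one step.
      intro σ' hσ'
      exact (key.time (t' := 8) (by omega)) σ' hσ'
  · intro he0
    simp only [Exp.eval, rX, g9, report_eq_zero] at he0
    subst he0
    exact (hfail σ τ γ hk g7 ga).time (by omega)

/-- A loop that chooses the remaining vertices of the output independently. -/
theorem run_forBelow_iter (hM : Mach w c U) {k t : ℕ} (hk : k < 2 ^ (c * w)) {P : Cmd}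
    {ν : PMF (Option (Fin n))} {F : State → Prop}
    (hF : ∀ τ v, F τ → F (τ.setReg 7 v)) (hF2 : ∀ τ, F τ → τ.reg 2 = k)
    (hP : ∀ τ l, F τ → τ.reg 0 = 1 → τ.reg 7 = l.length → l.length < k → OutList l τ →
      Run A w U P t τ ν (fun o τ' => F τ' ∧ τ'.reg 7 = l.length ∧ match o with
        | none => τ'.reg 0 = 0
        | some u => τ'.reg 0 = 1 ∧ OutList (l ++ [u]) τ')) :
    ∀ (m : ℕ) (l : List (Fin n)) (σ : State), F σ → σ.reg 0 = 1 → σ.reg 7 = l.length →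
      l.length + m = k → OutList l σ →
      Run A w U (forBelow rI (.reg rK) P) ((t + 2) * m + 1) σ (iterPMF ν m)
        (fun o τ => F τ ∧ match o with
          | none => τ.reg 0 = 0
          | some r => τ.reg 0 = 1 ∧ r.length = m ∧ OutList (l ++ r) τ) := by
  have h1 := hM.one_lt
  intro m
  induction m with
  | zero =>
    intro l σ hFσ h0 h7 hlen hout
    have h2 := hF2 σ hFσ
    refine (Run.while_false hM ?_ ?_ _ ⟨hFσ, h0, rfl, by simpa using hout⟩).time (by omega)
    · simp only [Exp.Bdd, rOk, rI, rK]; omega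
    · simp only [Exp.eval, rOk, rI, rK, h0, h7, h2]; simp; omega
  | succ m ih =>
    intro l σ hFσ h0 h7 hlen hout
    have h2 := hF2 σ hFσ
    refine (Run.while_true (t := t + 1) (t' := (t + 2) * m + 1) hM ?_ ?_
      (((hP σ l hFσ h0 h7 (by omega) hout).seq_det (t' := 1)
        (Q' := fun o τ' => F τ' ∧ τ'.reg 7 = l.length + 1 ∧ match o with
        | none => τ'.reg 0 = 0
        | some u => τ'.reg 0 = 1 ∧ OutList (l ++ [u]) τ')) ?_) ?_).time ?_
    · simp only [Exp.Bdd, rOk, rI, rK]; omega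
    · simp only [Exp.eval, rOk, rI, rK, h0, h7, h2]; simp; omega
    · rintro o τ ⟨g1, g2, g3⟩
      refine Run.assign hM ?_ () ⟨hF _ _ g1, ?_, ?_⟩
      · simp only [Exp.Bdd, rI, and_true]; omega
      · simp [rI, Exp.eval, g2]
      · rcases o with _ | u
        · simpa [rI] using g3
        · exact ⟨by simpa [rI] using g3.1, g3.2⟩
    · rintro o τ ⟨g1, g2, g3⟩
      have g22 := hF2 τ g1
      rcases o with _ | u
      · refine (Run.while_false hM ?_ ?_ _ ⟨g1, g3⟩).time (by omega)
        · simp only [Exp.Bdd, rOk, rI, rK]; simp only at g3; omega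
        · simp only at g3; simp [Exp.eval, rOk, g3]
      · refine ((ih (l ++ [u]) τ g1 g3.1 (by simpa using g2) (by simp; omega) g3.2).map_outcome
          _).post ?_
        rintro o' τ' ⟨o, rfl, q1, q2⟩
        refine ⟨q1, ?_⟩
        rcases o with _ | r
        · exact q2
        · refine ⟨q2.1, by simp [q2.2.1], ?_⟩
          have := q2.2.2
          rwa [List.append_assoc] at this
    · ring_nf; omega

end Phases

/-! ### The three sampling programs and their distributions. -/

section Samplers

variable {n : ℕ} [NeZero n] {A : Access n} {w c U : ℕ}

/-- What a sampler for the class `cls` guarantees for its outcome and the final memory. -/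
def SamplerPost (k : ℕ) (cls : Finset (Fin n) → Prop) (σ : State) (o : Option (Finset (Fin n)))
    (τ : State) : Prop :=
  Kept σ τ ∧ match o with
    | none => τ.reg 0 = 0
    | some s => cls s ∧ Returns k s τ

/-- The memory before the verification. -/
def PhasePost (G : QueryGraph n) (k : ℕ) (cls : Finset (Fin n) → Prop) (σ : State)
    (o : Option (List (Fin n))) (τ : State) : Prop :=
  Kept σ τ ∧ match o with
    | none => τ.reg 0 = 0
    | some l => τ.reg 0 = 1 ∧ l.length = k ∧ OutList l τ ∧ (G.IsOrdered k l → cls l.toFinset)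

theorem run_verified (hM : Mach w c U) {k : ℕ} (hk2 : 2 ≤ k) (hk : k < 2 ^ (c * w))
    (hn : n < 2 ^ (c * w)) {σ τ : State} {cls : Finset (Fin n) → Prop} (hkr : σ.reg 2 = k)
    {o : Option (List (Fin n))} (h : PhasePost A.G k cls σ o τ) :
    Run A w U verify (20 * k ^ 2) τ (PMF.pure (A.G.verified k o)) (SamplerPost k cls σ) := by
  classical
  obtain ⟨hK, h⟩ := h
  have h2 : τ.reg 2 = k := (hK.1 2 (by omega)).trans hkr
  rcases o with _ | l
  · exact ((det_verify_fail hM hk h2 h).pure_congr fun τ' h' =>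
      ⟨hK.trans h'.1.kept, h'.2⟩).time (by nlinarith)
  · obtain ⟨h0, hl, hout, hcls⟩ := h
    refine (det_verify hM hk2 hk hn (fun j hj => hout j (by omega)) h2 h0).pure_congr
      fun τ' ⟨hf, hr⟩ => ⟨hK.trans hf.kept, ?_⟩
    by_cases hv : A.G.IsOrdered k l
    · rw [if_pos hv.2] at hr
      simp only [QueryGraph.verified, if_pos hv]
      refine ⟨hcls hv, OutList.returns (fun j hj => ?_) hl hr⟩
      rw [hf.1, hout j hj]
    · rw [if_neg fun h' => hv ⟨hl, h'⟩] at hr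
      simpa only [QueryGraph.verified, if_neg hv] using hr

-- Both the remaining loop and the verification test the status first, so after a failure the rest
-- of the program takes constant time and changes only scratch memory.
omit [NeZero n] in
theorem run_failed_tail (hM : Mach w c U) {k m : ℕ} (hm : m ≤ 2) (hk2 : 2 ≤ k)
    (hk : k < 2 ^ (c * w)) {cls : Finset (Fin n) → Prop} {P : Cmd} {σ τ : State}
    (hkr : σ.reg 2 = k) (hK : Kept σ τ) (h0 : τ.reg 0 = 0) :
    Run A w U (.assign rI (.lit m) ;; forBelow rI (.reg rK) P ;; verify) 4 τ (PMF.pure none)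
      (SamplerPost k cls σ) := by
  have h1 := hM.one_lt
  have h2 : τ.reg 2 = k := (hK.1 2 (by omega)).trans hkr
  have hK' : Kept σ (τ.setReg 7 m) := hK.setReg _ (by omega)
  have hmk : m < 2 ^ (c * w) := by omega
  refine Run.assign_seq (e := .lit m) (t := 1 + 2) hM trivial ((Run.while_false
    (b := .mul (.reg rOk) (.lt (.reg rI) (.reg rK))) hM ?_ ?_ () ?_).det_seq
    (Q₁ := fun τ' => τ' = τ.setReg 7 m) ?_) (by simp only [Exp.size]; omega)
  · simp only [Exp.Bdd, Exp.eval, rOk, rI, rK, setReg_reg]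
    simp [h0, h2, hk, hmk]
  · simp [Exp.eval, rOk, rI, h0]
  · rfl
  · rintro _ rfl
    refine (det_verify_fail hM hk (by simp [h2]) (by simp [h0])).pure_congr fun τ' h' =>
      ⟨hK'.trans h'.1.kept, h'.2⟩

/-- The end of the samplers: a loop that chooses the remaining vertices, and the verification. -/
theorem run_tail (hM : Mach w c U) {k m t : ℕ} (hm : m ≤ 2) (hk2 : 2 ≤ k) (hk : k < 2 ^ (c * w))
    (hn : n < 2 ^ (c * w)) {cls : Finset (Fin n) → Prop} {P : Cmd} {σ τ : State}
    (hkr : σ.reg 2 = k) {ν : PMF (Option (Fin n))} {F : State → Prop}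
    (hF : ∀ τ v, F τ → F (τ.setReg 7 v)) (hFK : ∀ τ, F τ → Kept σ τ)
    (hP : ∀ τ l, F τ → τ.reg 0 = 1 → τ.reg 7 = l.length → l.length < k → OutList l τ →
      Run A w U P t τ ν (fun o τ' => F τ' ∧ τ'.reg 7 = l.length ∧ match o with
        | none => τ'.reg 0 = 0
        | some u => τ'.reg 0 = 1 ∧ OutList (l ++ [u]) τ'))
    {l : List (Fin n)} (hFτ : F τ) (h0 : τ.reg 0 = 1) (hl : l.length = m) (hout : OutList l τ)
    (hcls : ∀ r, iterPMF ν (k - m) (some r) ≠ 0 → A.G.IsOrdered k (l ++ r) → cls (l ++ r).toFinset) :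
    Run A w U (.assign rI (.lit m) ;; forBelow rI (.reg rK) P ;; verify)
      ((t + 2) * k + 1 + 20 * k ^ 2 + 1) τ
      (((iterPMF ν (k - m)).map (Option.map (l ++ ·))).map (A.G.verified k))
      (SamplerPost k cls σ) := by
  have hmk : (t + 2) * (k - m) ≤ (t + 2) * k := Nat.mul_le_mul_left _ (Nat.sub_le _ _)
  -- Restricting to outcomes of positive probability makes the hypothesis `hcls` applicable, which
  -- concerns such lists only.
  refine (Run.assign_seq (e := .lit m) hM trivial
    (((run_forBelow_iter hM hk hF (fun τ h => ((hFK τ h).1 2 (by omega)).trans hkr) hP (k - m) l _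
      (hF τ m hFτ) ?_ ?_ ?_ ?_).support.map_outcome (Option.map (l ++ ·))).seq_pure
      (t' := 20 * k ^ 2) (g := A.G.verified k) ?_)
    (by simp only [Exp.size]; omega)).time (by omega)
  · simpa using h0
  · simp [hl]
  · omega
  · exact hout
  · rintro _ ρ ⟨o, rfl, g0, g1, g2⟩
    refine run_verified hM hk2 hk hn hkr ⟨hFK _ g1, ?_⟩
    rcases o with _ | r
    · exact g2
    · exact ⟨g2.1, by simp [hl, g2.2.1]; omega, g2.2.2, hcls r g0⟩

/-- The low sampler. -/
theorem run_lowSampler (hM : Mach w c U) {k γ : ℕ} (hk2 : 2 ≤ k) (hk : k < 2 ^ (c * w))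
    (hn : n < 2 ^ (c * w)) (hγ1 : 1 ≤ γ) (hγ : γ < 2 ^ (c * w)) {σ : State} (h1 : σ.reg 1 = n)
    (h2 : σ.reg 2 = k) (h3 : σ.reg 3 = γ) :
    Run A w U lowSampler (100 * k ^ 2) σ ((lowPMF A.G k γ).map (A.G.verified k))
      (SamplerPost k (A.G.IsLowClique k γ) σ) := by
  have hd : ∀ u : Fin n, A.G.deg u < 2 ^ (c * w) := fun u => (A.G.deg_lt u).trans hn
  rw [lowPMF, PMF.map_bind]
  refine Run.time (t := 5 + ((6 + 2) * k + 1 + 20 * k ^ 2 + 1) + 2) ?_ (by nlinarith)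
  refine Run.time (Run.assign_seq (t := 1 + (2 + (2 + ((6 + 2) * k + 1 + 20 * k ^ 2 + 1)))) hM
    trivial (Run.seq (Run.rand_fin (n := n) hM ?_ ?_) ?_)) (by omega)
  · simp only [Exp.Bdd, rN, rOk, setReg_reg]; simp [h1, hn]
  · simp [Exp.eval, rN, rOk, h1]
  rintro v τ rfl
  set τ := ((σ.setReg rOk (Exp.eval σ (.lit 1))).setReg rV v).setArr 0 0 v with hτ
  have hK : Kept σ τ := ((Kept.setReg (Kept.refl σ) _ (by simp [rOk])).setReg _
    (by simp [rV])).setArr _ _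
  have e0 : τ.reg 0 = 1 := by simp [hτ, rOk, rV, Exp.eval]
  have e5 : τ.reg 5 = v := by simp [hτ, rV]
  have ea : τ.arr 0 0 = v := by simp [hτ]
  have e3 : τ.reg 3 = γ := (hK.1 3 (by omega)).trans h3
  have ee : Exp.eval ((σ.setReg rOk (Exp.eval σ (.lit 1))).setReg rV v) (.reg rV) = v := by
    simp [Exp.eval]
  refine Run.time (Run.store_seq (t := 1 + (2 + ((6 + 2) * k + 1 + 20 * k ^ 2 + 1))) hM trivial ?_
    ?_) (by omega)
  · simp only [Exp.Bdd, setReg_reg, reduceIte]; exact v.2.trans hn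
  simp only [ee]
  change Run A w U _ _ τ _ _
  refine Run.time (Run.deg_seq (t := 2 + ((6 + 2) * k + 1 + 20 * k ^ 2 + 1)) hM ?_ ?_) (by omega)
  · simp only [Exp.Bdd, rV, e5]; exact v.2.trans hn
  have e6 : A.degAnswer (Exp.eval τ (.reg rV)) = A.G.deg v := by
    simp [Exp.eval, rV, e5, A.degAnswer_val]
  rw [e6]
  have hK' : Kept σ (τ.setReg 6 (A.G.deg v)) := hK.setReg _ (by omega)
  refine Run.det_seq (Run.require hM ?_) ?_
  · simp only [Exp.Bdd, rDeg, rGamma, setReg_reg, and_true]; simp [e3, hγ, hd v]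
  rintro ρ rfl
  have hcond : Exp.eval (τ.setReg rDeg (A.G.deg v))
      ((Exp.reg rDeg).lt ((Exp.reg rGamma).add (Exp.lit 1))) ≠ 0 ↔ A.G.deg v ≤ γ := by
    simp [Exp.eval, rDeg, rGamma, e3]
  simp only [hcond]
  by_cases hv : A.G.deg v ≤ γ
  · rw [if_pos hv, if_pos hv]
    refine run_tail (l := [v]) (F := fun τ => Kept σ τ ∧ τ.reg 5 = v) hM (by norm_num) hk2 hk hn h2
      ?_ (fun τ h => h.1) ?_ ⟨hK', by simpa [rDeg] using e5⟩ (by simpa [rDeg] using e0) rfl ?_ ?_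
    · exact fun τ v h => ⟨h.1.setReg _ (by omega), by simpa using h.2⟩
    · rintro χ l ⟨g1, g2⟩ g3 g4 g5 g6
      have q3 : χ.reg 3 = γ := (g1.1 3 (by omega)).trans h3
      have hr := run_nbr (A := A) hM (σ := χ) (v := v) (e := .reg rGamma)
        (by simp only [Exp.Bdd, rGamma]; omega) (by decide)
        (by simp only [Exp.eval, rGamma]; omega) hn g2
      simp only [Exp.eval, rGamma, q3] at hr
      refine Run.time (t := 2 + 2) ?_ (by omega)
      have := hr.seq_det (t' := 2) (P' := .ite (.reg rX)
        (.store 0 (.reg rI) (.sub (.reg rX) (.lit 1))) fail) (Q' := fun o τ' =>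
          (Kept σ τ' ∧ τ'.reg 5 = v) ∧ τ'.reg 7 = l.length ∧ match o with
          | none => τ'.reg 0 = 0
          | some u => τ'.reg 0 = 1 ∧ OutList (l ++ [u]) τ') ?_
      · exact fun σ' hσ' => this σ' hσ'
      rintro o _ ⟨-, j, rfl⟩
      have hKj : Kept σ ((χ.setReg 8 j).setReg 9 (report o)) :=
        (g1.setReg _ (by omega)).setReg _ (by omega)
      refine Run.ite (t := 1) hM ?_ ?_ ?_
      · simp only [Exp.Bdd, rX, setReg_reg, reduceIte]
        rcases o with _ | u
        · simp [report]
        · have := u.2; simp only [report]; omega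
      · intro hne
        simp only [Exp.eval, rX, setReg_reg, reduceIte, ne_eq, report_eq_zero] at hne
        obtain ⟨u, rfl⟩ := Option.ne_none_iff_exists'.1 hne
        refine Run.store hM ?_ ?_ () ⟨⟨hKj.setArr _ _, by simpa using g2⟩, by simpa using g4,
          by simpa using g3, g6.append u ?_ ?_⟩
        · simp only [Exp.Bdd, rI, setReg_reg]; simp; omega
        · simp only [Exp.Bdd, rX, setReg_reg, reduceIte, report, and_true]; have := u.2; omega
        · simp [Exp.eval, rI, g4, rX, report]
        · intro j' hj'
          simp [Exp.eval, rI, g4, hj'.ne]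
      · intro he0
        simp only [Exp.eval, rX, setReg_reg, reduceIte, report_eq_zero] at he0
        subst he0
        refine Run.assign (e := .lit 0) hM trivial () ⟨⟨hKj.setReg _ (by simp [rOk]), ?_⟩, ?_, ?_⟩
        · simpa [rOk] using g2
        · simpa [rOk] using g4
        · simp [rOk, Exp.eval]
    · intro j hj
      obtain rfl : j = 0 := by simpa using hj
      simpa [rDeg] using ea
    · rintro r - hr
      refine ⟨hr.isNClique, ?_⟩
      have := QueryGraph.IsOrdered.minDeg_eq (v := v) (l := r) hr
      exact this.trans_le hv
  · rw [if_neg hv, if_neg hv, PMF.pure_map]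
    exact (run_failed_tail hM (by norm_num) hk2 hk h2 (hK'.setReg _ (by simp [rOk]))
      (by simp [rOk])).time (by omega)

omit [NeZero n] in
theorem run_ifOk_fail (hM : Mach w c U) {σ : State} {P : Cmd} (h : σ.reg 0 = 0) :
    Det A w U (ifOk P) 1 σ (fun τ => τ = σ) := by
  have h1 := hM.one_lt
  refine Run.ite (t := 0) hM ?_ (fun h' => ?_) (fun _ => Run.skip () rfl)
  · simp only [Exp.Bdd, rOk]; omega
  · simp [Exp.eval, rOk, h] at h'

omit [NeZero n] in
theorem run_ifOk {O : Type} (hM : Mach w c U) {σ : State} {P : Cmd} {t : ℕ} {μ : PMF O}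
    {Q : O → State → Prop} (h : σ.reg 0 = 1) (hP : Run A w U P t σ μ Q) :
    Run A w U (ifOk P) (t + 1) σ μ Q := by
  have h1 := hM.one_lt
  refine Run.ite hM ?_ (fun _ => hP) (fun h' => ?_)
  · simp only [Exp.Bdd, rOk]; omega
  · simp [Exp.eval, rOk, h] at h'

theorem natCast_le_sqrt {a b : ℕ} : (a : ℝ) ≤ √(b : ℝ) ↔ a * a ≤ b := by
  constructor
  · intro h
    have := mul_self_le_mul_self (Nat.cast_nonneg a) h
    rw [Real.mul_self_sqrt (Nat.cast_nonneg b)] at this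
    exact_mod_cast this
  · intro h
    exact Real.le_sqrt_of_sq_le (by rw [sq]; exact_mod_cast h)

/-- The medium sampler. -/
theorem run_mediumSampler (hM : Mach w c U) {Q : Cmd} {D : PMF (Option (Fin n))}
    {Data : State → Prop} (hQ : Accesses A w U Q D Data) {k γ mbar : ℕ} (hk2 : 2 ≤ k)
    (hk : k < 2 ^ (c * w)) (hn : n < 2 ^ (c * w)) (hγ : γ < 2 ^ (c * w))
    (hm : mbar < 2 ^ (c * w)) {σ : State} (hD : Data σ)
    (h2 : σ.reg 2 = k) (h3 : σ.reg 3 = γ) (h4 : σ.reg 4 = mbar) :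
    Run A w U (mediumSamplerWith Q) (100 * k ^ 2) σ
      ((mediumPMF A.G D k γ mbar).map (A.G.verified k))
      (SamplerPost k (A.G.IsMediumClique k γ mbar) σ) := by
  have h1 := hM.one_lt
  have hvn : ∀ u : Fin n, (u : ℕ) < 2 ^ (c * w) := fun u => u.2.trans hn
  have hd : ∀ u : Fin n, A.G.deg u < 2 ^ (c * w) := fun u => (A.G.deg_lt u).trans hn
  rw [mediumPMF, PMF.map_bind]
  refine Run.time (t := 12 + (3 + (5 + ((6 + 2) * k + 1 + 20 * k ^ 2 + 1))) + 1) ?_ (by nlinarith)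
  refine Run.assign_seq hM trivial ?_
  have hK₁ : Kept σ (σ.setReg rOk (Exp.eval σ (.lit 1))) :=
    (Kept.refl σ).setReg _ (by simp [rOk])
  refine Run.seq (run_sampleVertex hM hQ hγ hn (hQ.kept _ _ hK₁ hD)
    ((hK₁.1 3 (by omega)).trans h3)) ?_
  rintro o τ ⟨hK, -, -, ho⟩
  replace hK := hK₁.trans hK
  rcases o with _ | v
  · simp only [PMF.pure_map]
    exact ((run_ifOk_fail hM ho).det_seq fun _ hτ => hτ ▸ (run_ifOk_fail hM ho).det_seq
      fun _ hτ => hτ ▸ run_failed_tail hM le_rfl hk2 hk h2 hK ho).time (by omega)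
  obtain ⟨e0, e5, e6, hγv⟩ := ho
  replace e0 : τ.reg 0 = 1 := by rw [e0]; simp [rOk, Exp.eval]
  have e4 : τ.reg 4 = mbar := (hK.1 4 (by omega)).trans h4
  refine Run.det_seq (run_ifOk hM e0 (Run.require hM ?_)) ?_
  · simp only [Exp.Bdd, rDeg, rMbar, and_true]; have := hd v; omega
  rintro ρ rfl
  have hcond : Exp.eval τ (((Exp.reg rDeg).mul (Exp.reg rDeg)).lt
      ((Exp.reg rMbar).add (Exp.lit 1))) ≠ 0 ↔ A.G.deg v * A.G.deg v ≤ mbar := by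
    simp [Exp.eval, rDeg, rMbar, e4, e6]
  simp only [hcond]
  by_cases hv : A.G.deg v * A.G.deg v ≤ mbar
  · rw [if_pos hv, if_pos hv, PMF.map_bind]
    have hN : Run A w U (.store 0 (.lit 0) (.reg rV) ;; .rand rJ (.reg rDeg) ;;
        .nbr rX (.reg rV) (.reg rJ) ;; .store 0 (.lit 1) (.sub (.reg rX) (.lit 1))) 4 τ
        (nbrPMF A.G v (A.G.deg v)) (fun o τ' => o ≠ none ∧ Kept σ τ' ∧ τ'.reg 0 = 1 ∧
          τ'.reg 5 = v ∧ τ'.reg 6 = A.G.deg v ∧ τ'.arr 0 0 = v ∧ τ'.arr 0 1 = report o - 1) := by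
      refine Run.store_seq (t := 3) hM trivial ?_ ?_
      · simp only [Exp.Bdd, rV, e5]; exact hvn v
      have hr := run_nbr (A := A) hM (σ := τ.setArr 0 0 v) (v := v) (e := .reg rDeg)
        (by simp only [Exp.Bdd, rDeg, setArr_reg]; have := hd v; omega) (by decide)
        (by simp only [Exp.eval, rDeg, setArr_reg]; have := hd v; omega) hn (by simpa using e5)
      simp only [Exp.eval, rDeg, setArr_reg, e6] at hr
      have := hr.seq_det (t' := 1) (P' := .store 0 (.lit 1) (.sub (.reg rX) (.lit 1)))
        (Q' := fun o τ' => o ≠ none ∧ Kept σ τ' ∧ τ'.reg 0 = 1 ∧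
          τ'.reg 5 = v ∧ τ'.reg 6 = A.G.deg v ∧ τ'.arr 0 0 = v ∧ τ'.arr 0 1 = report o - 1) ?_
      · simp only [Exp.eval, rV, e5]
        exact fun σ' hσ' => this σ' hσ'
      rintro o _ ⟨hne, j, rfl⟩
      refine Run.store (i := .lit 1) hM trivial ?_ () ⟨hne (by omega) le_rfl,
        (((hK.setArr _ _).setReg _ (by omega)).setReg _ (by omega)).setArr _ _, by simpa using e0,
        by simpa using e5, by simpa using e6, by simp [Exp.eval], by simp [Exp.eval, rX]⟩
      simp only [Exp.Bdd, rX, setReg_reg, reduceIte, and_true]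
      rcases o with _ | u
      · simp [report]
      · have := u.2; simp only [report]; omega
    refine Run.seq (t := 5) (run_ifOk hM e0 hN) ?_
    rintro o ρ ⟨hne, gK, g0, g5, g6, ga, ga'⟩
    -- Since `d(v) > γ ≥ 0`, the random index is below `d(v)` and the neighbour query cannot fail.
    obtain ⟨u, rfl⟩ := Option.ne_none_iff_exists'.1 hne
    simp only
    refine run_tail (l := [v, u])
      (F := fun τ => Kept σ τ ∧ τ.reg 5 = v ∧ τ.reg 6 = A.G.deg v) hM le_rfl hk2 hk hn h2
      ?_ (fun τ h => h.1) ?_ ⟨gK, g5, g6⟩ g0 rfl ?_ ?_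
    · exact fun τ v h => ⟨h.1.setReg _ (by omega), by simpa using h.2.1, by simpa using h.2.2⟩
    · rintro χ l ⟨f1, f2, f6⟩ f3 f4 f5 fo
      have q4 : χ.reg 4 = mbar := (f1.1 4 (by omega)).trans h4
      have hr := run_nbr (A := A) hM (σ := χ) (v := v) (e := .reg rDeg)
        (by simp only [Exp.Bdd, rDeg]; have := hd v; omega) (by decide)
        (by simp only [Exp.eval, rDeg]; have := hd v; omega) hn f2
      simp only [Exp.eval, rDeg, f6] at hr
      refine Run.time (t := 2 + (1 + 2 + 1)) ?_ (by omega)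
      have := hr.seq (t' := 1 + 2 + 1) (P' := .store 0 (.reg rI) (.sub (.reg rX) (.lit 1)) ;;
        .coin rX (.mul (.reg rDeg) (.reg rDeg)) (.reg rMbar) ;; CliqueSampling.require (.reg rX))
        (ν := fun o => (coinPMF (A.G.deg v * A.G.deg v) mbar).map fun b => if b then o else none)
        (Q' := fun o τ' =>
          (Kept σ τ' ∧ τ'.reg 5 = v ∧ τ'.reg 6 = A.G.deg v) ∧ τ'.reg 7 = l.length ∧ match o with
          | none => τ'.reg 0 = 0
          | some u => τ'.reg 0 = 1 ∧ OutList (l ++ [u]) τ') ?_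
      · exact fun σ' hσ' => this σ' hσ'
      rintro o _ ⟨hne, j, rfl⟩
      obtain ⟨u, rfl⟩ := Option.ne_none_iff_exists'.1 (hne (by omega) le_rfl)
      have hKj : Kept σ ((χ.setReg 8 j).setReg 9 (report (some u))) :=
        (f1.setReg _ (by omega)).setReg _ (by omega)
      refine Run.store_seq hM ?_ ?_ ?_
      · simp only [Exp.Bdd, rI, setReg_reg]; simp; omega
      · simp only [Exp.Bdd, rX, setReg_reg, reduceIte, report, and_true]; have := u.2; omega
      set ψ := State.setArr ((χ.setReg 8 j).setReg 9 (report (some u))) 0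
        (Exp.eval ((χ.setReg 8 j).setReg 9 (report (some u))) (Exp.reg rI))
        (Exp.eval ((χ.setReg 8 j).setReg 9 (report (some u))) ((Exp.reg rX).sub (Exp.lit 1)))
        with hψ
      have p6 : ψ.reg 6 = A.G.deg v := by simpa [hψ] using f6
      have p4 : ψ.reg 4 = mbar := by simpa [hψ] using q4
      have pK : Kept σ ψ := hKj.setArr _ _
      have hco := Run.coin (A := A) (U := U) (x := rX) (σ := ψ)
        (e := .mul (.reg rDeg) (.reg rDeg)) (e' := .reg rMbar) hM
        (by simp only [Exp.Bdd, rDeg]; have := hd v; omega)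
        (by simp only [Exp.Bdd, rMbar]; omega)
      simp only [Exp.eval, rDeg, rMbar, p6, p4] at hco
      refine hco.seq_pure ?_
      rintro b _ rfl
      refine (Run.require hM ?_).pure_congr ?_
      · simp only [Exp.Bdd, setReg_reg, reduceIte]; split_ifs <;> omega
      rintro _ rfl
      rcases b with _ | _
      · simp only [Exp.eval, setReg_reg, rX, rOk]
        simp only [reduceIte, Bool.false_eq_true, ne_eq, not_true]
        refine ⟨⟨(pK.setReg _ (by omega)).setReg _ (by omega), ?_, ?_⟩, ?_, ?_⟩
        · simpa [hψ] using f2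
        · simpa [hψ] using f6
        · simpa [hψ] using f4
        · simp
      · simp only [Exp.eval, setReg_reg, rX, rOk]
        simp only [reduceIte, ne_eq, one_ne_zero, not_false_eq_true]
        refine ⟨⟨pK.setReg _ (by omega), ?_, ?_⟩, ?_, ?_, fo.append u ?_ ?_⟩
        · simpa [hψ] using f2
        · simpa [hψ] using f6
        · simpa [hψ] using f4
        · simpa [hψ] using f3
        · simp [hψ, Exp.eval, rI, f4, rX, report]
        · intro j' hj'
          simp [hψ, Exp.eval, rI, f4, hj'.ne]
    · intro j hj
      have : j < 2 := hj
      interval_cases j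
      · simpa using ga
      · simpa [report] using ga'
    · rintro r - hr
      have hmin := QueryGraph.IsOrdered.minDeg_eq (v := v) (l := u :: r) hr
      refine ⟨hr.isNClique, ?_, ?_⟩
      · exact hγv.trans_eq hmin.symm
      · rw [natCast_le_sqrt]
        have : A.G.minDeg ([v, u] ++ r).toFinset = A.G.deg v := hmin
        rwa [this]
  · rw [if_neg hv, if_neg hv, PMF.pure_map]
    have e0' : (τ.setReg rOk 0).reg 0 = 0 := by simp [rOk]
    exact ((run_ifOk_fail hM e0').det_seq fun _ hτ => hτ ▸ run_failed_tail hM le_rfl hk2 hk h2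
      (hK.setReg _ (by simp [rOk])) e0').time (by omega)

/-- The high sampler. -/
theorem run_highSampler (hM : Mach w c U) {Q : Cmd} {D : PMF (Option (Fin n))}
    {Data : State → Prop} (hQ : Accesses A w U Q D Data) {k γ mbar : ℕ} (hk2 : 2 ≤ k)
    (hk : k < 2 ^ (c * w)) (hn : n < 2 ^ (c * w)) (hγ : γ < 2 ^ (c * w))
    (hm : mbar < 2 ^ (c * w)) {σ : State} (hD : Data σ)
    (h2 : σ.reg 2 = k) (h3 : σ.reg 3 = γ) (h4 : σ.reg 4 = mbar) :
    Run A w U (highSamplerWith Q) (100 * k ^ 2) σ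
      ((highPMF A.G D k γ mbar).map (A.G.verified k))
      (SamplerPost k (A.G.IsHighClique k mbar) σ) := by
  have h1 := hM.one_lt
  have hvn : ∀ u : Fin n, (u : ℕ) < 2 ^ (c * w) := fun u => u.2.trans hn
  have hd : ∀ u : Fin n, A.G.deg u < 2 ^ (c * w) := fun u => (A.G.deg_lt u).trans hn
  refine Run.time (t := ((20 + 2) * k + 1 + 20 * k ^ 2 + 1) + 1) ?_ (by nlinarith)
  have hK₁ : Kept σ (σ.setReg rOk (Exp.eval σ (.lit 1))) :=
    (Kept.refl σ).setReg _ (by simp [rOk])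
  have hmap : highPMF A.G D k γ mbar =
      (iterPMF (highStepPMF A.G D γ mbar) (k - 0)).map (Option.map ([] ++ ·)) := by
    have : (Option.map fun x : List (Fin n) => [] ++ x) = id := by
      funext o; cases o <;> rfl
    rw [this, PMF.map_id, highPMF, Nat.sub_zero]
  rw [hmap]
  refine Run.assign_seq hM trivial ?_
  refine run_tail (l := []) (F := fun τ => Kept σ τ) hM (by norm_num) hk2 hk hn h2
    (fun τ v h => h.setReg _ (by omega)) (fun τ h => h) ?_ hK₁ (by simp [rOk, Exp.eval]) rfl
    (fun j hj => by simp at hj) ?_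
  · rintro χ l f1 f3 f4 f5 fo
    refine Run.time (t := 12 + (3 + 5)) ?_ (by omega)
    refine Run.seq (run_sampleVertex hM hQ hγ hn (hQ.kept _ _ f1 hD)
      ((f1.1 3 (by omega)).trans h3)) ?_
    rintro o τ ⟨hK, g7, ga, ho⟩
    replace hK := f1.trans hK
    have hout : OutList l τ := fun j hj => by rw [ga, fo j hj]
    rcases o with _ | v
    · refine ((run_ifOk_fail hM ho).det_seq (t' := 1) ?_).time (by omega)
      rintro _ rfl
      refine (run_ifOk_fail hM ho).pure_congr ?_
      rintro _ rfl
      exact ⟨hK, g7.trans f4, ho⟩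
    obtain ⟨e0, e5, e6, hγv⟩ := ho
    replace e0 : τ.reg 0 = 1 := e0.trans f3
    have e4 : τ.reg 4 = mbar := (hK.1 4 (by omega)).trans h4
    refine Run.det_seq (run_ifOk hM e0 (Run.require hM ?_)) ?_
    · simp only [Exp.Bdd, rDeg, rMbar]; have := hd v; omega
    rintro ρ rfl
    have hcond : Exp.eval τ ((Exp.reg rMbar).lt ((Exp.reg rDeg).mul (Exp.reg rDeg))) ≠ 0 ↔
        mbar < A.G.deg v * A.G.deg v := by
      simp [Exp.eval, rDeg, rMbar, e4, e6]
    simp only [hcond]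
    by_cases hv : mbar < A.G.deg v * A.G.deg v
    · rw [if_pos hv, if_pos hv]
      have hco := Run.coin (A := A) (U := U) (x := rX) (σ := τ) (e := .reg rMbar)
        (e' := .mul (.reg rDeg) (.reg rDeg)) hM (by simp only [Exp.Bdd, rMbar]; omega)
        (by simp only [Exp.Bdd, rDeg]; have := hd v; omega)
      simp only [Exp.eval, rDeg, rMbar, e6, e4] at hco
      refine run_ifOk (t := 1 + (2 + 1)) hM e0 (hco.seq_pure ?_)
      · rintro b _ rfl
        refine Run.det_seq (Run.require hM ?_) ?_
        · simp only [Exp.Bdd, setReg_reg, reduceIte]; split_ifs <;> omega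
        rintro _ rfl
        have hb : Exp.eval (τ.setReg rX (if b then 1 else 0)) (.reg rX) ≠ 0 ↔ b = true := by
          cases b <;> simp [Exp.eval]
        simp only [hb]
        rcases b with _ | _
        -- After an unsuccessful coin the vertex is still stored; this is harmless because the
        -- status is already `0`.
        · simp only [Bool.false_eq_true, if_false]
          refine Run.store hM ?_ ?_ _ ⟨((hK.setReg _ (by simp [rX])).setReg _
            (by simp [rOk])).setArr _ _, ?_, ?_⟩
          · simp [Exp.Bdd, rI, rX, rOk, g7, f4]; omega
          · simp [Exp.Bdd, rV, rX, rOk, e5]; exact hvn v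
          · simp [rX, rOk, g7, f4]
          · simp [rOk]
        · simp only [if_true]
          refine Run.store hM ?_ ?_ _ ⟨(hK.setReg _ (by simp [rX])).setArr _ _, ?_, ?_,
            hout.append v ?_ ?_⟩
          · simp [Exp.Bdd, rI, rX, g7, f4]; omega
          · simp [Exp.Bdd, rV, rX, e5]; exact hvn v
          · simp [rX, g7, f4]
          · simp [rX, e0]
          · simp [rX, rI, rV, Exp.eval, g7, f4, e5]
          · intro j hj
            simp [rX, rI, Exp.eval, g7, f4, hj.ne]
    · rw [if_neg hv, if_neg hv]
      have e0' : (τ.setReg rOk 0).reg 0 = 0 := by simp [rOk]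
      refine ((run_ifOk_fail hM e0').pure_congr ?_).time (by omega)
      rintro _ rfl
      exact ⟨hK.setReg _ (by simp [rOk]), by simpa [rOk] using g7.trans f4, e0'⟩
  · intro r hr0 hr
    rcases r with _ | ⟨v, r⟩
    · have := hr.1; simp at this; omega
    · have hmin := QueryGraph.IsOrdered.minDeg_eq (v := v) (l := r) hr
      refine ⟨hr.isNClique, ?_⟩
      -- Every vertex of a list of positive probability has passed the test `mbar < d(v) ^ 2`, in
      -- particular the first one, whose degree is the minimum.
      have h5 := iterPMF_ne_zero hr0 (u := v) (by simp)
      have : mbar < A.G.deg v * A.G.deg v := by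
        rw [highStepPMF, ← PMF.mem_support_iff, PMF.mem_support_bind_iff] at h5
        obtain ⟨o, -, h5⟩ := h5
        rcases o with _ | v'
        · simp at h5
        · simp only at h5
          split_ifs at h5 with hlt
          · simp only [PMF.mem_support_map_iff] at h5
            obtain ⟨b, -, hb⟩ := h5
            split_ifs at hb
            rwa [← Option.some.inj hb]
          · simp at h5
      refine lt_of_not_ge fun hle => ?_
      rw [natCast_le_sqrt] at hle
      have h6 : A.G.minDeg ([] ++ v :: r).toFinset = A.G.deg v := hmin
      rw [h6] at hle
      omega

end Samplers

/-! ### Probabilities of the cliques -/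

section Probabilities

theorem bind_eq_single {α β : Type} (μ : PMF α) (f : α → PMF β) (a : α) (b : β)
    (h : ∀ a', a' ≠ a → f a' b = 0) : μ.bind f b = μ a * f a b := by
  rw [PMF.bind_apply, tsum_eq_single a]
  intro a' ha'
  rw [h a' ha', mul_zero]

theorem map_apply_inj {α β : Type} (μ : PMF α) {f : α → β} {a : α} {b : β}
    (h : ∀ a', f a' = b ↔ a' = a) : μ.map f b = μ a := by
  classical
  rw [← avg_single, avg_map, ← avg_single]
  simp only [h]

theorem map_apply_zero {α β : Type} (μ : PMF α) {f : α → β} {b : β}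
    (h : ∀ a', f a' ≠ b) : μ.map f b = 0 := by
  classical
  rw [← avg_single, avg_map]
  simp [h, avg]

theorem map_cons_apply {α : Type} (μ : PMF (Option (List α))) (u : α) (r : List α) :
    μ.map (Option.map (u :: ·)) (some (u :: r)) = μ (some r) :=
  map_apply_inj μ fun o => by cases o <;> simp

theorem map_cons_apply_ne {α : Type} (μ : PMF (Option (List α))) {u u' : α} (r : List α)
    (h : u' ≠ u) : μ.map (Option.map (u' :: ·)) (some (u :: r)) = 0 :=
  map_apply_zero μ fun o => by cases o <;> simp [h]

theorem iterPMF_apply {α : Type} (ν : PMF (Option α)) (r : List α) :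
    iterPMF ν r.length (some r) = (r.map fun u => ν (some u)).prod := by
  induction r with
  | nil => simp [iterPMF, PMF.pure_apply]
  | cons u r ih =>
    rw [List.length_cons, iterPMF, bind_eq_single _ _ (some u)]
    · simp only [map_cons_apply, ih, List.map_cons, List.prod_cons]
    · rintro (_ | u') h
      · simp [PMF.pure_apply]
      · exact map_cons_apply_ne _ _ fun h' => h (by rw [h'])

variable {n : ℕ} (G : QueryGraph n)

/-- The list of neighbours has no duplicates, so `u` has exactly one index, and `d(v) ≤ a` puts this
index in the range of the draw. -/
theorem nbrPMF_apply {v u : Fin n} {a : ℕ} (hva : G.deg v ≤ a) (h : G.graph.Adj v u) :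
    nbrPMF G v a (some u) = (a : ℝ≥0∞)⁻¹ := by
  have hu := (G.mem_nbrs v u).2 h
  obtain ⟨i, hi, rfl⟩ := List.getElem_of_mem hu
  have hi' : i < G.deg v := hi
  rw [nbrPMF, map_apply_inj _ (a := i)]
  · rw [unif, PMF.uniformOfFinset_apply_of_mem _ (by simp; omega), Finset.card_range,
      max_eq_right (by omega)]
  · intro j
    constructor
    · intro hj
      obtain ⟨hj1, hj2⟩ := List.getElem?_eq_some_iff.1 hj
      exact (List.Nodup.getElem_inj_iff (G.nodup_nbrs v)).1 hj2
    · rintro rfl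
      exact List.getElem?_eq_getElem hi

theorem nbrPMF_apply_not_adj {v u : Fin n} {a : ℕ} (h : ¬ G.graph.Adj v u) :
    nbrPMF G v a (some u) = 0 := by
  refine map_apply_zero _ fun j hj => h ?_
  obtain ⟨hj1, hj2⟩ := List.getElem?_eq_some_iff.1 hj
  rw [← G.mem_nbrs, ← hj2]
  exact List.getElem_mem hj1

open Classical in
theorem vertexPMF_apply (D : PMF (Option (Fin n))) {γ : ℕ} {v : Fin n} (hv : γ < G.deg v) :
    vertexPMF G D γ (some v) =
      ∑ u, D (some u) * (if G.graph.Adj v u then (G.deg u : ℝ≥0∞)⁻¹ else 0) := by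
  rw [vertexPMF, PMF.bind_apply, tsum_fintype, Fintype.sum_option]
  simp only [PMF.pure_apply, reduceCtorEq, if_false, mul_zero, zero_add]
  refine Finset.sum_congr rfl fun u _ => ?_
  congr 1
  rw [map_apply_inj _ (a := some v)]
  · split_ifs with h
    · exact nbrPMF_apply G le_rfl h.symm
    · exact nbrPMF_apply_not_adj G fun h' => h h'.symm
  · rintro (_ | v')
    · simp
    · rw [Option.filter_eq_some_iff]
      constructor
      · exact fun h => h.1
      · rintro h
        exact ⟨h, by simpa using hv⟩

theorem degIn_eq (S : Multiset (Fin n)) (v : Fin n) :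
    (open Classical in ∑ u, if G.graph.Adj v u then S.count u else 0) = G.degIn S v := by
  classical
  rw [QueryGraph.degIn, ← Multiset.sum_count_eq_card (s := Finset.univ) (by simp)]
  refine Finset.sum_congr rfl fun u _ => ?_
  rw [Multiset.count_filter]

variable [NeZero n]

-- The weight `d(u)` in the data structure cancels the factor `1 / d(u)` of the uniform neighbour,
-- so only the number of neighbours of `v` in `S` is left. A vertex `u` adjacent to `v` has positive
-- degree, which makes the cancellation legitimate.
omit [NeZero n] in
theorem vertexPMF_eq {S : Multiset (Fin n)} {D : PMF (Option (Fin n))} {γ mbar : ℕ}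
    (hD : ∀ u, D (some u) =
      ENNReal.ofReal (S.count u * (G.deg u / (2 * (mbar / n : ℝ) * S.card))))
    {v : Fin n} (hv : γ < G.deg v) :
    vertexPMF G D γ (some v) =
      ENNReal.ofReal (G.degIn S v / (2 * (mbar / n : ℝ) * S.card)) := by
  classical
  rw [vertexPMF_apply G D hv, ← degIn_eq, Nat.cast_sum, Finset.sum_div,
    ENNReal.ofReal_sum_of_nonneg]
  · refine Finset.sum_congr rfl fun u _ => ?_
    rw [hD]
    split_ifs with h
    · have hpos : 0 < G.deg u := List.length_pos_of_mem ((G.mem_nbrs u v).2 h.symm)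
      have h0 : (G.deg u : ℝ) ≠ 0 := by positivity
      rw [← ENNReal.ofReal_natCast, ← ENNReal.ofReal_inv_of_pos (by positivity),
        ← ENNReal.ofReal_mul (by positivity)]
      congr 1
      field_simp
    · simp
  · intro u _; positivity

theorem vertexPMF_bounds {eps : ℝ} {D : PMF (Option (Fin n))} {γ mbar : ℕ} (hm : 1 ≤ mbar)
    (hD : G.IsTypicalDS eps γ mbar D) {v : Fin n} (hv : γ < G.deg v) :
    ENNReal.ofReal ((1 - eps) * (G.deg v / (2 * mbar))) ≤ vertexPMF G D γ (some v) ∧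
      vertexPMF G D γ (some v) ≤ ENNReal.ofReal ((1 + eps) * (G.deg v / (2 * mbar))) := by
  obtain ⟨S, ⟨hS, hS1, -⟩, hD⟩ := hD
  obtain ⟨h1, h2⟩ := hS1 v hv
  have hn : (0 : ℝ) < n := by exact_mod_cast Nat.pos_of_ne_zero (NeZero.ne n)
  have hc : (0 : ℝ) < S.card := by exact_mod_cast Multiset.card_pos.2 hS
  have hm' : (0 : ℝ) < mbar := by exact_mod_cast hm
  have key : ∀ x : ℝ, x * (G.deg v / (2 * mbar)) =
      x * (S.card * (G.deg v / n : ℝ)) / (2 * (mbar / n : ℝ) * S.card) := by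
    intro x; field_simp
  rw [vertexPMF_eq G hD hv, key, key]
  constructor <;> gcongr

theorem lowPMF_apply {k γ : ℕ} {v : Fin n} {r : List (Fin n)} (hv : G.deg v ≤ γ)
    (hr : r.length = k - 1) (hadj : ∀ u ∈ r, G.graph.Adj v u) :
    lowPMF G k γ (some (v :: r)) = (n : ℝ≥0∞)⁻¹ * ((γ : ℝ≥0∞)⁻¹) ^ (k - 1) := by
  rw [lowPMF, bind_eq_single _ _ v]
  · rw [if_pos hv, map_cons_apply, ← hr, iterPMF_apply]
    congr 1
    · simp [unifFin]
    · rw [List.map_congr_left (g := fun _ => (γ : ℝ≥0∞)⁻¹)]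
      · simp
      · exact fun u hu => nbrPMF_apply G hv (hadj u hu)
  · intro v' hv'
    split_ifs
    · exact map_cons_apply_ne _ _ hv'
    · simp [PMF.pure_apply]

omit [NeZero n] in
theorem mediumPMF_apply {D : PMF (Option (Fin n))} {k γ mbar : ℕ} {v u : Fin n}
    {r : List (Fin n)} (hv : G.deg v * G.deg v ≤ mbar) (hr : r.length = k - 2)
    (hu : G.graph.Adj v u) (hadj : ∀ u ∈ r, G.graph.Adj v u) :
    mediumPMF G D k γ mbar (some (v :: u :: r)) = vertexPMF G D γ (some v) *
      ENNReal.ofReal ((G.deg v : ℝ)⁻¹ * ((√(mbar : ℝ))⁻¹) ^ (k - 2)) := by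
  have hpos : 0 < G.deg v := List.length_pos_of_mem ((G.mem_nbrs v u).2 hu)
  have hpos' : (0 : ℝ) < G.deg v := by exact_mod_cast hpos
  have hm : 0 < mbar := lt_of_lt_of_le (Nat.mul_pos hpos hpos) hv
  have hm' : (0 : ℝ) < √(mbar : ℝ) := Real.sqrt_pos.2 (by exact_mod_cast hm)
  have hstep : ∀ x, G.graph.Adj v x →
      mediumStepPMF G v mbar (some x) = ENNReal.ofReal (√(mbar : ℝ))⁻¹ := by
    intro x hx
    rw [mediumStepPMF, bind_eq_single _ _ (some x)]
    · rw [map_apply_inj _ (a := true)]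
      · rw [nbrPMF_apply G le_rfl hx]
        simp only [coinPMF, PMF.ofFintype_apply, if_true]
        -- The coin takes integer arguments and a square root, so the irrational bias `d(v) / √mbar`
        -- is realised exactly. Together with the uniform neighbour, of probability `1 / d(v)`, it
        -- leaves `1 / √mbar`.
        have h1 : √(((G.deg v * G.deg v : ℕ) : ℝ) / (mbar : ℝ)) = G.deg v / √(mbar : ℝ) := by
          rw [Real.sqrt_div (by positivity), Nat.cast_mul, Real.sqrt_mul_self hpos'.le]
        have h2 : (G.deg v : ℝ) / √(mbar : ℝ) ≤ 1 := by
          rw [div_le_one hm']; exact natCast_le_sqrt.2 hv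
        rw [h1, min_eq_right (by rw [← ENNReal.ofReal_one]; gcongr),
          ← ENNReal.ofReal_natCast, ← ENNReal.ofReal_inv_of_pos hpos',
          ← ENNReal.ofReal_mul (by positivity)]
        congr 1
        field_simp
      · intro b; cases b <;> simp
    · rintro o ho
      refine map_apply_zero _ fun b => ?_
      cases b <;> simp [ho]
  rw [mediumPMF, bind_eq_single _ _ (some v)]
  · simp only [if_pos hv]
    rw [bind_eq_single _ _ (some u)]
    · congr 1
      rw [map_apply_inj (a := some r), ← hr, iterPMF_apply,
        List.map_congr_left (g := fun _ => ENNReal.ofReal (√(mbar : ℝ))⁻¹)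
          (fun x hx => hstep x (hadj x hx)), nbrPMF_apply G le_rfl hu,
        ENNReal.ofReal_mul (by positivity), ENNReal.ofReal_pow (by positivity),
        ENNReal.ofReal_inv_of_pos hpos']
      · simp
      · rintro (_ | a) <;> simp
    · rintro (_ | u') h
      · simp [PMF.pure_apply]
      · refine map_apply_zero _ fun o => ?_
        have : u' ≠ u := fun h' => h (by rw [h'])
        cases o <;> simp [this]
  · rintro (_ | v') h
    · simp [PMF.pure_apply]
    · have : v' ≠ v := fun h' => h (by rw [h'])
      simp only
      split_ifs
      · rw [PMF.bind_apply, ENNReal.tsum_eq_zero]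
        rintro (_ | u')
        · simp [PMF.pure_apply]
        · rw [map_apply_zero, mul_zero]
          intro o
          cases o <;> simp [this]
      · simp [PMF.pure_apply]

omit [NeZero n] in
theorem highStepPMF_apply {D : PMF (Option (Fin n))} {γ mbar : ℕ} {v : Fin n}
    (hv : mbar < G.deg v * G.deg v) :
    highStepPMF G D γ mbar (some v) =
      vertexPMF G D γ (some v) * ENNReal.ofReal (√(mbar : ℝ) / G.deg v) := by
  have hpos : 0 < G.deg v := Nat.pos_of_ne_zero fun h => by simp [h] at hv
  have hpos' : (0 : ℝ) < G.deg v := by exact_mod_cast hpos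
  rw [highStepPMF, bind_eq_single _ _ (some v)]
  · simp only [if_pos hv]
    rw [map_apply_inj _ (a := true)]
    · congr 1
      simp only [coinPMF, PMF.ofFintype_apply, if_true]
      have h1 : √((mbar : ℝ) / ((G.deg v * G.deg v : ℕ) : ℝ)) = √(mbar : ℝ) / G.deg v := by
        rw [Real.sqrt_div (by positivity), Nat.cast_mul, Real.sqrt_mul_self hpos'.le]
      have h2 : √(mbar : ℝ) / (G.deg v : ℝ) ≤ 1 := by
        rw [div_le_one hpos', Real.sqrt_le_left hpos'.le, sq]
        exact_mod_cast hv.le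
      rw [h1, min_eq_right (by rw [← ENNReal.ofReal_one]; gcongr)]
    · intro b; cases b <;> simp
  · rintro (_ | v') h
    · simp [PMF.pure_apply]
    · simp only
      split_ifs
      · refine map_apply_zero _ fun b => ?_
        cases b <;> simp
        rintro rfl; exact h rfl
      · simp [PMF.pure_apply]

variable {G}

/-- The least vertex of a clique is the first one in its increasing list. -/
theorem QueryGraph.ordered_cons {k : ℕ} (hk : 2 ≤ k) {s : Finset (Fin n)}
    (hs : G.graph.IsNClique k s) : ∃ v u r, G.ordered hs = v :: u :: r ∧ r.length = k - 2 ∧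
      (∀ x ∈ u :: r, G.graph.Adj v x) ∧ G.minDeg s = G.deg v := by
  have h := QueryGraph.isOrdered_ordered hs
  have h' := QueryGraph.ordered_toFinset hs
  rcases hl : G.ordered hs with _ | ⟨v, _ | ⟨u, r⟩⟩
  · have := h.1; simp [hl] at this; omega
  · have := h.1; simp [hl] at this; omega
  · rw [hl] at h h'
    refine ⟨v, u, r, rfl, ?_, ?_, ?_⟩
    · have := h.1; simp at this; omega
    · exact fun x hx => ((List.pairwise_cons.1 h.pairwise).1 x hx).1
    · rw [← h', h.minDeg_eq]

omit [NeZero n] in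
theorem QueryGraph.minDeg_le {s : Finset (Fin n)} {x : Fin n} (hx : x ∈ s) :
    G.minDeg s ≤ G.deg x := Nat.sInf_le ⟨x, hx, rfl⟩

theorem low_prob {k γ : ℕ} (hk : 2 ≤ k) (hγ : 1 ≤ γ) {s : Finset (Fin n)}
    (hs : G.IsLowClique k γ s) :
    (lowPMF G k γ).map (G.verified k) (some s) =
      ENNReal.ofReal (1 / ((n : ℝ) * (γ : ℝ) ^ (k - 1))) := by
  obtain ⟨v, u, r, h1, h2, h3, h4⟩ := QueryGraph.ordered_cons hk hs.1
  have hn : (0 : ℝ) < n := by exact_mod_cast Nat.pos_of_ne_zero (NeZero.ne n)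
  have hγ' : (0 : ℝ) < γ := by exact_mod_cast hγ
  rw [QueryGraph.map_verified_apply _ hs.1, h1, lowPMF_apply G (h4 ▸ hs.2) (by simp; omega) h3,
    one_div, mul_inv, ENNReal.ofReal_mul (by positivity), ← inv_pow,
    ENNReal.ofReal_pow (by positivity), ENNReal.ofReal_inv_of_pos hn,
    ENNReal.ofReal_inv_of_pos hγ', ENNReal.ofReal_natCast, ENNReal.ofReal_natCast]

theorem rpow_half (a k : ℕ) : (a : ℝ) ^ ((k : ℝ) / 2) = √(a : ℝ) ^ k := by
  rw [Real.sqrt_eq_rpow, ← Real.rpow_natCast, ← Real.rpow_mul (by positivity)]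
  congr 1; ring

/-- The product is `d(v) / (2 * mbar) * (1 / d(v)) * (1 / √mbar) ^ (k - 2)`, in which `d(v)`
cancels. Typicality is used only for the first vertex, so the error factor occurs once. -/
theorem medium_prob {eps : ℝ} {D : PMF (Option (Fin n))} {k γ mbar : ℕ}
    (hk : 2 ≤ k) (hm : 1 ≤ mbar) (hD : G.IsTypicalDS eps γ mbar D) {s : Finset (Fin n)}
    (hs : G.IsMediumClique k γ mbar s) :
    ENNReal.ofReal ((1 - eps) * (1 / (2 * √(mbar : ℝ) ^ k))) ≤
        (mediumPMF G D k γ mbar).map (G.verified k) (some s) ∧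
      (mediumPMF G D k γ mbar).map (G.verified k) (some s) ≤
        ENNReal.ofReal ((1 + eps) * (1 / (2 * √(mbar : ℝ) ^ k))) := by
  obtain ⟨v, u, r, h1, h2, h3, h4⟩ := QueryGraph.ordered_cons hk hs.1
  obtain ⟨hs0, hs1, hs2⟩ := hs
  rw [h4] at hs1 hs2
  have hpos : (0 : ℝ) < G.deg v := by exact_mod_cast (show 0 < G.deg v by omega)
  have hm' : (0 : ℝ) < mbar := by exact_mod_cast hm
  have hq : (0 : ℝ) < √(mbar : ℝ) := Real.sqrt_pos.2 hm'
  obtain ⟨b1, b2⟩ := vertexPMF_bounds G hm hD (v := v) (by omega)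
  rw [QueryGraph.map_verified_apply _ hs0, h1, mediumPMF_apply G (natCast_le_sqrt.1 hs2) h2
    (h3 u (by simp)) (fun x hx => h3 x (by simp [hx]))]
  have key : ∀ x : ℝ, x * (1 / (2 * √(mbar : ℝ) ^ k)) = x * (G.deg v / (2 * mbar)) *
      ((G.deg v : ℝ)⁻¹ * ((√(mbar : ℝ))⁻¹) ^ (k - 2)) := by
    intro x
    obtain ⟨j, rfl⟩ : ∃ j, k = j + 2 := ⟨k - 2, by omega⟩
    rw [Nat.add_sub_cancel, pow_add, Real.sq_sqrt hm'.le, inv_pow]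
    field_simp
  have split : ∀ x : ℝ, ENNReal.ofReal (x * (1 / (2 * √(mbar : ℝ) ^ k))) =
      ENNReal.ofReal (x * (G.deg v / (2 * mbar))) *
        ENNReal.ofReal ((G.deg v : ℝ)⁻¹ * ((√(mbar : ℝ))⁻¹) ^ (k - 2)) := fun x => by
    rw [key, ENNReal.ofReal_mul' (by positivity)]
  rw [split, split]
  exact ⟨mul_le_mul' b1 le_rfl, mul_le_mul' b2 le_rfl⟩

/-- Each vertex contributes `d(v) / (2 * mbar) * (√mbar / d(v)) = 1 / (2 * √mbar)`, up to one error
factor. The hypothesis `γ ≤ √mbar` makes typicality available for all vertices of degree above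
`√mbar`. -/
theorem high_prob {eps : ℝ} (h0 : 0 ≤ eps) (h1 : eps ≤ 1) {D : PMF (Option (Fin n))}
    {k γ mbar : ℕ} (hm : 1 ≤ mbar) (hγm : (γ : ℝ) ≤ √(mbar : ℝ))
    (hD : G.IsTypicalDS eps γ mbar D) {s : Finset (Fin n)} (hs : G.IsHighClique k mbar s) :
    ENNReal.ofReal ((1 - eps) ^ k * (1 / (2 ^ k * √(mbar : ℝ) ^ k))) ≤
        (highPMF G D k γ mbar).map (G.verified k) (some s) ∧
      (highPMF G D k γ mbar).map (G.verified k) (some s) ≤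
        ENNReal.ofReal ((1 + eps) ^ k * (1 / (2 ^ k * √(mbar : ℝ) ^ k))) := by
  have hm' : (0 : ℝ) < mbar := by exact_mod_cast hm
  have hq : (0 : ℝ) < √(mbar : ℝ) := Real.sqrt_pos.2 hm'
  obtain ⟨hs0, hs1⟩ := hs
  have hl := (QueryGraph.isOrdered_ordered hs0).1
  have hmem : ∀ x ∈ G.ordered hs0, x ∈ s := fun x hx => by
    rw [← QueryGraph.ordered_toFinset hs0]; simpa using hx
  have hstep : ∀ x ∈ G.ordered hs0,
      ENNReal.ofReal ((1 - eps) * (1 / (2 * √(mbar : ℝ)))) ≤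
          highStepPMF G D γ mbar (some x) ∧
        highStepPMF G D γ mbar (some x) ≤
          ENNReal.ofReal ((1 + eps) * (1 / (2 * √(mbar : ℝ)))) := by
    intro x hx
    have hd : √(mbar : ℝ) < G.deg x :=
      hs1.trans_le (by exact_mod_cast QueryGraph.minDeg_le (hmem x hx))
    have hdx : (0 : ℝ) < G.deg x := hq.trans hd
    have hlt : mbar < G.deg x * G.deg x := by
      refine lt_of_not_ge fun hle => ?_
      exact absurd (natCast_le_sqrt.2 hle) (not_le.2 hd)
    obtain ⟨b1, b2⟩ := vertexPMF_bounds G hm hD (v := x)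
      (by exact_mod_cast hγm.trans_lt hd)
    rw [highStepPMF_apply G hlt]
    have key : ∀ y : ℝ, y * (1 / (2 * √(mbar : ℝ))) = y * (G.deg x / (2 * mbar)) *
        (√(mbar : ℝ) / G.deg x) := by
      intro y
      nth_rewrite 2 [← Real.sq_sqrt hm'.le]
      field_simp
    have split : ∀ y : ℝ, ENNReal.ofReal (y * (1 / (2 * √(mbar : ℝ)))) =
        ENNReal.ofReal (y * (G.deg x / (2 * mbar))) *
          ENNReal.ofReal (√(mbar : ℝ) / G.deg x) := fun y => by
      rw [key, ENNReal.ofReal_mul' (by positivity)]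
    rw [split, split]
    exact ⟨mul_le_mul' b1 le_rfl, mul_le_mul' b2 le_rfl⟩
  have key : ∀ y : ℝ, 0 ≤ y → ENNReal.ofReal (y ^ k * (1 / (2 ^ k * √(mbar : ℝ) ^ k))) =
      ((G.ordered hs0).map fun _ => ENNReal.ofReal (y * (1 / (2 * √(mbar : ℝ))))).prod := by
    intro y hy
    rw [List.map_const', List.prod_replicate, hl, ← ENNReal.ofReal_pow (by positivity)]
    congr 1
    rw [mul_pow, div_pow, mul_pow, one_pow]
  have hval : (highPMF G D k γ mbar).map (G.verified k) (some s) =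
      ((G.ordered hs0).map fun x => highStepPMF G D γ mbar (some x)).prod := by
    have := iterPMF_apply (highStepPMF G D γ mbar) (G.ordered hs0)
    rw [hl] at this
    rw [QueryGraph.map_verified_apply _ hs0, highPMF, this]
  rw [hval, key _ (by linarith), key _ (by linarith)]
  exact ⟨List.prod_le_prod' fun x hx => (hstep x hx).1,
    List.prod_le_prod' fun x hx => (hstep x hx).2⟩

end Probabilities

/-! ### The attempted samplers -/

section Attempted

variable {n : ℕ} {A : Access n} {w c U k t : ℕ} {P : Cmd} {σ : State}
  {cls : Finset (Fin n) → Prop} {μ : PMF (Option (Finset (Fin n)))}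

/-- A `Run` tracks only time; the bound for the queries follows because the number of queries never
exceeds the time. -/
theorem isAttemptedSampler_of_run (h : Run A w U P t σ μ (SamplerPost k cls σ))
    (hq : σ.queries = 0) (ht : σ.time = 0) : IsAttemptedSampler A w k P σ cls (U * t) := by
  classical
  rw [IsAttemptedSampler, ← (h σ (SameMem.refl σ)).prob_eq_one
    (E := fun τ => (Fails τ ∨ ∃ c, cls c ∧ Returns k c τ) ∧ τ.time ≤ U * t)]
  · refine A.expect_congr_of_queries_le w 0 0 P (fun τ hτ => ?_) σ (by omega)
    congr 1
    refine propext (and_congr_right fun _ => ?_)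
    omega
  · rintro o τ ⟨ρ, ⟨-, h1⟩, h2, h3⟩
    refine ⟨?_, by rw [mul_comm]; omega⟩
    rcases o with _ | s
    · left; rw [Fails, h2.1]; exact h1
    · right
      refine ⟨s, h1.1, ?_⟩
      rw [Returns, h2.1, h2.2]; exact h1.2

theorem SamplerPost.returns_iff {o : Option (Finset (Fin n))} {τ ρ : State}
    {s : Finset (Fin n)} (h : SamplerPost k cls σ o ρ) (hm : SameMem τ ρ) :
    Returns k s τ ↔ o = some s := by
  have : Returns k s τ ↔ Returns k s ρ := by rw [Returns, Returns, hm.1, hm.2]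
  rw [this]
  obtain ⟨-, h⟩ := h
  rcases o with _ | s'
  · simp only at h
    simp [Returns, h]
  · simp only [Option.some.injEq]
    exact ⟨fun h' => h.2.unique h', fun h' => h' ▸ h.2⟩

theorem prob_returns_of_run (h : Run A w U P t σ μ (SamplerPost k cls σ)) (s : Finset (Fin n)) :
    A.prob w P σ (Returns k s) = μ (some s) :=
  (h σ (SameMem.refl σ)).prob_eq_apply fun _ _ ⟨_, h1, h2, _⟩ => h1.returns_iff h2

end Attempted

theorem attempted_samplers {n k γ mbar w : ℕ} (hn1 : 1 ≤ n) (hk2 : 2 ≤ k) (hγ1 : 1 ≤ γ)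
    (hm1 : 1 ≤ mbar) (hn : n < 2 ^ w) (hk : k < 2 ^ w) (hγ : γ < 2 ^ w) (hm : mbar < 2 ^ w)
    (G : QueryGraph n) (D : PMF (Option (Fin n))) :
    (IsAttemptedSampler ⟨G, D⟩ w k lowSampler (.start [n, k, γ, mbar]) (G.IsLowClique k γ)
        (10 ^ 10 * k ^ 2) ∧
      ∀ c, G.IsLowClique k γ c →
        Access.prob ⟨G, D⟩ w lowSampler (.start [n, k, γ, mbar]) (Returns k c) =
          ENNReal.ofReal (1 / ((n : ℝ) * (γ : ℝ) ^ (k - 1)))) ∧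
    (IsAttemptedSampler ⟨G, D⟩ w k mediumSampler (.start [n, k, γ, mbar])
        (G.IsMediumClique k γ mbar) (10 ^ 10 * k ^ 2) ∧
      ∀ eps : ℝ, 0 < eps → eps < 1 / 2 → G.IsTypicalDS eps γ mbar D →
        ∀ c, G.IsMediumClique k γ mbar c →
          ENNReal.ofReal ((1 - eps) * (1 / (2 * (mbar : ℝ) ^ ((k : ℝ) / 2)))) ≤
            Access.prob ⟨G, D⟩ w mediumSampler (.start [n, k, γ, mbar]) (Returns k c) ∧
          Access.prob ⟨G, D⟩ w mediumSampler (.start [n, k, γ, mbar]) (Returns k c) ≤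
            ENNReal.ofReal ((1 + eps) * (1 / (2 * (mbar : ℝ) ^ ((k : ℝ) / 2))))) ∧
    (IsAttemptedSampler ⟨G, D⟩ w k highSampler (.start [n, k, γ, mbar])
        (G.IsHighClique k mbar) (10 ^ 10 * k ^ 2) ∧
      ∀ eps : ℝ, 0 < eps → eps < 1 / 2 → G.IsTypicalDS eps γ mbar D →
        (γ : ℝ) ≤ √(mbar : ℝ) → ∀ c, G.IsHighClique k mbar c →
          ENNReal.ofReal ((1 - eps) ^ k * (1 / (2 ^ k * (mbar : ℝ) ^ ((k : ℝ) / 2)))) ≤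
            Access.prob ⟨G, D⟩ w highSampler (.start [n, k, γ, mbar]) (Returns k c) ∧
          Access.prob ⟨G, D⟩ w highSampler (.start [n, k, γ, mbar]) (Returns k c) ≤
            ENNReal.ofReal ((1 + eps) ^ k * (1 / (2 ^ k * (mbar : ℝ) ^ ((k : ℝ) / 2))))) := by
  have : NeZero n := ⟨by omega⟩
  have hw : 1 ≤ w := Nat.one_le_iff_ne_zero.2 fun h => by simp [h] at hn; omega
  -- All inputs fit into one word here, so a unit is an absolute constant, and `10 ^ 10` is the unit
  -- times the `100` of the running times.
  have hM : Mach w 1 (10 ^ 8) := ⟨hw, le_rfl, by norm_num⟩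
  have e1 : (State.start [n, k, γ, mbar]).reg 1 = n := rfl
  have e2 : (State.start [n, k, γ, mbar]).reg 2 = k := rfl
  have e3 : (State.start [n, k, γ, mbar]).reg 3 = γ := rfl
  have e4 : (State.start [n, k, γ, mbar]).reg 4 = mbar := rfl
  rw [← one_mul w] at hn hk hγ hm
  have hT : 10 ^ 10 * k ^ 2 = 10 ^ 8 * (100 * k ^ 2) := by ring
  have hQ := accesses_sample ⟨G, D⟩ hM
  have low := run_lowSampler (A := ⟨G, D⟩) hM hk2 hk hn hγ1 hγ e1 e2 e3
  have med := run_mediumSampler (A := ⟨G, D⟩) hM hQ hk2 hk hn hγ hm trivial e2 e3 e4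
  have high := run_highSampler (A := ⟨G, D⟩) hM hQ hk2 hk hn hγ hm trivial e2 e3 e4
  rw [← mediumSampler_eq] at med
  rw [← highSampler_eq] at high
  rw [hT]
  refine ⟨⟨isAttemptedSampler_of_run low rfl rfl, fun s hs => ?_⟩,
    ⟨isAttemptedSampler_of_run med rfl rfl, fun eps h0 h1 hD s hs => ?_⟩,
    ⟨isAttemptedSampler_of_run high rfl rfl, fun eps h0 h1 hD hγm s hs => ?_⟩⟩
  · rw [prob_returns_of_run low, low_prob hk2 hγ1 hs]
  · rw [prob_returns_of_run med, rpow_half]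
    exact medium_prob hk2 hm1 hD hs
  · rw [prob_returns_of_run high, rpow_half]
    exact high_prob h0.le (by linarith) hm1 hγm hD hs

/-! ### A data structure for sampling by degree from a list of vertices -/

section Look

variable {n : ℕ} (G : QueryGraph n)

/-- The sum of the degrees in a list, scaled by `n`. -/
def weight (S : List (Fin n)) : ℕ := n * (S.map G.deg).sum

theorem weight_cons (u : Fin n) (S : List (Fin n)) :
    weight G (u :: S) = n * G.deg u + weight G S := by
  simp [weight, mul_add]

theorem weight_append_singleton (S : List (Fin n)) (u : Fin n) :
    weight G (S ++ [u]) = weight G S + n * G.deg u := by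
  simp [weight, mul_add]

theorem weight_le (S : List (Fin n)) : weight G S ≤ n * n * S.length := by
  induction S with
  | nil => simp [weight]
  | cons u S ih =>
    rw [weight_cons, List.length_cons]
    have := Nat.mul_le_mul_left n (G.deg_lt u).le
    nlinarith

/-- The vertex in whose interval the number `x` lies, if the intervals belonging to the entries of
the list have the lengths `n * d(u)`. -/
def look : List (Fin n) → ℕ → Option (Fin n)
  | [], _ => none
  | u :: S, x => if x < n * G.deg u then some u else look S (x - n * G.deg u)

theorem look_eq_getElem {S : List (Fin n)} {x j : ℕ} (hj : j < S.length)
    (h : weight G (S.take j) ≤ x) (h' : x < weight G (S.take (j + 1))) :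
    look G S x = some S[j] := by
  induction S generalizing x j with
  | nil => simp at hj
  | cons u S ih =>
    rw [look]
    rcases j with _ | j
    · rw [if_pos (by simpa [weight] using h')]
      rfl
    · rw [List.take_succ_cons, weight_cons] at h h'
      rw [if_neg (by omega), ih (by simpa using hj) (by omega) (by omega)]
      rfl

theorem look_eq_none {S : List (Fin n)} {x : ℕ} (h : weight G S ≤ x) : look G S x = none := by
  induction S generalizing x with
  | nil => rfl
  | cons u S ih =>
    rw [weight_cons] at h
    rw [look, if_neg (by omega), ih (by omega)]

/-- Peeling off the interval of the first entry shifts the rest; each occurrence of `u` owns an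
interval of length `n * d(u)`. -/
theorem card_look (S : List (Fin n)) (u : Fin n) {T : ℕ} (h : weight G S ≤ T) :
    ((Finset.range T).filter fun x => look G S x = some u).card = S.count u * (n * G.deg u) := by
  induction S generalizing T with
  | nil => simp [look]
  | cons v S ih =>
    rw [weight_cons] at h
    obtain ⟨T, rfl⟩ : ∃ T', T = n * G.deg v + T' := ⟨T - n * G.deg v, by omega⟩
    have h1 : ∀ a b : ℕ, ∀ p : ℕ → Prop, [DecidablePred p] →
        ((Finset.range (a + b)).filter p).card = ((Finset.range a).filter p).card +
          ((Finset.range b).filter fun x => p (a + x)).card := by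
      intro a b p _
      simp only [Finset.card_filter]
      exact Finset.sum_range_add _ _ _
    rw [h1]
    have h2 : ((Finset.range T).filter fun x => look G (v :: S) (n * G.deg v + x) = some u).card =
        S.count u * (n * G.deg u) := by
      rw [← ih (show weight G S ≤ T by omega)]
      congr 1
      refine Finset.filter_congr fun x _ => ?_
      rw [look, if_neg (by omega), Nat.add_sub_cancel_left]
    have h3 : ((Finset.range (n * G.deg v)).filter fun x => look G (v :: S) x = some u) =
        if v = u then Finset.range (n * G.deg v) else ∅ := by
      split_ifs with hvu
      · refine Finset.filter_true_of_mem fun x hx => ?_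
        rw [look, if_pos (Finset.mem_range.1 hx), hvu]
      · refine Finset.filter_false_of_mem fun x hx => ?_
        rw [look, if_pos (Finset.mem_range.1 hx)]
        simpa using hvu
    rw [h2, h3, List.count_cons]
    by_cases hvu : v = u
    · subst hvu; simp; ring
    · simp [hvu]

/-- The distribution of the accesses to the data structure. -/
def dsPMF (S : List (Fin n)) (T : ℕ) : PMF (Option (Fin n)) := (unif T).map (look G S)

theorem dsPMF_apply {S : List (Fin n)} {T : ℕ} (hT : 1 ≤ T) (h : weight G S ≤ T) (u : Fin n) :
    dsPMF G S T (some u) = ENNReal.ofReal (S.count u * (n * G.deg u) / T) := by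
  classical
  rw [← avg_single, dsPMF, avg_map, avg_unif, max_eq_right hT, ENNReal.ofReal_div_of_pos
    (by exact_mod_cast hT), ENNReal.ofReal_natCast, Finset.sum_boole]
  congr 1
  rw [card_look G S u h, ← ENNReal.ofReal_natCast]
  push_cast; rfl

/-- Scaling the degrees by `n` clears the denominator of `mbar / n`: a uniform integer below `2 *
mbar * S.length` realises the prescribed probabilities exactly, and the integers beyond the total
weight mean failure. -/
theorem isTypicalDS_dsPMF {S : List (Fin n)} {eps : ℝ} {γ mbar : ℕ} (hm : 1 ≤ mbar)
    (hS : G.IsTypicalMultiset eps γ mbar S) (h : weight G S ≤ 2 * mbar * S.length) :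
    G.IsTypicalDS eps γ mbar (dsPMF G S (2 * mbar * S.length)) := by
  have hl : 0 < S.length := by
    have := Multiset.card_pos.2 hS.1
    simpa using this
  refine ⟨S, hS, fun u => ?_⟩
  have hn : (n : ℝ) ≠ 0 := by
    have := u.2
    have : n ≠ 0 := by omega
    exact_mod_cast this
  have hT : 1 ≤ 2 * mbar * S.length := Nat.mul_pos (by omega) hl
  have hl' : (S.length : ℝ) ≠ 0 := by positivity
  have hm' : (mbar : ℝ) ≠ 0 := by positivity
  rw [dsPMF_apply G hT h]
  congr 1
  simp only [Multiset.coe_count, Multiset.coe_card]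
  push_cast
  field_simp

end Look

theorem Exp.eval_lt_ne_zero {σ : State} {e f : Exp} :
    (Exp.lt e f).eval σ ≠ 0 ↔ e.eval σ < f.eval σ := by
  simp only [Exp.eval]; split_ifs <;> simp [*]

theorem Exp.eval_lt_eq_zero {σ : State} {e f : Exp} :
    (Exp.lt e f).eval σ = 0 ↔ f.eval σ ≤ e.eval σ := by
  rw [← not_iff_not, ← ne_eq, Exp.eval_lt_ne_zero, not_le]

/-- A whole access to the list, which takes logarithmically many steps, is counted as one step of
the larger unit `U'`; the analysis of the samplers with unit-time accesses then applies unchanged.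
-/
theorem Run.rescale {n : ℕ} {A : Access n} {w U U' : ℕ} {O : Type} {P : Cmd} {t t' : ℕ} {σ : State}
    {μ : PMF O} {Q : O → State → Prop} (h : Run A w U P t σ μ Q) (ht : t * U ≤ t' * U') :
    Run A w U' P t' σ μ Q := fun σ' hσ =>
  (h σ' hσ).mono fun _ _ ⟨τ, h1, h2, h3⟩ => ⟨τ, h1, h2, h3.trans (Nat.add_le_add_left ht _)⟩

/-- The data structure for the list `S` in the memory: the vertices in array `1`, the partial sums
of their scaled degrees in array `2`. -/
def ListData {n : ℕ} (G : QueryGraph n) (S : List (Fin n)) (τ : State) : Prop :=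
  τ.reg 19 = S.length ∧ τ.reg 20 = weight G S ∧
    (∀ j (hj : j < S.length), τ.arr 1 j = S[j]) ∧ ∀ j ≤ S.length, τ.arr 2 j = weight G (S.take j)

theorem ListData.congr {n : ℕ} {G : QueryGraph n} {S : List (Fin n)} {σ τ : State}
    (h : ListData G S σ) (h19 : τ.reg 19 = σ.reg 19) (h20 : τ.reg 20 = σ.reg 20)
    (h1 : τ.arr 1 = σ.arr 1) (h2 : τ.arr 2 = σ.arr 2) : ListData G S τ := by
  rw [ListData, h19, h20, h1, h2]; exact h

/-- Sample a vertex from the list. -/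
def accessList : Cmd :=
  .rand 40 (.mul (.mul (.lit 2) (.reg rMbar)) (.reg 19)) ;;
  .ite (.lt (.reg 40) (.reg 20))
    (.assign 41 (.lit 0) ;;
     .assign 42 (.reg 19) ;;
     .while (.lt (.add (.reg 41) (.lit 1)) (.reg 42))
       (.assign 43 (.div (.add (.reg 41) (.reg 42)) (.lit 2)) ;;
        .ite (.lt (.reg 40) (.get 2 (.reg 43))) (.assign 42 (.reg 43)) (.assign 41 (.reg 43))) ;;
     .assign 9 (.add (.get 1 (.reg 41)) (.lit 1)))
    (.assign 9 (.lit 0))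

/-! ### Binary search in the partial sums of the degrees. -/

section AccessList

variable {n : ℕ} {A : Access n} {w c U : ℕ}

theorem weight_take_le (G : QueryGraph n) (S : List (Fin n)) (j : ℕ) :
    weight G (S.take j) ≤ weight G S := by
  conv_rhs => rw [← List.take_append_drop j S]
  rw [weight, weight, List.map_append, List.sum_append]
  exact Nat.mul_le_mul_left _ (Nat.le_add_right _ _)

/-- The measure of the binary search: the larger half of an interval of length at least two has a
smaller logarithm. -/
theorem clog_half {d : ℕ} (hd : 2 ≤ d) {d' : ℕ} (h : d' ≤ (d + 1) / 2) :
    Nat.clog 2 d' < Nat.clog 2 d := by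
  rw [Nat.clog_of_two_le (by norm_num) hd]
  have := Nat.clog_mono_right 2 (show d' ≤ (d + 2 - 1) / 2 by omega)
  omega

/-- The loop keeps the random number between the partial sums at registers `41` and `42`. When these
are adjacent, the entry at the lower index owns the number (`look_eq_getElem`). Only array `2` is
consulted, so one access takes logarithmic time. -/
theorem run_accessList (hM : Mach w c U) {S : List (Fin n)} {mbar : ℕ} {σ : State}
    (hD : ListData A.G S σ) (h4 : σ.reg 4 = mbar) (hm1 : 1 ≤ mbar) (hn : n < 2 ^ (c * w))
    (hm : mbar < 2 ^ (c * w)) (hl1 : 1 ≤ S.length) (hT : 2 * mbar * S.length < 2 ^ (c * w))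
    (hW : weight A.G S ≤ 2 * mbar * S.length) :
    Run A w U accessList (4 * Nat.clog 2 S.length + 10) σ (dsPMF A.G S (2 * mbar * S.length))
      (fun o τ => τ.reg 9 = report o ∧ (∀ x < 40, x ≠ 9 → τ.reg x = σ.reg x) ∧
        τ.arr = σ.arr) := by
  obtain ⟨h19, h20, ha1, ha2⟩ := hD
  have hs : S.length < 2 ^ (c * w) := by
    refine lt_of_le_of_lt ?_ hT
    exact Nat.le_mul_of_pos_left _ (by omega)
  have hWl : ∀ j, weight A.G (S.take j) < 2 ^ (c * w) := fun j =>
    (weight_take_le A.G S j).trans_lt (hW.trans_lt hT)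
  refine Run.time (t := 1 + (4 * Nat.clog 2 S.length + 9)) ?_ (by omega)
  have hr := Run.rand (A := A) (U := U) (x := 40) (σ := σ)
    (e := .mul (.mul (.lit 2) (.reg rMbar)) (.reg 19)) hM
    (by simp only [Exp.Bdd, rMbar, h4, h19]; exact ⟨⟨trivial, hm⟩, hs⟩)
  have he : Exp.eval σ (.mul (.mul (.lit 2) (.reg rMbar)) (.reg 19)) = 2 * mbar * S.length := by
    simp [Exp.eval, rMbar, h4, h19]
  rw [he] at hr
  refine hr.seq_pure ?_
  rintro x τ ⟨hx, rfl⟩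
  have hx' : x < 2 ^ (c * w) := by
    have : max 1 (2 * mbar * S.length) = 2 * mbar * S.length :=
      max_eq_right (Nat.mul_pos (by omega) hl1)
    omega
  refine Run.time (t := (4 * Nat.clog 2 S.length + 4) + 1) ?_ (by omega)
  have hb : (Exp.lt (.reg 40) (.reg 20)).eval (σ.setReg 40 x) ≠ 0 ↔ x < weight A.G S := by
    simp [Exp.eval, h20]
  refine Run.ite hM ?_ ?_ ?_
  · simp only [Exp.Bdd, setReg_reg]
    simp only [reduceIte, h20, hx', true_and]
    simpa using hW.trans_lt hT
  · intro hb'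
    rw [hb] at hb'
    refine Run.time (t := (((4 * Nat.clog 2 S.length + 1) + 1) + 1) + 1) ?_ (by omega)
    refine Run.assign_seq (e := .lit 0) hM trivial (Run.assign_seq hM ?_ ?_)
    · simp only [Exp.Bdd, setReg_reg]; simpa [h19] using hs
    set ρ := ((σ.setReg 40 x).setReg 41 (Exp.eval (σ.setReg 40 x) (.lit 0))).setReg 42
      (Exp.eval ((σ.setReg 40 x).setReg 41 (Exp.eval (σ.setReg 40 x) (.lit 0))) (.reg 19)) with hρ
    have r40 : ρ.reg 40 = x := by simp [hρ]
    have r41 : ρ.reg 41 = 0 := by simp [hρ, Exp.eval]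
    have r42 : ρ.reg 42 = S.length := by simp [hρ, Exp.eval, h19]
    let Inv : State → Prop := fun τ => τ.reg 40 = x ∧ τ.reg 41 < τ.reg 42 ∧
      τ.reg 42 ≤ S.length ∧ weight A.G (S.take (τ.reg 41)) ≤ x ∧
      x < weight A.G (S.take (τ.reg 42)) ∧ (∀ y < 40, τ.reg y = σ.reg y) ∧ τ.arr = σ.arr
    have hρI : Inv ρ := by
      refine ⟨r40, by omega, by omega, ?_, ?_, ?_, rfl⟩
      · rw [r41]; simp [weight]
      · rw [r42, List.take_length]; exact hb'
      · intro y hy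
        simp only [hρ, setReg_reg]
        rw [if_neg (by omega), if_neg (by omega), if_neg (by omega)]
    have hloop := Run.while_det (A := A) (U := U) (t := 3) (σ := ρ)
      (b := .lt (.add (.reg 41) (.lit 1)) (.reg 42))
      (P := .assign 43 (.div (.add (.reg 41) (.reg 42)) (.lit 2)) ;;
        .ite (.lt (.reg 40) (.get 2 (.reg 43))) (.assign 42 (.reg 43)) (.assign 41 (.reg 43)))
      hM Inv (fun τ => Nat.clog 2 (τ.reg 42 - τ.reg 41)) ?_ ?_ hρI
    · rw [r42, r41, Nat.sub_zero] at hloop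
      refine (hloop.det_seq (t' := 1) ?_).time (by omega)
      rintro χ ⟨⟨i1, i2, i3, i4, i5, i6, i7⟩, hend⟩
      have hend' : χ.reg 42 = χ.reg 41 + 1 := by
        have := Exp.eval_lt_eq_zero.1 hend
        simp only [Exp.eval] at this; omega
      rw [hend'] at i5
      have hlt : χ.reg 41 < S.length := by omega
      have hv : χ.arr 1 (χ.reg 41) = S[χ.reg 41] := by rw [i7]; exact ha1 _ hlt
      refine Run.assign hM ?_ _ ⟨?_, ?_, i7⟩
      · simp only [Exp.Bdd, Exp.eval, hv, and_true]
        exact ⟨by omega, (S[χ.reg 41]).2.trans hn⟩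
      · rw [look_eq_getElem A.G hlt i4 i5]
        simp [Exp.eval, hv, report]
      · intro y hy hy'
        rw [setReg_reg, if_neg hy', i6 y hy]
    · rintro χ ⟨i1, i2, i3, i4, i5, i6, i7⟩
      simp only [Exp.Bdd, and_true]; omega
    · rintro χ ⟨i1, i2, i3, i4, i5, i6, i7⟩ hb''
      have hlt : χ.reg 41 + 1 < χ.reg 42 := by
        simpa only [Exp.eval] using Exp.eval_lt_ne_zero.1 hb''
      refine Run.time (t := (1 + 1) + 1) (Run.assign_seq hM ?_ ?_) le_rfl
      · simp only [Exp.Bdd, and_true]; omega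
      have he : Exp.eval χ (.div (.add (.reg 41) (.reg 42)) (.lit 2)) =
        (χ.reg 41 + χ.reg 42) / 2 := rfl
      rw [he]
      set mid := (χ.reg 41 + χ.reg 42) / 2 with hmid
      have hmle : mid ≤ S.length := by omega
      have hv : χ.arr 2 mid = weight A.G (S.take mid) := by rw [i7]; exact ha2 _ hmle
      refine Run.ite hM ?_ ?_ ?_
      · simp only [Exp.Bdd, Exp.eval, setReg_reg, setReg_arr]
        simp [hv, i1, hx', hWl]; omega
      · intro hc
        have hc' : x < weight A.G (S.take mid) := by simpa [Exp.eval, i1, hv] using hc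
        refine Run.assign hM ?_ () ?_
        · simp only [Exp.Bdd, setReg_reg, reduceIte]; omega
        · simp only [Inv, Exp.eval, setReg_reg, setReg_arr]
          simp only [reduceIte, show ¬ 40 = 42 by omega, show ¬ 40 = 43 by omega,
            show ¬ 41 = 42 by omega, show ¬ 41 = 43 by omega]
          refine ⟨⟨i1, by omega, hmle, i4, hc', fun y hy => ?_, i7⟩, ?_⟩
          · rw [if_neg (by omega), if_neg (by omega), i6 y hy]
          · exact clog_half (by omega) (by omega)
      · intro hc
        have hc' : weight A.G (S.take mid) ≤ x := by simpa [Exp.eval, i1, hv] using hc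
        refine Run.assign hM ?_ () ?_
        · simp only [Exp.Bdd, setReg_reg, reduceIte]; omega
        · simp only [Inv, Exp.eval, setReg_reg, setReg_arr]
          simp only [reduceIte, show ¬ 40 = 41 by omega, show ¬ 40 = 43 by omega,
            show ¬ 42 = 41 by omega, show ¬ 42 = 43 by omega]
          refine ⟨⟨i1, by omega, i3, hc', i5, fun y hy => ?_, i7⟩, ?_⟩
          · rw [if_neg (by omega), if_neg (by omega), i6 y hy]
          · exact clog_half (by omega) (by omega)
  · intro hb'
    have hb'' : weight A.G S ≤ x := by
      by_contra hlt
      exact (hb.2 (by omega)) hb'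
    refine (Run.assign (e := .lit 0) hM trivial _ ⟨?_, ?_, rfl⟩).time (by omega)
    · simp [Exp.eval, look_eq_none A.G hb'', report]
    · intro y hy hy'
      simp only [setReg_reg]
      rw [if_neg hy', if_neg (by omega)]

/-- The list in the memory is a data structure for the samplers. -/
theorem accesses_accessList {U' : ℕ} (hM : Mach w c U) {S : List (Fin n)} {mbar : ℕ}
    (hm1 : 1 ≤ mbar) (hn : n < 2 ^ (c * w)) (hm : mbar < 2 ^ (c * w)) (hl1 : 1 ≤ S.length)
    (hT : 2 * mbar * S.length < 2 ^ (c * w)) (hW : weight A.G S ≤ 2 * mbar * S.length)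
    (hU : (4 * Nat.clog 2 S.length + 10) * U ≤ U') :
    Accesses A w U' accessList (dsPMF A.G S (2 * mbar * S.length))
      (fun τ => ListData A.G S τ ∧ τ.reg 4 = mbar) where
  kept := fun σ τ h ⟨h1, h2⟩ => ⟨h1.congr (h.1 19 (by omega)) (h.1 20 (by omega))
    (h.2 1 le_rfl) (h.2 2 (by omega)), (h.1 4 (by omega)).trans h2⟩
  run := fun σ ⟨h1, h2⟩ => (run_accessList hM h1 h2 hm1 hn hm hl1 hT hW).rescale (by omega)

end AccessList

/-! ### The preparation of a data structure -/

/-- Lists of independent uniform vertices. -/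
def listPMF (n : ℕ) [NeZero n] : ℕ → PMF (List (Fin n))
  | 0 => PMF.pure []
  | m + 1 => (unifFin n).bind fun v => (listPMF n m).map (v :: ·)

/-- Choose as many random vertices as register `19` says. -/
def drawList : Cmd :=
  .assign 30 (.lit 0) ;;
  .assign 20 (.lit 0) ;;
  .store 2 (.lit 0) (.lit 0) ;;
  .while (.lt (.reg 30) (.reg 19))
    (.rand 31 (.reg rN) ;;
     .store 1 (.reg 30) (.reg 31) ;;
     .deg 32 (.reg 31) ;;
     .assign 20 (.add (.reg 20) (.mul (.reg rN) (.reg 32))) ;;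
     .assign 30 (.add (.reg 30) (.lit 1)) ;;
     .store 2 (.reg 30) (.reg 20))

section DrawList

variable {n : ℕ} [NeZero n] {A : Access n} {w c U : ℕ}

/-- The beginning of a data structure. -/
def PartialData (G : QueryGraph n) (l : List (Fin n)) (τ : State) : Prop :=
  τ.reg 20 = weight G l ∧ (∀ j (hj : j < l.length), τ.arr 1 j = l[j]) ∧
    ∀ j ≤ l.length, τ.arr 2 j = weight G (l.take j)

omit [NeZero n] in
theorem PartialData.append {G : QueryGraph n} {l : List (Fin n)} {σ τ : State} {u : Fin n}
    (h : PartialData G l σ) (h20 : τ.reg 20 = weight G l + n * G.deg u)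
    (h1 : ∀ j, τ.arr 1 j = if j = l.length then (u : ℕ) else σ.arr 1 j)
    (h2 : ∀ j, τ.arr 2 j = if j = l.length + 1 then weight G l + n * G.deg u else σ.arr 2 j) :
    PartialData G (l ++ [u]) τ := by
  refine ⟨h20.trans (weight_append_singleton G l u).symm, fun j hj => ?_, fun j hj => ?_⟩
  · rw [h1]
    split_ifs with hjl
    · subst hjl; simp
    · have : j < l.length := by simp at hj; omega
      rw [h.2.1 j this, List.getElem_append_left this]
  · rw [h2]
    simp only [List.length_append, List.length_singleton] at hj
    split_ifs with hjl
    · rw [List.take_of_length_le (by simp; omega), weight_append_singleton]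
    · rw [h.2.2 j (by omega), List.take_append_of_le_length (by omega)]

theorem run_drawLoop (hM : Mach w c U) {s : ℕ} (hn : n < 2 ^ (c * w))
    (hs : n * n * s < 2 ^ (c * w)) (m : ℕ) : ∀ (l : List (Fin n)) (σ : State), σ.reg 1 = n →
      σ.reg 19 = s → σ.reg 30 = l.length → l.length + m = s → PartialData A.G l σ →
      Run A w U (.while (.lt (.reg 30) (.reg 19))
        (.rand 31 (.reg rN) ;;
         .store 1 (.reg 30) (.reg 31) ;;
         .deg 32 (.reg 31) ;;
         .assign 20 (.add (.reg 20) (.mul (.reg rN) (.reg 32))) ;;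
         .assign 30 (.add (.reg 30) (.lit 1)) ;;
         .store 2 (.reg 30) (.reg 20))) (7 * m + 1) σ (listPMF n m)
        (fun r τ => r.length = m ∧ PartialData A.G (l ++ r) τ ∧
          ∀ x, x ≠ 20 → x ≠ 30 → x ≠ 31 → x ≠ 32 → τ.reg x = σ.reg x) := by
  have h1W := hM.one_lt
  have hn1 : 1 ≤ n := Nat.one_le_iff_ne_zero.2 (NeZero.ne n)
  have hsW : s < 2 ^ (c * w) :=
    lt_of_le_of_lt (Nat.le_mul_of_pos_left _ (Nat.mul_pos hn1 hn1)) hs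
  induction m with
  | zero =>
    intro l σ h1 h19 h30 hl hP
    refine Run.while_false hM ?_ ?_ _ ⟨rfl, by simpa using hP, fun _ _ _ _ _ => rfl⟩
    · simp only [Exp.Bdd]; omega
    · rw [Exp.eval_lt_eq_zero]; simp only [Exp.eval]; omega
  | succ m ih =>
    intro l σ h1 h19 h30 hl hP
    have hwl : weight A.G l < 2 ^ (c * w) := by
      refine (weight_le A.G l).trans_lt (lt_of_le_of_lt ?_ hs)
      exact Nat.mul_le_mul_left _ (by omega)
    refine (Run.while_true (t := 6) (t' := 7 * m + 1) (μ := unifFin n)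
      (ν := fun v => (listPMF n m).map (v :: ·))
      (Q := fun u τ => τ.reg 30 = l.length + 1 ∧ PartialData A.G (l ++ [u]) τ ∧
          ∀ x, x ≠ 20 → x ≠ 30 → x ≠ 31 → x ≠ 32 → τ.reg x = σ.reg x) hM ?_ ?_ ?_ ?_).time
      (by omega)
    · simp only [Exp.Bdd]; omega
    · rw [Exp.eval_lt_ne_zero]; simp only [Exp.eval]; omega
    · refine Run.time (t := 1 + 5) ((Run.rand_fin hM ?_ ?_).seq_det ?_) (by omega)
      · simp only [Exp.Bdd, rN]; omega
      · simp only [Exp.eval, rN, h1]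
      rintro u _ rfl
      refine Run.store_seq hM ?_ ?_ (Run.deg_seq hM ?_ (Run.assign_seq hM ?_
        (Run.assign_seq hM ?_ (Run.store hM ?_ ?_ () ?_))))
      · simp only [Exp.Bdd, setReg_reg]; simp; omega
      · simp only [Exp.Bdd, setReg_reg, reduceIte]; exact u.2.trans hn
      · simp only [Exp.Bdd, setReg_reg, setArr_reg, reduceIte]; exact u.2.trans hn
      · have := A.G.deg_lt u
        simp [Exp.Bdd, Exp.eval, rN, hP.1, h1, A.degAnswer_val]
        omega
      · simp [Exp.Bdd]; omega
      · simp [Exp.Bdd, Exp.eval]; omega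
      · have hwl' : weight A.G (l ++ [u]) < 2 ^ (c * w) := by
          refine (weight_le A.G _).trans_lt (lt_of_le_of_lt ?_ hs)
          exact Nat.mul_le_mul_left _ (by simp; omega)
        rw [weight_append_singleton] at hwl'
        simp [Exp.Bdd, Exp.eval, rN, hP.1, h1, A.degAnswer_val]
        omega
      · refine ⟨by simp [Exp.eval, h30], hP.append ?_ ?_ ?_, ?_⟩
        · simp [Exp.eval, rN, hP.1, h1, A.degAnswer_val]
        · intro j; simp [Exp.eval, h30]
        · intro j; simp [Exp.eval, rN, hP.1, h1, A.degAnswer_val, h30]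
        · intro x h20 h30 h31 h32
          simp [h20, h30, h31, h32]
    · rintro u τ ⟨g30, gP, gx⟩
      refine ((ih (l ++ [u]) τ ((gx 1 (by decide) (by decide) (by decide) (by decide)).trans h1)
        ((gx 19 (by decide) (by decide) (by decide) (by decide)).trans h19) (by simpa using g30)
        (by simp; omega) gP).map_outcome (u :: ·)).post ?_
      rintro _ χ ⟨r, rfl, q1, q2, q3⟩
      refine ⟨by simp [q1], by simpa using q2, fun x a b c d => ?_⟩
      rw [q3 x a b c d, gx x a b c d]

theorem run_drawList (hM : Mach w c U) {s : ℕ} (hn : n < 2 ^ (c * w))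
    (hs : n * n * s < 2 ^ (c * w)) {σ : State} (h1 : σ.reg 1 = n) (h19 : σ.reg 19 = s) :
    Run A w U drawList (7 * s + 4) σ (listPMF n s) (fun S τ => S.length = s ∧ ListData A.G S τ ∧
      ∀ x, x ≠ 20 → x ≠ 30 → x ≠ 31 → x ≠ 32 → τ.reg x = σ.reg x) := by
  refine Run.assign_seq (e := .lit 0) hM trivial (Run.assign_seq (e := .lit 0) hM trivial
    (Run.store_seq (i := .lit 0) (e := .lit 0) hM trivial trivial
    ((run_drawLoop hM hn hs s [] _ ?_ ?_ ?_ ?_ ?_).post ?_)))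
  · simpa using h1
  · simpa using h19
  · simp [Exp.eval]
  · simp
  · refine ⟨by simp [Exp.eval, weight], by simp, fun j hj => ?_⟩
    obtain rfl : j = 0 := by simpa using hj
    simp [Exp.eval, weight]
  · rintro S τ ⟨g1, g2, g3⟩
    refine ⟨g1, ⟨?_, by simpa [PartialData] using g2⟩, fun x a b c d => ?_⟩
    · rw [g3 19 (by decide) (by decide) (by decide) (by decide), g1]; simpa using h19
    · rw [g3 x a b c d]; simp [a, b]

end DrawList

/-! ### The threshold -/

/-- The number of doublings of `γ` needed to reach a threshold whose square is at least
`t / (2 * s)`. -/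
def doublings (γ s t : ℕ) : ℕ := sInf {j | t ≤ 2 * s * ((γ * 2 ^ j) * (γ * 2 ^ j))}

/-- The threshold `√mbar`. -/
def theta (γ s t : ℕ) : ℕ := γ * 2 ^ doublings γ s t

section Theta

variable {γ s t : ℕ}

/-- This is the degree-sum condition of typicality for `mbar = θ * θ`, so that condition holds for
every list by the choice of `θ` and needs no randomness. -/
theorem theta_spec (hγ : 1 ≤ γ) (hs : 1 ≤ s) :
    t ≤ 2 * s * (theta γ s t * theta γ s t) := by
  have : {j | t ≤ 2 * s * ((γ * 2 ^ j) * (γ * 2 ^ j))}.Nonempty := by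
    -- Far too many doublings, but they show that the search for the threshold ends, as `t < 2 ^ t`.
    refine ⟨t, ?_⟩
    have h1 : t < 2 ^ t := Nat.lt_two_pow_self
    have h2 : 2 ^ t ≤ γ * 2 ^ t := Nat.le_mul_of_pos_left _ hγ
    have h3 : γ * 2 ^ t ≤ (γ * 2 ^ t) * (γ * 2 ^ t) := Nat.le_mul_of_pos_left _ (by omega)
    have h4 : (γ * 2 ^ t) * (γ * 2 ^ t) ≤ 2 * s * ((γ * 2 ^ t) * (γ * 2 ^ t)) :=
      Nat.le_mul_of_pos_left _ (by omega)
    simp only [Set.mem_ofPred_eq]; omega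
  exact Nat.sInf_mem this

theorem le_theta : γ ≤ theta γ s t := Nat.le_mul_of_pos_right _ (by positivity)

theorem lt_of_lt_doublings {j : ℕ} (h : j < doublings γ s t) :
    2 * s * ((γ * 2 ^ j) * (γ * 2 ^ j)) < t := by
  have := Nat.notMem_of_lt_sInf h
  simpa using this

/-- By minimality the value before the last doubling violated the condition, and doubling multiplies
the square by four. This upper bound keeps the weights small in `totalWeight_le_mul`. -/
theorem theta_eq_or : theta γ s t = γ ∨ s * (theta γ s t * theta γ s t) < 2 * t := by
  rcases h : doublings γ s t with _ | j
  · left; simp [theta, h]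
  · right
    have := lt_of_lt_doublings (γ := γ) (s := s) (t := t) (j := j) (by omega)
    rw [theta, h, pow_succ]
    nlinarith

/-- The hypothesis on `t` holds for total weights because degrees are below `n`. Hence the threshold
is found after logarithmically many doublings. -/
theorem two_pow_doublings_le {n : ℕ} (hn : 1 ≤ n) (hγ : 1 ≤ γ) (ht : t ≤ n * n * s) :
    2 ^ doublings γ s t ≤ 2 * n := by
  rcases h : doublings γ s t with _ | j
  · simp; omega
  · have h1 := lt_of_lt_doublings (γ := γ) (s := s) (t := t) (j := j) (by omega)
    have h2 : 2 ^ j ≤ γ * 2 ^ j := Nat.le_mul_of_pos_left _ hγ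
    have h3 : 2 ^ j < n := by
      by_contra h4
      have h5 : n * n ≤ (γ * 2 ^ j) * (γ * 2 ^ j) := Nat.mul_le_mul (by omega) (by omega)
      have h6 : n * n * s ≤ (γ * 2 ^ j) * (γ * 2 ^ j) * s := Nat.mul_le_mul_right _ h5
      nlinarith
    rw [pow_succ]; omega

theorem theta_le {n : ℕ} (hγ : γ ≤ 2 * n) (ht : t ≤ n * n * s) :
    theta γ s t ≤ 2 * n := by
  rcases h : doublings γ s t with _ | j
  · simpa [theta, h] using hγ
  · have h1 := lt_of_lt_doublings (γ := γ) (s := s) (t := t) (j := j) (by omega)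
    have h3 : γ * 2 ^ j < n := by
      by_contra h4
      have h5 : n * n ≤ (γ * 2 ^ j) * (γ * 2 ^ j) := Nat.mul_le_mul (by omega) (by omega)
      have h6 : n * n * s ≤ (γ * 2 ^ j) * (γ * 2 ^ j) * s := Nat.mul_le_mul_right _ h5
      nlinarith
    rw [theta, h, pow_succ, ← mul_assoc]; omega

end Theta

/-- Compute the threshold in register `21` and its square in register `4`. -/
def findTheta : Cmd :=
  .assign 21 (.reg rGamma) ;;
  .while (.lt (.mul (.mul (.lit 2) (.reg 19)) (.mul (.reg 21) (.reg 21))) (.reg 20))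
    (.assign 21 (.mul (.reg 21) (.lit 2))) ;;
  .assign rMbar (.mul (.reg 21) (.reg 21))

/-- Compute the weights of the three samplers: their partial sums are in the registers `22`, `23`,
`24`. -/
def setWeights : Cmd :=
  .assign 22 (.reg rN) ;;
  .assign 23 (.mul (.lit 2) (.reg 21)) ;;
  .assign 24 (.mul (.lit 2) (.reg 21)) ;;
  .assign 30 (.lit 1) ;;
  .while (.lt (.reg 30) (.reg rK))
    (.assign 22 (.mul (.reg 22) (.reg rGamma)) ;;
     .assign 23 (.mul (.reg 23) (.reg 21)) ;;
     .assign 24 (.mul (.reg 24) (.mul (.lit 2) (.reg 21))) ;;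
     .assign 30 (.add (.reg 30) (.lit 1))) ;;
  .assign 23 (.add (.reg 22) (.reg 23)) ;;
  .assign 24 (.add (.reg 23) (.reg 24))

/-! ### Computing the threshold and the weights. -/

section Preparation

variable {n : ℕ} {A : Access n} {w c U : ℕ}

theorem run_findTheta (hM : Mach w c U) {γ s t : ℕ} (hγ1 : 1 ≤ γ) (hs1 : 1 ≤ s)
    (hθ : theta γ s t < 2 ^ (c * w)) (hs : s < 2 ^ (c * w)) (ht : t < 2 ^ (c * w)) {σ : State}
    (h3 : σ.reg 3 = γ) (h19 : σ.reg 19 = s) (h20 : σ.reg 20 = t) :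
    Det A w U findTheta (2 * doublings γ s t + 3) σ (fun τ => τ.reg 21 = theta γ s t ∧
      τ.reg 4 = theta γ s t * theta γ s t ∧ τ.arr = σ.arr ∧
      ∀ x, x ≠ 4 → x ≠ 21 → τ.reg x = σ.reg x) := by
  have hpow : ∀ j ≤ doublings γ s t, γ * 2 ^ j ≤ theta γ s t := fun j hj =>
    Nat.mul_le_mul_left _ (Nat.pow_le_pow_right (by norm_num) hj)
  refine Run.time (t := ((1 + 1) * doublings γ s t + 1 + 1) + 1) ?_ (by omega)
  refine Run.assign_seq hM ?_ ?_
  · simp only [Exp.Bdd, rGamma, h3]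
    exact le_theta.trans_lt hθ
  -- The measure of the loop reads the number of doublings made so far from the register.
  have hlog : ∀ j, Nat.log 2 (γ * 2 ^ j / γ) = j := fun j => by
    rw [Nat.mul_div_cancel_left _ (by omega), Nat.log_pow (by norm_num)]
  have hloop := Run.while_det (A := A) (U := U) (t := 1) (σ := σ.setReg 21 γ)
    (b := .lt (.mul (.mul (.lit 2) (.reg 19)) (.mul (.reg 21) (.reg 21))) (.reg 20))
    (P := .assign 21 (.mul (.reg 21) (.lit 2))) hM
    (fun τ => (∃ j ≤ doublings γ s t, τ.reg 21 = γ * 2 ^ j) ∧ τ.arr = σ.arr ∧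
      ∀ x, x ≠ 21 → τ.reg x = σ.reg x)
    (fun τ => doublings γ s t - Nat.log 2 (τ.reg 21 / γ)) ?_ ?_ ?_
  · have e : Exp.eval σ (.reg rGamma) = γ := h3
    rw [e]
    refine (hloop.det_seq (t' := 1) ?_).time ?_
    · rintro τ ⟨⟨⟨j, hj, hj'⟩, ga, gx⟩, hb⟩
      have hj'' : τ.reg 21 = theta γ s t := by
        rw [Exp.eval_lt_eq_zero] at hb
        simp only [Exp.eval, hj', gx 19 (by decide), gx 20 (by decide), h19, h20] at hb
        have : doublings γ s t ≤ j := Nat.sInf_le hb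
        rw [hj', theta]
        congr 2; omega
      refine Run.assign hM ?_ () ⟨?_, ?_, ga, ?_⟩
      · simp only [Exp.Bdd]; omega
      · simp [rMbar, hj'']
      · simp [rMbar, Exp.eval, hj'']
      · intro x h4 h21
        simp only [setReg_reg, rMbar]
        rw [if_neg h4, gx x h21]
    · have : (σ.setReg 21 γ).reg 21 = γ := by simp
      have h1 := hlog 0
      rw [pow_zero, mul_one] at h1
      simp only [this, h1]; omega
  · rintro τ ⟨⟨j, hj, hj'⟩, ga, gx⟩
    have := (hpow j hj).trans_lt hθ
    simp only [Exp.Bdd, gx 19 (by decide), gx 20 (by decide)]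
    exact ⟨⟨⟨trivial, by omega⟩, by omega, by omega⟩, by omega⟩
  · rintro τ ⟨⟨j, hj, hj'⟩, ga, gx⟩ hb
    have hlt : j < doublings γ s t := by
      rw [Exp.eval_lt_ne_zero] at hb
      simp only [Exp.eval, hj', gx 19 (by decide), gx 20 (by decide), h19, h20] at hb
      refine lt_of_le_of_ne hj fun h => ?_
      have := theta_spec (t := t) hγ1 hs1
      rw [theta, ← h] at this
      omega
    have := (hpow j hj).trans_lt hθ
    have e : Exp.eval τ (.mul (.reg 21) (.lit 2)) = γ * 2 ^ (j + 1) := by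
      simp [Exp.eval, hj', pow_succ, mul_assoc]
    refine Run.assign hM ?_ () ⟨⟨⟨j + 1, hlt, ?_⟩, ga, fun x hx => ?_⟩, ?_⟩
    · simp only [Exp.Bdd, and_true]; omega
    · rw [e]; simp
    · rw [setReg_reg, if_neg hx, gx x hx]
    · rw [e, hj', setReg_reg, if_pos rfl, hlog, hlog]; omega
  · exact ⟨⟨0, Nat.zero_le _, by simp⟩, rfl, fun x hx => by simp [hx]⟩

/-- The sum of the weights of the three samplers. -/
def totalWeight (n k γ θ : ℕ) : ℕ := n * γ ^ (k - 1) + 2 * θ ^ k + (2 * θ) ^ k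

theorem run_setWeights (hM : Mach w c U) {k γ θ : ℕ} (hk2 : 2 ≤ k) (hk : k < 2 ^ (c * w))
    (hn1 : 1 ≤ n) (hγ1 : 1 ≤ γ) (hθ1 : 1 ≤ θ) (hZ : totalWeight n k γ θ < 2 ^ (c * w)) {σ : State}
    (h1 : σ.reg 1 = n) (h2 : σ.reg 2 = k) (h3 : σ.reg 3 = γ) (h21 : σ.reg 21 = θ) :
    Det A w U setWeights (5 * k + 7) σ (fun τ => τ.reg 22 = n * γ ^ (k - 1) ∧
      τ.reg 23 = n * γ ^ (k - 1) + 2 * θ ^ k ∧ τ.reg 24 = totalWeight n k γ θ ∧ τ.arr = σ.arr ∧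
      ∀ x, x ≠ 22 → x ≠ 23 → x ≠ 24 → x ≠ 30 → τ.reg x = σ.reg x) := by
  have h1W := hM.one_lt
  have b1 : ∀ j ≤ k, n * γ ^ (j - 1) < 2 ^ (c * w) := fun j hj => by
    refine lt_of_le_of_lt ?_ hZ
    have : n * γ ^ (j - 1) ≤ n * γ ^ (k - 1) :=
      Nat.mul_le_mul_left _ (Nat.pow_le_pow_right hγ1 (by omega))
    simp only [totalWeight]; omega
  have b2 : ∀ j ≤ k, 2 * θ ^ j < 2 ^ (c * w) := fun j hj => by
    refine lt_of_le_of_lt ?_ hZ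
    have := Nat.pow_le_pow_right hθ1 hj
    simp only [totalWeight]; omega
  have b3 : ∀ j ≤ k, (2 * θ) ^ j < 2 ^ (c * w) := fun j hj => by
    refine lt_of_le_of_lt ?_ hZ
    have := Nat.pow_le_pow_right (show 1 ≤ 2 * θ by omega) hj
    simp only [totalWeight]; omega
  have hn : n < 2 ^ (c * w) := by simpa using b1 1 (by omega)
  have hγ : γ < 2 ^ (c * w) := by
    have := b1 2 hk2
    simp only [Nat.add_one_sub_one, pow_one] at this
    nlinarith
  have hθ : θ < 2 ^ (c * w) := by
    have := b3 1 (by omega); rw [pow_one] at this; omega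
  refine Run.time (t := ((((((4 + 1) * (k - 1) + 1 + (1 + 1)) + 1) + 1) + 1) + 1)) ?_ (by omega)
  refine Run.assign_seq hM ?_ (Run.assign_seq hM ?_ (Run.assign_seq hM ?_
    (Run.assign_seq (e := .lit 1) hM trivial ?_)))
  · simp only [Exp.Bdd, rN]; omega
  · simp [Exp.Bdd]; omega
  · simp [Exp.Bdd]; omega
  set ρ := (((σ.setReg 22 (Exp.eval σ (.reg rN))).setReg 23 _).setReg 24 _).setReg 30 _ with hρ
  have hloop := Run.while_det (A := A) (U := U) (t := 4) (σ := ρ)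
    (b := .lt (.reg 30) (.reg rK))
    (P := .assign 22 (.mul (.reg 22) (.reg rGamma)) ;;
     .assign 23 (.mul (.reg 23) (.reg 21)) ;;
     .assign 24 (.mul (.reg 24) (.mul (.lit 2) (.reg 21))) ;;
     .assign 30 (.add (.reg 30) (.lit 1))) hM
    (fun τ => (∃ j, 1 ≤ j ∧ j ≤ k ∧ τ.reg 30 = j ∧ τ.reg 22 = n * γ ^ (j - 1) ∧
      τ.reg 23 = 2 * θ ^ j ∧ τ.reg 24 = (2 * θ) ^ j) ∧ τ.arr = σ.arr ∧
      ∀ x, x ≠ 22 → x ≠ 23 → x ≠ 24 → x ≠ 30 → τ.reg x = σ.reg x)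
    (fun τ => k - τ.reg 30) ?_ ?_ ?_
  · have : ρ.reg 30 = 1 := by simp [hρ, Exp.eval]
    rw [this] at hloop
    refine hloop.det_seq (t' := 1 + 1) ?_
    rintro τ ⟨⟨⟨j, hj1, hj2, g30, g22, g23, g24⟩, ga, gx⟩, hb⟩
    have g2 := gx 2 (by decide) (by decide) (by decide) (by decide)
    rw [h2] at g2
    obtain rfl : j = k := by
      rw [Exp.eval_lt_eq_zero] at hb
      simp only [Exp.eval, rK] at hb; omega
    have c1 := b1 j le_rfl; have c2 := b2 j le_rfl; have c3 := b3 j le_rfl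
    refine Run.assign_seq hM ?_ (Run.assign hM ?_ () ⟨?_, ?_, ?_, ga, ?_⟩)
    · simp only [Exp.Bdd]; omega
    · simp only [totalWeight] at hZ
      simp [Exp.Bdd, Exp.eval]; omega
    · simpa using g22
    · simp [Exp.eval, g22, g23]
    · simp [Exp.eval, g22, g23, g24, totalWeight]
    · intro x a b c d
      simp [b, c, gx x a b c d]
  · rintro τ ⟨⟨j, hj1, hj2, g30, g22, g23, g24⟩, ga, gx⟩
    have g2 := gx 2 (by decide) (by decide) (by decide) (by decide)
    simp only [Exp.Bdd, rK]; omega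
  · rintro τ ⟨⟨j, hj1, hj2, g30, g22, g23, g24⟩, ga, gx⟩ hb
    have g2 := gx 2 (by decide) (by decide) (by decide) (by decide)
    have g3 := gx 3 (by decide) (by decide) (by decide) (by decide)
    have g21 := gx 21 (by decide) (by decide) (by decide) (by decide)
    rw [Exp.eval_lt_ne_zero] at hb
    simp only [Exp.eval, rK] at hb
    have c1 := b1 j hj2; have c2 := b2 j hj2; have c3 := b3 j hj2
    refine Run.assign_seq (t := 3) hM ?_ (Run.assign_seq hM ?_ (Run.assign_seq hM ?_
      (Run.assign hM ?_ () ⟨⟨⟨j + 1, by omega, by omega, ?_, ?_, ?_, ?_⟩, ga, ?_⟩, ?_⟩)))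
    · simp only [Exp.Bdd, rGamma]; omega
    · simp [Exp.Bdd]; omega
    · simp [Exp.Bdd]; omega
    · simp [Exp.Bdd]; omega
    · simp [Exp.eval, g30]
    · obtain ⟨i, rfl⟩ : ∃ i, j = i + 1 := ⟨j - 1, by omega⟩
      simp [Exp.eval, g22, rGamma, g3, h3, pow_succ, mul_assoc]
    · simp [Exp.eval, g23, g21, h21, pow_succ, mul_assoc]
    · simp [Exp.eval, g24, g21, h21, pow_succ]
    · intro x a b c d
      simp [a, b, c, d, gx x a b c d]
    · simp [Exp.eval]; omega
  · refine ⟨⟨1, le_rfl, by omega, ?_, ?_, ?_, ?_⟩, rfl, ?_⟩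
    · simp [hρ, Exp.eval]
    · simp [hρ, Exp.eval, rN, h1]
    · simp [hρ, Exp.eval, h21]
    · simp [hρ, Exp.eval, h21]
    · intro x a b c d
      simp [hρ, a, b, c, d]

end Preparation

/-! ### One round: a new data structure and a number of attempts -/

section RoundPMF

variable {n : ℕ} [NeZero n] (G : QueryGraph n)

/-- One attempt to sample a clique: one of the three samplers is chosen according to the weights. -/
def attemptPMF (k γ θ : ℕ) (S : List (Fin n)) : PMF (Option (Finset (Fin n))) :=
  (unif (totalWeight n k γ θ)).bind fun x =>
    if x < n * γ ^ (k - 1) then (lowPMF G k γ).map (G.verified k)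
    else if x < n * γ ^ (k - 1) + 2 * θ ^ k then
      (mediumPMF G (dsPMF G S (2 * (θ * θ) * S.length)) k γ (θ * θ)).map (G.verified k)
    else (highPMF G (dsPMF G S (2 * (θ * θ) * S.length)) k γ (θ * θ)).map (G.verified k)

/-- Repeated attempts with the number of successes and the last outcome. If `flag = 1`, stop at the
first success. -/
def triesPMF {α : Type} (μ : PMF (Option α)) (flag : ℕ) : ℕ → ℕ → Option α → PMF (ℕ × Option α)
  | 0, x, o => PMF.pure (x, o)
  | f + 1, x, o =>
    if flag * x < 1 then μ.bind fun o' => triesPMF μ flag f (x + if o'.isSome then 1 else 0) o'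
    else PMF.pure (x, o)

/-- The threshold for low degrees in the round with parameter `B`. -/
def gamma (n B : ℕ) : ℕ := n / B + 1

/-- The threshold for high degrees. -/
def thetaOf (B : ℕ) (S : List (Fin n)) : ℕ := theta (gamma n B) S.length (weight G S)

/-- The distribution of the outcome of a round: the number of successes, the last outcome and the
total weight. -/
def roundPMF (k K R flag B : ℕ) : PMF ((ℕ × Option (Finset (Fin n))) × ℕ) :=
  (listPMF n (B * K)).bind fun S =>
    (triesPMF (attemptPMF G k (gamma n B) (thetaOf G B S) S) flag (R * B) 0 none).map
      (·, totalWeight n k (gamma n B) (thetaOf G B S))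

end RoundPMF

def attempt : Cmd :=
  .rand 31 (.reg 24) ;;
  .ite (.lt (.reg 31) (.reg 22)) lowSampler
    (.ite (.lt (.reg 31) (.reg 23)) (mediumSamplerWith accessList) (highSamplerWith accessList))

def attempts : Cmd :=
  .assign 26 (.lit 0) ;;
  .assign 27 (.lit 0) ;;
  .while (.mul (.lt (.reg 26) (.reg 25)) (.lt (.mul (.reg 17) (.reg 27)) (.lit 1)))
    (attempt ;;
     .assign 27 (.add (.reg 27) (.reg 0)) ;;
     .assign 26 (.add (.reg 26) (.lit 1)))

def round : Cmd :=
  .assign rGamma (.add (.div (.reg rN) (.reg 18)) (.lit 1)) ;;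
  .assign 19 (.mul (.reg 18) (.reg 14)) ;;
  drawList ;;
  findTheta ;;
  setWeights ;;
  .assign 25 (.mul (.reg 16) (.reg 18)) ;;
  attempts

/-! ### Running time and outcome of repeated attempts. -/

section Attempts

variable {n : ℕ} [NeZero n] {A : Access n} {w c U : ℕ}

/-- The memory is ready for attempts. -/
structure Ready (G : QueryGraph n) (k γ θ : ℕ) (S : List (Fin n)) (σ : State) : Prop where
  data : ListData G S σ
  h1 : σ.reg 1 = n
  h2 : σ.reg 2 = k
  h3 : σ.reg 3 = γ
  h4 : σ.reg 4 = θ * θ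
  h22 : σ.reg 22 = n * γ ^ (k - 1)
  h23 : σ.reg 23 = n * γ ^ (k - 1) + 2 * θ ^ k
  h24 : σ.reg 24 = totalWeight n k γ θ

/-- The part of the memory that attempts do not change. -/
def AttemptFrame (σ τ : State) : Prop :=
  (∀ x, (1 ≤ x ∧ x ≤ 4) ∨ (11 ≤ x ∧ x < 40 ∧ x ≠ 26 ∧ x ≠ 27 ∧ x ≠ 31) → τ.reg x = σ.reg x) ∧
    ∀ a, 1 ≤ a → τ.arr a = σ.arr a

theorem AttemptFrame.trans {σ τ ρ : State} (h : AttemptFrame σ τ) (h' : AttemptFrame τ ρ) :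
    AttemptFrame σ ρ :=
  ⟨fun x hx => (h'.1 x hx).trans (h.1 x hx), fun a ha => (h'.2 a ha).trans (h.2 a ha)⟩

theorem AttemptFrame.refl (σ : State) : AttemptFrame σ σ := ⟨fun _ _ => rfl, fun _ _ => rfl⟩

theorem AttemptFrame.setReg {σ τ : State} (h : AttemptFrame σ τ) {x : ℕ} (v : ℕ)
    (hx : x = 26 ∨ x = 27 ∨ x = 31) : AttemptFrame σ (τ.setReg x v) :=
  ⟨fun y hy => by rw [setReg_reg, if_neg (by omega), h.1 y hy], h.2⟩

theorem Kept.attemptFrame {σ τ : State} (h : Kept σ τ) : AttemptFrame σ τ :=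
  ⟨fun x hx => h.1 x (by omega), h.2⟩

omit [NeZero n] in
theorem Ready.congr {G : QueryGraph n} {k γ θ : ℕ} {S : List (Fin n)} {σ τ : State}
    (h : Ready G k γ θ S σ) (hf : AttemptFrame σ τ) : Ready G k γ θ S τ where
  data := h.data.congr (hf.1 19 (by omega)) (hf.1 20 (by omega)) (hf.2 1 le_rfl)
    (hf.2 2 (by omega))
  h1 := (hf.1 1 (by omega)).trans h.h1
  h2 := (hf.1 2 (by omega)).trans h.h2
  h3 := (hf.1 3 (by omega)).trans h.h3
  h4 := (hf.1 4 (by omega)).trans h.h4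
  h22 := (hf.1 22 (by omega)).trans h.h22
  h23 := (hf.1 23 (by omega)).trans h.h23
  h24 := (hf.1 24 (by omega)).trans h.h24

/-- What is known about the memory after an attempt with outcome `o`. -/
def Outcome (G : QueryGraph n) (k : ℕ) (o : Option (Finset (Fin n))) (τ : State) : Prop :=
  match o with
  | none => τ.reg 0 = 0
  | some s => G.graph.IsNClique k s ∧ Returns k s τ

omit [NeZero n] in
theorem Outcome.reg_zero {G : QueryGraph n} {k : ℕ} {o : Option (Finset (Fin n))} {τ : State}
    (h : Outcome G k o τ) : τ.reg 0 = if o.isSome then 1 else 0 := by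
  rcases o with _ | s
  · exact h
  · exact h.2.1

/-- Numbers that fit into the words. -/
structure Fits (W n k γ θ s : ℕ) : Prop where
  k_lt : k < W
  n_lt : n < W
  γ_lt : γ < W
  θ_lt : θ * θ < W
  s_lt : 2 * (θ * θ) * s < W
  Z_lt : totalWeight n k γ θ < W

theorem run_attempt (hM : Mach w c U) {U' k γ θ : ℕ} {S : List (Fin n)} {σ : State}
    (hR : Ready A.G k γ θ S σ) (hk2 : 2 ≤ k) (hγ1 : 1 ≤ γ) (hθ1 : 1 ≤ θ) (hl : 1 ≤ S.length)
    (hF : Fits (2 ^ (c * w)) n k γ θ S.length) (hW : weight A.G S ≤ 2 * (θ * θ) * S.length)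
    (hU : (4 * Nat.clog 2 S.length + 10) * U ≤ U') :
    Run A w U' attempt (100 * k ^ 2 + 3) σ (attemptPMF A.G k γ θ S)
      (fun o τ => AttemptFrame σ τ ∧ τ.reg 26 = σ.reg 26 ∧ τ.reg 27 = σ.reg 27 ∧
        Outcome A.G k o τ) := by
  have hU2 : U ≤ U' := le_trans (Nat.le_mul_of_pos_left _ (by omega)) hU
  have hM' : Mach w c U' := ⟨hM.hw, hM.hc, hM.hU.trans hU2⟩
  have hQ := accesses_accessList (A := A) hM (S := S) (mbar := θ * θ) (Nat.mul_pos hθ1 hθ1)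
    hF.n_lt hF.θ_lt hl hF.s_lt hW hU
  have hZ1 : 1 ≤ totalWeight n k γ θ := by
    have : 1 ≤ θ ^ k := Nat.one_le_pow _ _ hθ1
    simp only [totalWeight]; omega
  have hrand := Run.rand (A := A) (U := U') (x := 31) (σ := σ) (e := .reg 24) hM'
    (by simp only [Exp.Bdd, hR.h24]; exact hF.Z_lt)
  have he : Exp.eval σ (.reg 24) = totalWeight n k γ θ := hR.h24
  rw [he, max_eq_right hZ1] at hrand
  refine Run.time (t := 1 + (((100 * k ^ 2) + 1) + 1)) (hrand.seq ?_) (by omega)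
  rintro x τ ⟨hx, rfl⟩
  have hf : AttemptFrame σ (σ.setReg 31 x) := (AttemptFrame.refl σ).setReg _ (by omega)
  have hR' := hR.congr hf
  have hWL : n * γ ^ (k - 1) < 2 ^ (c * w) :=
    lt_of_le_of_lt (by simp only [totalWeight]; omega) hF.Z_lt
  have hWM : n * γ ^ (k - 1) + 2 * θ ^ k < 2 ^ (c * w) :=
    lt_of_le_of_lt (by simp only [totalWeight]; omega) hF.Z_lt
  have hxW : x < 2 ^ (c * w) := hx.trans hF.Z_lt
  have post : ∀ {cls : Finset (Fin n) → Prop}, (∀ s, cls s → A.G.graph.IsNClique k s) →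
      ∀ o τ, SamplerPost k cls (σ.setReg 31 x) o τ → AttemptFrame σ τ ∧ τ.reg 26 = σ.reg 26 ∧
        τ.reg 27 = σ.reg 27 ∧ Outcome A.G k o τ := by
    rintro cls hcls o τ ⟨h1, h2⟩
    refine ⟨hf.trans h1.attemptFrame, ?_, ?_, ?_⟩
    · rw [h1.1 26 (by omega)]; simp
    · rw [h1.1 27 (by omega)]; simp
    · rcases o with _ | s
      · exact h2
      · exact ⟨hcls s h2.1, h2.2⟩
  have hb : ∀ y, (Exp.lt (.reg 31) (.reg y)).eval (σ.setReg 31 x) ≠ 0 ↔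
      x < (σ.setReg 31 x).reg y := fun y => by
    rw [Exp.eval_lt_ne_zero]; simp [Exp.eval]
  refine Run.ite hM' ?_ ?_ ?_
  · simp only [Exp.Bdd, hR'.h22]; simpa using ⟨hxW, hWL⟩
  · intro hb'
    rw [hb, hR'.h22] at hb'
    rw [if_pos hb']
    exact ((run_lowSampler hM' hk2 hF.k_lt hF.n_lt hγ1 hF.γ_lt hR'.h1 hR'.h2 hR'.h3).post
      (post fun s hs => hs.1)).time (by omega)
  · intro hb'
    have hb'' : ¬ x < n * γ ^ (k - 1) := fun h => ((hb 22).2 (hR'.h22 ▸ h)) hb'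
    rw [if_neg hb'']
    refine Run.ite hM' ?_ ?_ ?_
    · simp only [Exp.Bdd, hR'.h23]; simpa using ⟨hxW, hWM⟩
    · intro hc
      rw [hb, hR'.h23] at hc
      rw [if_pos hc]
      exact (run_mediumSampler hM' hQ hk2 hF.k_lt hF.n_lt hF.γ_lt hF.θ_lt
        ⟨hR'.data, hR'.h4⟩ hR'.h2 hR'.h3 hR'.h4).post (post fun s hs => hs.1)
    · intro hc
      have hc' : ¬ x < n * γ ^ (k - 1) + 2 * θ ^ k := fun h => ((hb 23).2 (hR'.h23 ▸ h)) hc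
      rw [if_neg hc']
      exact (run_highSampler hM' hQ hk2 hF.k_lt hF.n_lt hF.γ_lt hF.θ_lt
        ⟨hR'.data, hR'.h4⟩ hR'.h2 hR'.h3 hR'.h4).post (post fun s hs => hs.1)

/-- For `flag = 1` the loop ends right after the first success, so the clique in the output array is
the one that was counted; for `flag = 0` only the number of successes matters and nothing is claimed
about the array. -/
theorem run_attempts_loop (hM : Mach w c U) {U' k γ θ flag r : ℕ} {S : List (Fin n)}
    (hk2 : 2 ≤ k) (hγ1 : 1 ≤ γ) (hθ1 : 1 ≤ θ) (hl : 1 ≤ S.length)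
    (hF : Fits (2 ^ (c * w)) n k γ θ S.length) (hW : weight A.G S ≤ 2 * (θ * θ) * S.length)
    (hU : (4 * Nat.clog 2 S.length + 10) * U ≤ U') (hflag : flag ≤ 1) (hr : r < 2 ^ (c * w))
    (f : ℕ) : ∀ (x : ℕ) (o : Option (Finset (Fin n))) (σ : State), Ready A.G k γ θ S σ →
      σ.reg 17 = flag → σ.reg 25 = r → σ.reg 26 + f = r → σ.reg 27 = x → x ≤ σ.reg 26 →
      (flag = 1 → (1 ≤ x ↔ o.isSome) ∧ (1 ≤ x → Outcome A.G k o σ)) →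
      Run A w U' (.while (.mul (.lt (.reg 26) (.reg 25)) (.lt (.mul (.reg 17) (.reg 27)) (.lit 1)))
        (attempt ;;
         .assign 27 (.add (.reg 27) (.reg 0)) ;;
         .assign 26 (.add (.reg 26) (.lit 1)))) ((100 * k ^ 2 + 6) * f + 1) σ
        (triesPMF (attemptPMF A.G k γ θ S) flag f x o)
        (fun p τ => AttemptFrame σ τ ∧ τ.reg 27 = p.1 ∧ p.1 ≤ r ∧
          (flag = 1 → (1 ≤ p.1 ↔ p.2.isSome) ∧ (1 ≤ p.1 → Outcome A.G k p.2 τ))) := by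
  have hU2 : U ≤ U' := le_trans (Nat.le_mul_of_pos_left _ (by omega)) hU
  have hM' : Mach w c U' := ⟨hM.hw, hM.hc, hM.hU.trans hU2⟩
  have h1W := hM.one_lt
  have finish : ∀ (f x : ℕ) (o : Option (Finset (Fin n))) (σ : State), σ.reg 17 = flag →
      σ.reg 25 = r → σ.reg 26 + f = r → σ.reg 27 = x → x ≤ σ.reg 26 →
      (flag = 1 → (1 ≤ x ↔ o.isSome) ∧ (1 ≤ x → Outcome A.G k o σ)) →
      ¬ (0 < f ∧ flag * x < 1) →
      Run A w U' (.while (.mul (.lt (.reg 26) (.reg 25)) (.lt (.mul (.reg 17) (.reg 27)) (.lit 1)))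
        (attempt ;;
         .assign 27 (.add (.reg 27) (.reg 0)) ;;
         .assign 26 (.add (.reg 26) (.lit 1)))) 1 σ
        (PMF.pure (x, o))
        (fun p τ => AttemptFrame σ τ ∧ τ.reg 27 = p.1 ∧ p.1 ≤ r ∧
          (flag = 1 → (1 ≤ p.1 ↔ p.2.isSome) ∧ (1 ≤ p.1 → Outcome A.G k p.2 τ))) := by
    intro f x o σ h17 h25 h26 h27 hx ho hmore
    refine Run.while_false hM' ?_ ?_ _ ⟨AttemptFrame.refl σ, h27, by omega, ho⟩
    · simp only [Exp.Bdd, and_true]; omega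
    · simp only [Exp.eval, h17, h27, h25]
      by_cases h0 : 0 < f
      · rw [if_neg (fun h => hmore ⟨h0, h⟩ : ¬ flag * x < 1), mul_zero]
      · rw [if_neg (by omega), zero_mul]
  induction f with
  | zero =>
    intro x o σ hR h17 h25 h26 h27 hx ho
    exact finish 0 x o σ h17 h25 h26 h27 hx ho (by omega)
  | succ f ih =>
    intro x o σ hR h17 h25 h26 h27 hx ho
    rw [triesPMF]
    split_ifs with hc
    · refine (Run.while_true (t := 100 * k ^ 2 + 5) (t' := (100 * k ^ 2 + 6) * f + 1)
        (Q := fun o' τ => AttemptFrame σ τ ∧ τ.reg 26 = σ.reg 26 + 1 ∧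
          τ.reg 27 = x + (if o'.isSome then 1 else 0) ∧ Outcome A.G k o' τ) hM' ?_ ?_ ?_ ?_).time
        (by ring_nf; omega)
      · simp only [Exp.Bdd, and_true]; omega
      · simp only [Exp.eval, h17, h27, h25, if_pos hc]
        rw [if_pos (by omega)]; norm_num
      · refine Run.time (t := (100 * k ^ 2 + 3) + (1 + 1)) ((run_attempt hM hR hk2 hγ1 hθ1 hl hF hW
          hU).seq_det ?_) (by omega)
        rintro o' τ ⟨g1, g26, g27, g0⟩
        have g0' := g0.reg_zero
        have h0le : τ.reg 0 ≤ 1 := by rw [g0']; split_ifs <;> omega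
        refine Run.assign_seq hM' ?_ (Run.assign hM' ?_ () ⟨(g1.setReg _ (by omega)).setReg _
          (by omega), ?_, ?_, ?_⟩)
        · simp only [Exp.Bdd]; omega
        · simp [Exp.Bdd]; omega
        · simp [Exp.eval, g26]
        · simp [Exp.eval, g27, h27, g0']
        · rcases o' with _ | s
          · simpa [Outcome] using g0
          · simpa [Outcome, Returns] using g0
      · rintro o' τ ⟨g1, g26, g27, g0⟩
        refine (ih _ o' τ (hR.congr g1) ((g1.1 17 (by omega)).trans h17)
          ((g1.1 25 (by omega)).trans h25) (by omega) g27 ?_ ?_).post ?_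
        · split_ifs <;> omega
        · intro hfl
          -- With `flag = 1` the loop condition `flag * x < 1` says that there was no success yet.
          have hx0 : x = 0 := by subst hfl; omega
          refine ⟨?_, fun _ => g0⟩
          rw [hx0]
          cases o' <;> simp
        · rintro p χ ⟨q1, q2⟩
          exact ⟨g1.trans q1, q2⟩
    · exact (finish (f + 1) x o σ h17 h25 h26 h27 hx ho (fun h => hc h.2)).time (by omega)

end Attempts

/-! ### Running time and outcome of one round. -/

section Round

variable {n : ℕ} [NeZero n] {A : Access n} {w c U : ℕ}

/-- The part of the memory that a round does not change. -/
def RoundFrame (σ τ : State) : Prop :=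
  ∀ x, x = 1 ∨ x = 2 ∨ (11 ≤ x ∧ x ≤ 18) ∨ x = 28 ∨ x = 29 → τ.reg x = σ.reg x

/-- The memory after a round with outcome `p`. -/
def RoundPost (G : QueryGraph n) (k flag r : ℕ) (p : (ℕ × Option (Finset (Fin n))) × ℕ)
    (τ : State) : Prop :=
  τ.reg 27 = p.1.1 ∧ p.1.1 ≤ r ∧ (τ.reg 24 = p.2 ∧ p.2 ≤ 4 * (4 * n) ^ k) ∧ τ.reg 25 = r ∧
    (flag = 1 → (1 ≤ p.1.1 ↔ p.1.2.isSome) ∧ (1 ≤ p.1.1 → Outcome G k p.1.2 τ))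

theorem totalWeight_le {k γ θ : ℕ} (hk : 1 ≤ k) (hγ : γ ≤ 2 * n) (hθ : θ ≤ 2 * n) :
    totalWeight n k γ θ ≤ 4 * (4 * n) ^ k := by
  have hn1 : 1 ≤ n := Nat.one_le_iff_ne_zero.2 (NeZero.ne n)
  have h1 : n * γ ^ (k - 1) ≤ (4 * n) ^ k := by
    calc n * γ ^ (k - 1) ≤ (4 * n) * (4 * n) ^ (k - 1) :=
          Nat.mul_le_mul (by omega) (Nat.pow_le_pow_left (by omega) _)
      _ = (4 * n) ^ k := by rw [← pow_succ']; congr 1; omega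
  have h2 : θ ^ k ≤ (4 * n) ^ k := Nat.pow_le_pow_left (by omega) _
  have h3 : (2 * θ) ^ k ≤ (4 * n) ^ k := Nat.pow_le_pow_left (by omega) _
  simp only [totalWeight]; omega

-- Drawing the list, the doublings, the weights and the `R * B` attempts are all charged to a
-- multiple of `B`, so that the times of the rounds `B = 1, 2, 4, …` form a geometric series. All
-- intermediate numbers are bounded in advance in terms of `n`, `k`, `B`, `K` and `R`, independently
-- of the random list.
set_option maxHeartbeats 800000 in
theorem run_round (hM : Mach w c U) {U' k K R flag B l Λ : ℕ} (hk2 : 2 ≤ k) (hK1 : 1 ≤ K)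
    (hB1 : 1 ≤ B) (hflag : flag ≤ 1) (hk : k < 2 ^ (c * w))
    (hs : 8 * (n * n) * (B * K) < 2 ^ (c * w)) (hZ : 4 * (4 * n) ^ k < 2 ^ (c * w))
    (hK : K < 2 ^ (c * w)) (hRW : R < 2 ^ (c * w))
    (hr : R * B < 2 ^ (c * w)) (hl : 2 * n < 2 ^ l) (hΛ : Nat.clog 2 (B * K) ≤ Λ)
    (hU : (4 * Λ + 10) * U ≤ U') {σ : State} (h1 : σ.reg 1 = n) (h2 : σ.reg 2 = k)
    (h14 : σ.reg 14 = K) (h16 : σ.reg 16 = R) (h17 : σ.reg 17 = flag) (h18 : σ.reg 18 = B) :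
    Run A w U' round (B * (7 * K + 2 * l + 5 * k + R * (100 * k ^ 2 + 6) + 20)) σ
      (roundPMF A.G k K R flag B)
      (fun p τ => RoundFrame σ τ ∧ RoundPost A.G k flag (R * B) p τ) := by
  have hU2 : U ≤ U' := le_trans (Nat.le_mul_of_pos_left _ (by omega)) hU
  have hM' : Mach w c U' := ⟨hM.hw, hM.hc, hM.hU.trans hU2⟩
  have h1W := hM.one_lt
  have hn1 : 1 ≤ n := Nat.one_le_iff_ne_zero.2 (NeZero.ne n)
  have hs1 : 1 ≤ B * K := Nat.mul_pos hB1 hK1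
  have hnn : 1 ≤ n * n := Nat.mul_pos hn1 hn1
  have hγ1 : 1 ≤ gamma n B := by simp [gamma]
  have hγ2 : gamma n B ≤ 2 * n := by
    have := Nat.div_le_self n B
    simp only [gamma]; omega
  have hn4 : 4 * n ≤ (4 * n) ^ k := Nat.le_self_pow (by omega) _
  have hnW : n < 2 ^ (c * w) := by omega
  have hsW : B * K < 2 ^ (c * w) :=
    lt_of_le_of_lt (Nat.le_mul_of_pos_left _ (by omega)) hs
  have hBW : B < 2 ^ (c * w) := lt_of_le_of_lt (Nat.le_mul_of_pos_right _ hK1) hsW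
  refine Run.time (t := (((7 * (B * K) + 4) + ((2 * l + 3) + ((5 * k + 7) +
    (((((100 * k ^ 2 + 6) * (R * B) + 1) + 1) + 1) + 1)))) + 1) + 1) ?_ ?_
  swap
  · have h : ∀ a, a ≤ B * a := fun a => Nat.le_mul_of_pos_left _ hB1
    have := h (2 * l); have := h (5 * k); have := h 20
    nlinarith
  refine Run.assign_seq hM' ?_ (Run.assign_seq hM' ?_ ?_)
  · simp only [Exp.Bdd, rN, and_true]; omega
  · simp [Exp.Bdd, rGamma]; omega
  set ρ := (σ.setReg rGamma _).setReg 19 _ with hρ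
  have r3 : ρ.reg 3 = gamma n B := by simp [hρ, rGamma, Exp.eval, rN, h1, h18, gamma]
  have r19 : ρ.reg 19 = B * K := by simp [hρ, rGamma, Exp.eval, h14, h18]
  have rx : ∀ x, x ≠ 3 → x ≠ 19 → ρ.reg x = σ.reg x := fun x a b => by simp [hρ, rGamma, a, b]
  have hnns : n * n * (B * K) < 2 ^ (c * w) :=
    lt_of_le_of_lt (Nat.mul_le_mul_right _ (by omega)) hs
  refine Run.seq (run_drawList hM' hnW hnns ((rx 1 (by decide) (by decide)).trans h1) r19) ?_
  rintro S τ ⟨hS, hD, gx⟩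
  have hSl : 1 ≤ S.length := hS ▸ hs1
  have hw := weight_le A.G S
  have hγθ : gamma n B ≤ thetaOf A.G B S := le_theta
  have hθ2 : thetaOf A.G B S ≤ 2 * n := theta_le hγ2 hw
  have hspec : weight A.G S ≤ 2 * S.length * (thetaOf A.G B S * thetaOf A.G B S) :=
    theta_spec hγ1 hSl
  have hdbl : doublings (gamma n B) S.length (weight A.G S) ≤ l := by
    have := two_pow_doublings_le hn1 hγ1 hw
    exact (Nat.pow_lt_pow_iff_right (by norm_num)).1 (this.trans_lt hl) |>.le
  have hθθ : thetaOf A.G B S * thetaOf A.G B S ≤ (2 * n) * (2 * n) := Nat.mul_le_mul hθ2 hθ2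
  have hZ' : totalWeight n k (gamma n B) (thetaOf A.G B S) < 2 ^ (c * w) :=
    (totalWeight_le (by omega) hγ2 hθ2).trans_lt hZ
  have hθs : 2 * (thetaOf A.G B S * thetaOf A.G B S) * S.length < 2 ^ (c * w) := by
    refine lt_of_le_of_lt ?_ hs
    rw [hS]
    refine Nat.mul_le_mul_right _ ?_
    calc 2 * (thetaOf A.G B S * thetaOf A.G B S) ≤ 2 * ((2 * n) * (2 * n)) :=
          Nat.mul_le_mul_left _ hθθ
      _ = _ := by ring
  have hθW : thetaOf A.G B S * thetaOf A.G B S < 2 ^ (c * w) := by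
    refine lt_of_le_of_lt ?_ hθs
    calc _ ≤ 2 * (thetaOf A.G B S * thetaOf A.G B S) := by omega
      _ ≤ _ := Nat.le_mul_of_pos_right _ hSl
  have hθ1 : 1 ≤ thetaOf A.G B S := hγ1.trans hγθ
  have hθ0 : thetaOf A.G B S < 2 ^ (c * w) := lt_of_le_of_lt (Nat.le_mul_of_pos_left _ hθ1) hθW
  have hdet := run_findTheta (A := A) hM' (γ := gamma n B) (s := S.length)
    (t := weight A.G S) (σ := τ) hγ1 hSl hθ0 (hS ▸ hsW)
    (lt_of_le_of_lt hw (hS ▸ hnns))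
    ((gx 3 (by decide) (by decide) (by decide) (by decide)).trans r3) hD.1 hD.2.1
  refine Run.det_seq (hdet.time (by omega)) ?_
  rintro χ ⟨q21, q4, qa, qx⟩
  have c1 : χ.reg 1 = n := by
    rw [qx 1 (by decide) (by decide), gx 1 (by decide) (by decide) (by decide) (by decide),
      rx 1 (by decide) (by decide), h1]
  have c2 : χ.reg 2 = k := by
    rw [qx 2 (by decide) (by decide), gx 2 (by decide) (by decide) (by decide) (by decide),
      rx 2 (by decide) (by decide), h2]
  have c3 : χ.reg 3 = gamma n B := by
    rw [qx 3 (by decide) (by decide), gx 3 (by decide) (by decide) (by decide) (by decide), r3]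
  refine Run.det_seq (run_setWeights hM' hk2 hk hn1 hγ1 hθ1 hZ' c1 c2 c3 q21) ?_
  rintro ψ ⟨p22, p23, p24, pa, px⟩
  have frame : ∀ x, x ≠ 3 → x ≠ 4 → x ≠ 30 → x ≠ 31 → x ≠ 32 → ¬ (19 ≤ x ∧ x ≤ 24) →
      ψ.reg x = σ.reg x := by
    intro x a b c d e f
    rw [px x (by omega) (by omega) (by omega) (by omega), qx x (by omega) (by omega),
      gx x (by omega) (by omega) (by omega) (by omega), rx x (by omega) (by omega)]
  have f16 := frame 16 (by decide) (by decide) (by decide) (by decide) (by decide) (by decide)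
  have f18 := frame 18 (by decide) (by decide) (by decide) (by decide) (by decide) (by decide)
  refine Run.assign_seq hM' ?_ ?_
  · simp only [Exp.Bdd]; omega
  set ω := ψ.setReg 25 (Exp.eval ψ (.mul (.reg 16) (.reg 18))) with hω
  have o25 : ω.reg 25 = R * B := by simp [hω, Exp.eval, f16, f18, h16, h18]
  have ox : ∀ x, x ≠ 25 → ω.reg x = ψ.reg x := fun x hx => by simp [hω, hx]
  have hready : Ready A.G k (gamma n B) (thetaOf A.G B S) S ω := by
    refine ⟨hD.congr ?_ ?_ ?_ ?_, ?_, ?_, ?_, ?_, ?_, ?_, ?_⟩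
    · rw [ox 19 (by decide), px 19 (by decide) (by decide) (by decide) (by decide),
        qx 19 (by decide) (by decide)]
    · rw [ox 20 (by decide), px 20 (by decide) (by decide) (by decide) (by decide),
        qx 20 (by decide) (by decide)]
    · change ψ.arr 1 = _; rw [pa, qa]
    · change ψ.arr 2 = _; rw [pa, qa]
    · rw [ox 1 (by decide), px 1 (by decide) (by decide) (by decide) (by decide), c1]
    · rw [ox 2 (by decide), px 2 (by decide) (by decide) (by decide) (by decide), c2]
    · rw [ox 3 (by decide), px 3 (by decide) (by decide) (by decide) (by decide), c3]
    · rw [ox 4 (by decide), px 4 (by decide) (by decide) (by decide) (by decide), q4]; rfl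
    · rw [ox 22 (by decide), p22]
    · rw [ox 23 (by decide), p23]
    · rw [ox 24 (by decide), p24]
  have hfits : Fits (2 ^ (c * w)) n k (gamma n B) (thetaOf A.G B S) S.length :=
    ⟨hk, hnW, hγθ.trans_lt hθ0, hθW, hθs, hZ'⟩
  refine Run.assign_seq (e := .lit 0) hM' trivial (Run.assign_seq (e := .lit 0) hM' trivial ?_)
  have hf : AttemptFrame ω ((ω.setReg 26 (Exp.eval ω (.lit 0))).setReg 27
      (Exp.eval (ω.setReg 26 (Exp.eval ω (.lit 0))) (.lit 0))) :=
    ((AttemptFrame.refl ω).setReg _ (by omega)).setReg _ (by omega)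
  have hloop := run_attempts_loop (A := A) hM hk2 hγ1 hθ1 hSl hfits
    (hspec.trans_eq (by ring)) (le_trans (Nat.mul_le_mul_right _ (by rw [hS]; omega)) hU) hflag hr (R * B) 0
    none _ (hready.congr hf)
    ((hf.1 17 (by omega)).trans ((ox 17 (by decide)).trans ((frame 17 (by decide) (by decide)
      (by decide) (by decide) (by decide) (by decide)).trans h17)))
    ((hf.1 25 (by omega)).trans o25) (by simp [Exp.eval]) (by simp [Exp.eval]) (by simp)
    (by simp)
  refine (hloop.map_outcome (·, totalWeight n k (gamma n B) (thetaOf A.G B S))).post ?_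
  rintro _ ξ ⟨p, rfl, x1, x2, x3, x4⟩
  refine ⟨?_, x2, x3, ⟨?_, totalWeight_le (by omega) hγ2 hθ2⟩, ?_, x4⟩
  · intro x hx
    rw [x1.1 x (by omega), hf.1 x (by omega), ox x (by omega), frame x (by omega) (by omega)
      (by omega) (by omega) (by omega) (by omega)]
  · rw [x1.1 24 (by omega), hf.1 24 (by omega), ox 24 (by decide), p24]
  · rw [x1.1 25 (by omega), hf.1 25 (by omega), o25]

end Round

/-! ### The search: rounds with growing effort until one succeeds -/

/-- Parameters of the search: the size of the cliques, the factors for the size of the data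
structure and the number of attempts, whether a round stops at its first success, the number of
successes needed to end the search, a bound for `log (2 * n)` and the number of rounds. -/
structure Config where
  k : ℕ
  K : ℕ
  R : ℕ
  flag : ℕ
  thr : ℕ
  l : ℕ
  I : ℕ

/-- The outcome of a round and the outcome of a search (with the number of rounds). -/
abbrev RoundOut (n : ℕ) : Type := (ℕ × Option (Finset (Fin n))) × ℕ
abbrev SearchOut (n : ℕ) : Type := ℕ × Option (RoundOut n)

namespace Config

variable {n : ℕ} [NeZero n] (cfg : Config) (G : QueryGraph n)

def round (i : ℕ) : PMF (RoundOut n) := roundPMF G cfg.k cfg.K cfg.R cfg.flag (2 ^ i)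

/-- The outcome of up to `f` rounds, starting with number `i`. -/
def search : ℕ → ℕ → PMF (SearchOut n)
  | 0, i => PMF.pure (i, none)
  | f + 1, i => (cfg.round G i).bind fun p =>
    if cfg.thr ≤ p.1.1 then PMF.pure (i + 1, some p) else search f (i + 1)

/-- The time of a round, divided by its parameter `2 ^ i`. -/
def roundTime : ℕ :=
  7 * cfg.K + 2 * cfg.l + 5 * cfg.k + cfg.R * (100 * cfg.k ^ 2 + 6) + 30

/-- All numbers in the search fit into the words, and `U'` is the time for an access. -/
structure Valid (n W U U' : ℕ) : Prop where
  k2 : 2 ≤ cfg.k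
  K1 : 1 ≤ cfg.K
  flag1 : cfg.flag ≤ 1
  hl : 2 * n < 2 ^ cfg.l
  k_lt : cfg.k < W
  s_lt : 8 * (n * n) * (2 ^ cfg.I * cfg.K) < W
  Z_lt : 4 * (4 * n) ^ cfg.k < W
  r_lt : cfg.R * 2 ^ cfg.I < W
  I_lt : cfg.I < W
  thr_lt : cfg.thr < W
  hU : (4 * Nat.clog 2 (2 ^ cfg.I * cfg.K) + 10) * U ≤ U'

/-- The parameters are in the memory. -/
def Loaded (n : ℕ) (σ : State) : Prop :=
  σ.reg 1 = n ∧ σ.reg 2 = cfg.k ∧ σ.reg 13 = cfg.I ∧ σ.reg 14 = cfg.K ∧ σ.reg 15 = cfg.thr ∧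
    σ.reg 16 = cfg.R ∧ σ.reg 17 = cfg.flag

/-- The memory after a search with outcome `q`. -/
def Found (q : SearchOut n) (τ : State) : Prop :=
  match q.2 with
  | none => τ.reg 29 = 0
  | some p => τ.reg 29 = 1 ∧ cfg.thr ≤ p.1.1 ∧ q.1 ≤ cfg.I ∧
    RoundPost G cfg.k cfg.flag (cfg.R * 2 ^ (q.1 - 1)) p τ

end Config

def searchLoop : Cmd :=
  .while (.mul (.eq (.reg 29) (.lit 0)) (.lt (.reg 28) (.reg 13)))
    (round ;;
     .assign 29 (.lt (.reg 15) (.add (.reg 27) (.lit 1))) ;;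
     .assign 18 (.mul (.lit 2) (.reg 18)) ;;
     .assign 28 (.add (.reg 28) (.lit 1)))

def search : Cmd :=
  .assign 18 (.lit 1) ;;
  .assign 28 (.lit 0) ;;
  .assign 29 (.lit 0) ;;
  searchLoop

/-! ### Running time and outcome of a search. -/

section Search

variable {n : ℕ} [NeZero n] {A : Access n} {w c U U' : ℕ} {cfg : Config}

omit [NeZero n] in
theorem Config.Valid.mach (h : cfg.Valid n (2 ^ (c * w)) U U') (hM : Mach w c U) :
    Mach w c U' :=
  ⟨hM.hw, hM.hc, hM.hU.trans (le_trans (Nat.le_mul_of_pos_left _ (by omega)) h.hU)⟩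

omit [NeZero n] in
theorem Config.Loaded.congr {σ τ : State} (h : cfg.Loaded n σ)
    (hf : ∀ x, x = 1 ∨ x = 2 ∨ (13 ≤ x ∧ x ≤ 17) → τ.reg x = σ.reg x) : cfg.Loaded n τ := by
  simp only [Config.Loaded]
  rw [hf 1 (by omega), hf 2 (by omega), hf 13 (by omega), hf 14 (by omega), hf 15 (by omega),
    hf 16 (by omega), hf 17 (by omega)]
  exact h

/-- The subtracted `5` is paid from the slack between the `30` in `roundTime` and the `20` in
`run_round`; it is reserved for the loop test in `ref_searchLoop`. -/
theorem run_searchBody (hM : Mach w c U) (hV : cfg.Valid n (2 ^ (c * w)) U U') {i : ℕ}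
    (hi : i < cfg.I) {σ : State} (hL : cfg.Loaded n σ) (h18 : σ.reg 18 = 2 ^ i)
    (h28 : σ.reg 28 = i) :
    Run A w U' (round ;;
     .assign 29 (.lt (.reg 15) (.add (.reg 27) (.lit 1))) ;;
     .assign 18 (.mul (.lit 2) (.reg 18)) ;;
     .assign 28 (.add (.reg 28) (.lit 1))) (2 ^ i * cfg.roundTime - 5) σ (cfg.round A.G i)
      (fun p τ => cfg.Loaded n τ ∧ τ.reg 18 = 2 ^ (i + 1) ∧ τ.reg 28 = i + 1 ∧
        τ.reg 29 = (if cfg.thr ≤ p.1.1 then 1 else 0) ∧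
        RoundPost A.G cfg.k cfg.flag (cfg.R * 2 ^ i) p τ) := by
  have hM' := hV.mach hM
  have h1W := hM.one_lt
  have hB1 : 1 ≤ 2 ^ i := Nat.one_le_two_pow
  have hBI : 2 ^ i ≤ 2 ^ cfg.I := Nat.pow_le_pow_right (by norm_num) hi.le
  have hBI' : 2 * 2 ^ i ≤ 2 ^ cfg.I := by
    rw [← pow_succ']; exact Nat.pow_le_pow_right (by norm_num) hi
  have hn1 : 1 ≤ n := Nat.one_le_iff_ne_zero.2 (NeZero.ne n)
  have hnn : 1 ≤ n * n := Nat.mul_pos hn1 hn1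
  have hIK : 2 ^ cfg.I * cfg.K < 2 ^ (c * w) :=
    lt_of_le_of_lt (Nat.le_mul_of_pos_left _ (by omega)) hV.s_lt
  have hIW : 2 ^ cfg.I < 2 ^ (c * w) := lt_of_le_of_lt (Nat.le_mul_of_pos_right _ hV.K1) hIK
  have hKW : cfg.K < 2 ^ (c * w) :=
    lt_of_le_of_lt (Nat.le_mul_of_pos_left _ (by positivity)) hIK
  have hRW : cfg.R < 2 ^ (c * w) :=
    lt_of_le_of_lt (Nat.le_mul_of_pos_right _ (by positivity)) hV.r_lt
  have hRB : cfg.R * 2 ^ i < 2 ^ (c * w) :=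
    lt_of_le_of_lt (Nat.mul_le_mul_left _ hBI) hV.r_lt
  obtain ⟨l1, l2, l13, l14, l15, l16, l17⟩ := hL
  have hround := run_round (A := A) (l := cfg.l) (Λ := Nat.clog 2 (2 ^ cfg.I * cfg.K)) hM hV.k2
    hV.K1 hB1 hV.flag1 hV.k_lt
    (lt_of_le_of_lt (Nat.mul_le_mul_left _ (Nat.mul_le_mul_right _ hBI)) hV.s_lt) hV.Z_lt hKW hRW
    hRB hV.hl (Nat.clog_mono_right _ (Nat.mul_le_mul_right _ hBI)) hV.hU l1 l2 l14 l16 l17 h18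
  refine (hround.seq_det (t' := 1 + 1 + 1) ?_).time ?_
  · rintro p τ ⟨g, g27, gr, g24, g25, gs⟩
    have e15 : τ.reg 15 = cfg.thr := (g 15 (by omega)).trans l15
    have e18 : τ.reg 18 = 2 ^ i := (g 18 (by omega)).trans h18
    have e28 : τ.reg 28 = i := (g 28 (by omega)).trans h28
    have := hV.thr_lt; have := hV.I_lt
    refine Run.assign_seq hM' ?_ (Run.assign_seq hM' ?_ (Run.assign hM' ?_ () ?_))
    · simp only [Exp.Bdd, and_true]; omega
    · simp [Exp.Bdd]; omega
    · simp [Exp.Bdd]; omega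
    · refine ⟨?_, ?_, ?_, ?_, ?_, ?_, ⟨?_, ?_⟩, ?_, ?_⟩
      · refine Config.Loaded.congr (σ := σ) ⟨l1, l2, l13, l14, l15, l16, l17⟩ fun x hx => ?_
        simp only [setReg_reg]
        rw [if_neg (by omega), if_neg (by omega), if_neg (by omega), g x (by omega)]
      · simp [Exp.eval, e18, pow_succ']
      · simp [Exp.eval, e28]
      · simp [Exp.eval, e15, g27]
      · simpa using g27
      · exact gr
      · simpa using g24.1
      · exact g24.2
      · simpa using g25
      · intro hf
        refine ⟨(gs hf).1, fun hp => ?_⟩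
        have := (gs hf).2 hp
        rcases h : p.1.2 with _ | s
        · rw [h] at this; simpa [Outcome] using this
        · rw [h] at this; simpa [Outcome, Returns] using this
  · have : 10 ≤ 2 ^ i * 10 := by omega
    have h : ∀ a b : ℕ, 2 ^ i * (a + b + 30) = 2 ^ i * (a + b + 20) + 2 ^ i * 10 := fun a b => by
      ring
    simp only [Config.roundTime]
    rw [h]; omega

omit [NeZero n] in
theorem RoundPost.congr {G : QueryGraph n} {k flag r : ℕ} {p : RoundOut n} {σ τ : State}
    (h : RoundPost G k flag r p σ) (hm : SameMem τ σ) : RoundPost G k flag r p τ := by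
  obtain ⟨h1, h2, h3, h4, h5⟩ := h
  rw [← hm.1] at h1 h3 h4
  refine ⟨h1, h2, h3, h4, fun hf => ⟨(h5 hf).1, fun hp => ?_⟩⟩
  have := (h5 hf).2 hp
  rcases h : p.1.2 with _ | s
  · rw [h] at this
    simp only [Outcome] at this ⊢
    rwa [hm.1]
  · rw [h] at this
    simp only [Outcome, Returns] at this ⊢
    rwa [hm.1, hm.2]

omit [NeZero n] in
theorem Config.Found.congr {G : QueryGraph n} {q : SearchOut n} {σ τ : State}
    (h : cfg.Found G q σ) (hm : SameMem τ σ) : cfg.Found G q τ := by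
  obtain ⟨i, _ | p⟩ := q
  · simp only [Config.Found] at h ⊢
    rwa [hm.1]
  · simp only [Config.Found] at h ⊢
    exact ⟨by rw [hm.1, h.1], h.2.1, h.2.2.1, h.2.2.2.congr hm⟩

/-- The time depends on the outcome, so it is part of the relation in `Ref` and not a uniform bound
as in `Run`. The rounds from `i` to `q.1 - 1` cost multiples of `2 ^ i, …, 2 ^ (q.1 - 1)`, whose sum
is `2 ^ q.1 - 2 ^ i`; written with `2 ^ i` on the left, the bound telescopes. -/
theorem ref_searchLoop (hM : Mach w c U) (hV : cfg.Valid n (2 ^ (c * w)) U U') (f : ℕ) :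
    ∀ (i : ℕ) (σ : State), i + f = cfg.I → cfg.Loaded n σ → σ.reg 18 = 2 ^ i → σ.reg 28 = i →
      σ.reg 29 = 0 → Ref A w searchLoop σ (cfg.search A.G f i)
        (fun q τ => cfg.Loaded n τ ∧ cfg.Found A.G q τ ∧
          τ.time + 2 ^ i * cfg.roundTime * U' ≤
            σ.time + 2 ^ q.1 * cfg.roundTime * U' + U') := by
  have hM' := hV.mach hM
  have h1W := hM.one_lt
  have hten := hM'.ten_le
  have hIW := hV.I_lt
  have bdd : ∀ (j v : ℕ) (σ : State), j ≤ cfg.I → cfg.Loaded n σ → σ.reg 28 = j →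
      σ.reg 29 = v → v ≤ 1 →
      (Exp.mul (.eq (.reg 29) (.lit 0)) (.lt (.reg 28) (.reg 13))).Bdd w c σ := by
    intro j v σ hj hL h28 h29 hv
    have := hL.2.2.1
    simp only [Exp.Bdd, and_true]; omega
  have hcost : ∀ (j v : ℕ) (σ : State), j ≤ cfg.I → cfg.Loaded n σ → σ.reg 28 = j →
      σ.reg 29 = v → v ≤ 1 →
      1 + (Exp.mul (.eq (.reg 29) (.lit 0)) (.lt (.reg 28) (.reg 13))).cost w σ ≤ U' := by
    intro j v σ hj hL h28 h29 hv
    have := hM'.cost_le (bdd j v σ hj hL h28 h29 hv) (by decide)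
    omega
  have finish : ∀ (i v : ℕ) (q : SearchOut n) (σ : State), i ≤ cfg.I → cfg.Loaded n σ →
      σ.reg 28 = i → σ.reg 29 = v → v ≤ 1 → (v = 0 → i = cfg.I) → q.1 = i →
      cfg.Found A.G q σ → Ref A w searchLoop σ (PMF.pure q)
        (fun q τ => cfg.Loaded n τ ∧ cfg.Found A.G q τ ∧
          τ.time + 2 ^ i * cfg.roundTime * U' ≤
            σ.time + 2 ^ q.1 * cfg.roundTime * U' + U') := by
    intro i v q σ hi hL h28 h29 hv hend hq hF
    have hc := hcost i v σ hi hL h28 h29 hv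
    refine Ref.while_false ?_ q ⟨hL.congr fun x _ => rfl, ?_, ?_⟩
    · simp only [Exp.eval, h28, h29, hL.2.2.1]
      by_cases hv0 : v = 0
      · rw [if_neg (show ¬ i < cfg.I by have := hend hv0; omega), mul_zero]
      · rw [if_neg hv0, zero_mul]
    · exact hF.congr ⟨rfl, rfl⟩
    · simp only [State.tick, hq]; omega
  induction f with
  | zero =>
    intro i σ hi hL h18 h28 h29
    exact finish i 0 (i, none) σ (by omega) hL h28 h29 (by omega) (fun _ => by omega) rfl h29
  | succ f ih =>
    intro i σ hi hL h18 h28 h29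
    have hc := hcost i 0 σ (by omega) hL h28 h29 (by omega)
    rw [Config.search]
    refine Ref.while_true ?_ (run_searchBody (A := A) hM hV (by omega) hL h18 h28 _ ⟨rfl, rfl⟩) ?_
    · simp only [Exp.eval, h28, h29, hL.2.2.1, if_pos (show i < cfg.I by omega)]
      simp
    rintro p τ' ⟨τ, ⟨gL, g18, g28, g29, gP⟩, gm, gt⟩
    have gL' : cfg.Loaded n τ' := gL.congr fun x _ => by rw [gm.1]
    have time : τ'.time ≤ σ.time + 2 ^ i * cfg.roundTime * U' := by
      refine gt.trans ?_
      have h5 : 5 ≤ 2 ^ i * cfg.roundTime := by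
        have : 1 ≤ 2 ^ i := Nat.one_le_two_pow
        have h30 : 30 ≤ cfg.roundTime := by simp only [Config.roundTime]; omega
        nlinarith
      simp only [State.tick]
      obtain ⟨x, hx⟩ : ∃ x, 2 ^ i * cfg.roundTime = x + 5 := ⟨_, (Nat.sub_add_cancel h5).symm⟩
      rw [hx, Nat.add_sub_cancel, add_mul]
      omega
    have hpow : 2 ^ (i + 1) * cfg.roundTime * U' =
      2 ^ i * cfg.roundTime * U' + 2 ^ i * cfg.roundTime * U' := by rw [pow_succ]; ring
    have hi' : i + 1 ≤ cfg.I := by omega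
    by_cases hp : cfg.thr ≤ p.1.1
    · rw [if_pos hp]
      rw [if_pos hp] at g29
      refine (finish (i + 1) 1 (i + 1, some p) τ' (by omega) gL' (by rw [gm.1, g28])
        (by rw [gm.1, g29]) le_rfl (by omega) rfl
        ⟨by rw [gm.1, g29], hp, hi', gP.congr gm⟩).mono ?_
      rintro q χ ⟨q1, q2, q3⟩
      exact ⟨q1, q2, by omega⟩
    · rw [if_neg hp]
      rw [if_neg hp] at g29
      refine (ih (i + 1) τ' (by omega) gL' (by rw [gm.1, g18]) (by rw [gm.1, g28])
        (by rw [gm.1, g29])).mono ?_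
      rintro q χ ⟨q1, q2, q3⟩
      exact ⟨q1, q2, by omega⟩

theorem ref_search (hM : Mach w c U) (hV : cfg.Valid n (2 ^ (c * w)) U U') {σ : State}
    (hL : cfg.Loaded n σ) : Ref A w search σ (cfg.search A.G cfg.I 0)
      (fun q τ => cfg.Loaded n τ ∧ cfg.Found A.G q τ ∧
        τ.time ≤ σ.time + (2 ^ q.1 * cfg.roundTime + 4) * U') := by
  have hM' := hV.mach hM
  have hdet : Det A w U' (.assign 18 (.lit 1) ;; .assign 28 (.lit 0) ;; .assign 29 (.lit 0)) 3 σ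
      (fun τ => cfg.Loaded n τ ∧ τ.reg 18 = 1 ∧ τ.reg 28 = 0 ∧ τ.reg 29 = 0) := by
    refine Run.assign_seq (e := .lit 1) hM' trivial (Run.assign_seq (e := .lit 0) hM' trivial
      (Run.assign (e := .lit 0) hM' trivial () ⟨hL.congr fun x hx => ?_, ?_, ?_, ?_⟩))
    · simp only [setReg_reg]
      rw [if_neg (by omega), if_neg (by omega), if_neg (by omega)]
    all_goals simp [Exp.eval]
  have h := (hdet σ (SameMem.refl σ)).seq (ν := fun _ => cfg.search A.G cfg.I 0)
    (P' := searchLoop) (Q' := fun q τ => cfg.Loaded n τ ∧ cfg.Found A.G q τ ∧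
        τ.time ≤ σ.time + (2 ^ q.1 * cfg.roundTime + 4) * U') ?_
  · rw [PMF.pure_bind] at h
    exact fun v f hvf => h v f hvf
  · rintro - τ' ⟨τ, ⟨g1, g2, g3, g4⟩, gm, gt⟩
    refine (ref_searchLoop (A := A) hM hV cfg.I 0 τ' (by omega) (g1.congr fun x _ => by rw [gm.1])
      (by rw [gm.1, g2, pow_zero]) (by rw [gm.1, g3]) (by rw [gm.1, g4])).mono ?_
    rintro q χ ⟨q1, q2, q3⟩
    refine ⟨q1, q2, ?_⟩
    rw [add_mul]; omega

end Search

/-! ### The programs for counting and sampling -/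

/-- Parameters for counting cliques of size `k`, for `E = ⌈1 / ε⌉` and `2 ^ (l - 1) ≤ n < 2 ^ l`. -/
def countCfg (k E l : ℕ) : Config where
  k := k
  K := 2 ^ 14 * k ^ 3 * E ^ 3 * l
  R := 4 * (2 ^ 14 * E ^ 2 * (8 * k * l))
  flag := 0
  thr := 2 ^ 14 * E ^ 2 * (8 * k * l)
  l := l + 1
  I := 8 * k * l

/-- Parameters for sampling cliques. -/
def sampleCfg (k E l : ℕ) : Config where
  k := k
  K := 2 ^ 14 * k ^ 3 * E ^ 3 * l
  R := 64
  flag := 1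
  thr := 1
  l := l + 1
  I := 8 * k * l

/-- The literal `2 ^ 14`. -/
def bigLit : Exp := .mul (.mul (.lit 16) (.lit 16)) (.mul (.lit 8) (.lit 8))

def setup : Cmd :=
  .assign 12 (.lit 0) ;;
  .assign 30 (.lit 1) ;;
  .while (.lt (.reg 30) (.add (.reg 1) (.lit 1)))
    (.assign 30 (.mul (.reg 30) (.lit 2)) ;;
     .assign 12 (.add (.reg 12) (.lit 1))) ;;
  .assign 13 (.mul (.mul (.lit 8) (.reg 2)) (.reg 12)) ;;
  .assign 14 (.mul (.mul (.mul bigLit (.mul (.reg 2) (.mul (.reg 2) (.reg 2))))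
    (.mul (.reg 3) (.mul (.reg 3) (.reg 3)))) (.reg 12))

def countSetup : Cmd :=
  setup ;;
  .assign 15 (.mul (.mul bigLit (.mul (.reg 3) (.reg 3))) (.reg 13)) ;;
  .assign 16 (.mul (.lit 4) (.reg 15)) ;;
  .assign 17 (.lit 0)

/-- The program for approximate counting. -/
def countProgram : Cmd :=
  countSetup ;;
  search ;;
  .ite (.reg 29)
    (.assign 0 (.div (.add (.mul (.lit 2) (.mul (.reg 24) (.reg 27))) (.reg 25))
      (.mul (.lit 2) (.reg 25))))
    (.assign 0 (.lit 0))

/-- The preprocessing for sampling. -/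
def sampleSetup : Cmd :=
  setup ;;
  .assign 15 (.lit 1) ;;
  .assign 16 (.mul (.lit 8) (.lit 8)) ;;
  .assign 17 (.lit 1)

/-- The program for sampling. -/
def sampleProgram : Cmd :=
  .assign 29 (.lit 0) ;;
  .while (.eq (.reg 29) (.lit 0)) search

/-- The estimate for the number of cliques. -/
def Config.estimate {n : ℕ} (cfg : Config) (q : SearchOut n) : ℕ :=
  match q.2 with
  | none => 0
  | some p => (2 * (p.2 * p.1.1) + cfg.R * 2 ^ (q.1 - 1)) / (2 * (cfg.R * 2 ^ (q.1 - 1)))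

/-! ### The set-up and the counting program. -/

section Programs

variable {n : ℕ} {A : Access n} {w c U U' : ℕ}

/-- Register `12` counts the doublings from `1` until `n` is exceeded, so it ends as the number `l`
of binary digits of `n`. -/
theorem run_setup (hM : Mach w c U) (hn1 : 1 ≤ n) {k E l : ℕ} (hl : l = Nat.log 2 n + 1)
    (hn : 2 * n < 2 ^ (c * w)) (hk : k < 2 ^ (c * w)) (hE : E < 2 ^ (c * w))
    (hlW : l < 2 ^ (c * w)) {σ : State}
    (h1 : σ.reg 1 = n) (h2 : σ.reg 2 = k) (h3 : σ.reg 3 = E) :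
    Det A w U setup (3 * l + 5) σ (fun τ => τ.reg 1 = n ∧ τ.reg 2 = k ∧ τ.reg 3 = E ∧
      τ.reg 13 = 8 * k * l ∧ τ.reg 14 = 2 ^ 14 * k ^ 3 * E ^ 3 * l) := by
  have h1W := hM.one_lt
  have hpow : ∀ j, 2 ^ j ≤ n ↔ j < l := fun j => by
    rw [hl, Nat.lt_succ_iff, Nat.le_log_iff_pow_le (by norm_num) (by omega)]
  refine Run.time (t := (((2 + 1) * l + 1 + (1 + 1)) + 1) + 1) ?_ (by omega)
  refine Run.assign_seq (e := .lit 0) hM trivial (Run.assign_seq (e := .lit 1) hM trivial ?_)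
  set ρ := (σ.setReg 12 (Exp.eval σ (.lit 0))).setReg 30 (Exp.eval
    (σ.setReg 12 (Exp.eval σ (.lit 0))) (.lit 1)) with hρ
  have hloop := Run.while_det (A := A) (U := U) (t := 2) (σ := ρ)
    (b := .lt (.reg 30) (.add (.reg 1) (.lit 1)))
    (P := .assign 30 (.mul (.reg 30) (.lit 2)) ;; .assign 12 (.add (.reg 12) (.lit 1))) hM
    (fun τ => τ.reg 12 ≤ l ∧ τ.reg 30 = 2 ^ τ.reg 12 ∧ τ.reg 1 = n ∧ τ.reg 2 = k ∧ τ.reg 3 = E)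
    (fun τ => l - τ.reg 12) ?_ ?_ ?_
  · have r12 : ρ.reg 12 = 0 := by simp [hρ, Exp.eval]
    rw [r12, Nat.sub_zero] at hloop
    refine (hloop.det_seq (t' := 1 + 1) ?_).time (by omega)
    rintro τ ⟨⟨g12, g30, g1, g2, g3⟩, hb⟩
    have e12 : τ.reg 12 = l := by
      rw [Exp.eval_lt_eq_zero] at hb
      simp only [Exp.eval, g30, g1] at hb
      have := hpow (τ.reg 12)
      omega
    have e13 : Exp.eval τ (.mul (.mul (.lit 8) (.reg 2)) (.reg 12)) = 8 * k * l := by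
      simp only [Exp.eval, g2, e12]
    refine Run.assign_seq hM ?_ ?_
    · simp only [Exp.Bdd, true_and]; omega
    rw [e13]
    set χ := τ.setReg 13 (8 * k * l) with hχ
    have x1 : χ.reg 1 = n := by simp [hχ, g1]
    have x2 : χ.reg 2 = k := by simp [hχ, g2]
    have x3 : χ.reg 3 = E := by simp [hχ, g3]
    have x12 : χ.reg 12 = l := by simp [hχ, e12]
    have x13 : χ.reg 13 = 8 * k * l := by simp [hχ]
    -- A literal counts as much as its value, so `2 ^ 14` is written as a product of small literals
    -- to keep the size of the expression below `200`.
    have e14 : Exp.eval χ (.mul (.mul (.mul bigLit (.mul (.reg 2) (.mul (.reg 2) (.reg 2))))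
        (.mul (.reg 3) (.mul (.reg 3) (.reg 3)))) (.reg 12)) = 2 ^ 14 * k ^ 3 * E ^ 3 * l := by
      simp only [Exp.eval, bigLit, x2, x3, x12]; ring
    refine Run.assign hM ?_ () ?_
    · simp only [Exp.Bdd, bigLit, x2, x3, x12, true_and]; omega
    · rw [e14]
      refine ⟨?_, ?_, ?_, ?_, ?_⟩ <;> rw [setReg_reg]
      · rw [if_neg (by decide), x1]
      · rw [if_neg (by decide), x2]
      · rw [if_neg (by decide), x3]
      · rw [if_neg (by decide), x13]
      · rw [if_pos rfl]
  · rintro τ ⟨g12, g30, g1, g2, g3⟩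
    have : 2 ^ τ.reg 12 ≤ 2 * n := by
      rcases Nat.eq_zero_or_pos (τ.reg 12) with h | h
      · rw [h]; simp; omega
      · have := (hpow (τ.reg 12 - 1)).2 (by omega)
        obtain ⟨j, hj⟩ : ∃ j, τ.reg 12 = j + 1 := ⟨τ.reg 12 - 1, by omega⟩
        rw [hj, Nat.add_sub_cancel] at this
        rw [hj, pow_succ]; omega
    simp only [Exp.Bdd, and_true]; omega
  · rintro τ ⟨g12, g30, g1, g2, g3⟩ hb
    rw [Exp.eval_lt_ne_zero] at hb
    simp only [Exp.eval, g30, g1] at hb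
    have hlt := (hpow (τ.reg 12)).1 (by omega)
    refine Run.time (t := 1 + 1) (Run.assign_seq hM ?_ (Run.assign hM ?_ () ?_)) le_rfl
    · simp only [Exp.Bdd, and_true]; omega
    · simp [Exp.Bdd]; omega
    · simp [Exp.eval, g30, g1, g2, g3, pow_succ]; omega
  · simp [hρ, Exp.eval, h1, h2, h3]

/-- The numbers for which the set-up works. -/
structure SetupSizes (W n k E l : ℕ) : Prop where
  hn : 2 * n < W
  hk : k < W
  hE : E < W
  hl : l < W
  hI : 8 * k * l < W
  hthr : 2 ^ 14 * E ^ 2 * (8 * k * l) < W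

theorem run_countSetup (hM : Mach w c U) (hn1 : 1 ≤ n) {k E l : ℕ} (hl : l = Nat.log 2 n + 1)
    (hS : SetupSizes (2 ^ (c * w)) n k E l) {σ : State} (h1 : σ.reg 1 = n) (h2 : σ.reg 2 = k)
    (h3 : σ.reg 3 = E) :
    Det A w U countSetup (3 * l + 8) σ (fun τ => (countCfg k E l).Loaded n τ) := by
  refine Run.time (t := (3 * l + 5) + (1 + 1 + 1)) ((run_setup hM hn1 hl hS.hn hS.hk hS.hE hS.hl h1
    h2 h3).det_seq ?_) (by omega)
  rintro τ ⟨g1, g2, g3, g13, g14⟩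
  have e15 : Exp.eval τ (.mul (.mul bigLit (.mul (.reg 3) (.reg 3))) (.reg 13)) =
      2 ^ 14 * E ^ 2 * (8 * k * l) := by
    simp only [Exp.eval, bigLit, g3, g13]; ring
  have := hS.hI; have := hS.hE; have := hS.hthr
  refine Run.assign_seq hM ?_ (Run.assign_seq hM ?_ (Run.assign (e := .lit 0) hM trivial () ?_))
  · simp [Exp.Bdd, bigLit]; omega
  · simp only [Exp.Bdd, setReg_reg, e15, reduceIte, true_and]; exact hS.hthr
  · rw [e15]
    simp [Config.Loaded, countCfg, Exp.eval, g1, g2, g13, g14]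

theorem run_sampleSetup (hM : Mach w c U) (hn1 : 1 ≤ n) {k E l : ℕ} (hl : l = Nat.log 2 n + 1)
    (hS : SetupSizes (2 ^ (c * w)) n k E l) {σ : State} (h1 : σ.reg 1 = n) (h2 : σ.reg 2 = k)
    (h3 : σ.reg 3 = E) :
    Det A w U sampleSetup (3 * l + 8) σ (fun τ => (sampleCfg k E l).Loaded n τ) := by
  refine Run.time (t := (3 * l + 5) + (1 + 1 + 1)) ((run_setup hM hn1 hl hS.hn hS.hk hS.hE hS.hl h1
    h2 h3).det_seq ?_) (by omega)
  rintro τ ⟨g1, g2, g3, g13, g14⟩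
  refine Run.assign_seq (e := .lit 1) hM trivial (Run.assign_seq hM ⟨trivial, trivial⟩
    (Run.assign (e := .lit 1) hM trivial () ?_))
  simp [Config.Loaded, sampleCfg, Exp.eval, g1, g2, g13, g14]

variable [NeZero n]

theorem ref_countProgram (hM : Mach w c U) {k E l : ℕ} (hl : l = Nat.log 2 n + 1)
    (hS : SetupSizes (2 ^ (c * w)) n k E l)
    (hV : (countCfg k E l).Valid n (2 ^ (c * w)) U U') {σ : State} (h1 : σ.reg 1 = n)
    (h2 : σ.reg 2 = k) (h3 : σ.reg 3 = E) :
    Ref A w countProgram σ ((countCfg k E l).search A.G (countCfg k E l).I 0)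
      (fun q τ => τ.reg 0 = (countCfg k E l).estimate q ∧
        τ.time ≤ σ.time + (2 ^ q.1 * (countCfg k E l).roundTime + 3 * l + 14) * U') := by
  have hM' := hV.mach hM
  have h1W := hM.one_lt
  have hn1 : 1 ≤ n := Nat.one_le_iff_ne_zero.2 (NeZero.ne n)
  set cfg := countCfg k E l with hcfg
  have h := (run_countSetup (A := A) hM' hn1 hl hS h1 h2 h3 σ (SameMem.refl σ)).seq
    (ν := fun _ => cfg.search A.G cfg.I 0)
    (P' := search ;; .ite (.reg 29)
      (.assign 0 (.div (.add (.mul (.lit 2) (.mul (.reg 24) (.reg 27))) (.reg 25))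
        (.mul (.lit 2) (.reg 25)))) (.assign 0 (.lit 0)))
    (Q' := fun q τ => τ.reg 0 = cfg.estimate q ∧
      τ.time ≤ σ.time + (2 ^ q.1 * cfg.roundTime + 3 * l + 14) * U') ?_
  · rw [PMF.pure_bind] at h
    exact fun v f hvf => h v f hvf
  rintro - τ' ⟨τ, gL, gm, gt⟩
  have hs := (ref_search (A := A) hM hV (σ := τ') (gL.congr fun x _ => by rw [gm.1])).seq
    (ν := PMF.pure) (P' := .ite (.reg 29)
      (.assign 0 (.div (.add (.mul (.lit 2) (.mul (.reg 24) (.reg 27))) (.reg 25))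
        (.mul (.lit 2) (.reg 25)))) (.assign 0 (.lit 0)))
    (Q' := fun q τ => τ.reg 0 = cfg.estimate q ∧
      τ.time ≤ σ.time + (2 ^ q.1 * cfg.roundTime + 3 * l + 14) * U') ?_
  · rw [PMF.bind_pure] at hs
    exact fun v f hvf => hs v f hvf
  rintro q χ ⟨-, qF, qt⟩
  have hrun : Run A w U' (.ite (.reg 29)
      (.assign 0 (.div (.add (.mul (.lit 2) (.mul (.reg 24) (.reg 27))) (.reg 25))
        (.mul (.lit 2) (.reg 25)))) (.assign 0 (.lit 0))) (1 + 1) χ (PMF.pure q)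
      (fun q τ => τ.reg 0 = cfg.estimate q) := by
    obtain ⟨i, o⟩ := q
    rcases o with _ | p
    · have q29 : χ.reg 29 = 0 := qF
      refine Run.ite hM' ?_ (fun h => ?_) (fun _ => Run.assign (e := .lit 0) hM' trivial _ ?_)
      · simp only [Exp.Bdd]; omega
      · simp [Exp.eval, q29] at h
      · simp [Exp.eval, Config.estimate]
    · obtain ⟨q29, -, qi, q27, qX, ⟨q24, qZ⟩, q25, -⟩ := qF
      simp only at q29 qi q27 qX q24 qZ q25
      have hr : cfg.R * 2 ^ (i - 1) < 2 ^ (c * w) :=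
        lt_of_le_of_lt (Nat.mul_le_mul_left _ (Nat.pow_le_pow_right (by norm_num) (by omega)))
          hV.r_lt
      have hZ := hV.Z_lt
      refine Run.ite hM' ?_ (fun _ => Run.assign hM' ?_ _ ?_) (fun h => ?_)
      · simp only [Exp.Bdd]; omega
      · simp only [Exp.Bdd, q24, q25, q27, true_and]; omega
      · simp [Exp.eval, Config.estimate, q24, q25, q27]
      · simp [Exp.eval, q29] at h
  -- The postcondition holds for the outcome `q` only; discarding outcomes of probability zero
  -- identifies `q'` with it.
  refine (hrun.support χ (SameMem.refl χ)).mono ?_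
  rintro q' ψ ⟨ω, ⟨w0, w1⟩, w2, w3⟩
  obtain rfl : q' = q := by simpa [PMF.pure_apply] using w0
  refine ⟨by rw [w2.1, w1], ?_⟩
  rw [add_mul] at gt qt
  rw [add_mul, add_mul]
  nlinarith

end Programs

/-! ### Repetition of the search -/

/-- Since every query costs at least one unit, `queries + σ.time ≤ time + σ.queries` holds at the
start and persists; the difference of the queries may thus be replaced by its minimum with the
elapsed time. -/
theorem Access.expQueries_le_expTime {n : ℕ} (A : Access n) (w : ℕ) (P : Cmd) (σ : State) :
    A.expQueries w P σ ≤ A.expTime w P σ := by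
  rw [Access.expQueries, Access.expTime]
  split_ifs
  · rw [A.expect_congr_of_queries_le w σ.time σ.queries P (g := fun τ =>
      ((min (τ.queries - σ.queries) (τ.time - σ.time) : ℕ) : ℝ≥0∞)) (fun τ hτ => ?_) σ (by omega)]
    · refine A.expect_mono w P (fun τ => ?_) σ
      exact Nat.cast_le.2 (min_le_right _ _)
    · rw [min_eq_left (by omega)]
  · exact le_rfl

open Classical in
theorem Ref.expTime_le {n : ℕ} {A : Access n} {w : ℕ} {O : Type} {P : Cmd} {σ : State} {μ : PMF O}
    {Q : O → State → Prop} (h : Ref A w P σ μ Q) {cost : O → ℝ≥0∞}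
    (hQ : ∀ o τ, Q o τ → ((τ.time - σ.time : ℕ) : ℝ≥0∞) ≤ cost o) :
    A.expTime w P σ ≤ avg μ cost := by
  rw [Access.expTime, if_pos (h.prob_eq_one fun _ _ _ => trivial)]
  exact h.expect_le hQ

namespace Config

variable {n : ℕ} [NeZero n] (cfg : Config) (G : QueryGraph n)

/-- The probability that the search fails. -/
def failProb (f i : ℕ) : ℝ≥0∞ := avg (cfg.search G f i) fun q => if q.2.isSome then 0 else 1

/-- The successful outcomes. -/
def successes (n : ℕ) : Set (SearchOut n) := {q | q.2.isSome}

open Classical in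
theorem tsum_successes (f i : ℕ) (v : SearchOut n → ℝ≥0∞) :
    ∑' q, (successes n).indicator (cfg.search G f i) q * v q =
      avg (cfg.search G f i) fun q => if q.2.isSome then v q else 0 := by
  refine tsum_congr fun q => ?_
  by_cases h : q.2.isSome
  · simp [successes, h]
  · simp [successes, h]

theorem success_add_failProb (f i : ℕ) :
    (avg (cfg.search G f i) fun q => if q.2.isSome then 1 else 0) + cfg.failProb G f i = 1 := by
  rw [failProb, ← avg_add]
  refine (avg_congr _ fun q => ?_).trans (avg_const _ 1)
  split_ifs <;> simp

theorem failProb_le_one (f i : ℕ) : cfg.failProb G f i ≤ 1 :=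
  avg_le_const _ fun q => by split_ifs <;> simp

theorem tsum_indicator (f i : ℕ) :
    ∑' q, (successes n).indicator (cfg.search G f i) q = 1 - cfg.failProb G f i := by
  have h1 := cfg.tsum_successes G f i fun _ => 1
  have h2 := cfg.success_add_failProb G f i
  simp only [mul_one] at h1
  rw [h1]
  exact ENNReal.eq_sub_of_add_eq
    (ne_top_of_le_ne_top ENNReal.one_ne_top (cfg.failProb_le_one G f i)) h2

theorem exists_success {f i : ℕ} (h : cfg.failProb G f i < 1) :
    ∃ q ∈ successes n, q ∈ (cfg.search G f i).support := by
  by_contra! hne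
  have h0 : ∑' q, (successes n).indicator (cfg.search G f i) q = 0 := by
    rw [ENNReal.tsum_eq_zero]
    intro q
    by_cases hq : q ∈ successes n
    · simpa [hq] using hne q hq
    · simp [hq]
  rw [cfg.tsum_indicator, tsub_eq_zero_iff_le] at h0
  exact absurd h0 (not_le.2 h)

/-- The distribution of the outcome of the first successful search. -/
def foundPMF (h : cfg.failProb G cfg.I 0 < 1) : PMF (SearchOut n) :=
  (cfg.search G cfg.I 0).filter (successes n) (cfg.exists_success G h)

theorem avg_foundPMF (h : cfg.failProb G cfg.I 0 < 1) (v : SearchOut n → ℝ≥0∞) :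
    avg (cfg.foundPMF G h) v = (avg (cfg.search G cfg.I 0) fun q => if q.2.isSome then v q else 0) *
      (1 - cfg.failProb G cfg.I 0)⁻¹ := by
  classical
  simp only [avg, foundPMF, PMF.filter_apply, cfg.tsum_indicator]
  rw [← ENNReal.tsum_mul_right]
  refine tsum_congr fun q => ?_
  by_cases hq : q.2.isSome
  · simp [successes, hq]; ring
  · simp [successes, hq]

end Config

/-! ### Restarting the search until it succeeds. -/

section SampleProgram

variable {n : ℕ} [NeZero n] {A : Access n} {w c U U' : ℕ} {cfg : Config}

/-- With `a` the part of the average from successful searches and `b` the probability of failure,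
`t` restarts give the lower bound `a * (1 + b + ⋯ + b ^ (t - 1))`. Its limit `a / (1 - b)` is the
average under the conditional distribution given success. -/
theorem ref_sampleLoop (hM : Mach w c U) (hV : cfg.Valid n (2 ^ (c * w)) U U')
    (hfail : cfg.failProb A.G cfg.I 0 < 1) {σ : State} (hL : cfg.Loaded n σ)
    (h29 : σ.reg 29 = 0) :
    Ref A w (.while (.eq (.reg 29) (.lit 0)) search) σ (cfg.foundPMF A.G hfail)
      (fun q τ => cfg.Loaded n τ ∧ cfg.Found A.G q τ ∧ q.2.isSome) := by
  intro v f hvf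
  set a := avg (cfg.search A.G cfg.I 0) fun q => if q.2.isSome then v q else 0 with ha
  set b := cfg.failProb A.G cfg.I 0 with hb
  have key : ∀ t : ℕ, ∀ τ, cfg.Loaded n τ → τ.reg 29 = 0 →
      a * ∑ j ∈ Finset.range t, b ^ j ≤
        A.expect w (.while (.eq (.reg 29) (.lit 0)) search) f τ := by
    intro t
    induction t with
    | zero => intro τ _ _; simp
    | succ t ih =>
      intro τ hτ h29
      rw [A.expect_while_eq, Access.unfold, if_pos (by simp [Exp.eval, h29])]
      have hs := ref_search (A := A) hM hV
        (σ := τ.tick (1 + Exp.cost w τ (.eq (.reg 29) (.lit 0)))) (hτ.congr fun _ _ => rfl)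
      refine le_trans (le_of_eq ?_) (hs (fun q => (if q.2.isSome then v q else 0) +
        (a * ∑ j ∈ Finset.range t, b ^ j) * (if q.2.isSome then 0 else 1)) _ ?_)
      · rw [avg_add, avg_mul_left, ← ha, ← Config.failProb, ← hb, Finset.sum_range_succ',
          pow_zero, mul_add, mul_one, add_comm]
        congr 1
        simp only [pow_succ]
        rw [← Finset.sum_mul]; ring
      · rintro ⟨i, o⟩ χ ⟨g1, g2, -⟩
        rcases o with _ | p
        · have g29 : χ.reg 29 = 0 := g2
          simpa using ih χ g1 g29
        · have g29 : χ.reg 29 = 1 := g2.1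
          simp only [Option.isSome_some, if_true, mul_zero, add_zero]
          have he : Exp.eval χ (.eq (.reg 29) (.lit 0)) = 0 := by simp [Exp.eval, g29]
          rw [A.expect_while_eq, Access.unfold, he, if_neg (by simp)]
          exact hvf _ _ ⟨g1.congr fun _ _ => rfl, g2.congr ⟨rfl, rfl⟩, rfl⟩
  rw [cfg.avg_foundPMF A.G hfail, ← ha, ← hb, ← ENNReal.tsum_geometric, ENNReal.tsum_eq_iSup_nat,
    ENNReal.mul_iSup]
  exact iSup_le fun t => key t σ hL h29

theorem ref_sampleProgram (hM : Mach w c U) (hV : cfg.Valid n (2 ^ (c * w)) U U')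
    (hfail : cfg.failProb A.G cfg.I 0 < 1) {σ : State} (hL : cfg.Loaded n σ) :
    Ref A w sampleProgram σ (cfg.foundPMF A.G hfail)
      (fun q τ => cfg.Loaded n τ ∧ cfg.Found A.G q τ ∧ q.2.isSome) :=
  ref_sampleLoop (A := A) hM hV hfail
    (σ := (σ.setReg 29 (Exp.eval σ (.lit 0))).tick (1 + Exp.cost w σ (.lit 0)))
    (hL.congr fun x hx => by
      change (σ.setReg 29 _).reg x = _
      rw [setReg_reg, if_neg (by omega)]) (by simp [State.tick, Exp.eval])

/-- The expected running time of the sampling program. -/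
theorem expTime_sampleProgram (hM : Mach w c U) (hV : cfg.Valid n (2 ^ (c * w)) U U')
    (hfail : cfg.failProb A.G cfg.I 0 ≤ 1 / 2) {σ : State} (hL : cfg.Loaded n σ) :
    A.expTime w sampleProgram σ ≤ 2 * (avg (cfg.search A.G cfg.I 0) fun q =>
      (((2 ^ q.1 * cfg.roundTime + 8) * U' : ℕ) : ℝ≥0∞)) := by
  classical
  have hM' := hV.mach hM
  have hfail' : cfg.failProb A.G cfg.I 0 < 1 := hfail.trans_lt (by
    rw [one_div]; exact ENNReal.inv_lt_one.2 (by norm_num))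
  have hten := hM'.ten_le
  have h1W := hM.one_lt
  have hcost : ∀ τ : State, τ.reg 29 ≤ 1 → 1 + (Exp.eq (.reg 29) (.lit 0)).cost w τ ≤ U' := by
    intro τ hτ
    have := hM'.cost_le (σ := τ) (e := .eq (.reg 29) (.lit 0))
      (by simp only [Exp.Bdd, and_true]; omega) (by decide)
    omega
  set T : ℝ≥0∞ := avg (cfg.search A.G cfg.I 0) fun q =>
      (((2 ^ q.1 * cfg.roundTime + 6) * U' : ℕ) : ℝ≥0∞) with hT
  -- A potential for Park induction: the elapsed time, one unit for the last loop test, and `2 * T`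
  -- while no search has succeeded. It does not increase because `T + (1 / 2) * (2 * T) = 2 * T`.
  -- The value `⊤` disposes of states that do not occur.
  let Inv : State → ℝ≥0∞ := fun τ => if cfg.Loaded n τ ∧ τ.reg 29 ≤ 1 then
    ((τ.time - σ.time : ℕ) : ℝ≥0∞) + U' + (if τ.reg 29 = 0 then 2 * T else 0) else ⊤
  have hpark : A.expect w (.while (.eq (.reg 29) (.lit 0)) search)
      (fun τ => ((τ.time - σ.time : ℕ) : ℝ≥0∞)) ≤ Inv := by
    refine A.expect_while_le w fun τ => ?_
    by_cases hτ : cfg.Loaded n τ ∧ τ.reg 29 ≤ 1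
    swap
    · simp only [Inv, if_neg hτ, le_top]
    have hc := hcost τ hτ.2
    simp only [Inv, if_pos hτ]
    by_cases h29 : τ.reg 29 = 0
    · rw [Access.unfold, if_pos (by simp [Exp.eval, h29]), if_pos h29]
      have hs := ref_search (A := A) hM hV
        (σ := τ.tick (1 + Exp.cost w τ (.eq (.reg 29) (.lit 0)))) (hτ.1.congr fun _ _ => rfl)
      refine (hs.expect_le (v := fun q => (((τ.time - σ.time : ℕ) : ℝ≥0∞) + U') +
        (((2 ^ q.1 * cfg.roundTime + 6) * U' : ℕ) : ℝ≥0∞) +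
        (2 * T) * (if q.2.isSome then 0 else 1)) ?_).trans ?_
      · rintro ⟨i, o⟩ χ ⟨g1, g2, g3⟩
        have g29 : χ.reg 29 = if o.isSome then 1 else 0 := by
          rcases o with _ | p
          · exact g2
          · exact g2.1
        have hle : χ.reg 29 ≤ 1 := by rw [g29]; split_ifs <;> omega
        rw [if_pos ⟨g1, hle⟩]
        have ht : (χ.time - σ.time : ℕ) ≤ (τ.time - σ.time : ℕ) +
            (2 ^ i * cfg.roundTime + 6) * U' := by
          have h6 : (2 ^ i * cfg.roundTime + 6) * U' =
            (2 ^ i * cfg.roundTime + 4) * U' + 2 * U' := by ring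
          simp only [State.tick] at g3
          omega
        have h2T : (if χ.reg 29 = 0 then 2 * T else 0) = 2 * T * (if o.isSome then 0 else 1) := by
          rw [g29]; cases o <;> simp
        simp only [h2T]
        refine add_le_add ?_ le_rfl
        calc ((χ.time - σ.time : ℕ) : ℝ≥0∞) + U' ≤ (((τ.time - σ.time : ℕ) +
              (2 ^ i * cfg.roundTime + 6) * U' : ℕ) : ℝ≥0∞) + U' := by
              gcongr
          _ = _ := by push_cast; ring
      · rw [avg_add, avg_add, avg_const, avg_mul_left, ← hT, ← Config.failProb, add_assoc]
        gcongr
        calc T + 2 * T * cfg.failProb A.G cfg.I 0 ≤ T + 2 * T * (1 / 2) := by gcongr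
          _ = 2 * T := by
            rw [one_div, mul_comm (2 : ℝ≥0∞), mul_assoc, ENNReal.mul_inv_cancel (by norm_num)
              (by norm_num), mul_one, mul_two]
    · rw [Access.unfold, if_neg (by simp [Exp.eval, h29]), if_neg h29, add_zero]
      have : (τ.time + (1 + Exp.cost w τ (.eq (.reg 29) (.lit 0))) - σ.time : ℕ) ≤
          (τ.time - σ.time : ℕ) + U' := by omega
      simp only [State.tick]
      exact_mod_cast this
  rw [Access.expTime, if_pos ((ref_sampleProgram (A := A) hM hV hfail' hL).prob_eq_one
    fun _ _ _ => trivial)]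
  refine (hpark _).trans ?_
  have hL' : cfg.Loaded n ((σ.setReg 29 (Exp.eval σ (.lit 0))).tick
      (1 + Exp.cost w σ (.lit 0))) := hL.congr fun x hx => by
    change (σ.setReg 29 _).reg x = _
    rw [setReg_reg, if_neg (by omega)]
  have h29 : ((σ.setReg 29 (Exp.eval σ (.lit 0))).tick (1 + Exp.cost w σ (.lit 0))).reg 29 = 0 := by
    simp [State.tick, Exp.eval]
  have hc0 : 1 + Exp.cost w σ (.lit 0) ≤ U' := by
    have := hM'.cost_le (σ := σ) (e := .lit 0) trivial (by decide)
    omega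
  simp only [Inv]
  rw [if_pos ⟨hL', by omega⟩, if_pos h29]
  have h8 : (avg (cfg.search A.G cfg.I 0) fun q =>
      (((2 ^ q.1 * cfg.roundTime + 8) * U' : ℕ) : ℝ≥0∞)) = T + 2 * U' := by
    rw [hT, ← avg_const (cfg.search A.G cfg.I 0) (2 * (U' : ℝ≥0∞)), ← avg_add]
    refine avg_congr _ fun q => ?_
    push_cast; ring
  rw [h8]
  have h1 : (((σ.setReg 29 (Exp.eval σ (.lit 0))).tick (1 + Exp.cost w σ (.lit 0))).time -
      σ.time : ℕ) ≤ U' := by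
    simp only [State.tick, State.setReg]; omega
  calc _ ≤ (U' : ℝ≥0∞) + U' + 2 * T := by gcongr
    _ ≤ U' + U' + 2 * T + (U' + U') := le_self_add
    _ = 2 * (T + 2 * U') := by ring

end SampleProgram

/-! ### Sequences of samples -/

section Samples

variable {n : ℕ} [NeZero n] {A : Access n} {w c U U' : ℕ} {cfg : Config} {G : QueryGraph n}

/-- The clique found by a search. -/
def SearchOut.clique {n : ℕ} (q : SearchOut n) : Option (Finset (Fin n)) := q.2.bind fun p => p.1.2

omit [NeZero n] in
theorem Config.Found.outcome (hflag : cfg.flag = 1) (hthr : cfg.thr = 1) {q : SearchOut n}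
    {τ : State} (h : cfg.Found G q τ) (hq : q.2.isSome) :
    ∃ s, q.clique = some s ∧ G.graph.IsNClique cfg.k s ∧ Returns cfg.k s τ := by
  obtain ⟨i, _ | p⟩ := q
  · simp at hq
  · obtain ⟨-, h1, -, -, -, -, -, h2⟩ := h
    obtain ⟨h3, h4⟩ := h2 hflag
    rw [hthr] at h1
    have h5 := h3.1 h1
    have h6 := h4 h1
    obtain ⟨s, hs⟩ := Option.isSome_iff_exists.1 h5
    rw [hs] at h6
    exact ⟨s, hs, h6.1, h6.2⟩

/-- The probability that the first successful search finds the set `s`. -/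
def Config.foundProb (cfg : Config) (G : QueryGraph n) (h : cfg.failProb G cfg.I 0 < 1)
    (s : Finset (Fin n)) : ℝ≥0∞ :=
  avg (cfg.foundPMF G h) fun q => if q.clique = some s then 1 else 0

-- Outcomes that leave no clique have the dummy value `c₀`; they do not occur for a successful
-- search. The value of `p` at a clique is found by computing the probability of returning it in two
-- ways.
open Classical in
theorem exists_cliquePMF (hM : Mach w c U) (hV : cfg.Valid n (2 ^ (c * w)) U U')
    (hflag : cfg.flag = 1) (hthr : cfg.thr = 1) (hfail : cfg.failProb A.G cfg.I 0 < 1)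
    {σ₀ : State} (hL₀ : cfg.Loaded n σ₀)
    (c₀ : {s : Finset (Fin n) // A.G.graph.IsNClique cfg.k s}) :
    ∃ p : PMF {s : Finset (Fin n) // A.G.graph.IsNClique cfg.k s},
      (∀ s, p s = cfg.foundProb A.G hfail s.1) ∧
      ∀ σ, cfg.Loaded n σ → Ref A w sampleProgram σ p
        (fun s τ => cfg.Loaded n τ ∧ Returns cfg.k s.1 τ) := by
  let g : SearchOut n → {s : Finset (Fin n) // A.G.graph.IsNClique cfg.k s} := fun q =>
    if h : ∃ s, q.clique = some s ∧ A.G.graph.IsNClique cfg.k s then ⟨h.choose, h.choose_spec.2⟩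
    else c₀
  have href : ∀ σ, cfg.Loaded n σ → Ref A w sampleProgram σ ((cfg.foundPMF A.G hfail).map g)
      (fun s τ => cfg.Loaded n τ ∧ Returns cfg.k s.1 τ) := by
    intro σ hσ
    refine ((ref_sampleProgram (A := A) hM hV hfail hσ).map g).mono ?_
    rintro _ τ ⟨q, rfl, h1, h2, h3⟩
    obtain ⟨s, hs, hs1, hs2⟩ := h2.outcome hflag hthr h3
    have h : ∃ s, q.clique = some s ∧ A.G.graph.IsNClique cfg.k s := ⟨s, hs, hs1⟩
    refine ⟨h1, ?_⟩
    simp only [g, dif_pos h]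
    have := h.choose_spec.1.symm.trans hs
    rw [Option.some.inj this]
    exact hs2
  refine ⟨_, fun s => ?_, href⟩
  rw [← (href σ₀ hL₀).prob_eq_apply (E := Returns cfg.k s.1) (a := s), Config.foundProb,
    (ref_sampleProgram (A := A) hM hV hfail hL₀).prob_eq (E' := fun q => q.clique = some s.1)]
  · exact avg_congr _ fun q => by congr
  · rintro q τ ⟨-, h2, h3⟩
    obtain ⟨s', hs', -, hs2⟩ := h2.outcome hflag hthr h3
    rw [hs', Option.some.injEq]
    exact ⟨fun h => hs2.unique h, fun h => h ▸ hs2⟩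
  · rintro s' τ ⟨-, h⟩
    exact ⟨fun h' => Subtype.ext (h.unique h'), fun h' => h' ▸ h⟩

-- Each run restores the invariant on which alone its distribution depends, so later runs are
-- independent of earlier ones. Distinct cliques are never returned at once, so the indicator
-- selects a single outcome.
omit [NeZero n] in
theorem jointProb_eq_prod {k : ℕ} {P : Cmd} {Inv : State → Prop}
    {p : PMF {s : Finset (Fin n) // A.G.graph.IsNClique k s}}
    (h : ∀ σ, Inv σ → Ref A w P σ p (fun s τ => Inv τ ∧ Returns k s.1 τ))
    (cs : List {s : Finset (Fin n) // A.G.graph.IsNClique k s}) :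
    ∀ σ, Inv σ → jointProb A w k P (cs.map fun s => s.1) σ = (cs.map p).prod := by
  classical
  induction cs with
  | nil => intro σ _; simp [jointProb]
  | cons s cs ih =>
    intro σ hσ
    rw [List.map_cons, jointProb, (h σ hσ).expect_eq
      (v := fun s' => (cs.map p).prod * if s' = s then 1 else 0), avg_mul_left, avg_single,
      List.map_cons, List.prod_cons, mul_comm]
    rintro s' τ ⟨h1, h2⟩
    by_cases hs : s' = s
    · subst hs
      rw [if_pos h2, ih τ h1, if_pos rfl, mul_one]
    · have : ¬ Returns k s.1 τ := fun h' => hs (Subtype.ext (h2.unique h'))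
      simp [hs, this]

omit [NeZero n] in
theorem expect_iterate_le {P : Cmd} {Inv : State → Prop} {O : Type} {p : PMF O}
    {Q : O → State → Prop} (h : ∀ σ, Inv σ → Ref A w P σ p (fun s τ => Inv τ ∧ Q s τ))
    {f : State → ℝ≥0∞} {T : ℝ≥0∞} (hf : ∀ σ, Inv σ → f σ ≤ T) (r : ℕ) :
    ∀ σ, Inv σ → (A.expect w P)^[r] f σ ≤ T := by
  induction r with
  | zero => exact hf
  | succ r ih =>
    intro σ hσ
    rw [Function.iterate_succ_apply']
    exact ((h σ hσ).expect_le (v := fun _ => T) fun s τ hτ => ih τ hτ.1).trans (avg_const _ _).le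

theorem samplesFrom_of_loaded (hM : Mach w c U) (hV : cfg.Valid n (2 ^ (c * w)) U U')
    (hflag : cfg.flag = 1) (hthr : cfg.thr = 1) (hfail : cfg.failProb G cfg.I 0 < 1)
    (hfail2 : cfg.failProb G cfg.I 0 ≤ 1 / 2) {eps : ℝ} {T : ℝ≥0∞}
    (hN : 1 ≤ G.numCliques cfg.k)
    (hp : ∀ p : PMF {s : Finset (Fin n) // G.graph.IsNClique cfg.k s},
      (∀ s, p s = cfg.foundProb G hfail s.1) →
      ∀ s, |(p s).toReal - 1 / (G.numCliques cfg.k : ℝ)| < eps / (G.numCliques cfg.k : ℝ))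
    (hT : 2 * (avg (cfg.search G cfg.I 0) fun q =>
      (((2 ^ q.1 * cfg.roundTime + 8) * U' : ℕ) : ℝ≥0∞)) ≤ T) {σ : State} (hL : cfg.Loaded n σ) :
    SamplesFrom G w cfg.k eps T sampleProgram σ := by
  obtain ⟨s₀, hs₀⟩ : {s : Finset (Fin n) | G.graph.IsNClique cfg.k s}.Nonempty := by
    rw [← Set.ncard_pos]; exact hN
  obtain ⟨p, hp1, hp2⟩ := exists_cliquePMF (A := G.access) hM hV hflag hthr hfail hL ⟨s₀, hs₀⟩
  have htime : ∀ τ, cfg.Loaded n τ → G.access.expTime w sampleProgram τ ≤ T := fun τ hτ =>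
    (expTime_sampleProgram (A := G.access) hM hV hfail2 hτ).trans hT
  exact ⟨⟨p, hp p hp1, fun cs => jointProb_eq_prod (A := G.access) hp2 cs σ hL⟩, fun r =>
    ⟨expect_iterate_le hp2 htime r σ hL, expect_iterate_le hp2
      (fun τ hτ => (G.access.expQueries_le_expTime w _ τ).trans (htime τ hτ)) r σ hL⟩⟩

end Samples

/-! ### Repeated attempts -/

section Tries

variable {α : Type} [Fintype α] (μ : PMF (Option α))

theorem avg_option (v : Option α → ℝ≥0∞) :
    avg μ v = μ none * v none + ∑ s, μ (some s) * v (some s) := by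
  rw [avg, tsum_fintype, Fintype.sum_option]

theorem sum_add_none : ∑ s, μ (some s) + μ none = 1 := by
  rw [← avg_const μ 1, avg_option, add_comm]
  simp

omit [Fintype α] in
theorem triesPMF_one_done (f : ℕ) {x : ℕ} (hx : 1 ≤ x) (o : Option α) :
    triesPMF μ 1 f x o = PMF.pure (x, o) := by
  cases f with
  | zero => rfl
  | succ f => rw [triesPMF, if_neg (by omega)]

theorem avg_triesPMF_one (f : ℕ) (o : Option α) (v : ℕ × Option α → ℝ≥0∞) :
    avg (triesPMF μ 1 (f + 1) 0 o) v =
      μ none * avg (triesPMF μ 1 f 0 none) v + ∑ s, μ (some s) * v (1, some s) := by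
  rw [triesPMF, if_pos (by norm_num), avg_bind, avg_option]
  simp [triesPMF_one_done]

-- The first success occurs after `j` failures. The geometric factor is common to all cliques, so
-- repeating attempts preserves the ratios of their probabilities exactly.
open Classical in
theorem triesPMF_one_apply (s : α) (f : ℕ) : ∀ o,
    avg (triesPMF μ 1 f 0 o) (fun p => if 1 ≤ p.1 ∧ p.2 = some s then 1 else 0) =
      μ (some s) * ∑ j ∈ Finset.range f, μ none ^ j := by
  induction f with
  | zero => intro o; simp [triesPMF]
  | succ f ih =>
    intro o
    rw [avg_triesPMF_one, ih, Finset.sum_range_succ', pow_zero, mul_add, mul_one]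
    congr 1
    · simp only [pow_succ]
      rw [← Finset.sum_mul]; ring
    · simp

theorem triesPMF_one_fail (f : ℕ) : ∀ o,
    avg (triesPMF μ 1 f 0 o) (fun p => if 1 ≤ p.1 then 0 else 1) = μ none ^ f := by
  induction f with
  | zero => intro o; simp [triesPMF]
  | succ f ih =>
    intro o
    rw [avg_triesPMF_one, ih, pow_succ']
    simp

omit [Fintype α] in
theorem avg_triesPMF_zero (f x : ℕ) (o : Option α) (v : ℕ × Option α → ℝ≥0∞) :
    avg (triesPMF μ 0 (f + 1) x o) v =
      avg μ fun o' => avg (triesPMF μ 0 f (x + if o'.isSome then 1 else 0) o') v := by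
  rw [triesPMF, if_pos (by norm_num), avg_bind]

/-- The second moment of the number of successes. -/
theorem triesPMF_zero_moment {q : ℝ} (hq : 0 ≤ q) (hq1 : q ≤ 1)
    (hs : ∑ s, μ (some s) = ENNReal.ofReal q) (a : ℝ) (f : ℕ) : ∀ (x : ℕ) (o : Option α),
    avg (triesPMF μ 0 f x o) (fun p => ENNReal.ofReal (((p.1 : ℝ) - a) ^ 2)) =
      ENNReal.ofReal ((x + q * f - a) ^ 2 + f * (q * (1 - q))) := by
  have hn : μ none = ENNReal.ofReal (1 - q) := by
    rw [ENNReal.ofReal_sub _ hq, ENNReal.ofReal_one, ← hs]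
    refine ENNReal.eq_sub_of_add_eq' (by norm_num) ?_
    rw [add_comm]; exact sum_add_none μ
  -- An arbitrary starting value `x` and centre `a` make the identity stable under one attempt: the
  -- square is averaged over its two shifts, which adds the variance `q * (1 - q)`.
  induction f with
  | zero => intro x o; simp [triesPMF]
  | succ f ih =>
    intro x o
    have h0 : 0 ≤ q * (1 - q) := mul_nonneg hq (by linarith)
    rw [avg_triesPMF_zero, avg_option]
    simp only [ih]
    simp only [Option.isSome_none, Option.isSome_some, if_true, Bool.false_eq_true, if_false]
    rw [← Finset.sum_mul, hs, hn, ← ENNReal.ofReal_mul (by linarith), ← ENNReal.ofReal_mul hq,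
      ← ENNReal.ofReal_add (by have := sub_nonneg.2 hq1; positivity) (by positivity)]
    congr 1
    push_cast
    ring

/-- If no attempt can succeed, then there are no successes. -/
theorem triesPMF_eq_zero (hs : ∀ s, μ (some s) = 0) (flag f : ℕ) : ∀ (x : ℕ) (o : Option α)
    (v : ℕ → ℝ≥0∞), avg (triesPMF μ flag f x o) (fun p => v p.1) = v x := by
  have hn : μ none = 1 := by
    have := sum_add_none μ
    simpa [hs] using this
  induction f with
  | zero => intro x o v; simp [triesPMF]
  | succ f ih =>
    intro x o v
    rw [triesPMF]
    split_ifs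
    · rw [avg_bind, avg_option, hn, one_mul]
      simp [hs, ih]
    · simp

end Tries

theorem avg_markov {O : Type} (μ : PMF O) {v : O → ℝ≥0∞} {E : O → Prop} [DecidablePred E] {c : ℝ}
    (hc : 0 < c) (h : ∀ o, E o → ENNReal.ofReal c ≤ v o) :
    avg μ (fun o => if E o then 1 else 0) ≤ ENNReal.ofReal (1 / c) * avg μ v := by
  rw [← avg_mul_left]
  refine avg_mono μ fun o => ?_
  split_ifs with ho
  · refine le_trans (le_of_eq ?_) (mul_le_mul_right (h o ho) _)
    rw [← ENNReal.ofReal_mul (by positivity), one_div_mul_cancel hc.ne', ENNReal.ofReal_one]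
  · exact zero_le

/-! ### Chebyshev bounds for the number of successes. -/

section Tails

variable {α : Type} [Fintype α] (μ : PMF (Option α)) {q : ℝ}

open Classical in
/-- Chebyshev's inequality for the number of successes. -/
theorem triesPMF_zero_chebyshev (hq : 0 ≤ q) (hq1 : q ≤ 1)
    (hs : ∑ s, μ (some s) = ENNReal.ofReal q) (f : ℕ) {E : ℕ → Prop} {d : ℝ} (hd : 0 < d)
    (hE : ∀ x, E x → d ≤ |(x : ℝ) - q * f|) :
    avg (triesPMF μ 0 f 0 none) (fun p => if E p.1 then 1 else 0) ≤
      ENNReal.ofReal (q * f / d ^ 2) := by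
  refine (avg_markov _ (E := fun p : ℕ × Option α => E p.1) (c := d ^ 2) (by positivity)
    (v := fun p => ENNReal.ofReal (((p.1 : ℝ) - q * f) ^ 2)) fun p hp => ?_).trans ?_
  · refine ENNReal.ofReal_le_ofReal ?_
    rw [← sq_abs ((p.1 : ℝ) - q * f)]
    exact pow_le_pow_left₀ hd.le (hE _ hp) 2
  · rw [triesPMF_zero_moment μ hq hq1 hs, ← ENNReal.ofReal_mul (by positivity)]
    refine ENNReal.ofReal_le_ofReal ?_
    rw [one_div, div_eq_inv_mul]
    refine mul_le_mul_of_nonneg_left ?_ (by positivity)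
    have : 0 ≤ q * q * f := by positivity
    push_cast
    nlinarith

/-- The number of successes is at least `t` but off by the factor `1 ± 1 / (8 * E)`. -/
theorem triesPMF_zero_accuracy (hq : 0 ≤ q) (hq1 : q ≤ 1)
    (hs : ∑ s, μ (some s) = ENNReal.ofReal q) (f : ℕ) {E t : ℕ} (hE : 1 ≤ E) (ht : 1 ≤ t) :
    avg (triesPMF μ 0 f 0 none) (fun p =>
      if t ≤ p.1 ∧ q * f / (8 * E) < |(p.1 : ℝ) - q * f| then 1 else 0) ≤
      ENNReal.ofReal (128 * E ^ 2 / t) := by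
  have hE' : (1 : ℝ) ≤ E := by exact_mod_cast hE
  have ht' : (1 : ℝ) ≤ t := by exact_mod_cast ht
  have hqf : 0 ≤ q * f := by positivity
  -- If the mean is below `t / 2`, merely reaching `t` is a deviation of at least `t / 2`. Otherwise
  -- the relative variance is at most `2 / t`, and the relative deviation `1 / (8 * E)` costs a
  -- factor `64 * E ^ 2`.
  rcases lt_or_ge (2 * (q * f)) t with h | h
  · refine le_trans (le_of_eq (avg_congr _ fun p => by congr)) <|
      (triesPMF_zero_chebyshev μ hq hq1 hs f (d := t / 2) (by positivity)
      (E := fun x => t ≤ x ∧ q * f / (8 * E) < |(x : ℝ) - q * f|) ?_).trans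
      (ENNReal.ofReal_le_ofReal ?_)
    · rintro x ⟨h1, -⟩
      have : (t : ℝ) ≤ x := by exact_mod_cast h1
      exact le_trans (by linarith) (le_abs_self _)
    · rw [div_le_div_iff₀ (by positivity) (by positivity)]
      have h1 : (1 : ℝ) ≤ E ^ 2 := one_le_pow₀ hE'
      nlinarith [mul_nonneg hqf (show (0 : ℝ) ≤ t by linarith), mul_nonneg (sub_nonneg.2 h1)
        (sq_nonneg (t : ℝ))]
  · have hpos : 0 < q * f := by linarith
    refine le_trans (le_of_eq (avg_congr _ fun p => by congr)) <|
      (triesPMF_zero_chebyshev μ hq hq1 hs f (d := q * f / (8 * E)) (by positivity)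
      (E := fun x => t ≤ x ∧ q * f / (8 * E) < |(x : ℝ) - q * f|) ?_).trans
      (ENNReal.ofReal_le_ofReal ?_)
    · rintro x ⟨-, h1⟩
      exact h1.le
    · have : q * f / (q * f / (8 * E)) ^ 2 = 64 * E ^ 2 / (q * f) := by
        field_simp; ring
      rw [this, div_le_div_iff₀ hpos (by positivity)]
      nlinarith [sq_nonneg (E : ℝ)]

theorem triesPMF_zero_fail (hq : 0 ≤ q) (hq1 : q ≤ 1)
    (hs : ∑ s, μ (some s) = ENNReal.ofReal q) (f : ℕ) {t : ℕ} (ht : 1 ≤ t)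
    (h : 2 * (t : ℝ) ≤ q * f) :
    avg (triesPMF μ 0 f 0 none) (fun p => if t ≤ p.1 then 0 else 1) ≤
      ENNReal.ofReal (2 / t) := by
  have ht' : (1 : ℝ) ≤ t := by exact_mod_cast ht
  have hpos : 0 < q * f := by linarith
  refine le_trans (avg_mono _ fun p => ?_) <|
    (triesPMF_zero_chebyshev μ hq hq1 hs f (d := q * f / 2) (by positivity)
    (E := fun x => x < t) ?_).trans (ENNReal.ofReal_le_ofReal ?_)
  · by_cases hp : t ≤ p.1
    · simp [hp]
    · simp [hp, not_le.1 hp]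
  · intro x hx
    have : (x : ℝ) ≤ t := by exact_mod_cast hx.le
    rw [abs_sub_comm]
    exact le_trans (by linarith) (le_abs_self _)
  · have : q * f / (q * f / 2) ^ 2 = 4 / (q * f) := by field_simp; ring
    rw [this, div_le_div_iff₀ hpos (by positivity)]
    linarith

end Tails

/-! ### The probabilities of the cliques in one attempt -/

theorem Ref.apply_eq_zero {n : ℕ} {A : Access n} {w : ℕ} {O : Type} {P : Cmd} {σ : State}
    {μ : PMF O} {Q : O → State → Prop} (h : Ref A w P σ μ Q) {a : O} (ha : ∀ τ, ¬ Q a τ) :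
    μ a = 0 := by
  classical
  rw [← avg_single μ a]
  refine le_antisymm ((h _ (fun _ => 0) fun o τ ho => ?_).trans (A.expect_const_le w 0 P σ))
    zero_le
  have hoa : o ≠ a := by rintro rfl; exact ha τ ho
  simp [hoa]

section Support

variable {n : ℕ} [NeZero n] (G : QueryGraph n)

omit [NeZero n] in
theorem apply_eq_zero_of_run {A : Access n} {w U t k : ℕ} {P : Cmd} {σ : State}
    {cls : Finset (Fin n) → Prop} {μ : PMF (Option (Finset (Fin n)))}
    (h : Run A w U P t σ μ (SamplerPost k cls σ)) {s : Finset (Fin n)} (hs : ¬ cls s) :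
    μ (some s) = 0 :=
  (h σ (SameMem.refl σ)).apply_eq_zero fun _ ⟨_, h1, _, _⟩ => hs h1.2.1

/-- A statement on distributions read off from the programs: these are run with the word length `n +
k + γ + mbar`, where all inputs fit, and their postcondition excludes sets outside the class. -/
theorem samplers_eq_zero {k γ mbar : ℕ} (hk2 : 2 ≤ k) (hγ1 : 1 ≤ γ) (D : PMF (Option (Fin n)))
    (s : Finset (Fin n)) :
    (¬ G.IsLowClique k γ s → (lowPMF G k γ).map (G.verified k) (some s) = 0) ∧
    (¬ G.IsMediumClique k γ mbar s → (mediumPMF G D k γ mbar).map (G.verified k) (some s) = 0) ∧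
    (¬ G.IsHighClique k mbar s → (highPMF G D k γ mbar).map (G.verified k) (some s) = 0) := by
  set w := n + k + γ + mbar with hw
  have hlt : w < 2 ^ (1 * w) := by rw [one_mul]; exact Nat.lt_two_pow_self
  have hM : Mach w 1 (10 ^ 8) := ⟨by omega, le_rfl, by norm_num⟩
  have hQ := accesses_sample ⟨G, D⟩ hM
  have e1 : (State.start [n, k, γ, mbar]).reg 1 = n := rfl
  have e2 : (State.start [n, k, γ, mbar]).reg 2 = k := rfl
  have e3 : (State.start [n, k, γ, mbar]).reg 3 = γ := rfl
  have e4 : (State.start [n, k, γ, mbar]).reg 4 = mbar := rfl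
  exact ⟨apply_eq_zero_of_run (run_lowSampler (A := ⟨G, D⟩) hM hk2 (by omega) (by omega) hγ1
      (by omega) e1 e2 e3),
    apply_eq_zero_of_run (run_mediumSampler (A := ⟨G, D⟩) hM hQ hk2 (by omega) (by omega)
      (by omega) (by omega) trivial e2 e3 e4),
    apply_eq_zero_of_run (run_highSampler (A := ⟨G, D⟩) hM hQ hk2 (by omega) (by omega)
      (by omega) (by omega) trivial e2 e3 e4)⟩

end Support

/-! ### All cliques are nearly equally likely in one attempt. -/

section Attempt

variable {n : ℕ} [NeZero n] (G : QueryGraph n)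

theorem attemptPMF_apply {k γ θ : ℕ} (hZ : 1 ≤ totalWeight n k γ θ) (S : List (Fin n))
    (s : Finset (Fin n)) :
    attemptPMF G k γ θ S (some s) =
      (((n * γ ^ (k - 1) : ℕ) : ℝ≥0∞) * (lowPMF G k γ).map (G.verified k) (some s) +
        ((2 * θ ^ k : ℕ) : ℝ≥0∞) * (mediumPMF G (dsPMF G S (2 * (θ * θ) * S.length)) k γ
          (θ * θ)).map (G.verified k) (some s) +
        (((2 * θ) ^ k : ℕ) : ℝ≥0∞) * (highPMF G (dsPMF G S (2 * (θ * θ) * S.length)) k γ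
          (θ * θ)).map (G.verified k) (some s)) / (totalWeight n k γ θ : ℕ) := by
  classical
  rw [← avg_single, attemptPMF, avg_bind, avg_unif, max_eq_right hZ]
  congr 1
  rw [totalWeight, Finset.sum_range_add, Finset.sum_range_add]
  congr 1
  · congr 1
    · rw [Finset.sum_congr rfl (g := fun _ => (lowPMF G k γ).map (G.verified k) (some s)),
        Finset.sum_const, Finset.card_range, nsmul_eq_mul]
      intro x hx
      rw [if_pos (Finset.mem_range.1 hx), avg_single]
    · rw [Finset.sum_congr rfl (g := fun _ => (mediumPMF G (dsPMF G S (2 * (θ * θ) * S.length)) k γ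
        (θ * θ)).map (G.verified k) (some s)), Finset.sum_const, Finset.card_range, nsmul_eq_mul]
      intro x hx
      rw [if_neg (by omega), if_pos (by have := Finset.mem_range.1 hx; omega), avg_single]
  · rw [Finset.sum_congr rfl (g := fun _ => (highPMF G (dsPMF G S (2 * (θ * θ) * S.length)) k γ
      (θ * θ)).map (G.verified k) (some s)), Finset.sum_const, Finset.card_range, nsmul_eq_mul]
    intro x hx
    rw [if_neg (by omega), if_neg (by omega), avg_single]

theorem one_le_totalWeight {k γ θ : ℕ} (hγ : 1 ≤ γ) : 1 ≤ totalWeight n k γ θ := by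
  have : 1 ≤ n * γ ^ (k - 1) := Nat.mul_pos (Nat.pos_of_ne_zero (NeZero.ne n)) (pow_pos hγ _)
  rw [totalWeight]; omega

theorem attemptPMF_eq_zero {k γ θ : ℕ} (hk : 2 ≤ k) (hγ : 1 ≤ γ) (S : List (Fin n))
    {s : Finset (Fin n)} (hs : ¬ G.graph.IsNClique k s) : attemptPMF G k γ θ S (some s) = 0 := by
  obtain ⟨h1, h2, h3⟩ := samplers_eq_zero G (mbar := θ * θ) hk hγ
    (dsPMF G S (2 * (θ * θ) * S.length)) s
  rw [attemptPMF_apply G (one_le_totalWeight hγ), h1 fun h => hs h.1, h2 fun h => hs h.1,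
    h3 fun h => hs h.1]
  simp

/-- A clique has exactly one type, so only one sampler can return it, and the weight of this sampler
is the reciprocal of its ideal probability. The error of the high case, a `k`-th power, dominates
the others. As `mbar = θ * θ`, its square root is the integer `θ` and all weights are integers. -/
theorem attemptPMF_bounds {eps : ℝ} (h0 : 0 ≤ eps) (h1 : eps ≤ 1) {k γ θ : ℕ} (hk : 2 ≤ k)
    (hγ : 1 ≤ γ) (hγθ : γ ≤ θ) {S : List (Fin n)} (hS : G.IsTypicalMultiset eps γ (θ * θ) S)
    (hw : weight G S ≤ 2 * (θ * θ) * S.length) {s : Finset (Fin n)}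
    (hs : G.graph.IsNClique k s) :
    ENNReal.ofReal ((1 - eps) ^ k / (totalWeight n k γ θ : ℕ)) ≤ attemptPMF G k γ θ S (some s) ∧
      attemptPMF G k γ θ S (some s) ≤
        ENNReal.ofReal ((1 + eps) ^ k / (totalWeight n k γ θ : ℕ)) := by
  have hZ := one_le_totalWeight (n := n) (k := k) (θ := θ) hγ
  have hZ' : (0 : ℝ) < (totalWeight n k γ θ : ℕ) := by exact_mod_cast hZ
  have hθ : 1 ≤ θ := hγ.trans hγθ
  have hm : 1 ≤ θ * θ := Nat.mul_pos hθ hθ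
  have hθ' : (0 : ℝ) < θ := by exact_mod_cast hθ
  have hγ' : (0 : ℝ) < γ := by exact_mod_cast hγ
  have hn' : (0 : ℝ) < n := by exact_mod_cast Nat.pos_of_ne_zero (NeZero.ne n)
  have hsq : √((θ * θ : ℕ) : ℝ) = θ := by rw [Nat.cast_mul, Real.sqrt_mul_self hθ'.le]
  have hD := isTypicalDS_dsPMF G hm hS hw
  set D := dsPMF G S (2 * (θ * θ) * S.length)
  obtain ⟨z1, z2, z3⟩ := samplers_eq_zero G (mbar := θ * θ) hk hγ D s
  rw [attemptPMF_apply G hZ, ENNReal.ofReal_div_of_pos hZ', ENNReal.ofReal_div_of_pos hZ',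
    ENNReal.ofReal_natCast]
  have l1 : (1 - eps) ^ k ≤ 1 - eps := pow_le_of_le_one (by linarith) (by linarith) (by omega)
  have l2 : 1 + eps ≤ (1 + eps) ^ k := le_self_pow₀ (by linarith) (by omega)
  refine and_imp.2 (fun h h' => ⟨ENNReal.div_le_div_right h _, ENNReal.div_le_div_right h' _⟩) ?_
  have mulNat : ∀ (a : ℕ) (x : ℝ), (a : ℝ≥0∞) * ENNReal.ofReal x = ENNReal.ofReal (a * x) :=
    fun a x => by rw [ENNReal.ofReal_mul (by positivity), ENNReal.ofReal_natCast]
  rcases le_or_gt (G.minDeg s) γ with hlow | hlow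
  · have hl : G.IsLowClique k γ s := ⟨hs, hlow⟩
    rw [z2 fun h => absurd h.2.1 (by omega), z3 fun h => by
      have h2 := h.2
      rw [hsq] at h2
      have : θ < G.minDeg s := by exact_mod_cast h2
      omega, low_prob hk hγ hl, mul_zero, mul_zero, add_zero, add_zero, mulNat]
    have : ((n * γ ^ (k - 1) : ℕ) : ℝ) * (1 / ((n : ℝ) * (γ : ℝ) ^ (k - 1))) = 1 := by
      push_cast; field_simp
    rw [this]
    exact ⟨ENNReal.ofReal_le_ofReal (by linarith), ENNReal.ofReal_le_ofReal (by linarith)⟩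
  rcases le_or_gt (G.minDeg s) θ with hmed | hhigh
  · have hm' : G.IsMediumClique k γ (θ * θ) s := ⟨hs, hlow, by rw [hsq]; exact_mod_cast hmed⟩
    obtain ⟨b1, b2⟩ := medium_prob hk hm hD hm'
    rw [z1 fun h => absurd h.2 (by omega), z3 fun h => by
      have h2 := h.2
      rw [hsq] at h2
      have : θ < G.minDeg s := by exact_mod_cast h2
      omega, mul_zero, mul_zero, add_zero, zero_add]
    rw [hsq] at b1 b2
    have key : ∀ x : ℝ, ((2 * θ ^ k : ℕ) : ℝ≥0∞) * ENNReal.ofReal (x * (1 / (2 * (θ : ℝ) ^ k))) =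
        ENNReal.ofReal x := fun x => by
      rw [mulNat]; congr 1; push_cast; field_simp
    refine ⟨(ENNReal.ofReal_le_ofReal l1).trans ?_, le_trans ?_ (ENNReal.ofReal_le_ofReal l2)⟩
    · rw [← key]; exact mul_le_mul_right b1 _
    · rw [← key]; exact mul_le_mul_right b2 _
  · have hh : G.IsHighClique k (θ * θ) s := ⟨hs, by rw [hsq]; exact_mod_cast hhigh⟩
    obtain ⟨b1, b2⟩ := high_prob h0 h1 hm (by rw [hsq]; exact_mod_cast hγθ) hD hh
    rw [z1 fun h => absurd h.2 (by omega), z2 fun h => by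
      have h2 := h.2.2
      rw [hsq] at h2
      have : G.minDeg s ≤ θ := by exact_mod_cast h2
      omega, mul_zero, mul_zero, zero_add, zero_add]
    rw [hsq] at b1 b2
    have key : ∀ x : ℝ, (((2 * θ) ^ k : ℕ) : ℝ≥0∞) *
        ENNReal.ofReal (x * (1 / (2 ^ k * (θ : ℝ) ^ k))) = ENNReal.ofReal x := fun x => by
      rw [mulNat]; congr 1; push_cast; rw [mul_pow]; field_simp
    constructor
    · rw [← key]; exact mul_le_mul_right b1 _
    · rw [← key]; exact mul_le_mul_right b2 _

end Attempt

/-- Bernoulli's inequality. Typicality is demanded with the error `y / k`, so that the `k`-th power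
in the high case has only the error `y`. -/
theorem one_sub_pow_ge {k : ℕ} (hk : 1 ≤ k) {y : ℝ} (h1 : y ≤ 1) :
    1 - y ≤ (1 - y / k) ^ k := by
  have hk' : (1 : ℝ) ≤ k := by exact_mod_cast hk
  have h2 : y / k ≤ 1 := by rw [div_le_one (by positivity)]; linarith
  have := one_add_mul_le_pow (a := -(y / k)) (by linarith) k
  have h3 : (k : ℝ) * -(y / k) = -y := by field_simp
  rw [h3] at this
  simpa [sub_eq_add_neg] using this

/-- Via `(1 + y / k) ^ k ≤ exp y ≤ 1 / (1 - y)`; the bound `y ≤ 1 / 2` turns the last term into `1 +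
2 * y`. -/
theorem one_add_pow_le {k : ℕ} (hk : 1 ≤ k) {y : ℝ} (h0 : 0 ≤ y) (h1 : y ≤ 1 / 2) :
    (1 + y / k) ^ k ≤ 1 + 2 * y := by
  have hk' : (1 : ℝ) ≤ k := by exact_mod_cast hk
  have h2 : (1 + y / k) ^ k ≤ Real.exp y := by
    calc (1 + y / k) ^ k ≤ Real.exp (y / k) ^ k :=
          pow_le_pow_left₀ (by positivity) (by linarith [Real.add_one_le_exp (y / k)]) k
      _ = Real.exp y := by rw [← Real.exp_nat_mul]; congr 1; field_simp
  refine h2.trans ((Real.exp_bound_div_one_sub_of_interval h0 (by linarith)).trans ?_)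
  rw [div_le_iff₀ (by linarith)]
  nlinarith

/-! ### Random lists of vertices are typical -/

section ListPMF

variable {n : ℕ} [NeZero n] (G : QueryGraph n)

theorem avg_listPMF_succ (m : ℕ) (v : List (Fin n) → ℝ≥0∞) :
    avg (listPMF n (m + 1)) v = avg (unifFin n) fun u => avg (listPMF n m) fun S => v (u :: S) := by
  rw [listPMF, avg_bind]
  exact avg_congr _ fun u => avg_map _ _ _

theorem avg_listPMF_mono {m : ℕ} : ∀ {v v' : List (Fin n) → ℝ≥0∞},
    (∀ S, S.length = m → v S ≤ v' S) → avg (listPMF n m) v ≤ avg (listPMF n m) v' := by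
  induction m with
  | zero => intro v v' h; simpa [listPMF] using h [] rfl
  | succ m ih =>
    intro v v' h
    rw [avg_listPMF_succ, avg_listPMF_succ]
    exact avg_mono _ fun u => ih fun S hS => h _ (by simp [hS])

theorem avg_listPMF_prod (g : Fin n → ℝ≥0∞) (m : ℕ) :
    avg (listPMF n m) (fun S => (S.map g).prod) = avg (unifFin n) g ^ m := by
  induction m with
  | zero => simp [listPMF]
  | succ m ih =>
    rw [avg_listPMF_succ, pow_succ]
    simp only [List.map_cons, List.prod_cons, avg_mul_left, ih]
    simp only [mul_comm (g _)]
    rw [avg_mul_left]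

/-- A uniform vertex has mean degree `G.m / n`, and the scaling by `n` in `weight` removes the
denominator. -/
theorem avg_listPMF_weight (m : ℕ) :
    avg (listPMF n m) (fun S => (weight G S : ℝ≥0∞)) = m * G.m := by
  have hn : (n : ℝ≥0∞) ≠ 0 := by exact_mod_cast NeZero.ne n
  induction m with
  | zero => simp [listPMF, weight]
  | succ m ih =>
    rw [avg_listPMF_succ]
    simp only [weight_cons, Nat.cast_add, avg_add, avg_const, ih]
    rw [avg_unifFin, QueryGraph.m, ← Nat.cast_sum, ← Finset.mul_sum, Nat.cast_mul, mul_div_assoc,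
      ENNReal.mul_div_cancel hn (by simp)]
    push_cast; ring

theorem weight_markov (m : ℕ) :
    avg (listPMF n m) (fun S => if 4 * m * G.m < weight G S then 1 else 0) ≤
      ENNReal.ofReal (1 / 4) := by
  -- The strict inequality between integers gives one unit more, which also keeps the threshold
  -- positive when there are no edges.
  refine (avg_markov _ (c := ((4 * m * G.m + 1 : ℕ) : ℝ)) (by positivity)
    (v := fun S => (weight G S : ℝ≥0∞)) fun S hS => ?_).trans ?_
  · rw [ENNReal.ofReal_natCast]
    exact_mod_cast hS
  · rw [avg_listPMF_weight, ← Nat.cast_mul, ← ENNReal.ofReal_natCast,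
      ← ENNReal.ofReal_mul (by positivity)]
    refine ENNReal.ofReal_le_ofReal ?_
    rw [one_div_mul_eq_div, div_le_div_iff₀ (by positivity) (by norm_num)]
    push_cast
    nlinarith

omit [NeZero n] in
theorem degIn_cons (u : Fin n) (S : Multiset (Fin n)) (v : Fin n) [Decidable (G.graph.Adj v u)] :
    G.degIn (u ::ₘ S) v = (if G.graph.Adj v u then 1 else 0) + G.degIn S v := by
  classical
  simp only [QueryGraph.degIn]
  split_ifs with h
  · rw [Multiset.filter_cons_of_pos _ h, Multiset.card_cons, add_comm]
  · rw [Multiset.filter_cons_of_neg _ h, zero_add]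

/-- A Chernoff bound for the number of neighbours of `v` in a random list. -/
theorem degIn_tail (v : Fin n) (m : ℕ) {t : ℝ} (ht : |t| ≤ 1) (a : ℝ) (E : List (Fin n) → Prop)
    [DecidablePred E] (hE : ∀ S : List (Fin n), E S → t * a ≤ t * G.degIn S v) :
    avg (listPMF n m) (fun S => if E S then 1 else 0) ≤
      ENNReal.ofReal (Real.exp (m * (G.deg v / n) * (t + t ^ 2) - t * a)) := by
  classical
  have hn : (0 : ℝ) < n := by exact_mod_cast Nat.pos_of_ne_zero (NeZero.ne n)
  set g : Fin n → ℝ≥0∞ := fun u =>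
    ENNReal.ofReal (Real.exp (t * if G.graph.Adj v u then 1 else 0)) with hg
  have hprod : ∀ S : List (Fin n), (S.map g).prod = ENNReal.ofReal (Real.exp (t * G.degIn S v)) := by
    intro S
    induction S with
    | nil => simp [QueryGraph.degIn]
    | cons u S ih =>
      rw [List.map_cons, List.prod_cons, ih, hg, ← ENNReal.ofReal_mul (by positivity),
        ← Real.exp_add, ← Multiset.cons_coe, degIn_cons]
      congr 2
      push_cast
      ring
  have hcard : (Finset.univ.filter fun u => G.graph.Adj v u).card = G.deg v := by
    rw [G.deg_eq_degree, ← SimpleGraph.card_neighborFinset_eq_degree]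
    congr 1; ext u; simp
  have hmean : avg (unifFin n) g ≤ ENNReal.ofReal (Real.exp (G.deg v / n * (t + t ^ 2))) := by
    rw [avg_unifFin, ← ENNReal.ofReal_sum_of_nonneg (fun u _ => by positivity),
      ← ENNReal.ofReal_natCast n, ← ENNReal.ofReal_div_of_pos hn]
    refine ENNReal.ofReal_le_ofReal ?_
    have hsum : ∑ u, Real.exp (t * if G.graph.Adj v u then 1 else 0) =
        n + G.deg v * (Real.exp t - 1) := by
      have : ∀ u, Real.exp (t * if G.graph.Adj v u then 1 else 0) =
          1 + if G.graph.Adj v u then Real.exp t - 1 else 0 := fun u => by split_ifs <;> simp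
      simp only [this, Finset.sum_add_distrib, ← Finset.sum_filter, Finset.sum_const, hcard]
      simp
    -- The only estimate of the moment generating function that is needed; it holds for both signs
    -- of `t`, so that one lemma serves both tails.
    have hexp : Real.exp t - 1 ≤ t + t ^ 2 := by
      have := (abs_le.1 (Real.abs_exp_sub_one_sub_id_le ht)).2
      linarith
    rw [hsum, add_div, div_self hn.ne', mul_div_right_comm, add_comm]
    refine le_trans ?_ (Real.add_one_le_exp _)
    have : (0 : ℝ) ≤ G.deg v / n := by positivity
    nlinarith
  refine (avg_markov _ (c := Real.exp (t * a)) (Real.exp_pos _) (v := fun S => (S.map g).prod)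
    fun S hS => ?_).trans ?_
  · rw [hprod]
    exact ENNReal.ofReal_le_ofReal (Real.exp_le_exp.2 (hE S hS))
  · rw [avg_listPMF_prod]
    refine (mul_le_mul_right (pow_le_pow_left' hmean m) _).trans (le_of_eq ?_)
    rw [← ENNReal.ofReal_pow (by positivity), ← ENNReal.ofReal_mul (by positivity),
      ← Real.exp_nat_mul, one_div, ← Real.exp_neg, ← Real.exp_add]
    congr 2
    ring

/-- The list `S` drawn in the round with parameter `B` is typical. -/
def Good (eps : ℝ) (B : ℕ) (S : List (Fin n)) : Prop :=
  G.IsTypicalMultiset eps (gamma n B) (thetaOf G B S * thetaOf G B S) S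

omit [NeZero n] in
theorem weight_le_theta {B K : ℕ} (hB : 1 ≤ B) (hK : 1 ≤ K) {S : List (Fin n)}
    (hS : S.length = B * K) :
    weight G S ≤ 2 * (thetaOf G B S * thetaOf G B S) * S.length := by
  have := theta_spec (γ := gamma n B) (s := S.length) (t := weight G S)
    (Nat.succ_le_succ (Nat.zero_le _)) (by rw [hS]; exact Nat.mul_pos hB hK)
  rw [thetaOf]
  linarith

-- A union bound over the vertices and the two tails. With `t = ± eps / 2` the exponent in
-- `degIn_tail` becomes `-(μ * eps ^ 2 / 4)` for the expected number `μ` of neighbours in the list.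
open Classical in
theorem not_good_le {eps : ℝ} (h0 : 0 < eps) (h1 : eps ≤ 1) {B K : ℕ} (hB : 1 ≤ B) (hK : 1 ≤ K) :
    avg (listPMF n (B * K)) (fun S => if Good G eps B S then 0 else 1) ≤
      ENNReal.ofReal (2 * n * Real.exp (-(K * eps ^ 2 / 4))) := by
  have hn : (0 : ℝ) < n := by exact_mod_cast Nat.pos_of_ne_zero (NeZero.ne n)
  have hB' : (0 : ℝ) < B := by exact_mod_cast hB
  let lower : Fin n → List (Fin n) → Prop := fun v S => gamma n B < G.deg v ∧
    (G.degIn S v : ℝ) < (1 - eps) * ((B * K : ℕ) * (G.deg v / n : ℝ))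
  let upper : Fin n → List (Fin n) → Prop := fun v S => gamma n B < G.deg v ∧
    (1 + eps) * ((B * K : ℕ) * (G.deg v / n : ℝ)) < G.degIn S v
  -- This is the purpose of `γ = n / B + 1`: a degree above it exceeds `n / B`, so a list of `B * K`
  -- vertices contains at least `K` neighbours on average.
  have hp : ∀ v, gamma n B < G.deg v → (K : ℝ) ≤ (B * K : ℕ) * (G.deg v / n : ℝ) := by
    intro v hv
    have h2 : (n : ℝ) / B < G.deg v := by
      have h3 : (n : ℝ) / B < (n / B : ℕ) + 1 := by
        rw [div_lt_iff₀ hB']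
        exact_mod_cast Nat.lt_mul_of_div_lt (Nat.lt_succ_self (n / B)) hB
      refine h3.trans ?_
      rw [gamma] at hv
      exact_mod_cast hv
    rw [div_lt_iff₀ hB'] at h2
    rw [Nat.cast_mul, mul_div_assoc', le_div_iff₀ hn]
    nlinarith [show (0 : ℝ) ≤ K by positivity]
  have abs1 : |eps / 2| ≤ 1 := by rw [abs_of_pos (by positivity)]; linarith
  have tail : ∀ v, avg (listPMF n (B * K)) (fun S => if lower v S then 1 else 0) +
      avg (listPMF n (B * K)) (fun S => if upper v S then 1 else 0) ≤
      ENNReal.ofReal (2 * Real.exp (-(K * eps ^ 2 / 4))) := by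
    intro v
    by_cases hv : gamma n B < G.deg v
    · have hp := hp v hv
      set μ : ℝ := (B * K : ℕ) * (G.deg v / n : ℝ) with hμ
      have ineq : ∀ x, x = -(μ * eps ^ 2 / 4) → ENNReal.ofReal (Real.exp x) ≤
          ENNReal.ofReal (Real.exp (-(K * eps ^ 2 / 4))) := by
        rintro x rfl
        refine ENNReal.ofReal_le_ofReal (Real.exp_le_exp.2 ?_)
        have := sq_nonneg eps
        nlinarith
      rw [two_mul, ENNReal.ofReal_add (by positivity) (by positivity)]
      refine add_le_add ((degIn_tail G v (B * K) (t := -(eps / 2)) (by rwa [abs_neg])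
        ((1 - eps) * μ) _ fun S hS => ?_).trans (ineq _ ?_))
        ((degIn_tail G v (B * K) (t := eps / 2) abs1 ((1 + eps) * μ) _ fun S hS => ?_).trans
          (ineq _ ?_))
      · have := hS.2
        nlinarith
      · rw [hμ]; ring
      · have := hS.2
        nlinarith
      · rw [hμ]; ring
    · simp [lower, upper, hv]
  refine (avg_listPMF_mono (v' := fun S => ∑ v ∈ Finset.univ,
    ((if lower v S then 1 else 0) + if upper v S then 1 else 0)) fun S hS => ?_).trans ?_
  · split_ifs with hg
    · exact zero_le
    · have hl : (0 : ℝ) < S.length := by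
        rw [hS]; exact_mod_cast Nat.mul_pos hB hK
      have hS0 : (S : Multiset (Fin n)) ≠ 0 := by
        intro h; rw [← Multiset.card_eq_zero] at h; simp at h; simp [h] at hl
      -- The condition on the degree sum holds for every list, by the choice of the threshold.
      have hdeg : ((((S : Multiset (Fin n)).map G.deg).sum : ℕ) : ℝ) ≤
          2 * (S : Multiset (Fin n)).card *
            (((thetaOf G B S * thetaOf G B S : ℕ) : ℝ) / n : ℝ) := by
        have h := weight_le_theta G hB hK hS
        rw [weight] at h
        have h' : (n : ℝ) * (S.map G.deg).sum ≤
            2 * (thetaOf G B S * thetaOf G B S : ℕ) * S.length := by exact_mod_cast h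
        rw [mul_div_assoc', le_div_iff₀ hn]
        simp only [Multiset.map_coe, Multiset.sum_coe, Multiset.coe_card]
        linarith
      obtain ⟨v, hv⟩ : ∃ v, lower v S ∨ upper v S := by
        by_contra! hne
        refine hg ⟨hS0, fun v hv => ?_, hdeg⟩
        have := hne v
        simp only [lower, upper, hv, true_and, not_lt, ← hS] at this
        exact this
      refine le_trans ?_ (Finset.single_le_sum (f := fun v => ((if lower v S then (1 : ℝ≥0∞)
        else 0) + if upper v S then 1 else 0)) (fun _ _ => zero_le) (Finset.mem_univ v))
      rcases hv with hv | hv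
      · simp only [if_pos hv]; exact le_self_add
      · simp only [if_pos hv]; exact le_add_self
  · rw [avg_finset_sum]
    simp only [avg_add]
    refine (Finset.sum_le_sum fun v _ => tail v).trans (le_of_eq ?_)
    rw [Finset.sum_const, Finset.card_univ, Fintype.card_fin, nsmul_eq_mul,
      ← ENNReal.ofReal_natCast, ← ENNReal.ofReal_mul (by positivity)]
    congr 1; ring

end ListPMF

/-! ### The effort that is needed -/

section Effort

variable {n : ℕ} (G : QueryGraph n) {k : ℕ}

/-- The main term of the complexity. -/
def effort (k : ℕ) : ℝ :=
  (n : ℝ) / (G.numCliques k : ℝ) ^ (1 / (k : ℝ)) +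
    (G.m : ℝ) ^ ((k : ℝ) / 2) / (G.numCliques k : ℝ)

open Classical in
theorem numCliques_eq : G.numCliques k =
    (Finset.univ.filter fun s : Finset (Fin n) => G.graph.IsNClique k s).card := by
  rw [QueryGraph.numCliques, ← Set.ncard_coe_finset]
  congr 1; ext s; simp

theorem numCliques_le : G.numCliques k ≤ n ^ k := by
  classical
  rw [numCliques_eq]
  calc _ ≤ (Finset.univ.powersetCard k : Finset (Finset (Fin n))).card := by
        refine Finset.card_le_card fun s hs => ?_
        rw [Finset.mem_filter] at hs
        rw [Finset.mem_powersetCard]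
        exact ⟨Finset.subset_univ _, hs.2.card_eq⟩
    _ = n.choose k := by rw [Finset.card_powersetCard, Finset.card_univ, Fintype.card_fin]
    _ ≤ n ^ k := Nat.choose_le_pow n k

theorem root_bounds (hk : 2 ≤ k) (hN : 1 ≤ G.numCliques k) :
    1 ≤ (G.numCliques k : ℝ) ^ (1 / (k : ℝ)) ∧ (G.numCliques k : ℝ) ^ (1 / (k : ℝ)) ≤ n ∧
      ((G.numCliques k : ℝ) ^ (1 / (k : ℝ))) ^ k = G.numCliques k := by
  have hk' : (k : ℝ) ≠ 0 := by
    have : k ≠ 0 := by omega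
    exact_mod_cast this
  have hN' : (1 : ℝ) ≤ G.numCliques k := by exact_mod_cast hN
  refine ⟨Real.one_le_rpow hN' (by positivity), ?_, ?_⟩
  · have h : (G.numCliques k : ℝ) ≤ (n : ℝ) ^ k := by exact_mod_cast numCliques_le G
    calc (G.numCliques k : ℝ) ^ (1 / (k : ℝ)) ≤ ((n : ℝ) ^ k) ^ (1 / (k : ℝ)) :=
          Real.rpow_le_rpow (by positivity) h (by positivity)
      _ = n := by
          rw [one_div]; exact Real.pow_rpow_inv_natCast (by positivity) (by omega)
  · rw [one_div]; exact Real.rpow_inv_natCast_pow (by positivity) (by omega)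

theorem one_le_effort (hk : 2 ≤ k) (hN : 1 ≤ G.numCliques k) : 1 ≤ effort G k := by
  obtain ⟨h1, h2, -⟩ := root_bounds G hk hN
  have h3 : 1 ≤ (n : ℝ) / (G.numCliques k : ℝ) ^ (1 / (k : ℝ)) := by
    rwa [le_div_iff₀ (by linarith), one_mul]
  have h4 : 0 ≤ (G.m : ℝ) ^ ((k : ℝ) / 2) / (G.numCliques k : ℝ) := by positivity
  rw [effort]; linarith

theorem m_le_sq : G.m ≤ n * n := by
  calc G.m ≤ ∑ _v : Fin n, n := Finset.sum_le_sum fun v _ => (G.deg_lt v).le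
    _ = n * n := by simp

theorem effort_le (hk : 2 ≤ k) (hn : 1 ≤ n) (hN : 1 ≤ G.numCliques k) :
    effort G k ≤ 2 * (n : ℝ) ^ k := by
  obtain ⟨h1, h2, -⟩ := root_bounds G hk hN
  have hn' : (1 : ℝ) ≤ n := by exact_mod_cast hn
  have h3 : (n : ℝ) / (G.numCliques k : ℝ) ^ (1 / (k : ℝ)) ≤ (n : ℝ) ^ k :=
    (div_le_self (by positivity) h1).trans (le_self_pow₀ hn' (by omega))
  have h4 : (G.m : ℝ) ^ ((k : ℝ) / 2) / (G.numCliques k : ℝ) ≤ (n : ℝ) ^ k := by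
    refine (div_le_self (by positivity) (by exact_mod_cast hN)).trans ?_
    rw [rpow_half]
    refine pow_le_pow_left₀ (by positivity) ?_ k
    rw [Real.sqrt_le_left (by positivity), sq]
    exact_mod_cast m_le_sq G
  rw [effort]; linarith

/-- Each of the three weights is at most a third of `N * B`. With `u = N ^ (1 / k)`, the term `n /
u` of the effort gives `γ ≤ 2 * u` and controls the low weight; the high weight dominates the medium
one and is controlled by whichever case of `theta_eq_or` applies. -/
theorem totalWeight_le_mul (hk : 2 ≤ k) (hn : 1 ≤ n) (hN : 1 ≤ G.numCliques k) {B K : ℕ}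
    (hK : 1 ≤ K) (hB : 3 * 6 ^ k * effort G k ≤ B) {S : List (Fin n)} (hS : S.length = B * K)
    (hw : weight G S ≤ 4 * (B * K) * G.m) :
    (totalWeight n k (gamma n B) (thetaOf G B S) : ℝ) ≤ G.numCliques k * B := by
  obtain ⟨u1, u2, u3⟩ := root_bounds G hk hN
  have hN' : (1 : ℝ) ≤ G.numCliques k := by exact_mod_cast hN
  set N : ℝ := (G.numCliques k : ℝ) with hNdef
  set u : ℝ := N ^ (1 / (k : ℝ)) with hu
  set γ := gamma n B with hγ
  set θ := thetaOf G B S with hθ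
  have hu0 : 0 < u := by linarith
  have hM0 : 0 ≤ (G.m : ℝ) ^ ((k : ℝ) / 2) / N := by positivity
  have hnu : 1 ≤ n / u := by rwa [le_div_iff₀ hu0, one_mul]
  have h6 : (1 : ℝ) ≤ 6 ^ k := one_le_pow₀ (by norm_num)
  have hB1 : 3 * 6 ^ k * (n / u) ≤ B := by
    refine le_trans ?_ hB
    rw [effort]
    exact mul_le_mul_of_nonneg_left (by linarith) (by positivity)
  have hB2 : 3 * 6 ^ k * ((G.m : ℝ) ^ ((k : ℝ) / 2) / N) ≤ B := by
    refine le_trans ?_ hB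
    rw [effort]
    exact mul_le_mul_of_nonneg_left (by linarith) (by positivity)
  have hBpos : (0 : ℝ) < B := by nlinarith
  have hB0 : 1 ≤ B := by exact_mod_cast hBpos
  have hγ2 : (γ : ℝ) ≤ 2 * u := by
    have h1 : (n : ℝ) / B ≤ u := by
      rw [div_le_iff₀ hBpos, mul_comm, ← div_le_iff₀ hu0]
      nlinarith
    have h2 : ((n / B : ℕ) : ℝ) ≤ n / B := Nat.cast_div_le
    rw [hγ, gamma, Nat.cast_add, Nat.cast_one]
    linarith
  have hlow : (n : ℝ) * (γ : ℝ) ^ (k - 1) ≤ N * B / 3 := by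
    have h1 : (γ : ℝ) ^ (k - 1) ≤ (2 * u) ^ (k - 1) := pow_le_pow_left₀ (by positivity) hγ2 _
    have h2 : (2 * u) ^ (k - 1) * u ≤ 6 ^ k * N := by
      rw [mul_pow, mul_assoc, ← pow_succ, Nat.sub_add_cancel (by omega), u3]
      refine mul_le_mul_of_nonneg_right ?_ (by linarith)
      calc (2 : ℝ) ^ (k - 1) ≤ 6 ^ (k - 1) := pow_le_pow_left₀ (by norm_num) (by norm_num) _
        _ ≤ 6 ^ k := pow_le_pow_right₀ (by norm_num) (by omega)
    have h3 : (n : ℝ) = n / u * u := by field_simp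
    calc (n : ℝ) * (γ : ℝ) ^ (k - 1) ≤ n * (2 * u) ^ (k - 1) := by gcongr
      _ = n / u * ((2 * u) ^ (k - 1) * u) := by rw [h3]; field_simp
      _ ≤ n / u * (6 ^ k * N) := by gcongr
      _ ≤ N * B / 3 := by nlinarith
  have hhigh : (2 * (θ : ℝ)) ^ k ≤ N * B / 3 := by
    -- Either `2 * θ = 2 * γ ≤ 4 * u`, or the bound on the weight of `S` gives `θ ^ 2 ≤ 8 * m` and
    -- hence `2 * θ ≤ 6 * √m`; the latter explains the factor `6 ^ k`.
    rcases theta_eq_or (γ := γ) (s := S.length) (t := weight G S) with h | h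
    · have h1 : (θ : ℝ) = γ := by rw [hθ, thetaOf, h]
      have h2 : (2 * (θ : ℝ)) ^ k ≤ (4 * u) ^ k :=
        pow_le_pow_left₀ (by positivity) (by rw [h1]; linarith) k
      refine h2.trans ?_
      rw [mul_pow, u3]
      have h4 : (4 : ℝ) ^ k ≤ 6 ^ k := pow_le_pow_left₀ (by norm_num) (by norm_num) k
      have h5 : 3 * 4 ^ k ≤ (B : ℝ) := by nlinarith
      nlinarith
    · have hs : 0 < S.length := by rw [hS]; exact Nat.mul_pos hB0 hK
      have h1 : θ * θ ≤ 8 * G.m := by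
        refine Nat.le_of_mul_le_mul_left (h.le.trans ?_) hs
        rw [hS]
        calc 2 * weight G S ≤ 2 * (4 * (B * K) * G.m) := Nat.mul_le_mul_left _ hw
          _ = _ := by ring
      have h1' : (θ : ℝ) * θ ≤ 8 * G.m := by exact_mod_cast h1
      have h2 : 2 * (θ : ℝ) ≤ 6 * √(G.m : ℝ) := by
        refine abs_le_of_sq_le_sq' ?_ (by positivity) |>.2
        rw [mul_pow 6, Real.sq_sqrt (by positivity)]
        nlinarith [show (0 : ℝ) ≤ G.m by positivity]
      refine (pow_le_pow_left₀ (by positivity) h2 k).trans ?_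
      rw [mul_pow, ← rpow_half]
      have h3 : (G.m : ℝ) ^ ((k : ℝ) / 2) = (G.m : ℝ) ^ ((k : ℝ) / 2) / N * N := by
        field_simp
      rw [h3]
      nlinarith
  have hmed : 2 * (θ : ℝ) ^ k ≤ (2 * (θ : ℝ)) ^ k := by
    rw [mul_pow]
    exact mul_le_mul_of_nonneg_right (le_self_pow₀ (by norm_num) (by omega)) (by positivity)
  rw [totalWeight]
  push_cast
  linarith

end Effort

/-! ### The probabilities of the outcomes of a round -/

section Rounds

variable {n : ℕ} [NeZero n] (G : QueryGraph n) {k K R B : ℕ} {y : ℝ}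

/-- The distribution of an attempt in the round with parameter `B` and the list `S`. -/
def attemptOf (k B : ℕ) (S : List (Fin n)) : PMF (Option (Finset (Fin n))) :=
  attemptPMF G k (gamma n B) (thetaOf G B S) S

/-- The total weight in the round with parameter `B` and the list `S`. -/
def weightOf (k B : ℕ) (S : List (Fin n)) : ℕ := totalWeight n k (gamma n B) (thetaOf G B S)

omit [NeZero n] in
theorem one_le_gamma : 1 ≤ gamma n B := Nat.succ_le_succ (Nat.zero_le _)

theorem weightOf_pos (S : List (Fin n)) : (0 : ℝ) < (weightOf G k B S : ℕ) := by
  exact_mod_cast one_le_totalWeight (n := n) one_le_gamma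

theorem avg_roundPMF (flag : ℕ) (v : RoundOut n → ℝ≥0∞) :
    avg (roundPMF G k K R flag B) v = avg (listPMF n (B * K)) fun S =>
      avg (triesPMF (attemptOf G k B S) flag (R * B) 0 none) fun p => v (p, weightOf G k B S) := by
  rw [roundPMF, avg_bind]
  exact avg_congr _ fun S => avg_map _ _ _

theorem attemptOf_eq_zero (hk : 2 ≤ k) (S : List (Fin n)) {s : Finset (Fin n)}
    (hs : ¬ G.graph.IsNClique k s) : attemptOf G k B S (some s) = 0 :=
  attemptPMF_eq_zero G hk one_le_gamma S hs

theorem attemptOf_bounds (hk : 2 ≤ k) (hK : 1 ≤ K) (hB : 1 ≤ B) (h0 : 0 < y) (h1 : y ≤ 1 / 2)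
    {S : List (Fin n)} (hS : S.length = B * K) (hG : Good G (y / k) B S) {s : Finset (Fin n)}
    (hs : G.graph.IsNClique k s) :
    ENNReal.ofReal ((1 - y) / (weightOf G k B S : ℕ)) ≤ attemptOf G k B S (some s) ∧
      attemptOf G k B S (some s) ≤ ENNReal.ofReal ((1 + 2 * y) / (weightOf G k B S : ℕ)) := by
  have hk' : (1 : ℝ) ≤ k := by exact_mod_cast (show 1 ≤ k by omega)
  obtain ⟨b1, b2⟩ := attemptPMF_bounds G (eps := y / k) (by positivity)
    (by rw [div_le_one (by positivity)]; linarith) hk one_le_gamma le_theta hG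
    (weight_le_theta G hB hK hS) hs
  refine ⟨(ENNReal.ofReal_le_ofReal ?_).trans b1, b2.trans (ENNReal.ofReal_le_ofReal ?_)⟩
  · exact div_le_div_of_nonneg_right (one_sub_pow_ge (by omega) (by linarith)) (by positivity)
  · exact div_le_div_of_nonneg_right (one_add_pow_le (by omega) h0.le h1) (by positivity)

/-- The probability of success of an attempt. -/
theorem exists_success_prob (hk : 2 ≤ k) (hK : 1 ≤ K) (hB : 1 ≤ B) (h0 : 0 < y) (h1 : y ≤ 1 / 2)
    {S : List (Fin n)} (hS : S.length = B * K) (hG : Good G (y / k) B S) :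
    ∃ q : ℝ, 0 ≤ q ∧ q ≤ 1 ∧ ∑ s, attemptOf G k B S (some s) = ENNReal.ofReal q ∧
      (1 - y) * G.numCliques k / (weightOf G k B S : ℕ) ≤ q ∧
      q ≤ (1 + 2 * y) * G.numCliques k / (weightOf G k B S : ℕ) := by
  classical
  set Q := ∑ s, attemptOf G k B S (some s) with hQ
  have hQ1 : Q ≤ 1 := by rw [← sum_add_none (attemptOf G k B S)]; exact le_self_add
  have hQt : Q ≠ ⊤ := ne_top_of_le_ne_top ENNReal.one_ne_top hQ1
  have hW := weightOf_pos G (k := k) (B := B) S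
  have hsum : Q = ∑ s ∈ Finset.univ.filter (fun s => G.graph.IsNClique k s),
      attemptOf G k B S (some s) := by
    rw [Finset.sum_filter, hQ]
    refine Finset.sum_congr rfl fun s _ => ?_
    split_ifs with hs
    · rfl
    · exact attemptOf_eq_zero G hk S hs
  have hconst : ∀ x : ℝ, 0 ≤ x → ∑ s ∈ Finset.univ.filter (fun s => G.graph.IsNClique k s),
      ENNReal.ofReal (x / (weightOf G k B S : ℕ)) =
      ENNReal.ofReal (x * G.numCliques k / (weightOf G k B S : ℕ)) := by
    intro x hx
    rw [Finset.sum_const, ← numCliques_eq, nsmul_eq_mul, ← ENNReal.ofReal_natCast,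
      ← ENNReal.ofReal_mul (by positivity)]
    congr 1; ring
  refine ⟨Q.toReal, ENNReal.toReal_nonneg, ?_, (ENNReal.ofReal_toReal hQt).symm, ?_, ?_⟩
  · exact ENNReal.toReal_le_of_le_ofReal zero_le_one (by simpa using hQ1)
  · refine (ENNReal.ofReal_le_iff_le_toReal hQt).1 ?_
    rw [hsum, ← hconst _ (by linarith)]
    exact Finset.sum_le_sum fun s hs =>
      (attemptOf_bounds G hk hK hB h0 h1 hS hG (Finset.mem_filter.1 hs).2).1
  · refine ENNReal.toReal_le_of_le_ofReal (by positivity) ?_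
    rw [hsum, ← hconst _ (by linarith)]
    exact Finset.sum_le_sum fun s hs =>
      (attemptOf_bounds G hk hK hB h0 h1 hS hG (Finset.mem_filter.1 hs).2).2

open Classical in
/-- The probability that the list is not typical. -/
def badProb (y : ℝ) (k K B : ℕ) : ℝ≥0∞ :=
  avg (listPMF n (B * K)) fun S => if Good G (y / k) B S then 0 else 1

-- Properties of a round need proof for typical lists only; the others contribute at most their
-- probability.
open Classical in
theorem avg_roundPMF_le {flag : ℕ} {v : RoundOut n → ℝ≥0∞} (hv : ∀ p, v p ≤ 1) {c : ℝ≥0∞}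
    (h : ∀ S : List (Fin n), S.length = B * K → Good G (y / k) B S →
      avg (triesPMF (attemptOf G k B S) flag (R * B) 0 none) (fun p => v (p, weightOf G k B S)) ≤
        c) :
    avg (roundPMF G k K R flag B) v ≤ badProb G y k K B + c := by
  rw [avg_roundPMF, badProb, ← avg_const (listPMF n (B * K)) c, ← avg_add]
  refine avg_listPMF_mono fun S hS => ?_
  split_ifs with hG
  · rw [zero_add]; exact h S hS hG
  · exact (avg_le_const _ fun p => hv _).trans le_self_add

-- As for `avg_roundPMF_le`, with a second exceptional event: a total degree above four times its
-- mean, which has probability at most `1 / 4` by Markov.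
open Classical in
theorem round_fail_le {flag thr : ℕ} {c : ℝ≥0∞}
    (h : ∀ S : List (Fin n), S.length = B * K → Good G (y / k) B S →
      weight G S ≤ 4 * (B * K) * G.m →
      avg (triesPMF (attemptOf G k B S) flag (R * B) 0 none)
        (fun p => if thr ≤ p.1 then 0 else 1) ≤ c) :
    avg (roundPMF G k K R flag B) (fun p => if thr ≤ p.1.1 then 0 else 1) ≤
      badProb G y k K B + ENNReal.ofReal (1 / 4) + c := by
  have h1 := weight_markov G (B * K)
  rw [avg_roundPMF]
  refine le_trans ?_ (add_le_add (add_le_add le_rfl h1) le_rfl)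
  rw [badProb, ← avg_const (listPMF n (B * K)) c, ← avg_add, ← avg_add]
  refine avg_listPMF_mono fun S hS => ?_
  have hle : avg (triesPMF (attemptOf G k B S) flag (R * B) 0 none)
      (fun p => if thr ≤ p.1 then 0 else 1) ≤ 1 := avg_le_const _ fun p => by split_ifs <;> simp
  by_cases hG : Good G (y / k) B S
  · by_cases hw : 4 * (B * K) * G.m < weight G S
    · simp only [hG, hw, if_true, zero_add]
      exact hle.trans le_self_add
    · simp only [hG, hw, if_true, if_false, zero_add]
      exact h S hS hG (not_lt.1 hw)
  · simp only [hG, if_false]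
    rw [add_assoc]
    exact hle.trans le_self_add

/-- In one round, all cliques have nearly the same probability of being found. -/
theorem round_ratio (hk : 2 ≤ k) (hK : 1 ≤ K) (hB : 1 ≤ B) (h0 : 0 < y) (h1 : y ≤ 1 / 2)
    {s s' : Finset (Fin n)} (hs : G.graph.IsNClique k s) (hs' : G.graph.IsNClique k s') :
    avg (roundPMF G k K R 1 B) (fun p => if 1 ≤ p.1.1 ∧ p.1.2 = some s then 1 else 0) ≤
      ENNReal.ofReal ((1 + 2 * y) / (1 - y)) *
        avg (roundPMF G k K R 1 B) (fun p => if 1 ≤ p.1.1 ∧ p.1.2 = some s' then 1 else 0) +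
      badProb G y k K B := by
  classical
  have hy : 0 < 1 - y := by linarith
  rw [avg_roundPMF, avg_roundPMF, badProb, ← avg_mul_left, ← avg_add]
  refine avg_listPMF_mono fun S hS => ?_
  split_ifs with hG
  -- For a fixed list both probabilities carry the same geometric factor, so it suffices to compare
  -- single attempts.
  · have e : ∀ t, avg (triesPMF (attemptOf G k B S) 1 (R * B) 0 none)
        (fun p => if 1 ≤ p.1 ∧ p.2 = some t then 1 else 0) = attemptOf G k B S (some t) *
          ∑ j ∈ Finset.range (R * B), attemptOf G k B S none ^ j := fun t => by
      rw [← triesPMF_one_apply]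
      exact avg_congr _ fun p => by congr
    rw [e, e, add_zero, ← mul_assoc]
    refine mul_le_mul_left ?_ _
    refine (attemptOf_bounds G hk hK hB h0 h1 hS hG hs).2.trans (le_trans (le_of_eq ?_)
      (mul_le_mul_right (attemptOf_bounds G hk hK hB h0 h1 hS hG hs').1 _))
    rw [← ENNReal.ofReal_mul (by positivity)]
    congr 1; field_simp
  · refine (avg_le_const _ fun p => ?_).trans le_add_self
    split_ifs <;> simp

/-- The number `X` of successes among `r` attempts with total weight `Z` yields a good estimate for
the number of cliques. -/
def Accurate (k E r X Z : ℕ) : Prop :=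
  |(Z : ℝ) * X / r - G.numCliques k| ≤ G.numCliques k / (2 * E)

-- No lower bound on `B` is assumed: a round in which enough successes occur is reliable even if the
-- effort is too small for such a round to be likely.
open Classical in
theorem round_accuracy (hk : 2 ≤ k) (hK : 1 ≤ K) (hB : 1 ≤ B) (hR : 1 ≤ R) {E t : ℕ}
    (hE : 1 ≤ E) (ht : 1 ≤ t) :
    avg (roundPMF G k K R 0 B) (fun p =>
        if t ≤ p.1.1 ∧ ¬ Accurate G k E (R * B) p.1.1 p.2 then 1 else 0) ≤
      badProb G (1 / (16 * E)) k K B + ENNReal.ofReal (128 * E ^ 2 / t) := by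
  have hE' : (1 : ℝ) ≤ E := by exact_mod_cast hE
  have hy0 : (0 : ℝ) < 1 / (16 * E) := by positivity
  have hy1 : (1 : ℝ) / (16 * E) ≤ 1 / 16 := by
    rw [div_le_div_iff₀ (by positivity) (by norm_num)]; linarith
  refine avg_roundPMF_le G (fun p => by split_ifs <;> simp) fun S hS hG => ?_
  obtain ⟨q, q0, q1, hq, hl, hu⟩ := exists_success_prob G hk hK hB hy0 (by linarith) hS hG
  refine (avg_mono _ fun p => ?_).trans
    (triesPMF_zero_accuracy (attemptOf G k B S) q0 q1 hq (R * B) hE ht)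
  by_cases ht' : t ≤ p.1
  swap
  · simp [ht']
  by_cases hacc : Accurate G k E (R * B) p.1 (weightOf G k B S)
  · simp [hacc]
  rw [if_pos ⟨ht', hacc⟩, if_pos]
  refine ⟨ht', lt_of_not_ge fun hle => hacc ?_⟩
  have hW := weightOf_pos G (k := k) (B := B) S
  set Z : ℝ := ((weightOf G k B S : ℕ) : ℝ)
  set N : ℝ := (G.numCliques k : ℝ) with hN
  have hN0 : 0 ≤ N := by positivity
  have hr : (0 : ℝ) < (R * B : ℕ) := by exact_mod_cast Nat.mul_pos hR hB
  set r : ℝ := ((R * B : ℕ) : ℝ)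
  have hl' : (1 - 1 / (16 * E)) * N ≤ Z * q := by rw [div_le_iff₀ hW] at hl; linarith
  have hu' : Z * q ≤ (1 + 2 * (1 / (16 * E))) * N := by rw [le_div_iff₀ hW] at hu; linarith
  obtain ⟨a1, a2⟩ := abs_le.1 hle
  -- In units of `y`: both `Z * q / N` and `X / (q * r)` are within `2 * y` of `1`, so their product
  -- is within `4 * y + 4 * y ^ 2`, which is at most the allowed `8 * y = 1 / (2 * E)`.
  set y : ℝ := 1 / (16 * E) with hy
  have e1 : q * r / (8 * E) = 2 * y * (q * r) := by rw [hy]; field_simp; ring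
  have e2 : N / (2 * E) = 8 * y * N := by rw [hy]; field_simp; ring
  rw [e1] at a1 a2
  rw [Accurate, e2, abs_le]
  have hZq : 0 ≤ Z * q := by positivity
  have hx1 : Z * p.1 / r ≤ Z * q * (1 + 2 * y) := by
    rw [div_le_iff₀ hr]
    have := mul_le_mul_of_nonneg_left a2 hW.le
    linarith
  have hx2 : Z * q * (1 - 2 * y) ≤ Z * p.1 / r := by
    rw [le_div_iff₀ hr]
    have := mul_le_mul_of_nonneg_left a1 hW.le
    linarith
  have b1 : Z * q * (1 + 2 * y) ≤ (1 + 2 * y) * N * (1 + 2 * y) :=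
    mul_le_mul_of_nonneg_right hu' (by linarith)
  have b2 : (1 - y) * N * (1 - 2 * y) ≤ Z * q * (1 - 2 * y) :=
    mul_le_mul_of_nonneg_right hl' (by linarith)
  have b3 : y * y * N ≤ y * N := by nlinarith [mul_nonneg hy0.le hN0]
  have b4 : 0 ≤ y * N := by positivity
  constructor <;> nlinarith

/-- With enough effort, the expected number of successes is large. -/
theorem exists_large_success_prob (hk : 2 ≤ k) (hK : 1 ≤ K) (hN : 1 ≤ G.numCliques k)
    (hB : 3 * 6 ^ k * effort G k ≤ B) (h0 : 0 < y) (h1 : y ≤ 1 / 32) {S : List (Fin n)}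
    (hS : S.length = B * K) (hG : Good G (y / k) B S) (hw : weight G S ≤ 4 * (B * K) * G.m) :
    ∃ q : ℝ, 0 ≤ q ∧ q ≤ 1 ∧ ∑ s, attemptOf G k B S (some s) = ENNReal.ofReal q ∧
      31 / 32 * R ≤ q * (R * B : ℕ) := by
  have hn : 1 ≤ n := Nat.one_le_iff_ne_zero.2 (NeZero.ne n)
  have hB' : (0 : ℝ) < B := by
    refine lt_of_lt_of_le ?_ hB
    have := one_le_effort G hk hN
    positivity
  have hB1 : 1 ≤ B := by exact_mod_cast hB'
  obtain ⟨q, q0, q1, hq, hl, -⟩ := exists_success_prob G hk hK hB1 h0 (by linarith) hS hG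
  refine ⟨q, q0, q1, hq, ?_⟩
  have hZ := totalWeight_le_mul G hk hn hN hK hB hS hw
  rw [div_le_iff₀ (weightOf_pos G S)] at hl
  rw [weightOf] at hl
  have hN' : (0 : ℝ) < G.numCliques k := by exact_mod_cast hN
  have h2 : 31 / 32 * (G.numCliques k : ℝ) ≤ q * B * G.numCliques k := by
    nlinarith
  have h3 : 31 / 32 ≤ q * B := le_of_mul_le_mul_right h2 hN'
  push_cast
  nlinarith [show (0 : ℝ) ≤ R by positivity]

/-- The expected number of successes is at least `64 * 31 / 32 = 62`, and the probability of no
success at all is at most `exp (-62) ≤ 1 / 63`. -/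
theorem round_fail_sample (hk : 2 ≤ k) (hK : 1 ≤ K) (hN : 1 ≤ G.numCliques k)
    (hB : 3 * 6 ^ k * effort G k ≤ B) (h0 : 0 < y) (h1 : y ≤ 1 / 32) :
    avg (roundPMF G k K 64 1 B) (fun p => if 1 ≤ p.1.1 then 0 else 1) ≤
      badProb G y k K B + ENNReal.ofReal (1 / 4) + ENNReal.ofReal (1 / 60) := by
  refine round_fail_le G fun S hS hG hw => ?_
  obtain ⟨q, q0, q1, hq, hl⟩ := exists_large_success_prob G (R := 64) hk hK hN hB h0 h1 hS hG hw
  have hnone : attemptOf G k B S none = ENNReal.ofReal (1 - q) := by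
    rw [ENNReal.ofReal_sub _ q0, ENNReal.ofReal_one, ← hq]
    refine ENNReal.eq_sub_of_add_eq' (by norm_num) ?_
    rw [add_comm]; exact sum_add_none _
  rw [triesPMF_one_fail, hnone, ← ENNReal.ofReal_pow (by linarith)]
  refine ENNReal.ofReal_le_ofReal ?_
  have h2 : (1 - q) ^ (64 * B) ≤ Real.exp (-(q * (64 * B : ℕ))) := by
    calc (1 - q) ^ (64 * B) ≤ Real.exp (-q) ^ (64 * B) :=
          pow_le_pow_left₀ (by linarith) (by linarith [Real.add_one_le_exp (-q)]) _
      _ = _ := by rw [← Real.exp_nat_mul]; congr 1; ring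
  refine h2.trans ?_
  rw [Real.exp_neg, ← one_div]
  refine one_div_le_one_div_of_le (by norm_num) ?_
  have := Real.add_one_le_exp (q * (64 * B : ℕ))
  norm_num at hl
  push_cast at this ⊢
  linarith

/-- With `R = 4 * t` the mean is at least `2 * t`, so fewer than `t` successes are a deviation by
half the mean. -/
theorem round_fail_count (hk : 2 ≤ k) (hK : 1 ≤ K) (hN : 1 ≤ G.numCliques k)
    (hB : 3 * 6 ^ k * effort G k ≤ B) (h0 : 0 < y) (h1 : y ≤ 1 / 32) {t : ℕ} (ht : 1 ≤ t) :
    avg (roundPMF G k K (4 * t) 0 B) (fun p => if t ≤ p.1.1 then 0 else 1) ≤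
      badProb G y k K B + ENNReal.ofReal (1 / 4) + ENNReal.ofReal (2 / t) := by
  refine round_fail_le G fun S hS hG hw => ?_
  obtain ⟨q, q0, q1, hq, hl⟩ := exists_large_success_prob G (R := 4 * t) hk hK hN hB h0 h1 hS hG hw
  refine triesPMF_zero_fail _ q0 q1 hq _ ht (le_trans ?_ hl)
  have : (1 : ℝ) ≤ t := by exact_mod_cast ht
  push_cast
  linarith

/-- If there are no cliques, then there are no successes. -/
theorem round_of_no_cliques (hk : 2 ≤ k) (hN : G.numCliques k = 0) {flag thr : ℕ}
    (hthr : 1 ≤ thr) :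
    avg (roundPMF G k K R flag B) (fun p => if thr ≤ p.1.1 then 1 else 0) = 0 := by
  classical
  rw [avg_roundPMF]
  refine le_antisymm (avg_le_const _ fun S => ?_) zero_le
  rw [triesPMF_eq_zero (attemptOf G k B S) (fun s => attemptOf_eq_zero G hk S fun hs => ?_) flag _ 0
    none (fun x => if thr ≤ x then 1 else 0), if_neg (by omega)]
  rw [numCliques_eq, Finset.card_eq_zero, Finset.filter_eq_empty_iff] at hN
  exact hN (Finset.mem_univ s) hs

end Rounds

/-! ### The probabilities of the outcomes of a search -/

/-! ### Untypical lists are negligible even when summed over all rounds. -/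

section BadProb

variable {n : ℕ} [NeZero n] (G : QueryGraph n)

-- Only crude bounds are needed: `256 ≤ exp 6`, `x ≤ exp x` and `n ≤ 2 ^ l ≤ exp l`. The exponent on
-- the right has the term `k * l` to dominate `n ^ (k + 1)`.
omit [NeZero n] in
theorem exp_large {k E l : ℕ} (hk : 2 ≤ k) (hE : 1 ≤ E) (hl : 1 ≤ l) (hn : n < 2 ^ l) :
    256 * (E * k * l * (n : ℝ) ^ (k + 1)) ≤ Real.exp (16 * k * E * l) := by
  have e6 : (256 : ℝ) ≤ Real.exp 6 := by
    have h := Real.exp_one_gt_d9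
    have : Real.exp 6 = Real.exp 1 ^ 6 := by rw [← Real.exp_nat_mul]; norm_num
    rw [this]
    calc (256 : ℝ) ≤ 2.7 ^ 6 := by norm_num
      _ ≤ Real.exp 1 ^ 6 := pow_le_pow_left₀ (by norm_num) (by linarith) 6
  have ex : ∀ x : ℝ, x ≤ Real.exp x := fun x => by linarith [Real.add_one_le_exp x]
  have en : (n : ℝ) ≤ Real.exp l := by
    calc (n : ℝ) ≤ 2 ^ l := by exact_mod_cast hn.le
      _ ≤ Real.exp 1 ^ l := pow_le_pow_left₀ (by norm_num) (by linarith [Real.exp_one_gt_d9]) l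
      _ = Real.exp l := by rw [← Real.exp_nat_mul, mul_one]
  calc 256 * (E * k * l * (n : ℝ) ^ (k + 1))
      ≤ Real.exp 6 * (Real.exp E * Real.exp k * Real.exp l * Real.exp l ^ (k + 1)) := by
        gcongr <;> exact ex _
    _ = Real.exp (6 + (E + k + l + (k + 1 : ℕ) * l)) := by
        rw [← Real.exp_nat_mul, ← Real.exp_add, ← Real.exp_add, ← Real.exp_add, ← Real.exp_add]
    _ ≤ Real.exp (16 * k * E * l) := by
        refine Real.exp_le_exp.2 ?_
        have h : 6 + (E + k + l + (k + 1) * l) ≤ 16 * k * E * l := by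
          have h1 : 1 * 1 ≤ E * l := Nat.mul_le_mul hE hl
          have h2 : k * 1 ≤ k * (E * l) := Nat.mul_le_mul_left _ h1
          have h3 : E * (1 * 1) ≤ E * (k * l) :=
            Nat.mul_le_mul_left _ (Nat.mul_le_mul (by omega) hl)
          have h4 : l * (1 * 1) ≤ l * (k * E) :=
            Nat.mul_le_mul_left _ (Nat.mul_le_mul (by omega) hE)
          have h5 : k * l * 1 ≤ k * l * E := Nat.mul_le_mul_left _ hE
          have e : k * (E * l) = k * E * l := by ring
          have e3 : E * (k * l) = k * E * l := by ring
          have e4 : l * (k * E) = k * E * l := by ring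
          have e5 : k * l * E = k * E * l := by ring
          have e6 : 16 * k * E * l = 16 * (k * E * l) := by ring
          rw [e] at h2; rw [e3] at h3; rw [e4] at h4; rw [e5] at h5
          rw [e6, add_mul]
          omega
        exact_mod_cast h

/-- The factor `K` is chosen such that the Chernoff exponent for the error `1 / (16 * E * k)` equals
`16 * k * E * l`. Summed over the `8 * k * l` rounds the bound is `1 / (16 * E * n ^ k)`, small
compared with `1 / N` because `N ≤ n ^ k`. -/
theorem badProb_le {k E l : ℕ} (hk : 2 ≤ k) (hE : 1 ≤ E) (hl : 1 ≤ l) (hn : n < 2 ^ l) {B : ℕ}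
    (hB : 1 ≤ B) :
    badProb G (1 / (16 * E)) k (2 ^ 14 * k ^ 3 * E ^ 3 * l) B ≤
      ENNReal.ofReal (1 / (16 * E * (n : ℝ) ^ k * (8 * k * l : ℕ))) := by
  have hE' : (1 : ℝ) ≤ E := by exact_mod_cast hE
  have hk' : (2 : ℝ) ≤ k := by exact_mod_cast hk
  have hl' : (1 : ℝ) ≤ l := by exact_mod_cast hl
  have hn' : (0 : ℝ) < n := by exact_mod_cast Nat.pos_of_ne_zero (NeZero.ne n)
  have hK : 1 ≤ 2 ^ 14 * k ^ 3 * E ^ 3 * l :=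
    Nat.mul_pos (Nat.mul_pos (Nat.mul_pos (by norm_num) (pow_pos (by omega) _))
      (pow_pos hE _)) hl
  refine (not_good_le G (eps := 1 / (16 * E) / k) (by positivity) ?_ hB hK).trans
    (ENNReal.ofReal_le_ofReal ?_)
  · rw [div_div, div_le_one (by positivity)]
    nlinarith
  · have e : ((2 ^ 14 * k ^ 3 * E ^ 3 * l : ℕ) : ℝ) * (1 / (16 * E) / k) ^ 2 / 4 =
        16 * k * E * l := by
      push_cast; field_simp; ring
    rw [e, Real.exp_neg, ← div_eq_mul_inv, div_le_div_iff₀ (Real.exp_pos _) (by positivity), one_mul]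
    refine le_trans (le_of_eq ?_) (exp_large hk hE hl hn)
    push_cast; ring

end BadProb

/-! ### Failure, effort and errors of a search. -/

namespace Config

variable {n : ℕ} [NeZero n] (cfg : Config) (G : QueryGraph n)

theorem avg_search_succ (f i : ℕ) (v : SearchOut n → ℝ≥0∞) :
    avg (cfg.search G (f + 1) i) v = avg (cfg.round G i) fun p =>
      if cfg.thr ≤ p.1.1 then v (i + 1, some p) else avg (cfg.search G f (i + 1)) v := by
  rw [search, avg_bind]
  refine avg_congr _ fun p => ?_
  split_ifs
  · rw [avg_pure]
  · rfl

/-- The probability that a round fails. -/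
def roundFail (i : ℕ) : ℝ≥0∞ := avg (cfg.round G i) fun p => if cfg.thr ≤ p.1.1 then 0 else 1

theorem roundFail_le_one (i : ℕ) : cfg.roundFail G i ≤ 1 :=
  avg_le_const _ fun p => by split_ifs <;> simp

theorem avg_search_succ' (f i : ℕ) (v : SearchOut n → ℝ≥0∞) :
    avg (cfg.search G (f + 1) i) v =
      (avg (cfg.round G i) fun p => if cfg.thr ≤ p.1.1 then v (i + 1, some p) else 0) +
        avg (cfg.search G f (i + 1)) v * cfg.roundFail G i := by
  rw [avg_search_succ, roundFail, ← avg_mul_left, ← avg_add]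
  refine avg_congr _ fun p => ?_
  split_ifs <;> simp

theorem failProb_succ (f i : ℕ) :
    cfg.failProb G (f + 1) i = cfg.failProb G f (i + 1) * cfg.roundFail G i := by
  rw [failProb, avg_search_succ', failProb]
  simp

/-- The rounds are independent, so the search fails with the product of their probabilities of
failure; any single good round bounds it. -/
theorem failProb_le_roundFail (f : ℕ) : ∀ {i j : ℕ}, i ≤ j → j < i + f →
    cfg.failProb G f i ≤ cfg.roundFail G j := by
  induction f with
  | zero => intro i j h1 h2; omega
  | succ f ih =>
    intro i j h1 h2
    rw [failProb_succ]
    rcases Nat.eq_or_lt_of_le h1 with rfl | h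
    · exact mul_le_of_le_one_left' (cfg.failProb_le_one G _ _)
    · exact (mul_le_of_le_one_right' (cfg.roundFail_le_one G i)).trans (ih h (by omega))

/-- The expected effort of a search, if all rounds from number `j` on fail with a probability of at
most `3 / 10`. -/
theorem avg_search_two_pow {j : ℕ} (hj : ∀ i, j ≤ i → cfg.roundFail G i ≤ ENNReal.ofReal (3 / 10))
    (f : ℕ) : ∀ i, avg (cfg.search G f i) (fun q => (2 : ℝ≥0∞) ^ q.1) ≤ 5 * 2 ^ max i j := by
  induction f with
  | zero =>
    intro i
    simp only [search, avg_pure]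
    calc (2 : ℝ≥0∞) ^ i ≤ 2 ^ max i j := pow_le_pow_right₀ (by norm_num) (le_max_left _ _)
      _ ≤ 5 * 2 ^ max i j := le_mul_of_one_le_left' (by norm_num)
  | succ f ih =>
    intro i
    rcases le_or_gt j i with h | h
    · rw [avg_search_succ', max_eq_left h]
      have h1 : (avg (cfg.round G i) fun p => if cfg.thr ≤ p.1.1 then (2 : ℝ≥0∞) ^ (i + 1) else 0) ≤
          2 ^ (i + 1) := avg_le_const _ fun p => by split_ifs <;> simp
      have h2 := ih (i + 1)
      rw [max_eq_left (by omega)] at h2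
      -- The constant `5` solves `2 + 2 * 5 * (3 / 10) = 5`: each further round doubles the effort
      -- but is reached with probability at most `3 / 10`.
      refine (add_le_add h1 (mul_le_mul' h2 (hj i h))).trans (le_of_eq ?_)
      have e : ∀ t : ℕ, (2 : ℝ≥0∞) ^ t = ENNReal.ofReal (2 ^ t) := fun t => by
        rw [ENNReal.ofReal_pow (by norm_num)]; norm_num
      have e5 : (5 : ℝ≥0∞) = ENNReal.ofReal 5 := by norm_num
      rw [e, e, e5, ← ENNReal.ofReal_mul (by positivity), ← ENNReal.ofReal_mul (by positivity),
        ← ENNReal.ofReal_mul (by positivity), ← ENNReal.ofReal_add (by positivity) (by positivity)]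
      congr 1
      rw [pow_succ]; ring
    · rw [avg_search_succ, max_eq_right h.le]
      refine avg_le_const _ fun p => ?_
      split_ifs
      · calc (2 : ℝ≥0∞) ^ (i + 1) ≤ 2 ^ j := pow_le_pow_right₀ (by norm_num) h
          _ ≤ 5 * 2 ^ j := le_mul_of_one_le_left' (by norm_num)
      · have := ih (i + 1)
        rwa [max_eq_right (by omega)] at this

open Classical in
/-- In a search, all cliques have nearly the same probability of being found. -/
theorem search_ratio {s s' : Finset (Fin n)} {ρ β : ℝ≥0∞}
    (h : ∀ i, avg (cfg.round G i) (fun p => if cfg.thr ≤ p.1.1 ∧ p.1.2 = some s then 1 else 0) ≤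
      ρ * avg (cfg.round G i) (fun p => if cfg.thr ≤ p.1.1 ∧ p.1.2 = some s' then 1 else 0) + β)
    (f : ℕ) : ∀ i, avg (cfg.search G f i) (fun q => if q.clique = some s then 1 else 0) ≤
      ρ * avg (cfg.search G f i) (fun q => if q.clique = some s' then 1 else 0) + f * β := by
  induction f with
  | zero => intro i; simp [search, SearchOut.clique]
  | succ f ih =>
    intro i
    have e : ∀ t : Finset (Fin n), (avg (cfg.round G i) fun p => if cfg.thr ≤ p.1.1 then
        (if SearchOut.clique (n := n) (i + 1, some p) = some t then (1 : ℝ≥0∞) else 0) else 0) =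
        avg (cfg.round G i) (fun p => if cfg.thr ≤ p.1.1 ∧ p.1.2 = some t then 1 else 0) := by
      intro t
      refine avg_congr _ fun p => ?_
      simp only [SearchOut.clique, Option.bind_some]
      split_ifs <;> simp_all
    rw [avg_search_succ', avg_search_succ', e, e]
    calc _ ≤ (ρ * avg (cfg.round G i) (fun p => if cfg.thr ≤ p.1.1 ∧ p.1.2 = some s' then 1 else 0)
          + β) + (ρ * avg (cfg.search G f (i + 1)) (fun q => if q.clique = some s' then 1 else 0)
          + f * β) * cfg.roundFail G i := add_le_add (h i) (mul_le_mul_left (ih (i + 1)) _)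
      _ ≤ (ρ * avg (cfg.round G i) (fun p => if cfg.thr ≤ p.1.1 ∧ p.1.2 = some s' then 1 else 0)
          + β) + (ρ * avg (cfg.search G f (i + 1)) (fun q => if q.clique = some s' then 1 else 0) *
          cfg.roundFail G i + f * β) := by
        -- The multiplicative error `ρ` must not accumulate, so the common factor `roundFail` is
        -- kept in its term; it is dropped only in the additive error, which grows by `β` per round.
        rw [add_mul]
        exact add_le_add le_rfl (add_le_add le_rfl
          (mul_le_of_le_one_right' (cfg.roundFail_le_one G i)))
      _ = _ := by push_cast; ring

open Classical in
/-- The probability that the search ends with a round whose outcome has the property `E`. -/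
theorem search_bad_le {E : ℕ → RoundOut n → Prop} {β : ℝ≥0∞}
    (h : ∀ i, avg (cfg.round G i) (fun p => if cfg.thr ≤ p.1.1 ∧ E i p then 1 else 0) ≤ β) (f : ℕ) :
    ∀ i, avg (cfg.search G f i) (fun q => if ∃ p, q.2 = some p ∧ E (q.1 - 1) p then 1 else 0) ≤
      f * β := by
  induction f with
  | zero => intro i; simp [search]
  | succ f ih =>
    intro i
    rw [avg_search_succ']
    calc _ ≤ β + (f * β) * 1 := by
          refine add_le_add (le_trans (avg_mono _ fun p => ?_) (h i))
            (mul_le_mul' (ih (i + 1)) (cfg.roundFail_le_one G i))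
          simp only [Option.some.injEq, Nat.add_sub_cancel, exists_eq_left']
          split_ifs <;> simp_all
      _ = _ := by push_cast; ring

end Config

/-! ### The accuracy of the programs -/

/-- A distribution whose values are nearly equal is pointwise close to uniform. -/
theorem PMF.near_uniform {α : Type} [Fintype α] (p : PMF α) (hN : 1 ≤ Fintype.card α) {y eta : ℝ}
    (h0 : 0 < y) (h1 : y ≤ 1 / 32) (heta : 0 ≤ eta) (hη : Fintype.card α * eta ≤ 2 * y)
    (h : ∀ a b, p a ≤ ENNReal.ofReal ((1 + 2 * y) / (1 - y)) * p b + ENNReal.ofReal eta) (a : α) :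
    |(p a).toReal - 1 / (Fintype.card α : ℝ)| < 16 * y / (Fintype.card α : ℝ) := by
  set N : ℝ := (Fintype.card α : ℝ) with hNdef
  have hN' : (0 : ℝ) < N := Nat.cast_pos.2 hN
  have hsum : ∑ b, (p b).toReal = 1 := by
    rw [← ENNReal.toReal_sum fun b _ => p.apply_ne_top b, ← tsum_fintype (L := .unconditional _),
      p.tsum_coe, ENNReal.toReal_one]
  have hρ0 : 0 ≤ (1 + 2 * y) / (1 - y) := div_nonneg (by linarith) (by linarith)
  have hρ : (1 + 2 * y) / (1 - y) ≤ 1 + 4 * y := by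
    rw [div_le_iff₀ (by linarith)]; nlinarith
  have hr : ∀ a b, (p a).toReal ≤ (1 + 4 * y) * (p b).toReal + eta := by
    intro a b
    have h2 := h a b
    rw [← ENNReal.ofReal_toReal (p.apply_ne_top b), ← ENNReal.ofReal_mul hρ0,
      ← ENNReal.ofReal_add (by positivity) heta] at h2
    refine (ENNReal.toReal_le_of_le_ofReal (by positivity) h2).trans ?_
    have : (1 + 2 * y) / (1 - y) * (p b).toReal ≤ (1 + 4 * y) * (p b).toReal :=
      mul_le_mul_of_nonneg_right hρ ENNReal.toReal_nonneg
    linarith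
  -- Summing the comparison over one of its two arguments, with the other one fixed, compares `N * p
  -- a` with the total mass `1`.
  have hup : N * (p a).toReal ≤ (1 + 4 * y) + N * eta := by
    have := Finset.sum_le_sum fun b (_ : b ∈ Finset.univ) => hr a b
    rw [Finset.sum_add_distrib, ← Finset.mul_sum, hsum] at this
    simpa using this
  have hlo : 1 ≤ (1 + 4 * y) * (N * (p a).toReal) + N * eta := by
    have := Finset.sum_le_sum fun b (_ : b ∈ Finset.univ) => hr b a
    rw [hsum] at this
    simp only [Finset.sum_const, Finset.card_univ, nsmul_eq_mul, ← hNdef] at this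
    linarith
  have e : (p a).toReal - 1 / N = (N * (p a).toReal - 1) / N := by field_simp
  rw [e, abs_div, abs_of_pos hN']
  refine div_lt_div_of_pos_right (abs_lt.2 ⟨?_, by linarith⟩) hN'
  -- Otherwise `(1 + 4 * y) * (1 - 16 * y) + 2 * y = 1 - 10 * y - 64 * y ^ 2 < 1` contradicts `hlo`.
  by_contra hc
  have hc' : N * (p a).toReal ≤ 1 - 16 * y := by linarith
  have := mul_le_mul_of_nonneg_left hc' (show 0 ≤ 1 + 4 * y by linarith)
  nlinarith

section Sampling

variable {n : ℕ} [NeZero n] {G : QueryGraph n} {k E l : ℕ}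

/-- The bounds on the parameters that are used below. -/
structure Params (n k E l : ℕ) : Prop where
  hk : 2 ≤ k
  hE : 2 ≤ E
  hl : 1 ≤ l
  hn : n < 2 ^ l

omit [NeZero n] in
theorem Params.one_le_K (h : Params n k E l) : 1 ≤ 2 ^ 14 * k ^ 3 * E ^ 3 * l :=
  Nat.mul_pos (Nat.mul_pos (Nat.mul_pos (by norm_num) (pow_pos (by have := h.hk; omega) _))
    (pow_pos (by have := h.hE; omega) _)) h.hl

omit [NeZero n] in
theorem Params.one_le_I (h : Params n k E l) : 1 ≤ 8 * k * l :=
  Nat.mul_pos (Nat.mul_pos (by norm_num) (by have := h.hk; omega)) h.hl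

omit [NeZero n] in
theorem Params.y_bounds (h : Params n k E l) :
    (0 : ℝ) < 1 / (16 * E) ∧ (1 : ℝ) / (16 * E) ≤ 1 / 32 := by
  have : (2 : ℝ) ≤ E := by exact_mod_cast h.hE
  exact ⟨by positivity, by rw [div_le_div_iff₀ (by positivity) (by norm_num)]; linarith⟩

theorem Params.badProb_le (h : Params n k E l) (i : ℕ) :
    badProb G (1 / (16 * E)) k (2 ^ 14 * k ^ 3 * E ^ 3 * l) (2 ^ i) ≤
      ENNReal.ofReal (1 / (16 * E * (n : ℝ) ^ k * (8 * k * l : ℕ))) :=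
  CliqueSampling.badProb_le G h.hk (by have := h.hE; omega) h.hl h.hn Nat.one_le_two_pow

theorem Params.badProb_le' (h : Params n k E l) (i : ℕ) :
    badProb G (1 / (16 * E)) k (2 ^ 14 * k ^ 3 * E ^ 3 * l) (2 ^ i) ≤ ENNReal.ofReal (1 / 100) := by
  refine (h.badProb_le i).trans (ENNReal.ofReal_le_ofReal ?_)
  have h1 : 1 ≤ n ^ k := pow_pos (Nat.pos_of_ne_zero (NeZero.ne n)) _
  have h2 : 1 ≤ k * l := Nat.mul_pos (by have := h.hk; omega) h.hl
  have h3 : 2 * 1 ≤ E * n ^ k := Nat.mul_le_mul h.hE h1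
  have h4 : 2 * 1 * 1 ≤ E * n ^ k * (k * l) := Nat.mul_le_mul h3 h2
  have h5 : (2 : ℝ) ≤ E * n ^ k * (k * l) := by exact_mod_cast h4
  refine one_div_le_one_div_of_le (by norm_num) ?_
  push_cast
  nlinarith

/-- The three sources of failure add up to `1 / 100 + 1 / 4 + 1 / 60`, below `7 / 25`, which in turn
is below the `3 / 10` that the geometric series allows. -/
theorem sample_roundFail (h : Params n k E l) (hN : 1 ≤ G.numCliques k) {i : ℕ}
    (hi : 3 * 6 ^ k * effort G k ≤ 2 ^ i) :
    (sampleCfg k E l).roundFail G i ≤ ENNReal.ofReal (7 / 25) := by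
  refine (round_fail_sample G h.hk h.one_le_K hN (by exact_mod_cast hi) h.y_bounds.1
    h.y_bounds.2).trans ((add_le_add (add_le_add (h.badProb_le' i) le_rfl) le_rfl).trans ?_)
  rw [← ENNReal.ofReal_add (by norm_num) (by norm_num),
    ← ENNReal.ofReal_add (by norm_num) (by norm_num)]
  exact ENNReal.ofReal_le_ofReal (by norm_num)

omit [NeZero n] in
theorem Params.thr_bounds (h : Params n k E l) : 2 ^ 14 ≤ 2 ^ 14 * E ^ 2 * (8 * k * l) := by
  rw [mul_assoc]
  exact Nat.le_mul_of_pos_right _ (Nat.mul_pos (pow_pos (by have := h.hE; omega) _) h.one_le_I)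

theorem count_roundFail (h : Params n k E l) (hN : 1 ≤ G.numCliques k) {i : ℕ}
    (hi : 3 * 6 ^ k * effort G k ≤ 2 ^ i) :
    (countCfg k E l).roundFail G i ≤ ENNReal.ofReal (7 / 25) := by
  have ht := h.thr_bounds
  refine (round_fail_count G h.hk h.one_le_K hN (by exact_mod_cast hi) h.y_bounds.1
    h.y_bounds.2 (t := 2 ^ 14 * E ^ 2 * (8 * k * l)) (by omega)).trans
    ((add_le_add (add_le_add (h.badProb_le' i) le_rfl) (ENNReal.ofReal_le_ofReal
      (q := 1 / 100) ?_)).trans ?_)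
  · have ht' : ((2 ^ 14 : ℕ) : ℝ) ≤ (2 ^ 14 * E ^ 2 * (8 * k * l) : ℕ) := Nat.cast_le.2 ht
    rw [div_le_div_iff₀ (by push_cast at ht' ⊢; linarith) (by norm_num)]
    push_cast at ht' ⊢
    linarith
  · rw [← ENNReal.ofReal_add (by norm_num) (by norm_num),
      ← ENNReal.ofReal_add (by norm_num) (by norm_num)]
    exact ENNReal.ofReal_le_ofReal (by norm_num)

/-- The cliques found by the first successful search are nearly uniform. -/
theorem foundProb_near_uniform (h : Params n k E l) (hN : 1 ≤ G.numCliques k)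
    (hfail : (sampleCfg k E l).failProb G (sampleCfg k E l).I 0 < 1)
    (hfail2 : (sampleCfg k E l).failProb G (sampleCfg k E l).I 0 ≤ 1 / 2)
    (p : PMF {s : Finset (Fin n) // G.graph.IsNClique k s})
    (hp : ∀ s, p s = (sampleCfg k E l).foundProb G hfail s.1)
    (s : {s : Finset (Fin n) // G.graph.IsNClique k s}) :
    |(p s).toReal - 1 / (G.numCliques k : ℝ)| < (1 / E) / (G.numCliques k : ℝ) := by
  classical
  have hcard : Fintype.card {s : Finset (Fin n) // G.graph.IsNClique k s} = G.numCliques k := by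
    rw [Fintype.card_subtype, numCliques_eq]
  have hE : (2 : ℝ) ≤ E := by exact_mod_cast h.hE
  obtain ⟨hy0, hy1⟩ := h.y_bounds
  have hn : (0 : ℝ) < n := by exact_mod_cast Nat.pos_of_ne_zero (NeZero.ne n)
  -- For `y = 1 / (16 * E)` the resulting error `16 * y` is `1 / E`. The additive error is that of
  -- all rounds together, doubled by conditioning on success.
  have key := PMF.near_uniform p (by rwa [hcard]) hy0 hy1
    (eta := 2 * (1 / (16 * E * (n : ℝ) ^ k))) (by positivity) ?_ ?_ s
  · rw [hcard] at key
    have e : 16 * (1 / (16 * (E : ℝ))) = 1 / E := by field_simp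
    rwa [e] at key
  · rw [hcard]
    have h1 : (G.numCliques k : ℝ) ≤ (n : ℝ) ^ k := by exact_mod_cast numCliques_le G
    have e : (n : ℝ) ^ k * (2 * (1 / (16 * E * (n : ℝ) ^ k))) = 2 * (1 / (16 * E)) := by
      field_simp
    rw [← e]
    exact mul_le_mul_of_nonneg_right h1 (by positivity)
  · intro a b
    have e : ∀ a : {s : Finset (Fin n) // G.graph.IsNClique k s}, p a =
        avg ((sampleCfg k E l).search G (sampleCfg k E l).I 0)
          (fun q => if q.clique = some a.1 then 1 else 0) *
        (1 - (sampleCfg k E l).failProb G (sampleCfg k E l).I 0)⁻¹ := by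
      intro a
      rw [hp, Config.foundProb, Config.avg_foundPMF]
      congr 1
      refine avg_congr _ fun q => ?_
      rcases q with ⟨i, _ | x⟩
      · simp [SearchOut.clique]
      · simp
    -- Conditioning divides by a probability of success of at least `1 / 2`. The multiplicative
    -- comparison is not affected, only the additive error doubles.
    have hinv : (1 - (sampleCfg k E l).failProb G (sampleCfg k E l).I 0)⁻¹ ≤ 2 := by
      rw [ENNReal.inv_le_iff_inv_le]
      refine ENNReal.le_sub_of_add_le_right (ne_top_of_lt hfail) ?_
      calc _ ≤ (2 : ℝ≥0∞)⁻¹ + 1 / 2 := add_le_add le_rfl hfail2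
        _ = 1 := by rw [one_div, ENNReal.inv_two_add_inv_two]
    have hratio := (sampleCfg k E l).search_ratio G (s := a.1) (s' := b.1)
      (ρ := ENNReal.ofReal ((1 + 2 * (1 / (16 * E))) / (1 - 1 / (16 * E))))
      (β := ENNReal.ofReal (1 / (16 * E * (n : ℝ) ^ k * (8 * k * l : ℕ)))) (fun i =>
        le_trans (le_of_eq (avg_congr _ fun _ => by congr)) <|
          (round_ratio G (R := 64) (B := 2 ^ i) h.hk h.one_le_K Nat.one_le_two_pow hy0
          (by linarith) a.2 b.2).trans <| add_le_add
            (mul_le_mul_right (le_of_eq (avg_congr _ fun _ => by congr)) _) (h.badProb_le i))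
      (sampleCfg k E l).I 0
    have hI : (((sampleCfg k E l).I : ℕ) : ℝ≥0∞) *
        ENNReal.ofReal (1 / (16 * E * (n : ℝ) ^ k * (8 * k * l : ℕ))) =
        ENNReal.ofReal (1 / (16 * E * (n : ℝ) ^ k)) := by
      change ((8 * k * l : ℕ) : ℝ≥0∞) * _ = _
      rw [← ENNReal.ofReal_natCast, ← ENNReal.ofReal_mul (by positivity)]
      congr 1
      have h1 : ((8 * k * l : ℕ) : ℝ) ≠ 0 := by have := h.one_le_I; positivity
      field_simp
    rw [hI] at hratio
    rw [e, e]
    refine (mul_le_mul_left hratio _).trans ?_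
    rw [add_mul, ← mul_assoc, mul_comm 2 (1 / (16 * (E : ℝ) * (n : ℝ) ^ k)),
      ENNReal.ofReal_mul (q := 2) (by positivity)]
    refine add_le_add le_rfl (mul_le_mul_right ?_ _)
    simpa using hinv

/-- Rounding at most doubles the error of an approximation of an integer. -/
theorem round_error {a r N : ℕ} (hr : 1 ≤ r) :
    |(((2 * a + r) / (2 * r) : ℕ) : ℝ) - N| ≤ 2 * |(a : ℝ) / r - N| := by
  set e := (2 * a + r) / (2 * r) with he
  have hr' : (0 : ℝ) < r := by exact_mod_cast hr
  have h1 : 2 * r * e ≤ 2 * a + r := Nat.mul_div_le _ _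
  have h2 : 2 * a + r < 2 * r * (e + 1) := Nat.lt_mul_div_succ _ (by omega)
  have h1' : 2 * (r : ℝ) * e ≤ 2 * a + r := by exact_mod_cast h1
  have h2' : 2 * (a : ℝ) + r < 2 * r * (e + 1) := by exact_mod_cast h2
  have h3 : (e : ℝ) - a / r ≤ 1 / 2 := by
    rw [sub_le_iff_le_add, div_add_div _ _ (by norm_num) hr'.ne', le_div_iff₀ (by positivity)]
    linarith
  have h4 : (a : ℝ) / r - e ≤ 1 / 2 := by
    rw [sub_le_iff_le_add, div_le_iff₀ hr']
    linarith
  -- If the rounded value differs from the integer `N`, then by at least `1`; rounding moved it by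
  -- at most `1 / 2`, so the error before rounding was at least half of the present one.
  rcases lt_trichotomy e N with h | h | h
  · have h5 : (e : ℝ) + 1 ≤ N := by exact_mod_cast h
    rw [abs_of_nonpos (by linarith)]
    have := neg_abs_le ((a : ℝ) / r - N)
    linarith
  · simp [h]
  · have h5 : (N : ℝ) + 1 ≤ e := by exact_mod_cast h
    rw [abs_of_nonneg (by linarith)]
    have := le_abs_self ((a : ℝ) / r - N)
    linarith

open Classical in
/-- The probability that the estimate is wrong. -/
theorem count_error (h : Params n k E l)
    (hN : 1 ≤ G.numCliques k → ∃ i < 8 * k * l, 3 * 6 ^ k * effort G k ≤ 2 ^ i) :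
    avg ((countCfg k E l).search G (countCfg k E l).I 0) (fun q =>
      if |((countCfg k E l).estimate q : ℝ) - G.numCliques k| ≤ G.numCliques k / E then 0 else 1) ≤
      ENNReal.ofReal (1 / 3) := by
  have hthr := h.thr_bounds
  have hR : 1 ≤ (countCfg k E l).R := by
    change 1 ≤ 4 * (2 ^ 14 * E ^ 2 * (8 * k * l)); omega
  have hE : (2 : ℝ) ≤ E := by exact_mod_cast h.hE
  -- Without cliques no round can succeed, and a failed search has the estimate `0`, which is exact.
  rcases Nat.eq_zero_or_pos (G.numCliques k) with h0 | hpos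
  · have hbad := (countCfg k E l).search_bad_le G (E := fun _ _ => True) (β := 0) (fun i => by
      have := round_of_no_cliques G (K := (countCfg k E l).K) (R := (countCfg k E l).R) (B := 2 ^ i)
        h.hk h0 (flag := 0) (thr := (countCfg k E l).thr)
        (show 1 ≤ 2 ^ 14 * E ^ 2 * (8 * k * l) by omega)
      refine le_trans (le_of_eq (avg_congr _ fun p => ?_)) this.le
      simp only [and_true]) (countCfg k E l).I 0
    refine (avg_mono _ fun q => ?_).trans (hbad.trans (by simp))
    rcases q with ⟨i, _ | p⟩
    · simp [Config.estimate, h0]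
    · simp only [Option.some.injEq, and_true, exists_eq', if_true]
      split_ifs <;> simp
  · obtain ⟨j, hj, hi⟩ := hN hpos
    have hfail := ((countCfg k E l).failProb_le_roundFail G (countCfg k E l).I (Nat.zero_le j)
      (by rw [zero_add]; exact hj)).trans (count_roundFail h hpos hi)
    have hbad := (countCfg k E l).search_bad_le G
      (E := fun i p => ¬ Accurate G k E ((countCfg k E l).R * 2 ^ i) p.1.1 p.2)
      (β := ENNReal.ofReal (1 / (16 * E * (n : ℝ) ^ k * (8 * k * l : ℕ))) +
        ENNReal.ofReal (128 * E ^ 2 / (2 ^ 14 * E ^ 2 * (8 * k * l) : ℕ))) (fun i =>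
        le_trans (le_of_eq (avg_congr _ fun _ => by congr)) <| (round_accuracy G (R := (countCfg k E l).R) (B := 2 ^ i) h.hk h.one_le_K Nat.one_le_two_pow
          hR (E := E) (by have := h.hE; omega) (t := 2 ^ 14 * E ^ 2 * (8 * k * l))
          (by omega)).trans (add_le_add (h.badProb_le i) le_rfl)) (countCfg k E l).I 0
    have hβ : (((countCfg k E l).I : ℕ) : ℝ≥0∞) *
        (ENNReal.ofReal (1 / (16 * E * (n : ℝ) ^ k * (8 * k * l : ℕ))) +
        ENNReal.ofReal (128 * E ^ 2 / (2 ^ 14 * E ^ 2 * (8 * k * l) : ℕ))) ≤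
        ENNReal.ofReal (1 / 25) := by
      change ((8 * k * l : ℕ) : ℝ≥0∞) * _ ≤ _
      have hI : (1 : ℝ) ≤ (8 * k * l : ℕ) := by exact_mod_cast h.one_le_I
      rw [← ENNReal.ofReal_add (by positivity) (by positivity), ← ENNReal.ofReal_natCast,
        ← ENNReal.ofReal_mul (by positivity)]
      refine ENNReal.ofReal_le_ofReal ?_
      have hnk : (1 : ℝ) ≤ (n : ℝ) ^ k :=
        one_le_pow₀ (by exact_mod_cast Nat.one_le_iff_ne_zero.2 (NeZero.ne n))
      have e : ((8 * k * l : ℕ) : ℝ) * (1 / (16 * E * (n : ℝ) ^ k * (8 * k * l : ℕ)) +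
          128 * E ^ 2 / (2 ^ 14 * E ^ 2 * (8 * k * l) : ℕ)) =
          1 / (16 * (E * (n : ℝ) ^ k)) + 1 / 128 := by
        rw [Nat.cast_mul (2 ^ 14 * E ^ 2)]
        set I : ℝ := ((8 * k * l : ℕ) : ℝ)
        push_cast
        field_simp
        ring
      rw [e]
      have h32 : (1 : ℝ) / (16 * (E * (n : ℝ) ^ k)) ≤ 1 / 32 := by
        refine one_div_le_one_div_of_le (by norm_num) ?_
        nlinarith
      linarith
    -- A wrong estimate means a failed search or a successful last round that is inaccurate. The
    -- probabilities `7 / 25` and `1 / 25` sum to `8 / 25 < 1 / 3`.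
    refine (avg_mono (v' := fun q : SearchOut n => (if q.2.isSome then 0 else 1) +
      if ∃ p, q.2 = some p ∧ ¬ Accurate G k E ((countCfg k E l).R * 2 ^ (q.1 - 1)) p.1.1 p.2
        then 1 else 0) _ fun q => ?_).trans ?_
    · rcases q with ⟨i, _ | p⟩
      · simp only [Option.isSome_none, Bool.false_eq_true, if_false]
        refine le_trans ?_ le_self_add
        split_ifs <;> simp
      · by_cases hacc : Accurate G k E ((countCfg k E l).R * 2 ^ (i - 1)) p.1.1 p.2
        · rw [if_pos]
          · exact zero_le
          · refine (round_error (Nat.mul_pos hR (by positivity))).trans ?_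
            rw [Accurate] at hacc
            rw [Nat.cast_mul p.2]
            refine (mul_le_mul_of_nonneg_left hacc (by norm_num)).trans (le_of_eq ?_)
            field_simp
        · refine le_trans ?_ le_add_self
          simp only [Option.some.injEq, exists_eq_left', hacc, not_false_eq_true, if_true]
          split_ifs <;> simp
    · rw [avg_add]
      refine (add_le_add hfail (le_trans (le_of_eq (avg_congr _ fun _ => by congr))
        (hbad.trans hβ))).trans ?_
      rw [← ENNReal.ofReal_add (by norm_num) (by norm_num)]
      exact ENNReal.ofReal_le_ofReal (by norm_num)

end Sampling

/-! ### Sizes of numbers and running times -/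

section Sizes

variable {n k E l w : ℕ}

/-- The size of the input numbers. -/
structure InputSizes (n k E l w : ℕ) : Prop where
  n_le : n ≤ 2 ^ w
  k_le : k ≤ 2 ^ w
  E_le : E ≤ 2 ^ w
  l_le : l ≤ w
  w2 : 2 ≤ w

/-- The time for an operation of the programs, up to the factor for accesses to the list. -/
def unitTime (k : ℕ) : ℕ := 10 ^ 8 * (18 * k) ^ 2

/-- The time for an access. -/
def accessTime (k E l : ℕ) : ℕ :=
  (4 * Nat.clog 2 (2 ^ (8 * k * l) * (2 ^ 14 * k ^ 3 * E ^ 3 * l)) + 10) * unitTime k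

theorem InputSizes.mach (h : InputSizes n k E l w) (hk : 2 ≤ k) : Mach w (18 * k) (unitTime k) :=
  ⟨by have := h.w2; omega, by omega, le_rfl⟩

/-- Every number is bounded by a power of `x = 2 ^ w`; the largest exponent is `8 * k + 18`, below
`18 * k` because `k ≥ 2`. Numbers such as `2 ^ (8 * k * l)` and `(4 * n) ^ k` really need `O(k)`
words, which is why `c = 18 * k`. -/
theorem InputSizes.facts (h : InputSizes n k E l w) (hP : Params n k E l) :
    8 * (n * n) * (2 ^ (8 * k * l) * (2 ^ 14 * k ^ 3 * E ^ 3 * l)) < 2 ^ (18 * k * w) ∧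
    4 * (4 * n) ^ k < 2 ^ (18 * k * w) ∧
    4 * (2 ^ 14 * E ^ 2 * (8 * k * l)) * 2 ^ (8 * k * l) < 2 ^ (18 * k * w) ∧
    64 * 2 ^ (8 * k * l) < 2 ^ (18 * k * w) ∧ 2 * n < 2 ^ (18 * k * w) ∧
    k < 2 ^ (18 * k * w) ∧ E < 2 ^ (18 * k * w) ∧ l < 2 ^ (18 * k * w) := by
  have hk := hP.hk
  obtain ⟨hn, hk', hE, hl, hw⟩ := h
  have hlw : l ≤ 2 ^ w := hl.trans Nat.lt_two_pow_self.le
  have hI : 2 ^ (8 * k * l) ≤ (2 ^ w) ^ (8 * k) := by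
    rw [← pow_mul]
    refine Nat.pow_le_pow_right (by norm_num) ?_
    rw [mul_comm w]
    exact Nat.mul_le_mul_left _ hl
  have h4 : 4 ≤ 2 ^ w := by
    calc 4 = 2 ^ 2 := by norm_num
      _ ≤ 2 ^ w := Nat.pow_le_pow_right (by norm_num) hw
  rw [mul_comm (18 * k), pow_mul 2 w (18 * k)]
  set x := 2 ^ w
  have h8 : 8 ≤ x ^ 2 := by nlinarith
  have h14 : 2 ^ 14 ≤ x ^ 7 := by
    calc 2 ^ 14 = 4 ^ 7 := by norm_num
      _ ≤ x ^ 7 := Nat.pow_le_pow_left h4 7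
  have h64 : 64 ≤ x ^ 3 := by
    calc 64 = 4 ^ 3 := by norm_num
      _ ≤ x ^ 3 := Nat.pow_le_pow_left h4 3
  have lt : ∀ {a i : ℕ}, a ≤ x ^ i → i < 18 * k → a < x ^ (18 * k) := fun ha hi =>
    ha.trans_lt (Nat.pow_lt_pow_right (by omega) hi)
  refine ⟨lt (i := 8 * k + 18) ?_ (by omega), lt (i := 2 * k + 1) ?_ (by omega),
    lt (i := 8 * k + 14) ?_ (by omega), lt (i := 8 * k + 3) ?_ (by omega),
    lt (i := 2) ?_ (by omega), lt (i := 1) (by simpa using hk') (by omega),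
    lt (i := 1) (by simpa using hE) (by omega), lt (i := 1) (by simpa using hlw) (by omega)⟩
  · calc _ ≤ x ^ 2 * (x * x) * (x ^ (8 * k) * (x ^ 7 * x ^ 3 * x ^ 3 * x)) := by gcongr
      _ = _ := by ring
  · calc _ ≤ x * (x * x) ^ k := by gcongr
      _ = _ := by ring
  · calc _ ≤ x * (x ^ 7 * x ^ 2 * (x ^ 2 * x * x)) * x ^ (8 * k) := by gcongr
      _ = _ := by ring
  · calc _ ≤ x ^ 3 * x ^ (8 * k) := by gcongr
      _ = _ := by ring
  · nlinarith

theorem InputSizes.setupSizes (h : InputSizes n k E l w) (hP : Params n k E l) :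
    SetupSizes (2 ^ (18 * k * w)) n k E l := by
  obtain ⟨-, -, h3, h4, h5, h6, h7, h8⟩ := h.facts hP
  have h1 : 8 * k * l < 2 ^ (8 * k * l) := Nat.lt_two_pow_self
  refine ⟨h5, h6, h7, h8, by omega, lt_of_le_of_lt ?_ h3⟩
  refine le_trans ?_ (Nat.le_mul_of_pos_right _ (by positivity))
  omega

theorem InputSizes.valid_sample (h : InputSizes n k E l w) (hP : Params n k E l) :
    (sampleCfg k E l).Valid n (2 ^ (18 * k * w)) (unitTime k) (accessTime k E l) := by
  obtain ⟨h1, h2, h3, h4, h5, h6, h7, h8⟩ := h.facts hP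
  have hI : 8 * k * l < 2 ^ (8 * k * l) := Nat.lt_two_pow_self
  refine ⟨hP.hk, hP.one_le_K, le_rfl, ?_, h6, h1, h2, h4, ?_, ?_, le_rfl⟩
  · have := hP.hn
    simp only [sampleCfg, pow_succ]; omega
  · simp only [sampleCfg]; omega
  · simp only [sampleCfg]; omega

theorem InputSizes.valid_count (h : InputSizes n k E l w) (hP : Params n k E l) :
    (countCfg k E l).Valid n (2 ^ (18 * k * w)) (unitTime k) (accessTime k E l) := by
  obtain ⟨h1, h2, h3, h4, h5, h6, h7, h8⟩ := h.facts hP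
  have hI : 8 * k * l < 2 ^ (8 * k * l) := Nat.lt_two_pow_self
  refine ⟨hP.hk, hP.one_le_K, Nat.zero_le _, ?_, h6, h1, h2, h3, ?_, (h.setupSizes hP).hthr, le_rfl⟩
  · have := hP.hn
    simp only [countCfg, pow_succ]; omega
  · simp only [countCfg]; omega

/-- The logarithm of the length of the largest list is linear in `k * l`, `k`, `E` and `l`, and each
of these is at most `k * E * l`. -/
theorem Params.accessTime_le (hP : Params n k E l) :
    accessTime k E l ≤ 77 * (k * E * l) * unitTime k := by
  have hk := hP.hk
  have hE := hP.hE
  have hl := hP.hl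
  refine Nat.mul_le_mul_right _ ?_
  have h1 : Nat.clog 2 (2 ^ (8 * k * l) * (2 ^ 14 * k ^ 3 * E ^ 3 * l)) ≤
      8 * k * l + (14 + 3 * k + 3 * E + l) := by
    refine Nat.clog_le_of_le_pow ?_
    have hk2 : k ≤ 2 ^ k := Nat.lt_two_pow_self.le
    have hE2 : E ≤ 2 ^ E := Nat.lt_two_pow_self.le
    have hl2 : l ≤ 2 ^ l := Nat.lt_two_pow_self.le
    calc _ ≤ 2 ^ (8 * k * l) * (2 ^ 14 * (2 ^ k) ^ 3 * (2 ^ E) ^ 3 * 2 ^ l) := by gcongr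
      _ = _ := by ring
  have e1 : k * l * 1 ≤ k * l * E := Nat.mul_le_mul_left _ (by omega)
  have e2 : k * (1 * 1) ≤ k * (E * l) := Nat.mul_le_mul_left _ (Nat.mul_le_mul (by omega) hl)
  have e3 : E * (1 * 1) ≤ E * (k * l) := Nat.mul_le_mul_left _ (Nat.mul_le_mul (by omega) hl)
  have e4 : l * (1 * 1) ≤ l * (k * E) := Nat.mul_le_mul_left _ (Nat.mul_le_mul (by omega) (by omega))
  have e5 : 2 * 2 * 1 ≤ k * E * l := Nat.mul_le_mul (Nat.mul_le_mul hk hE) hl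
  have r1 : k * l * E = k * E * l := by ring
  have r2 : k * (E * l) = k * E * l := by ring
  have r3 : E * (k * l) = k * E * l := by ring
  have r4 : l * (k * E) = k * E * l := by ring
  have r5 : 8 * k * l = 8 * (k * l) := by ring
  rw [r1] at e1; rw [r2] at e2; rw [r3] at e3; rw [r4] at e4
  omega

/-- A bound for the times of the rounds of both programs. -/
def roundBound (k E l : ℕ) : ℕ := 2 ^ 26 * (k ^ 3 * E ^ 3 * l)

theorem Params.roundTime_le (hP : Params n k E l) {R : ℕ}
    (hR : R ≤ 4 * (2 ^ 14 * E ^ 2 * (8 * k * l))) :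
    7 * (2 ^ 14 * k ^ 3 * E ^ 3 * l) + 2 * (l + 1) + 5 * k + R * (100 * k ^ 2 + 6) + 30 ≤
      roundBound k E l := by
  have hk := hP.hk
  have hE := hP.hE
  have hl := hP.hl
  have h1 : R * (100 * k ^ 2 + 6) ≤ 2 ^ 19 * 102 * (k ^ 3 * E ^ 3 * l) := by
    calc R * (100 * k ^ 2 + 6) ≤ 4 * (2 ^ 14 * E ^ 2 * (8 * k * l)) * (102 * k ^ 2) :=
          Nat.mul_le_mul hR (by nlinarith)
      _ = 2 ^ 19 * 102 * (k ^ 3 * E ^ 2 * l) := by ring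
      _ ≤ 2 ^ 19 * 102 * (k ^ 3 * E ^ 3 * l) := by
          gcongr
          · omega
          · norm_num
  have hk3 : k ≤ k ^ 3 := Nat.le_self_pow (by norm_num) k
  have hE3 : 1 ≤ E ^ 3 := Nat.one_le_pow _ _ (by omega)
  have hk1 : 1 ≤ k ^ 3 := by omega
  have e2 : k * 1 * 1 ≤ k ^ 3 * E ^ 3 * l := Nat.mul_le_mul (Nat.mul_le_mul hk3 hE3) hl
  have e4 : 1 * 1 * l ≤ k ^ 3 * E ^ 3 * l := Nat.mul_le_mul_right _ (Nat.mul_le_mul hk1 hE3)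
  have r : 7 * (2 ^ 14 * k ^ 3 * E ^ 3 * l) = 7 * 2 ^ 14 * (k ^ 3 * E ^ 3 * l) := by ring
  rw [r, roundBound]
  omega

theorem Params.roundTime_count (hP : Params n k E l) :
    (countCfg k E l).roundTime ≤ roundBound k E l := hP.roundTime_le le_rfl

theorem Params.roundTime_sample (hP : Params n k E l) :
    (sampleCfg k E l).roundTime ≤ roundBound k E l := by
  refine hP.roundTime_le ?_
  have := hP.thr_bounds
  simp only [sampleCfg]; omega

theorem Params.small_le (hP : Params n k E l) : 3 * l + 14 ≤ roundBound k E l := by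
  have hl := hP.hl
  have hE3 : 1 ≤ E ^ 3 := Nat.one_le_pow _ _ (by have := hP.hE; omega)
  have hk1 : 1 ≤ k ^ 3 := Nat.one_le_pow _ _ (by have := hP.hk; omega)
  have e4 : 1 * 1 * l ≤ k ^ 3 * E ^ 3 * l := Nat.mul_le_mul_right _ (Nat.mul_le_mul hk1 hE3)
  rw [roundBound]; omega

end Sizes

/-! ### From the number of steps to the stated bound. -/

section Times

variable {n : ℕ} [NeZero n] (G : QueryGraph n) {k E l : ℕ}

theorem Config.avg_time_le (cfg : Config) {j : ℕ}
    (hj : ∀ i, j ≤ i → cfg.roundFail G i ≤ ENNReal.ofReal (7 / 25)) (d U' : ℕ) :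
    (avg (cfg.search G cfg.I 0) fun q => (((2 ^ q.1 * cfg.roundTime + d) * U' : ℕ) : ℝ≥0∞)) ≤
      (((5 * 2 ^ j * cfg.roundTime + d) * U' : ℕ) : ℝ≥0∞) := by
  have h := cfg.avg_search_two_pow G (j := j) (fun i hi => (hj i hi).trans
    (ENNReal.ofReal_le_ofReal (by norm_num))) cfg.I 0
  rw [max_eq_right (Nat.zero_le _)] at h
  have e : (fun q : SearchOut n => (((2 ^ q.1 * cfg.roundTime + d) * U' : ℕ) : ℝ≥0∞)) =
      fun q => ((cfg.roundTime * U' : ℕ) : ℝ≥0∞) * 2 ^ q.1 + ((d * U' : ℕ) : ℝ≥0∞) := by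
    funext q; push_cast; ring
  rw [e, avg_add, avg_mul_left, avg_const]
  calc _ ≤ ((cfg.roundTime * U' : ℕ) : ℝ≥0∞) * (5 * 2 ^ j) + ((d * U' : ℕ) : ℝ≥0∞) :=
        add_le_add (mul_le_mul_right h _) le_rfl
    _ = _ := by push_cast; ring

/-- The first power of two beyond the sufficient effort. Since the effort is at most `2 * n ^ k ≤ 2
* 2 ^ (l * k)`, its exponent lies below the maximal number `8 * k * l` of rounds, so the search does
reach it. -/
theorem exists_rounds (hP : Params n k E l) (hN : 1 ≤ G.numCliques k) :
    ∃ j < 8 * k * l, 3 * 6 ^ k * effort G k ≤ 2 ^ j ∧ (2 : ℝ) ^ j ≤ 6 * 6 ^ k * effort G k := by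
  have hk := hP.hk
  have hl := hP.hl
  have hn1 : 1 ≤ n := Nat.one_le_iff_ne_zero.2 (NeZero.ne n)
  have he := one_le_effort G hk hN
  have h6 : (1 : ℝ) ≤ 6 ^ k := one_le_pow₀ (by norm_num)
  have hx : (1 : ℝ) ≤ 3 * 6 ^ k * effort G k := by nlinarith
  obtain ⟨m, h1, h2⟩ := exists_nat_pow_near hx (by norm_num : (1 : ℝ) < 2)
  refine ⟨m + 1, ?_, h2.le, ?_⟩
  · have h3 : (2 : ℝ) ^ m ≤ 2 ^ (3 + 3 * k + l * k) := by
      calc (2 : ℝ) ^ m ≤ 3 * 6 ^ k * (2 * (n : ℝ) ^ k) :=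
            h1.trans (mul_le_mul_of_nonneg_left (effort_le G hk hn1 hN) (by positivity))
        _ = 6 * 6 ^ k * (n : ℝ) ^ k := by ring
        _ ≤ 8 * 8 ^ k * ((2 : ℝ) ^ l) ^ k := by
            have hn : (n : ℝ) ≤ 2 ^ l := by exact_mod_cast hP.hn.le
            gcongr <;> norm_num
        _ = 2 ^ (3 + 3 * k + l * k) := by
            rw [pow_add, pow_add, pow_mul, pow_mul]; norm_num
    have h4 : m ≤ 3 + 3 * k + l * k := (pow_le_pow_iff_right₀ (by norm_num)).1 h3
    have h5 : k * 1 ≤ k * l := Nat.mul_le_mul_left _ hl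
    have r1 : l * k = k * l := mul_comm _ _
    have r2 : 8 * k * l = 8 * (k * l) := by ring
    rw [r1] at h4
    omega
  · rw [pow_succ]; linarith

omit [NeZero n] in
/-- The bound for the time, without suppressed factors. -/
theorem Params.time_le (hP : Params n k E l) {j : ℕ} {rt : ℕ}
    (hrt : rt ≤ roundBound k E l) (hj : (2 : ℝ) ^ j ≤ 6 * 6 ^ k * effort G k) :
    ((2 * ((5 * 2 ^ j * rt + (3 * l + 14)) * accessTime k E l) : ℕ) : ℝ) ≤
      10 ^ 23 * (6 ^ k * (k : ℝ) ^ 6) * ((E : ℝ) ^ 4 * (l : ℝ) ^ 2) * effort G k := by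
  have h1 : 2 * ((5 * 2 ^ j * rt + (3 * l + 14)) * accessTime k E l) ≤
      2 * ((6 * 2 ^ j * roundBound k E l) * (77 * (k * E * l) * unitTime k)) := by
    refine Nat.mul_le_mul_left _ (Nat.mul_le_mul ?_ hP.accessTime_le)
    have h2 : 5 * 2 ^ j * rt ≤ 5 * 2 ^ j * roundBound k E l := Nat.mul_le_mul_left _ hrt
    have h3 : 3 * l + 14 ≤ 2 ^ j * roundBound k E l :=
      hP.small_le.trans (Nat.le_mul_of_pos_left _ (by positivity))
    have e : 6 * 2 ^ j * roundBound k E l =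
      5 * 2 ^ j * roundBound k E l + 2 ^ j * roundBound k E l := by ring
    omega
  calc _ ≤ ((2 * ((6 * 2 ^ j * roundBound k E l) * (77 * (k * E * l) * unitTime k)) : ℕ) : ℝ) :=
        Nat.cast_le.2 h1
    _ = (2 * 6 * 2 ^ 26 * 77 * 10 ^ 8 * 18 ^ 2 * (k : ℝ) ^ 6 * ((E : ℝ) ^ 4 * (l : ℝ) ^ 2)) *
          2 ^ j := by
        rw [roundBound, unitTime]; push_cast; ring
    _ ≤ (2 * 6 * 2 ^ 26 * 77 * 10 ^ 8 * 18 ^ 2 * (k : ℝ) ^ 6 * ((E : ℝ) ^ 4 * (l : ℝ) ^ 2)) *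
          (6 * 6 ^ k * effort G k) := mul_le_mul_of_nonneg_left hj (by positivity)
    _ = (2 * 6 * 2 ^ 26 * 77 * 10 ^ 8 * 18 ^ 2 * 6) * ((6 ^ k * (k : ℝ) ^ 6) *
          ((E : ℝ) ^ 4 * (l : ℝ) ^ 2) * effort G k) := by ring
    _ ≤ 10 ^ 23 * ((6 ^ k * (k : ℝ) ^ 6) * ((E : ℝ) ^ 4 * (l : ℝ) ^ 2) * effort G k) := by
        refine mul_le_mul_of_nonneg_right (by norm_num) ?_
        rw [effort]; positivity
    _ = _ := by ring

/-- The factor `6 ^ k` stems from the sufficient effort and `k ^ 6` from loops and word lengths. As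
`k ^ 6 ≤ 720 * exp k` and `6 * e < 17`, the product is at most `720 * 17 ^ k`, and `17 ^ k / k! ≤
exp 17 < 3 ^ 17`. -/
theorem pow_six_le (k : ℕ) : 6 ^ k * (k : ℝ) ^ 6 ≤ 720 * 3 ^ 17 * (k ! : ℝ) := by
  have he := Real.exp_one_lt_d9
  have h1 : (k : ℝ) ^ 6 ≤ 720 * Real.exp k := by
    have := Real.pow_div_factorial_le_exp (k : ℝ) (by positivity) 6
    rw [div_le_iff₀ (by positivity)] at this
    norm_num [Nat.factorial] at this
    linarith
  have h2 : (17 : ℝ) ^ k ≤ 3 ^ 17 * (k ! : ℝ) := by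
    have := Real.pow_div_factorial_le_exp (17 : ℝ) (by norm_num) k
    rw [div_le_iff₀ (by positivity)] at this
    refine this.trans (mul_le_mul_of_nonneg_right ?_ (by positivity))
    have e : Real.exp 17 = Real.exp 1 ^ 17 := by rw [← Real.exp_nat_mul]; norm_num
    rw [e]
    exact pow_le_pow_left₀ (Real.exp_pos _).le (by linarith) 17
  calc 6 ^ k * (k : ℝ) ^ 6 ≤ 6 ^ k * (720 * Real.exp k) := by gcongr
    _ = 720 * (6 * Real.exp 1) ^ k := by
        rw [mul_pow, ← Real.exp_nat_mul, mul_one]; ring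
    _ ≤ 720 * 17 ^ k := by
        gcongr
        linarith
    _ ≤ 720 * (3 ^ 17 * (k ! : ℝ)) := by gcongr
    _ = _ := by ring

theorem log_le (hl : l = Nat.log 2 n + 1) : (l : ℝ) ≤ 2 * (1 + Real.log n) := by
  have hn0 : n ≠ 0 := NeZero.ne n
  have hn : (1 : ℝ) ≤ n := by exact_mod_cast Nat.one_le_iff_ne_zero.2 hn0
  have h1 : (2 : ℝ) ^ Nat.log 2 n ≤ n := by exact_mod_cast Nat.pow_log_le_self 2 hn0
  have h2 : (Nat.log 2 n : ℝ) * Real.log 2 ≤ Real.log n := by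
    rw [← Real.log_pow]; exact Real.log_le_log (by positivity) h1
  have h3 := Real.log_two_gt_d9
  have h4 : (0 : ℝ) ≤ Nat.log 2 n := by positivity
  rw [hl]; push_cast
  nlinarith

/-- Both `E` and `l` are at most `2 * L` with `L = (1 + log n) / eps ≥ 1`, so their powers are
absorbed by `L ^ C`. The factor `1 / 2` is reserved for `log (2 / δ)`, which exceeds `log 2 > 1 /
2`. -/
theorem starBound_ge {eps : ℝ} (h0 : 0 < eps) (h1 : eps < 1) (hE : E = ⌈1 / eps⌉₊)
    (hl : l = Nat.log 2 n + 1) {C : ℕ} (hC : 10 ^ 40 ≤ C) :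
    10 ^ 23 * (6 ^ k * (k : ℝ) ^ 6) * ((E : ℝ) ^ 4 * (l : ℝ) ^ 2) * effort G k ≤
      starBound G k eps C * (1 / 2) := by
  have hn0 : n ≠ 0 := NeZero.ne n
  have hn : (1 : ℝ) ≤ n := by exact_mod_cast Nat.one_le_iff_ne_zero.2 hn0
  have hlog : 0 ≤ Real.log n := Real.log_nonneg hn
  set L : ℝ := (1 + Real.log n) / eps with hL
  have hLl : 1 + Real.log n ≤ L := by
    rw [hL, le_div_iff₀ h0]; nlinarith
  have hL1 : 1 ≤ L := by linarith
  have hE2 : (E : ℝ) ≤ 2 * L := by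
    have h2 := (Nat.ceil_lt_add_one (show 0 ≤ 1 / eps by positivity)).le
    rw [← hE] at h2
    have h3 : 1 / eps ≤ L := by rw [hL]; exact div_le_div_of_nonneg_right (by linarith) h0.le
    linarith
  have hl2 : (l : ℝ) ≤ 2 * L := (log_le hl).trans (by linarith)
  have heff : 0 ≤ effort G k := by rw [effort]; positivity
  have hEl : (E : ℝ) ^ 4 * (l : ℝ) ^ 2 ≤ 64 * L ^ C := by
    calc (E : ℝ) ^ 4 * (l : ℝ) ^ 2 ≤ (2 * L) ^ 4 * (2 * L) ^ 2 := by gcongr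
      _ = 64 * L ^ 6 := by ring
      _ ≤ 64 * L ^ C := mul_le_mul_of_nonneg_left
          (pow_le_pow_right₀ hL1 (le_trans (by norm_num) hC)) (by norm_num)
  have hC' : (10 : ℝ) ^ 40 ≤ C := by exact_mod_cast hC
  calc _ ≤ 10 ^ 23 * (720 * 3 ^ 17 * (k ! : ℝ)) * (64 * L ^ C) * effort G k := by
        gcongr 10 ^ 23 * ?_ * ?_ * effort G k
        exact pow_six_le k
    _ = (10 ^ 23 * (720 * 3 ^ 17) * 64) * ((k ! : ℝ) * L ^ C * effort G k) := by ring
    _ ≤ (C * (1 / 2)) * ((k ! : ℝ) * L ^ C * effort G k) := by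
        refine mul_le_mul_of_nonneg_right ?_ (by positivity)
        norm_num
        linarith
    _ = starBound G k eps C * (1 / 2) := by
        rw [starBound, effort]; ring

end Times

/-! ### Counting and sampling -/

section Main

variable {n k w : ℕ} {eps : ℝ}

theorem inputs_ok (hn1 : 1 ≤ n) (hk2 : 2 ≤ k) (h0 : 0 < eps) (h1 : eps < 1) (hn : n < 2 ^ w)
    (hk : k < 2 ^ w) (hE : ⌈1 / eps⌉₊ < 2 ^ w) :
    Params n k ⌈1 / eps⌉₊ (Nat.log 2 n + 1) ∧
      InputSizes n k ⌈1 / eps⌉₊ (Nat.log 2 n + 1) w := by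
  refine ⟨⟨hk2, ?_, by omega, Nat.lt_pow_succ_log_self (by norm_num) n⟩,
    ⟨hn.le, hk.le, hE.le, Nat.log_lt_of_lt_pow (by omega) hn, ?_⟩⟩
  · refine Nat.lt_ceil.2 ?_
    rw [Nat.cast_one, lt_div_iff₀ h0]; linarith
  · by_contra hw
    have : 2 ^ w ≤ 2 ^ 1 := Nat.pow_le_pow_right (by norm_num) (by omega)
    omega

theorem ceil_le {N : ℝ} (hN : 0 ≤ N) (h0 : 0 < eps) : N / ⌈1 / eps⌉₊ ≤ eps * N := by
  have h2 := Nat.le_ceil (1 / eps)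
  have hpos : (0 : ℝ) < ⌈1 / eps⌉₊ := lt_of_lt_of_le (by positivity) h2
  rw [div_le_iff₀ h0] at h2
  rw [div_le_iff₀ hpos]
  nlinarith

theorem approximate_counting {C : ℕ} (hC : 10 ^ 40 ≤ C) (hn1 : 1 ≤ n) (hk2 : 2 ≤ k) (h0 : 0 < eps)
    (h1 : eps < 1) (hn : n < 2 ^ w) (hk : k < 2 ^ w) (hE : ⌈1 / eps⌉₊ < 2 ^ w)
    (G : QueryGraph n) :
    2 / 3 ≤ G.access.prob w countProgram (.start [n, k, ⌈1 / eps⌉₊])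
      (fun τ => (1 - eps) * (G.numCliques k : ℝ) ≤ τ.reg 0 ∧
        (τ.reg 0 : ℝ) ≤ (1 + eps) * (G.numCliques k : ℝ)) ∧
    (1 ≤ G.numCliques k →
      G.access.expTime w countProgram (.start [n, k, ⌈1 / eps⌉₊]) ≤
        ENNReal.ofReal (starBound G k eps C) ∧
      G.access.expQueries w countProgram (.start [n, k, ⌈1 / eps⌉₊]) ≤
        ENNReal.ofReal (starBound G k eps C)) := by
  classical
  have : NeZero n := ⟨by omega⟩
  obtain ⟨hP, hI⟩ := inputs_ok hn1 hk2 h0 h1 hn hk hE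
  set l := Nat.log 2 n + 1 with hl
  set E := ⌈1 / eps⌉₊ with hEdef
  have ref : Ref G.access w countProgram _ ((countCfg k E l).search G (countCfg k E l).I 0) _ :=
    ref_countProgram (A := G.access) (hI.mach hk2) hl (hI.setupSizes hP)
    (hI.valid_count hP) (σ := .start [n, k, E]) rfl rfl rfl
  have herr := count_error (G := G) hP fun hN => by
    obtain ⟨j, hj, hj', -⟩ := exists_rounds G hP hN
    exact ⟨j, hj, hj'⟩
  refine ⟨?_, fun hN => ?_⟩
  · rw [ref.prob_eq (E' := fun q => (1 - eps) * (G.numCliques k : ℝ) ≤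
      (countCfg k E l).estimate q ∧ ((countCfg k E l).estimate q : ℝ) ≤
        (1 + eps) * (G.numCliques k : ℝ)) fun q τ hq => by rw [hq.1]]
    have h23 : (2 / 3 : ℝ≥0∞) = ENNReal.ofReal (2 / 3) := by
      rw [ENNReal.ofReal_div_of_pos (by norm_num)]; norm_num
    have hsum : (1 : ℝ≥0∞) = 2 / 3 + ENNReal.ofReal (1 / 3) := by
      rw [h23, ← ENNReal.ofReal_add (by norm_num) (by norm_num)]; norm_num
    -- The complement is bounded, and subtraction of extended reals is avoided by adding `1 / 3` to
    -- both sides.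
    refine (ENNReal.add_le_add_iff_right (a := ENNReal.ofReal (1 / 3)) ENNReal.ofReal_ne_top).1 ?_
    rw [← hsum]
    refine le_trans ?_ (add_le_add (le_of_eq (avg_congr _ fun _ => by congr)) herr)
    rw [← avg_add]
    refine (avg_const ((countCfg k E l).search G (countCfg k E l).I 0) 1).ge.trans ?_
    refine avg_mono _ fun q => ?_
    by_cases hq : |((countCfg k E l).estimate q : ℝ) - G.numCliques k| ≤ G.numCliques k / E
    · have hle := hq.trans (ceil_le (eps := eps) (by positivity) h0)
      obtain ⟨a1, a2⟩ := abs_le.1 hle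
      rw [if_pos ⟨by linarith, by linarith⟩]
      exact le_self_add
    · rw [if_neg hq]
      exact le_add_self
  · obtain ⟨j, hj, hj1, hj2⟩ := exists_rounds G hP hN
    have htime : G.access.expTime w countProgram (.start [n, k, E]) ≤
        ENNReal.ofReal (starBound G k eps C) := by
      refine (ref.expTime_le (cost := fun q =>
        (((2 ^ q.1 * (countCfg k E l).roundTime + (3 * l + 14)) * accessTime k E l : ℕ) : ℝ≥0∞))
        fun q τ hq => Nat.cast_le.2 ?_).trans ?_
      · have := hq.2
        rw [← add_assoc]; omega
      refine ((countCfg k E l).avg_time_le G (j := j) (fun i hi => count_roundFail hP hN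
        (hj1.trans (pow_le_pow_right₀ (by norm_num) hi))) _ _).trans ?_
      rw [← ENNReal.ofReal_natCast]
      refine ENNReal.ofReal_le_ofReal ?_
      have h3 := hP.time_le G hP.roundTime_count hj2
      have h4 := starBound_ge G (k := k) h0 h1 hEdef hl hC
      have hlog : 0 ≤ Real.log n := Real.log_nonneg (by exact_mod_cast hn1)
      have hstar : 0 ≤ starBound G k eps C := by rw [starBound]; positivity
      rw [Nat.cast_mul 2, Nat.cast_ofNat] at h3
      have h5 : (0 : ℝ) ≤ ((5 * 2 ^ j * (countCfg k E l).roundTime + (3 * l + 14)) *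
        accessTime k E l : ℕ) := Nat.cast_nonneg _
      linarith
    exact ⟨htime, (G.access.expQueries_le_expTime w _ _).trans htime⟩

/-- The preprocessing is deterministic: it only computes parameters and reaches a good state with
probability one. Every run of the sampling program draws its own lists, so the runs are independent,
and it repeats failed searches, so it always returns a clique and only its running time is random.
-/
theorem approximate_sampling {C : ℕ} (hC : 10 ^ 40 ≤ C) {δ : ℝ} (hn1 : 1 ≤ n) (hk2 : 2 ≤ k)
    (h0 : 0 < eps) (h1 : eps < 1) (hδ0 : 0 < δ) (hδ1 : δ < 1) (hn : n < 2 ^ w) (hk : k < 2 ^ w)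
    (hE : ⌈1 / eps⌉₊ < 2 ^ w) (G : QueryGraph n) (hN : 1 ≤ G.numCliques k) :
    G.access.expTime w sampleSetup (.start [n, k, ⌈1 / eps⌉₊, ⌈1 / δ⌉₊]) ≤
      ENNReal.ofReal (starBound G k eps C * Real.log (2 / δ)) ∧
    G.access.expQueries w sampleSetup (.start [n, k, ⌈1 / eps⌉₊, ⌈1 / δ⌉₊]) ≤
      ENNReal.ofReal (starBound G k eps C * Real.log (2 / δ)) ∧
    ENNReal.ofReal (1 - δ) ≤
      G.access.prob w sampleSetup (.start [n, k, ⌈1 / eps⌉₊, ⌈1 / δ⌉₊])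
        (SamplesFrom G w k eps (ENNReal.ofReal (starBound G k eps C * Real.log (2 / δ)))
          sampleProgram) := by
  classical
  have : NeZero n := ⟨by omega⟩
  obtain ⟨hP, hI⟩ := inputs_ok hn1 hk2 h0 h1 hn hk hE
  set l := Nat.log 2 n + 1 with hl
  set E := ⌈1 / eps⌉₊ with hEdef
  have hM := hI.mach hk2
  have hV := hI.valid_sample hP
  obtain ⟨j, hj, hj1, hj2⟩ := exists_rounds G hP hN
  have hlog : 1 / 2 ≤ Real.log (2 / δ) := by
    have h3 := Real.log_two_gt_d9
    have h4 : Real.log 2 ≤ Real.log (2 / δ) :=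
      Real.log_le_log (by norm_num) (by rw [le_div_iff₀ hδ0]; nlinarith)
    linarith
  have hround : ∀ i, j ≤ i → (sampleCfg k E l).roundFail G i ≤ ENNReal.ofReal (7 / 25) :=
    fun i hi => sample_roundFail hP hN (hj1.trans (pow_le_pow_right₀ (by norm_num) hi))
  have hstar : 0 ≤ starBound G k eps C := by
    have : 0 ≤ Real.log n := Real.log_nonneg (by exact_mod_cast hn1)
    rw [starBound]; positivity
  have hbound : ∀ t : ℕ, t ≤ 2 * ((5 * 2 ^ j * (sampleCfg k E l).roundTime + (3 * l + 14)) *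
      accessTime k E l) →
      (t : ℝ≥0∞) ≤ ENNReal.ofReal (starBound G k eps C * Real.log (2 / δ)) := by
    intro t ht
    rw [← ENNReal.ofReal_natCast]
    refine ENNReal.ofReal_le_ofReal ((Nat.cast_le.2 ht).trans ((hP.time_le G hP.roundTime_sample
      hj2).trans ((starBound_ge G (k := k) h0 h1 hEdef hl hC).trans ?_)))
    exact mul_le_mul_of_nonneg_left hlog hstar
  have hdet := (run_sampleSetup (A := G.access) (hV.mach hM) hn1 hl (hI.setupSizes hP)
    (σ := .start [n, k, E, ⌈1 / δ⌉₊]) rfl rfl rfl) _ (SameMem.refl _)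
  have htime : G.access.expTime w sampleSetup (.start [n, k, E, ⌈1 / δ⌉₊]) ≤
      ENNReal.ofReal (starBound G k eps C * Real.log (2 / δ)) := by
    refine (hdet.expTime_le (cost := fun _ => (((3 * l + 8) * accessTime k E l : ℕ) : ℝ≥0∞))
      fun q τ hq => Nat.cast_le.2 ?_).trans ((avg_const _ _).le.trans (hbound _ ?_))
    · obtain ⟨ρ, -, -, ht⟩ := hq
      omega
    · calc (3 * l + 8) * accessTime k E l ≤
          (5 * 2 ^ j * (sampleCfg k E l).roundTime + (3 * l + 14)) * accessTime k E l :=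
            Nat.mul_le_mul_right _ (by omega)
        _ ≤ _ := Nat.le_mul_of_pos_left _ (by norm_num)
  refine ⟨htime, (G.access.expQueries_le_expTime w _ _).trans htime, ?_⟩
  have hfail2 : (sampleCfg k E l).failProb G (sampleCfg k E l).I 0 ≤ 1 / 2 := by
    refine ((sampleCfg k E l).failProb_le_roundFail G (sampleCfg k E l).I (Nat.zero_le j)
      (by rw [zero_add]; exact hj)).trans ((hround j le_rfl).trans ?_)
    have e : (1 / 2 : ℝ≥0∞) = ENNReal.ofReal (1 / 2) := by
      rw [ENNReal.ofReal_div_of_pos (by norm_num)]; norm_num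
    rw [e]
    exact ENNReal.ofReal_le_ofReal (by norm_num)
  have hfail : (sampleCfg k E l).failProb G (sampleCfg k E l).I 0 < 1 := hfail2.trans_lt (by
    rw [one_div]; exact ENNReal.inv_lt_one.2 (by norm_num))
  rw [hdet.prob_eq_one]
  · exact ENNReal.ofReal_le_one.2 (by linarith)
  rintro - τ ⟨ρ, hρ, hm, -⟩
  have hL : (sampleCfg k E l).Loaded n τ := hρ.congr fun x _ => by rw [hm.1]
  refine samplesFrom_of_loaded (cfg := sampleCfg k E l) hM hV rfl rfl hfail hfail2 hN
    (fun p hp s => (foundProb_near_uniform hP hN hfail hfail2 p hp s).trans_le ?_) ?_ hL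
  · refine div_le_div_of_nonneg_right ?_ (by positivity)
    have := ceil_le (N := 1) (by norm_num) h0
    rwa [mul_one] at this
  · refine (mul_le_mul_right ((sampleCfg k E l).avg_time_le G hround 8 (accessTime k E l)) 2).trans ?_
    refine le_trans (le_of_eq ?_) (hbound (2 * ((5 * 2 ^ j * (sampleCfg k E l).roundTime + 8) *
      accessTime k E l)) (Nat.mul_le_mul_left _ (Nat.mul_le_mul_right _ (by omega))))
    rw [Nat.cast_mul 2]; norm_num

end Main

end CliqueSampling

end

theorem mainTheorem5 :
    -- the three attempted samplers
    (∃ C : ℕ, ∀ (n k γ mbar w : ℕ), 1 ≤ n → 2 ≤ k → 1 ≤ γ → 1 ≤ mbar →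
      n < 2 ^ w → k < 2 ^ w → γ < 2 ^ w → mbar < 2 ^ w →
      ∀ (G : CliqueSampling.QueryGraph n) (D : PMF (Option (Fin n))),
        (CliqueSampling.IsAttemptedSampler ⟨G, D⟩ w k CliqueSampling.lowSampler
            (CliqueSampling.State.start [n, k, γ, mbar]) (G.IsLowClique k γ) (C * k ^ 2) ∧
          ∀ c, G.IsLowClique k γ c →
            CliqueSampling.Access.prob ⟨G, D⟩ w CliqueSampling.lowSampler
                (CliqueSampling.State.start [n, k, γ, mbar]) (CliqueSampling.Returns k c) =
              ENNReal.ofReal (1 / ((n : ℝ) * (γ : ℝ) ^ (k - 1)))) ∧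
        (CliqueSampling.IsAttemptedSampler ⟨G, D⟩ w k CliqueSampling.mediumSampler
            (CliqueSampling.State.start [n, k, γ, mbar]) (G.IsMediumClique k γ mbar) (C * k ^ 2) ∧
          ∀ eps : ℝ, 0 < eps → eps < 1 / 2 → G.IsTypicalDS eps γ mbar D →
            ∀ c, G.IsMediumClique k γ mbar c →
              ENNReal.ofReal ((1 - eps) * (1 / (2 * (mbar : ℝ) ^ ((k : ℝ) / 2)))) ≤
                CliqueSampling.Access.prob ⟨G, D⟩ w CliqueSampling.mediumSampler
                  (CliqueSampling.State.start [n, k, γ, mbar]) (CliqueSampling.Returns k c) ∧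
              CliqueSampling.Access.prob ⟨G, D⟩ w CliqueSampling.mediumSampler
                  (CliqueSampling.State.start [n, k, γ, mbar]) (CliqueSampling.Returns k c) ≤
                ENNReal.ofReal ((1 + eps) * (1 / (2 * (mbar : ℝ) ^ ((k : ℝ) / 2))))) ∧
        (CliqueSampling.IsAttemptedSampler ⟨G, D⟩ w k CliqueSampling.highSampler
            (CliqueSampling.State.start [n, k, γ, mbar]) (G.IsHighClique k mbar) (C * k ^ 2) ∧
          ∀ eps : ℝ, 0 < eps → eps < 1 / 2 → G.IsTypicalDS eps γ mbar D →
            (γ : ℝ) ≤ √(mbar : ℝ) →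
            ∀ c, G.IsHighClique k mbar c →
              ENNReal.ofReal ((1 - eps) ^ k * (1 / (2 ^ k * (mbar : ℝ) ^ ((k : ℝ) / 2)))) ≤
                CliqueSampling.Access.prob ⟨G, D⟩ w CliqueSampling.highSampler
                  (CliqueSampling.State.start [n, k, γ, mbar]) (CliqueSampling.Returns k c) ∧
              CliqueSampling.Access.prob ⟨G, D⟩ w CliqueSampling.highSampler
                  (CliqueSampling.State.start [n, k, γ, mbar]) (CliqueSampling.Returns k c) ≤
                ENNReal.ofReal ((1 + eps) ^ k * (1 / (2 ^ k * (mbar : ℝ) ^ ((k : ℝ) / 2)))))) ∧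
    -- approximate counting
    (∃ (P : CliqueSampling.Cmd) (C : ℕ), ∀ (n k w : ℕ) (eps : ℝ), 1 ≤ n → 2 ≤ k →
      0 < eps → eps < 1 → n < 2 ^ w → k < 2 ^ w → ⌈1 / eps⌉₊ < 2 ^ w →
      ∀ G : CliqueSampling.QueryGraph n,
        2 / 3 ≤ G.access.prob w P (CliqueSampling.State.start [n, k, ⌈1 / eps⌉₊])
          (fun τ => (1 - eps) * (G.numCliques k : ℝ) ≤ τ.reg 0 ∧
            (τ.reg 0 : ℝ) ≤ (1 + eps) * (G.numCliques k : ℝ)) ∧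
        (1 ≤ G.numCliques k →
          G.access.expTime w P (CliqueSampling.State.start [n, k, ⌈1 / eps⌉₊]) ≤
            ENNReal.ofReal (CliqueSampling.starBound G k eps C) ∧
          G.access.expQueries w P (CliqueSampling.State.start [n, k, ⌈1 / eps⌉₊]) ≤
            ENNReal.ofReal (CliqueSampling.starBound G k eps C))) ∧
    -- sampling pointwise close to uniform
    (∃ (Pre Samp : CliqueSampling.Cmd) (C : ℕ), ∀ (n k w : ℕ) (eps δ : ℝ), 1 ≤ n → 2 ≤ k →
      0 < eps → eps < 1 → 0 < δ → δ < 1 →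
      n < 2 ^ w → k < 2 ^ w → ⌈1 / eps⌉₊ < 2 ^ w → ⌈1 / δ⌉₊ < 2 ^ w →
      ∀ G : CliqueSampling.QueryGraph n, 1 ≤ G.numCliques k →
        G.access.expTime w Pre (CliqueSampling.State.start [n, k, ⌈1 / eps⌉₊, ⌈1 / δ⌉₊]) ≤
          ENNReal.ofReal (CliqueSampling.starBound G k eps C * Real.log (2 / δ)) ∧
        G.access.expQueries w Pre (CliqueSampling.State.start [n, k, ⌈1 / eps⌉₊, ⌈1 / δ⌉₊]) ≤
          ENNReal.ofReal (CliqueSampling.starBound G k eps C * Real.log (2 / δ)) ∧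
        ENNReal.ofReal (1 - δ) ≤
          G.access.prob w Pre (CliqueSampling.State.start [n, k, ⌈1 / eps⌉₊, ⌈1 / δ⌉₊])
            (CliqueSampling.SamplesFrom G w k eps
              (ENNReal.ofReal (CliqueSampling.starBound G k eps C * Real.log (2 / δ))) Samp)) := by
  -- The constant `10 ^ 40` dominates the product of `10 ^ 23` from `Params.time_le`, `720 * 3 ^ 17`
  -- from `pow_six_le` and `64` from the powers of `E` and `l`, together with the reserved factor
  -- `2`.
  refine ⟨⟨10 ^ 10, fun n k γ mbar w h1 h2 h3 h4 h5 h6 h7 h8 G D =>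
    CliqueSampling.attempted_samplers h1 h2 h3 h4 h5 h6 h7 h8 G D⟩,
    ⟨CliqueSampling.countProgram, 10 ^ 40, fun n k w eps h1 h2 h3 h4 h5 h6 h7 G =>
      CliqueSampling.approximate_counting le_rfl h1 h2 h3 h4 h5 h6 h7 G⟩,
    ⟨CliqueSampling.sampleSetup, CliqueSampling.sampleProgram, 10 ^ 40,
      fun n k w eps δ h1 h2 h3 h4 h5 h6 h7 h8 h9 _ G hN =>
      CliqueSampling.approximate_sampling le_rfl h1 h2 h3 h4 h5 h6 h7 h8 h9 G hN⟩⟩
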